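/- **Setting.** Let $P$ be a simple polygon in the plane, no three of whose vertices are collinear, with an arbitrary triangulation $T$ (triangles with corners at vertices of $P$, whose sides are edges or interior diagonals of $P$, which pairwise meet in a common face and cover $P$). Let $a\neq b$ be edges of $P$, and let $t_1,\dots,t_k$ be the path in the weak dual graph of $T$ from the triangle incident to $a$ to the triangle incident to $b$ (the *important* triangles). Put $b_0=a$, $b_k=b$, and let $b_i$ be the side shared by $t_i$ and $t_{i+1}$ for $1\le i<k$. Let $\ell(b_i)$, $r(b_i)$ be the left and right endpoint of $b_i$: $r(a),\ell(a),\ell(b_i),r(b_i)$ is their clockwise order on the boundary of $P_i=t_1\cup\dots\cup t_i$ (with $P_0=a$). An interior point $p$ of $P$ is *visible* from $a$ if the segment from $p$ to some relatively interior point of $a$ lies, except for its endpoint on $a$, in the interior of $P$; the visibility polygon $V(a)$ is the closure of the set of visible points. The edge $b$ is visible from $a$ if there are relatively interior points of $a$ and $b$ such that the open segment between them lies in the interior of $P$. Let $t_h$ be the triangle of highest index that contains a visible point. If $b$ is not visible from $a$, the *first window* $w(a)$ is the edge of $V(a)$ that runs through the interior of $t_h$ closest to $b_h$ (vertices of $P$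 on the boundary of $V(a)$ count as vertices of $V(a)$; distances to $b_h$ are measured from the part of the edge in $t_h$). **Algorithm.** Start with the paths $\pi^\ell=[\ell(a)]$, $\pi^r=[r(a)]$ and the directed lines $\lambda^\ell$ with source $r(a)$ and target $\ell(a)$, and $\lambda^r$ with source $\ell(a)$ and target $r(a)$. For $i=1,\dots,k$: if $r(b_i)=r(b_{i-1})$, then 1. if $\ell(b_i)$ lies to the right of $\lambda^r$, return the segment from the target of $\lambda^r$ to $x$, the first intersection of $\lambda^r$ with the boundary of $P$ after its target; 2. append $\ell(b_i)$ to $\pi^\ell$, and while the last bend of $\pi^\ell$ is a right bend, remove the second to last element of $\pi^\ell$; 3. if $\ell(b_i)$ lies to the right of $\lambda^\ell$, make it the target of $\lambda^\ell$, and while $\lambda^\ell$ is not a tangent of $\pi^r$ at its source (some neighbour of the source on $\pi^r$ lies to the left of $\lambda^\ell$) and the source has a successor on $\pi^r$, replace the source by this successor. If instead $\ell(b_i)=\ell(b_{i-1})$, proceed symmetrically. Time is measured in elementary steps (orientation tests, array operations, counter updates), where finding the first intersection $x$ in the return statement counts as one step. **Lemma.** There is an absolute constant $C$ such that the algorithm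 halts after at most $C\cdot h$ steps. If $b$ is not visible from $a$, then $V(a)$ has exactly one first window $w(a)$ as defined above, and the algorithm returns it. If $b$ is visible from $a$, then $h=k$ and the algorithm finishes without returning a window. Moreover, for each $i<h$, and also for $i=h$ if $b$ is visible, the state after the $i$-th iteration (the initial state for $i=0$) is as follows. $\pi^\ell$ is a shortest polygonal path in $P_i$ from $\ell(a)$ to $\ell(b_i)$, and $\pi^r$ is one from $r(a)$ to $r(b_i)$. The line $\lambda^\ell$ is the left visibility line: a shortest path in $P_i$ from $r(a)$ to $\ell(b_i)$ follows $\pi^r$ up to the source of $\lambda^\ell$, then the segment from its source to its target, then the rest of $\pi^\ell$ from its target on. The symmetric statement holds for $\lambda^r$. Finally, when a window is returned, $x$ can be found by walking from $t_h$ along $\lambda^r$ (or $\lambda^\ell$) through the triangulation, from triangle to adjacent triangle. This walk takes at most $m+1$ constant-time steps, where $m$ is the number of triangles of $T$ other than $t_1,\dots,t_h$ whose interior $w(a)$ meets. -/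

import Mathlib

open Set

noncomputable section

namespace FirstWindow

/-- The Euclidean plane. -/
abbrev Pt : Type := EuclideanSpace ℝ (Fin 2)

/-- Twice the signed area of the triangle `p q r`: positive iff `r` lies strictly to the left of
the line through `p` and `q`, directed from `p` to `q`. -/
def cross (p q r : Pt) : ℝ :=
  (q 0 - p 0) * (r 1 - p 1) - (q 1 - p 1) * (r 0 - p 0)

inductive Side
  | left
  | right
  deriving DecidableEq

def Side.opp : Side → Side
  | .left => .right
  | .right => .left

/-- `r` lies strictly on side `s` of the line directed from `p` to `q`. -/
def OnSide : Side → Pt → Pt → Pt → Prop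
  | .left, p, q, r => 0 < cross p q r
  | .right, p, q, r => cross p q r < 0

/-! ### Simple polygons and their triangulations -/

/-- A simple polygon with `n` vertices in cyclic order: the vertices are distinct, and two distinct
edges meet at most in a common endpoint. -/
structure SimplePolygon (n : ℕ) [NeZero n] where
  vert : Fin n → Pt
  three_le : 3 ≤ n
  injective : Function.Injective vert
  simple : ∀ i j : Fin n, i ≠ j →
    segment ℝ (vert i) (vert (i + 1)) ∩ segment ℝ (vert j) (vert (j + 1)) ⊆
      vert '' (({i, i + 1} : Set (Fin n)) ∩ {j, j + 1})

namespace SimplePolygon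

variable {n : ℕ} [NeZero n] (P : SimplePolygon n)

/-- The boundary curve of the polygon. -/
def curve : Set Pt := ⋃ i : Fin n, segment ℝ (P.vert i) (P.vert (i + 1))

/-- The interior of the polygon: the points off the boundary curve whose connected component in the
complement of the curve is bounded. -/
def inside : Set Pt :=
  {p | p ∉ P.curve ∧ Bornology.IsBounded (connectedComponentIn P.curveᶜ p)}

/-- The closed region bounded by the polygon. -/
def region : Set Pt := P.inside ∪ P.curve

/-- No three vertices are collinear. -/
def GeneralPosition : Prop :=
  ∀ i j k : Fin n, i ≠ j → j ≠ k → i ≠ k → ¬ Collinear ℝ {P.vert i, P.vert j, P.vert k}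

/-- The closed convex hull of a set of vertices, e.g. the closed triangle spanned by three. -/
def hull (t : Finset (Fin n)) : Set Pt := convexHull ℝ (P.vert '' (t : Set (Fin n)))

/-- `T` (a set of triples of vertices) is a triangulation of the polygon. -/
structure IsTriangulation (T : Finset (Finset (Fin n))) : Prop where
  card_eq : ∀ t ∈ T, t.card = 3
  nondegenerate : ∀ t ∈ T, ¬ Collinear ℝ (P.vert '' (t : Set (Fin n)))
  /-- every side of a triangle is an edge or an (interior) diagonal of the polygon -/
  sides : ∀ t ∈ T, ∀ i ∈ t, ∀ j ∈ t, i ≠ j →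
    j = i + 1 ∨ i = j + 1 ∨ openSegment ℝ (P.vert i) (P.vert j) ⊆ P.inside
  /-- distinct triangles meet in a common face (a side, a corner, or not at all) -/
  face : ∀ t ∈ T, ∀ t' ∈ T, t ≠ t' → P.hull t ∩ P.hull t' = P.hull (t ∩ t')
  cover : ⋃ t ∈ T, P.hull t = P.region

/-- `t 1, …, t k` is the path of (important) triangles in the weak dual graph of `T` between
the triangles incident to the distinct polygon edges `a` (from vertex `α` to `α + 1`) and `b`
(from `β` to `β + 1`). Put `b₀ = a`, `bₖ = b`, and let `bᵢ` be the side
shared by `tᵢ` and `tᵢ₊₁` for `1 ≤ i < k`. Then `e .left i` and `e .right i` are the left and the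
right endpoint of `bᵢ`, as seen when walking from `a` to `b`, i.e. `e .right 0, e .left 0,
e .left i, e .right i` is their clockwise order on the boundary of `t₁ ∪ … ∪ tᵢ`. -/
structure IsImportant (T : Finset (Finset (Fin n))) (α β : Fin n) (k : ℕ)
    (t : ℕ → Finset (Fin n)) (e : Side → ℕ → Fin n) : Prop where
  edges_ne : α ≠ β
  one_le : 1 ≤ k
  mem : ∀ i, 1 ≤ i → i ≤ k → t i ∈ T
  inj : ∀ i j, 1 ≤ i → i ≤ k → 1 ≤ j → j ≤ k → t i = t j → i = j
  adj : ∀ i, 1 ≤ i → i < k → (t i ∩ t (i + 1)).card = 2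
  first_mem : {α, α + 1} ⊆ t 1
  last_mem : {β, β + 1} ⊆ t k
  first_edge : {e .left 0, e .right 0} = ({α, α + 1} : Finset (Fin n))
  shared_edge : ∀ i, 1 ≤ i → i < k → {e .left i, e .right i} = t i ∩ t (i + 1)
  last_edge : {e .left k, e .right k} = ({β, β + 1} : Finset (Fin n))
  /-- the first triangle lies to the left of `a`, directed from its left to its right endpoint -/
  first_oriented : ∀ w ∈ t 1, w ≠ e .left 0 → w ≠ e .right 0 →
    OnSide .left (P.vert (e .left 0)) (P.vert (e .right 0)) (P.vert w)
  /-- `tᵢ` lies to the right of `bᵢ`, directed from its left to its right endpoint -/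
  oriented : ∀ i, 1 ≤ i → i ≤ k → ∀ w ∈ t i, w ≠ e .left i → w ≠ e .right i →
    OnSide .right (P.vert (e .left i)) (P.vert (e .right i)) (P.vert w)

/-! ### Visibility and the window -/

/-- The interior points of the polygon that are visible from the edge with endpoints `u`, `w`:
some (relatively interior) point of the edge sees them inside the polygon. -/
def visible (u w : Fin n) : Set Pt :=
  {p | p ∈ P.inside ∧ ∃ q ∈ openSegment ℝ (P.vert u) (P.vert w), openSegment ℝ p q ⊆ P.inside}

/-- The visibility polygon, as a closed set. -/
def visPolygon (u w : Fin n) : Set Pt := closure (P.visible u w)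

/-- Some segment in the interior of the polygon starts at the edge `u w` and ends at the edge
`u' w'`. -/
def EdgeVisible (u w u' w' : Fin n) : Prop :=
  ∃ q ∈ openSegment ℝ (P.vert u) (P.vert w), ∃ p ∈ openSegment ℝ (P.vert u') (P.vert w'),
    openSegment ℝ p q ⊆ P.inside

/-- `s` is a nondegenerate segment on the boundary of `V` without a polygon vertex
in its relative interior. -/
def IsBoundarySegment (V s : Set Pt) : Prop :=
  ∃ x y : Pt, x ≠ y ∧ s = segment ℝ x y ∧ s ⊆ frontier V ∧
    ∀ i, P.vert i ∉ openSegment ℝ x y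

/-- `s` is an edge of the polygonal region `V`, where polygon vertices on the boundary of `V`
count as vertices of `V`. -/
def IsEdgeOf (V s : Set Pt) : Prop :=
  P.IsBoundarySegment V s ∧ ∀ s', P.IsBoundarySegment V s' → s ⊆ s' → s' = s

/-- `s` is the window of the edge `u w` in the triangle `t` with respect to its side
`u' w'`: the edge of the visibility polygon that runs through `t` closest to `u' w'`. -/
def IsWindow (u w : Fin n) (t : Finset (Fin n)) (u' w' : Fin n) (s : Set Pt) : Prop :=
  P.IsEdgeOf (P.visPolygon u w) s ∧ (s ∩ interior (P.hull t)).Nonempty ∧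
    ∀ s', P.IsEdgeOf (P.visPolygon u w) s' → (s' ∩ interior (P.hull t)).Nonempty →
      ∀ p' ∈ s' ∩ P.hull t, ∀ z' ∈ segment ℝ (P.vert u') (P.vert w'),
        ∃ p ∈ s ∩ P.hull t, ∃ z ∈ segment ℝ (P.vert u') (P.vert w'), dist p z ≤ dist p' z'

end SimplePolygon

/-! ### Shortest polygonal paths -/

/-- The polygonal path with the given list of vertices goes from `p` to `q` inside `S`. -/
def IsPathIn (S : Set Pt) (p q : Pt) (c : List Pt) : Prop :=
  c.head? = some p ∧ c.getLast? = some q ∧ (∀ x ∈ c, x ∈ S) ∧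
    c.IsChain (fun x y => segment ℝ x y ⊆ S)

/-- The Euclidean length of a polygonal path. -/
def pathLength (c : List Pt) : ℝ := (List.zipWith dist c c.tail).sum

/-- A shortest polygonal path from `p` to `q` in `S`. -/
def IsShortestPath (S : Set Pt) (p q : Pt) (c : List Pt) : Prop :=
  IsPathIn S p q c ∧ ∀ c', IsPathIn S p q c' → pathLength c ≤ pathLength c'

/-! ### The algorithm

The algorithm is given as a machine. One step of it performs a bounded number of elementary
operations: arithmetic and comparisons on coordinates of vertices (an orientation test), reading an
entry of the input or of an array, appending to an array or removing next to its end, changing a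
counter; the instruction that returns the window takes one more operation, the first intersection
of a ray with the boundary of the polygon. -/

/-- `x` is the first point of `C` on the ray from `y` away from `p`, after `y`. -/
def IsFirstHit (C : Set Pt) (p y x : Pt) : Prop :=
  ∃ τ : ℝ, 0 < τ ∧ x = y + τ • (y - p) ∧ x ∈ C ∧
    ∀ τ' : ℝ, 0 < τ' → τ' < τ → y + τ' • (y - p) ∉ C

def firstHit (C : Set Pt) (p y : Pt) : Pt := Classical.epsilon (IsFirstHit C p y)

/-- The current instruction. The parameter of type `Side` is the side of the new vertex of the
triangle that is being processed. -/
inductive Phase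
  /-- head of the main loop, and test whether `bᵢ` is still visible -/
  | loop
  /-- one round of the loop that restores the outward convexity of the extended path -/
  | scan (s : Side)
  /-- test whether the new vertex lies in the visibility cone -/
  | cone (s : Side)
  /-- one round of the loop that advances the source of the visibility line -/
  | tangent (s : Side)
  /-- halted; the window is the segment from the target of the visibility line to `x` -/
  | window (s : Side) (x : Pt)
  /-- halted after the last triangle, without a window -/
  | finished

/-- A state of the machine: `path s` is the path on side `s`; the visibility line
of side `s` has as target the vertex `tgt s`, and as source the vertex at position `src s` of
the path on the opposite side. -/
structure State (n : ℕ) where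
  phase : Phase
  i : ℕ
  path : Side → List (Fin n)
  src : Side → ℕ
  tgt : Side → Fin n

section Machine

variable {n : ℕ} [NeZero n] (P : SimplePolygon n) (k : ℕ) (e : Side → ℕ → Fin n)

/-- The source of the visibility line of side `s`. -/
def State.source (st : State n) (s : Side) : Fin n := (st.path s.opp).getD (st.src s) 0

/-- `q` lies strictly on side `d` of the visibility line of side `s`. -/
def State.OnSideOfLine (st : State n) (d s : Side) (q : Fin n) : Prop :=
  OnSide d (P.vert (st.source s)) (P.vert (st.tgt s)) (P.vert q)

/-- The visibility line of side `s` is tangent to the opposite path at its source: no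
neighbour of the source on that path lies strictly on side `s` of the line. -/
def State.IsTangent (st : State n) (s : Side) : Prop :=
  (∀ q, (st.path s.opp)[st.src s + 1]? = some q → ¬ st.OnSideOfLine P s s q) ∧
  (∀ j q, j + 1 = st.src s → (st.path s.opp)[j]? = some q → ¬ st.OnSideOfLine P s s q)

/-- The path has a last bend, and this bend is towards side `d`. -/
def LastBend (d : Side) (c : List (Fin n)) : Prop :=
  match c.reverse with
  | r :: q :: p :: _ => OnSide d (P.vert p) (P.vert q) (P.vert r)
  | _ => False

def removeSecondToLast (c : List (Fin n)) : List (Fin n) :=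
  match c.reverse with
  | r :: _ :: l => (r :: l).reverse
  | _ => c

def State.init : State n where
  phase := .loop
  i := 1
  path := fun s => [e s 0]
  src := fun _ => 0
  tgt := fun s => e s 0

/-- The side of the new vertex of the `i`-th triangle: the side on which the
endpoints of `bᵢ` and `bᵢ₋₁` differ. -/
def newSide (i : ℕ) : Side := if e .right i = e .right (i - 1) then .left else .right

open Classical in
/-- One step of the machine. -/
def State.step (st : State n) : State n :=
  match st.phase with
  | .loop =>
    if k < st.i then { st with phase := .finished }
    else
      let s := newSide e st.i
      if st.OnSideOfLine P s.opp s.opp (e s st.i) then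
        { st with
          phase := .window s
            (firstHit P.curve (P.vert (st.source s.opp)) (P.vert (st.tgt s.opp))) }
      else
        { st with
          phase := .scan s
          path := Function.update st.path s (st.path s ++ [e s st.i]) }
  | .scan s =>
    if LastBend P s.opp (st.path s) then
      { st with path := Function.update st.path s (removeSecondToLast (st.path s)) }
    else { st with phase := .cone s }
  | .cone s =>
    if st.OnSideOfLine P s.opp s (e s st.i) then
      { st with phase := .tangent s, tgt := Function.update st.tgt s (e s st.i) }
    else { st with phase := .loop, i := st.i + 1 }
  | .tangent s =>
    if ¬ st.IsTangent P s ∧ st.src s + 1 < (st.path s.opp).length then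
      { st with src := Function.update st.src s (st.src s + 1) }
    else { st with phase := .loop, i := st.i + 1 }
  | .window _ _ => st
  | .finished => st

/-- The state of the machine after `N` steps. -/
def run (N : ℕ) : State n := (State.step P k e)^[N] (State.init e)

/-- The region `t₁ ∪ … ∪ tᵢ` (just the edge `a` for `i = 0`). -/
def sleeve (t : ℕ → Finset (Fin n)) (i : ℕ) : Set Pt :=
  segment ℝ (P.vert (e .left 0)) (P.vert (e .right 0)) ∪
    ⋃ j ∈ Finset.Icc 1 i, P.hull (t j)

/-- The state holds, for both sides `s`, the shortest path in `t₁ ∪ … ∪ tᵢ` between the endpoints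
on side `s` of `a` and `bᵢ`, and the visibility line of side `s`, i.e. its source and target
are the vertices at which the shortest path to the endpoint of `bᵢ` on side `s` from the endpoint
of `a` on the other side changes over from the path on that side to the path on side `s`. -/
def State.Holds (t : ℕ → Finset (Fin n)) (i : ℕ) (st : State n) : Prop :=
  st.phase = .loop ∧ st.i = i + 1 ∧ ∀ s : Side,
    IsShortestPath (sleeve P e t i) (P.vert (e s 0)) (P.vert (e s i)) ((st.path s).map P.vert) ∧
    st.src s < (st.path s.opp).length ∧
    ∃ j, (st.path s)[j]? = some (st.tgt s) ∧
      IsShortestPath (sleeve P e t i) (P.vert (e s.opp 0)) (P.vert (e s i))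
        (((st.path s.opp).take (st.src s + 1) ++ (st.path s).drop j).map P.vert)

end Machine

/-! ### Finding the first intersection by walking through the triangulation -/

/-- A state of the walk along a ray: `run l r o` says that the ray is about to leave
the triangle `l r o` through its side `l r`, with `l` to its left and `r` to its right. -/
inductive Walk (n : ℕ)
  | run (l r o : Fin n)
  | done (x : Pt)

section Walk

variable {n : ℕ} [NeZero n] (P : SimplePolygon n) (T : Finset (Finset (Fin n)))

/-- The third corner of the triangle on the other side of `l r` than `o`, if there is one. -/
def apex (l r o : Fin n) : Option (Fin n) :=
  (Finset.univ.filter fun z => z ≠ l ∧ z ≠ r ∧ z ≠ o ∧ {l, r, z} ∈ T).toList.head?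

open Classical in
/-- One step of the walk along the ray that starts at `y` and points away from `p`: enter the
next triangle, or, if there is none, intersect the ray with the edge `l r` of the polygon. -/
def Walk.step (p y : Pt) : Walk n → Walk n
  | .done x => .done x
  | .run l r o =>
    match apex T l r o with
    | none =>
      .done (P.vert l + (cross p y (P.vert l) / (cross p y (P.vert l) - cross p y (P.vert r))) •
        (P.vert r - P.vert l))
    | some z => if OnSide .left p y (P.vert z) then .run z r l else .run l z r

/-- The start of the walk: the ray leaves the `i`-th triangle through the side other than
`bᵢ₋₁` and `bᵢ`. -/
def Walk.start (e : Side → ℕ → Fin n) (i : ℕ) : Side → Walk n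
  | .left => .run (e .left (i - 1)) (e .left i) (e .right i)
  | .right => .run (e .right i) (e .right (i - 1)) (e .left i)

open Classical in
/-- The number of triangles of `T` not among `t₁, …, tᵢ` that the set `w` passes through. -/
def crossed (t : ℕ → Finset (Fin n)) (i : ℕ) (w : Set Pt) : ℕ :=
  (T.filter fun t' => (∀ j, 1 ≤ j → j ≤ i → t j ≠ t') ∧
    (w ∩ interior (P.hull t')).Nonempty).card

end Walk

end FirstWindow

end

open Set
noncomputable section
namespace FirstWindow

open Filter Topology

/-! ### Orientation and sign lemmas in the plane -/

/-! Visibility from `a` is a question about separating lines. A line of sight from `a` into the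
triangle after `b_M` crosses `b_1, …, b_M`, because every diagonal separates the polygon, and it
avoids all vertices. So it has all left endpoints of these diagonals strictly on one side and all
right endpoints strictly on the other (`StrictSep`, `exists_strictSep`). Conversely, a line with
this property meets the diagonals in their order and stays inside the polygon between them
(`exists_openSegment_of_sep`). The two visibility lines are limits of such lines: they separate the
endpoints weakly (`Stab`) and pass through a vertex of either side.

The invariant `Config` says that both chains bend outward, that each chain edge crosses the
diagonals between its endpoints, that edges from the source position on also cross every later
diagonal up to `b_i`, that edges between source and target position cross all of `b_0, …, b_i`, and
that both visibility lines cross all of these. Its preservation is an analysis of signs of oriented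
areas. Along either chain, from its source position on, the side on which the new vertex sees the
edges changes at most once (`right_of_next`, `left_of_next`); hence the removals at the end of one
chain and the advances on the other stop at tangent points. A new edge or visibility line starts at
such a point and runs between two lines through it that already cross all diagonals, so it crosses
them as well (`between`). The results are `Config.keep` and `Config.update`. Each removal shortens a
chain and each advance increases a source position, which never exceeds the length of its chain;
this pays for both inner loops.

Shortest paths are certified by a calibration. `LowerBound` bounds the length of every path to a
point of `b_i` below by an affine function of that point, whose gradient is the unit vector of the
last edge. The bound passes from diagonal to diagonal, since a path has to cross them all, and at a
bend its gradient can be rotated while the sleeve turns around the vertex (`lowerBound_fan`).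

The sum of the equations of the two visibility lines, shifted slightly, separates strictly, so `b_i`
is visible as long as the invariant is reached. If the window test succeeds, a strictly separating
line for the next diagonal would have to meet it on the wrong side of the opposite visibility line
(`not_strictSep_of_blocked`). Thus the test first succeeds in the last triangle with a visible
point, unless `b` is visible.

The window lies on the line `S Q` of the successful test. Turning this line slightly about a point
between `S` and `Q` gives strictly separating lines, so the ray from `Q` to its first hit `x`
belongs to the visibility polygon; nearby points on its other side are invisible, since their lines
of sight would have to pass the diagonal at `Q`. The segment cannot be prolonged as an edge: `Q` is
a vertex, and `x` is a vertex or the ray leaves the polygon there. Every other edge in the triangle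
lies on the visible side and is farther from `b_h`, since points strictly between the two visibility
lines are interior to the visibility polygon (`isWindow_iff`).

Two topological facts are proved by hand: every boundary point is a limit of exterior points
(`curve_subset_closure_outside`), and a diagonal separates the triangles on its two sides
(`exists_coloring`). The latter uses the winding number of a boundary arc closed by the diagonal. -/

/-- The signed area, positive if `r` lies on side `s` of the line from `p` to `q`. -/
def turn : Side → Pt → Pt → Pt → ℝ
  | .left, p, q, r => cross p q r
  | .right, p, q, r => -cross p q r

lemma onSide_iff (s : Side) (p q r : Pt) : OnSide s p q r ↔ 0 < turn s p q r := by
  cases s <;> simp [OnSide, turn]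

@[simp] lemma Side.opp_opp (s : Side) : s.opp.opp = s := by cases s <;> rfl

lemma Side.ne_opp (s : Side) : s ≠ s.opp := by cases s <;> simp [Side.opp]

lemma Side.eq_or (s s' : Side) : s' = s ∨ s' = s.opp := by cases s <;> cases s' <;> simp [Side.opp]

lemma turn_opp (s : Side) (p q r : Pt) : turn s.opp p q r = -turn s p q r := by
  cases s <;> simp [turn, Side.opp]

lemma turn_cyc (s : Side) (p q r : Pt) : turn s p q r = turn s q r p := by
  cases s <;> simp only [turn, cross] <;> ring

lemma turn_swap (s : Side) (p q r : Pt) : turn s p q r = -turn s q p r := by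
  cases s <;> simp only [turn, cross] <;> ring

lemma turn_swap' (s : Side) (p q r : Pt) : turn s p q r = -turn s p r q := by
  cases s <;> simp only [turn, cross] <;> ring

lemma turn_opp_swap (s : Side) (p q r : Pt) : turn s.opp q p r = turn s p q r := by
  rw [turn_opp, ← turn_swap]

@[simp] lemma turn_self_left (s : Side) (p q : Pt) : turn s p q p = 0 := by
  cases s <;> simp only [turn, cross] <;> ring

@[simp] lemma turn_self_right (s : Side) (p q : Pt) : turn s p q q = 0 := by
  cases s <;> simp only [turn, cross] <;> ring

lemma turn_eq_zero_iff (s : Side) (p q r : Pt) : turn s p q r = 0 ↔ cross p q r = 0 := by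
  cases s <;> simp [turn]

/-- Affine functions on the plane. -/
def IsAff (g : Pt → ℝ) : Prop := ∃ a b c : ℝ, ∀ z, g z = a * z 0 + b * z 1 + c

lemma isAff_turn (s : Side) (p q : Pt) : IsAff (turn s p q) := by
  cases s
  · exact ⟨-(q 1 - p 1), q 0 - p 0, -(q 0 - p 0) * p 1 + (q 1 - p 1) * p 0, fun z => by
      simp only [turn, cross]; ring⟩
  · exact ⟨(q 1 - p 1), -(q 0 - p 0), (q 0 - p 0) * p 1 - (q 1 - p 1) * p 0, fun z => by
      simp only [turn, cross]; ring⟩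

lemma isAff_cross (p q : Pt) : IsAff (cross p q) := isAff_turn .left p q

lemma IsAff.add {g h : Pt → ℝ} (hg : IsAff g) (hh : IsAff h) : IsAff (fun z => g z + h z) := by
  obtain ⟨a, b, c, H⟩ := hg
  obtain ⟨a', b', c', H'⟩ := hh
  exact ⟨a + a', b + b', c + c', fun z => by simp only [H, H']; ring⟩

lemma IsAff.smul {g : Pt → ℝ} (hg : IsAff g) (k : ℝ) : IsAff (fun z => k * g z) := by
  obtain ⟨a, b, c, H⟩ := hg
  exact ⟨k * a, k * b, k * c, fun z => by simp only [H]; ring⟩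

lemma IsAff.neg {g : Pt → ℝ} (hg : IsAff g) : IsAff (fun z => -g z) := by
  simpa using hg.smul (-1)

lemma isAff_const (k : ℝ) : IsAff (fun _ => k) := ⟨0, 0, k, fun z => by ring⟩

lemma IsAff.lineMap {g : Pt → ℝ} (hg : IsAff g) (x y : Pt) (κ : ℝ) :
    g (x + κ • (y - x)) = (1 - κ) * g x + κ * g y := by
  obtain ⟨a, b, c, H⟩ := hg
  simp only [H, PiLp.add_apply, PiLp.smul_apply, PiLp.sub_apply, smul_eq_mul]; ring

lemma IsAff.comb {g : Pt → ℝ} (hg : IsAff g) (x y : Pt) {α β : ℝ} (h : α + β = 1) :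
    g (α • x + β • y) = α * g x + β * g y := by
  obtain ⟨a, b, c, H⟩ := hg
  obtain rfl : α = 1 - β := by linarith
  simp only [H, PiLp.add_apply, PiLp.smul_apply, smul_eq_mul]; ring

lemma IsAff.comb₃ {g : Pt → ℝ} (hg : IsAff g) (x y z : Pt) {α β γ : ℝ} (h : α + β + γ = 1) :
    g (α • x + β • y + γ • z) = α * g x + β * g y + γ * g z := by
  obtain ⟨a, b, c, H⟩ := hg
  obtain rfl : α = 1 - β - γ := by linarith
  simp only [H, PiLp.add_apply, PiLp.smul_apply, smul_eq_mul]; ring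

lemma IsAff.ray {g : Pt → ℝ} (hg : IsAff g) (x y : Pt) (κ : ℝ) :
    g (y + κ • (y - x)) = g y + κ * (g y - g x) := by
  obtain ⟨a, b, c, H⟩ := hg
  simp only [H, PiLp.add_apply, PiLp.smul_apply, PiLp.sub_apply, smul_eq_mul]; ring

lemma IsAff.continuous {g : Pt → ℝ} (hg : IsAff g) : Continuous g := by
  obtain ⟨a, b, c, H⟩ := hg
  have : g = fun z => a * z 0 + b * z 1 + c := funext H
  rw [this]; fun_prop

/-- The four-point identity: an affine function at `x` in barycentric coordinates of `p q r`. -/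
lemma IsAff.bary {g : Pt → ℝ} (hg : IsAff g) (s : Side) (p q r x : Pt) :
    turn s p q r * g x = turn s q r x * g p + turn s r p x * g q + turn s p q x * g r := by
  obtain ⟨a, b, c, H⟩ := hg
  cases s <;> simp only [turn, cross, H] <;> ring

/-- The line through `w` and `a` meets the line through `A` and `B`. -/
lemma IsAff.meet {g : Pt → ℝ} (hg : IsAff g) (s : Side) (A B w a : Pt) :
    turn s A B a * g w - turn s A B w * g a = turn s w B a * g A + turn s w a A * g B := by
  obtain ⟨x, y, c, H⟩ := hg
  cases s <;> simp only [turn, cross, H] <;> ring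

/-- The three-term Grassmann–Plücker relation for the four vectors from `w` to `u`, `v`, `x`, `y`.
It transfers orientations around a common vertex. -/
lemma plucker (s : Side) (w u v x y : Pt) :
    turn s w u v * turn s w x y - turn s w u x * turn s w v y
      + turn s w u y * turn s w v x = 0 := by
  cases s <;> simp only [turn, cross] <;> ring

/-- If the point `a` beyond `A B` and the point `w` before it lie on the side of `A` of a line that
crosses `A B`, then from `w`, the point `a` is seen on that side of `B`. -/
lemma wrap {f : Pt → ℝ} (hf : IsAff f) {s : Side} {A B w a : Pt} (hA : 0 ≤ f A) (hB : f B ≤ 0)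
    (hw : 0 ≤ f w) (ha : 0 < f a) (hw' : turn s A B w < 0) (ha' : 0 < turn s A B a) :
    0 < turn s w B a := by
  by_contra hc
  push Not at hc
  have h := hf.meet s A B w a
  have hD : turn s A B a - turn s A B w = turn s w a A - turn s w a B := by
    cases s <;> simp only [turn, cross] <;> ring
  have h1 := turn_swap' s w B a
  have h2 : 0 < turn s w a A := by linarith
  nlinarith [mul_nonneg ha'.le hw, mul_pos (neg_pos.2 hw') ha, mul_nonneg (neg_nonneg.2 hc) hA,
    mul_nonneg h2.le (neg_nonneg.2 hB)]

/-- Right of an edge, hence right of the next edge, which turns left. -/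
lemma right_of_next {s : Side} {v w x B a : Pt} (h1 : 0 < turn s v w x) (h2 : turn s v w B < 0)
    (h3 : turn s w x B < 0) (h4 : 0 < turn s w B a) (h5 : turn s v w a < 0) :
    turn s w x a < 0 := by
  have h := plucker s w v B x a
  have e1 := turn_cyc s v w x
  have e2 := turn_cyc s v w B
  have e3 := turn_cyc s v w a
  have e4 := turn_swap' s w x v
  have e5 := turn_swap' s w B v
  have e6 := turn_swap' s w a v
  have e7 := turn_swap' s w x B
  by_contra hc
  push Not at hc
  have a1 : 0 < turn s w v B := by linarith
  have a2 : turn s w v x < 0 := by linarith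
  have a3 : 0 < turn s w v a := by linarith
  have a4 : 0 < turn s w B x := by linarith
  nlinarith [mul_nonneg a1.le hc, mul_pos (neg_pos.2 a2) h4, mul_pos a3 a4]

/-- Left of an edge, hence left of the next edge, which turns right. -/
lemma left_of_next {s : Side} {v w x B a : Pt} (h1 : turn s v w x < 0) (h2 : turn s v w B < 0)
    (h3 : turn s w x B < 0) (h4 : 0 < turn s w B a) (h5 : 0 < turn s v w a) :
    0 < turn s w x a := by
  have h := plucker s w v B x a
  have e1 := turn_cyc s v w x
  have e2 := turn_cyc s v w B
  have e3 := turn_cyc s v w a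
  have e4 := turn_swap' s w x v
  have e5 := turn_swap' s w B v
  have e6 := turn_swap' s w a v
  have e7 := turn_swap' s w x B
  by_contra hc
  push Not at hc
  have a1 : 0 < turn s w v B := by linarith
  have a2 : 0 < turn s w v x := by linarith
  have a3 : turn s w v a < 0 := by linarith
  have a4 : 0 < turn s w B x := by linarith
  nlinarith [mul_nonneg a1.le (neg_nonneg.2 hc), mul_pos a2 h4, mul_pos (neg_pos.2 a3) a4]

/-- Barycentric coordinates of `z` in the triangle `A B A'`, with the weight of `B` eliminated. So
`f` matters only relative to its value at the pivot `B`. -/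
lemma IsAff.advance {f : Pt → ℝ} (hf : IsAff f) (s : Side) (A B A' z : Pt) :
    turn s A B A' * (f z - f B) =
      -turn s A' B z * (f A - f B) + turn s A B z * (f A' - f B) := by
  obtain ⟨x, y, c, H⟩ := hf
  cases s <;> simp only [turn, cross, H] <;> ring

/-- A point beyond `A' B` is beyond `A B`. -/
lemma above_of_above {f : Pt → ℝ} (hf : IsAff f) {s : Side} {A B A' z : Pt} (hA : f B ≤ f A)
    (hA' : f B ≤ f A') (hz : f B < f z) (hD : 0 < turn s A B A') (h : 0 ≤ turn s A' B z) :
    0 < turn s A B z := by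
  by_contra hc
  push Not at hc
  have e := hf.advance s A B A' z
  nlinarith [mul_pos hD (sub_pos.2 hz), mul_nonneg h (sub_nonneg.2 hA),
    mul_nonneg (neg_nonneg.2 hc) (sub_nonneg.2 hA')]

/-- A point before `A B` is before `A' B`. -/
lemma below_of_below {f : Pt → ℝ} (hf : IsAff f) {s : Side} {A B A' z : Pt} (hA : f B ≤ f A)
    (hA' : f B < f A') (hz : f B ≤ f z) (hD : 0 < turn s A B A') (h : turn s A B z < 0) :
    turn s A' B z < 0 := by
  by_contra hc
  push Not at hc
  have e := hf.advance s A B A' z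
  nlinarith [mul_nonneg hD.le (sub_nonneg.2 hz), mul_nonneg hc (sub_nonneg.2 hA),
    mul_pos (neg_pos.2 h) (sub_pos.2 hA')]

/-- Two directed lines through `w`, and a point `a` between them in front: the line from `w` to `a`
has on each side what both lines have there. -/
lemma between {s : Side} {p₁ q₁ p₂ q₂ w a : Pt} (h1 : turn s p₁ q₁ w = 0) (h2 : turn s p₂ q₂ w = 0)
    (hD : turn s p₁ q₁ q₂ < turn s p₁ q₁ p₂) (ha1 : turn s p₁ q₁ a ≤ 0)
    (ha2 : 0 ≤ turn s p₂ q₂ a) (z : Pt) :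
    (0 ≤ turn s p₁ q₁ z → 0 ≤ turn s p₂ q₂ z → 0 ≤ turn s w a z) ∧
      (turn s p₁ q₁ z ≤ 0 → turn s p₂ q₂ z ≤ 0 → turn s w a z ≤ 0) := by
  -- Lines through `w` form a pencil, so the equation of `w a` is a combination of the two given
  -- ones. The signs of `hD`, `ha1`, `ha2` make it a nonnegative one.
  have key : (turn s p₁ q₁ q₂ - turn s p₁ q₁ p₂) * turn s w a z =
      -turn s p₂ q₂ a * turn s p₁ q₁ z + turn s p₁ q₁ a * turn s p₂ q₂ z := by
    have : ∀ p q z : Pt, turn s p q w = 0 → turn s p q z = turn s p q z - turn s p q w := by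
      intro p q z h; rw [h, sub_zero]
    rw [this p₂ q₂ a h2, this p₂ q₂ z h2, this p₁ q₁ a h1, this p₁ q₁ z h1]
    cases s <;> simp only [turn, cross] <;> ring
  constructor
  · intro hz1 hz2
    by_contra hc
    push Not at hc
    nlinarith [mul_pos (sub_pos.2 hD) (neg_pos.2 hc), mul_nonneg ha2 hz1,
      mul_nonneg (neg_nonneg.2 ha1) hz2]
  · intro hz1 hz2
    by_contra hc
    push Not at hc
    nlinarith [mul_pos (sub_pos.2 hD) hc, mul_nonneg ha2 (neg_nonneg.2 hz1),
      mul_nonneg (neg_nonneg.2 ha1) (neg_nonneg.2 hz2)]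

/-- The point `a` in the cone between two visibility lines lies behind the edge `v w` that ends in
the source `w` of one of them. -/
lemma right_of_previous {f : Pt → ℝ} (hf : IsAff f) {s : Side} {v w t A a : Pt} (hw : f w ≤ 0)
    (ht : 0 ≤ f t) (hA : 0 ≤ f A) (ha : 0 < f a) (hvA : 0 ≤ turn s v w A)
    (htA : 0 < turn s w t A) (hta : turn s w t a < 0) (htv : turn s w t v ≤ 0) :
    turn s v w a ≤ 0 := by
  by_contra hc
  push Not at hc
  have e1 := turn_cyc s v w A
  have e2 := turn_cyc s v w a
  have e3 := turn_swap' s w A v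
  have e4 := turn_swap' s w a v
  have p1 := plucker s w t v A a
  have a1 : turn s w v A ≤ 0 := by linarith
  have a2 : turn s w v a < 0 := by linarith
  have a3 : turn s w t v * turn s w A a < 0 := by
    nlinarith [mul_pos htA (neg_pos.2 a2), mul_nonneg (neg_nonneg.2 hta.le) (neg_nonneg.2 a1)]
  have a4 : 0 < turn s w A a := by
    by_contra h; push Not at h
    nlinarith [mul_nonneg (neg_nonneg.2 htv) (neg_nonneg.2 h)]
  -- The linear relation between the vectors from `w` to `A`, `t`, `a`, evaluated by `f`. Its left
  -- side is nonnegative and its right side negative.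
  have key : turn s w A a * (f t - f w) =
      turn s w t a * (f A - f w) - turn s w t A * (f a - f w) := by
    obtain ⟨x, y, c, H⟩ := hf
    cases s <;> simp only [turn, cross, H] <;> ring
  nlinarith [mul_nonneg a4.le (by linarith : 0 ≤ f t - f w),
    mul_nonneg (neg_nonneg.2 hta.le) (by linarith : 0 ≤ f A - f w),
    mul_pos htA (by linarith : 0 < f a - f w)]

/-- A point `p` beyond the segment `A T` and on the wrong side of `S T` is not on a line that has
`S` and `A` on one side, and `T` on the other. -/
lemma blocked {g : Pt → ℝ} (hg : IsAff g) {s : Side} {S A T p : Pt} (hA : 0 ≤ turn s S T A)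
    (hp : 0 < turn s A T p) (hp' : turn s S T p ≤ 0) (gS : 0 < g S) (gA : 0 ≤ g A) (gp : 0 ≤ g p)
    (gT : g T < 0) : False := by
  have h := hg.bary s S A p T
  have e1 : turn s A p T = -turn s A T p := turn_swap' ..
  have e2 : turn s p S T = turn s S T p := turn_cyc ..
  have e3 : turn s S A T = -turn s S T A := turn_swap' ..
  have hs : turn s S A p = turn s A p T + turn s p S T + turn s S A T := by
    cases s <;> simp only [turn, cross] <;> ring
  rw [e1, e2, e3] at h hs
  have hD : turn s S A p < 0 := by linarith
  nlinarith [mul_pos (neg_pos.2 hD) (neg_pos.2 gT), mul_pos hp gS,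
    mul_nonneg (neg_nonneg.2 hp') gA, mul_nonneg hA gp]

/-! ### Segments and affine functions -/

lemma IsAff.nonneg_segment {g : Pt → ℝ} (hg : IsAff g) {x y z : Pt} (hx : 0 ≤ g x) (hy : 0 ≤ g y)
    (hz : z ∈ segment ℝ x y) : 0 ≤ g z := by
  obtain ⟨a, b, ha, hb, hab, rfl⟩ := hz
  rw [hg.comb x y hab]; positivity

lemma IsAff.nonpos_segment {g : Pt → ℝ} (hg : IsAff g) {x y z : Pt} (hx : g x ≤ 0) (hy : g y ≤ 0)
    (hz : z ∈ segment ℝ x y) : g z ≤ 0 := by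
  have := hg.neg.nonneg_segment (neg_nonneg.2 hx) (neg_nonneg.2 hy) hz
  linarith

lemma IsAff.pos_openSegment {g : Pt → ℝ} (hg : IsAff g) {x y z : Pt} (hx : 0 ≤ g x) (hy : 0 < g y)
    (hz : z ∈ openSegment ℝ x y) : 0 < g z := by
  obtain ⟨a, b, ha, hb, hab, rfl⟩ := hz
  rw [hg.comb x y hab]; positivity

lemma IsAff.eq_zero_segment {g : Pt → ℝ} (hg : IsAff g) {x y z : Pt} (hx : g x = 0) (hy : g y = 0)
    (hz : z ∈ segment ℝ x y) : g z = 0 :=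
  le_antisymm (hg.nonpos_segment hx.le hy.le hz) (hg.nonneg_segment hx.ge hy.ge hz)

/-- A zero of an affine function on a segment. -/
lemma IsAff.exists_zero {g : Pt → ℝ} (hg : IsAff g) {x y : Pt} (hx : 0 ≤ g x) (hy : g y ≤ 0) :
    ∃ z ∈ segment ℝ x y, g z = 0 := by
  rcases eq_or_lt_of_le (hy.trans hx) with h | h
  · exact ⟨x, left_mem_segment .., le_antisymm (h ▸ hy) hx⟩
  · refine ⟨(-g y / (g x - g y)) • x + (g x / (g x - g y)) • y,
      ⟨_, _, div_nonneg (by linarith) (by linarith), div_nonneg hx (by linarith), ?_, rfl⟩, ?_⟩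
    · have : g x - g y ≠ 0 := by linarith
      field_simp; ring
    · have : g x - g y ≠ 0 := by linarith
      rw [hg.comb]
      · field_simp; ring
      · field_simp; ring

lemma IsAff.exists_zero_open {g : Pt → ℝ} (hg : IsAff g) {x y : Pt} (hx : 0 < g x) (hy : g y < 0) :
    ∃ z ∈ openSegment ℝ x y, g z = 0 := by
  have : g x - g y ≠ 0 := by linarith
  refine ⟨(-g y / (g x - g y)) • x + (g x / (g x - g y)) • y,
      ⟨_, _, div_pos (by linarith) (by linarith), div_pos hx (by linarith), ?_, rfl⟩, ?_⟩
  · field_simp; ring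
  · rw [hg.comb]
    · field_simp; ring
    · field_simp; ring

lemma ext_pt {x y : Pt} (h0 : x 0 = y 0) (h1 : x 1 = y 1) : x = y := by
  ext i; fin_cases i <;> assumption

/-- A point on the line through two distinct points. -/
lemma exists_of_cross_eq_zero {p q r : Pt} (hpq : p ≠ q) (h : cross p q r = 0) :
    ∃ κ : ℝ, r = p + κ • (q - p) := by
  by_cases h0 : q 0 - p 0 = 0
  · have h1 : q 1 - p 1 ≠ 0 := fun h1 => hpq (ext_pt (by linarith) (by linarith))
    refine ⟨(r 1 - p 1) / (q 1 - p 1), ext_pt ?_ ?_⟩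
    · simp only [cross, h0, zero_mul, zero_sub, neg_eq_zero, mul_eq_zero, h1, false_or] at h
      simp [h0]; linarith
    · simp; field_simp; ring
  · refine ⟨(r 0 - p 0) / (q 0 - p 0), ext_pt ?_ ?_⟩
    · simp; field_simp; ring
    · simp only [cross] at h
      simp; field_simp; linarith

lemma collinear_iff_cross (p q r : Pt) : Collinear ℝ {p, q, r} ↔ cross p q r = 0 := by
  constructor
  · intro h
    rw [collinear_iff_of_mem (p₀ := p) (by simp)] at h
    obtain ⟨v, hv⟩ := h
    obtain ⟨a, ha⟩ := hv q (by simp)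
    obtain ⟨b, hb⟩ := hv r (by simp)
    rw [ha, hb]; simp [cross]; ring
  · intro h
    by_cases hpq : p = q
    · subst hpq; simpa using collinear_pair ℝ p r
    · obtain ⟨κ, rfl⟩ := exists_of_cross_eq_zero hpq h
      rw [collinear_iff_of_mem (p₀ := p) (by simp)]
      refine ⟨q - p, ?_⟩
      rintro x (rfl | rfl | rfl)
      · exact ⟨0, by simp⟩
      · exact ⟨1, by simp⟩
      · exact ⟨κ, by simp [add_comm]⟩

/-! ### Triangles -/

lemma IsAff.eventually_pos {g : Pt → ℝ} (hg : IsAff g) {x y : Pt}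
    (h : 0 < g x ∨ g x = 0 ∧ 0 < g y) : ∀ᶠ ε : ℝ in 𝓝[>] 0, 0 < g (x + ε • (y - x)) := by
  simp only [hg.lineMap]
  rcases h with h | ⟨h, h'⟩
  · have : Tendsto (fun ε : ℝ => (1 - ε) * g x + ε * g y) (𝓝 0) (𝓝 ((1 - 0) * g x + 0 * g y)) :=
      Continuous.tendsto (by fun_prop) 0
    exact (this.mono_left nhdsWithin_le_nhds).eventually_const_lt (by simpa using h)
  · filter_upwards [self_mem_nhdsWithin] with ε (hε : 0 < ε)
    rw [h, mul_zero, zero_add]; positivity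

lemma IsAff.isOpen_pos {g : Pt → ℝ} (hg : IsAff g) : IsOpen {z | 0 < g z} :=
  isOpen_lt continuous_const hg.continuous

lemma IsAff.convex_nonneg {g : Pt → ℝ} (hg : IsAff g) : Convex ℝ {z | 0 ≤ g z} := by
  intro x hx y hy a b ha hb hab
  simp only [mem_ofPred_eq] at *
  rw [hg.comb x y hab]; positivity

lemma IsAff.convex_pos {g : Pt → ℝ} (hg : IsAff g) : Convex ℝ {z | 0 < g z} := by
  intro x hx y hy a b ha hb hab
  simp only [mem_ofPred_eq] at *
  rw [hg.comb x y hab]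
  rcases ha.eq_or_lt with rfl | ha
  · obtain rfl : b = 1 := by linarith
    simpa using hy
  · positivity

section Triangle

variable {s : Side} {a b c z : Pt}

lemma bary_eq (h : turn s a b c ≠ 0) (z : Pt) :
    z = (turn s b c z / turn s a b c) • a + (turn s c a z / turn s a b c) • b
      + (turn s a b z / turn s a b c) • c := by
  apply ext_pt
  · have := IsAff.bary (g := fun z => z 0) ⟨1, 0, 0, fun z => by ring⟩ s a b c z
    simp; field_simp; linarith
  · have := IsAff.bary (g := fun z => z 1) ⟨0, 1, 0, fun z => by ring⟩ s a b c z
    simp; field_simp; linarith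

lemma turn_sum (s : Side) (a b c z : Pt) :
    turn s b c z + turn s c a z + turn s a b z = turn s a b c := by
  cases s <;> simp only [turn, cross] <;> ring

lemma mem_triangle_iff (h : 0 < turn s a b c) :
    z ∈ convexHull ℝ {a, b, c} ↔ 0 ≤ turn s a b z ∧ 0 ≤ turn s b c z ∧ 0 ≤ turn s c a z := by
  have h' : 0 < turn s b c a := by rwa [← turn_cyc]
  have h'' : 0 < turn s c a b := by rwa [← turn_cyc, ← turn_cyc]
  constructor
  · intro hz
    refine ⟨convexHull_min ?_ (isAff_turn s a b).convex_nonneg hz,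
      convexHull_min ?_ (isAff_turn s b c).convex_nonneg hz,
      convexHull_min ?_ (isAff_turn s c a).convex_nonneg hz⟩ <;>
    · rintro x (rfl | rfl | rfl) <;> simp [h.le, h'.le, h''.le]
  · rintro ⟨h1, h2, h3⟩
    have hs := turn_sum s a b c z
    have := (convex_convexHull ℝ {a, b, c}).sum_mem (t := Finset.univ)
      (w := ![turn s b c z / turn s a b c, turn s c a z / turn s a b c, turn s a b z / turn s a b c])
      (z := ![a, b, c]) ?_ ?_ ?_
    · rw [bary_eq h.ne' z]
      simpa [Fin.sum_univ_three] using this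
    · intro i _; fin_cases i <;> simp <;> positivity
    · simp [Fin.sum_univ_three]; field_simp; linarith
    · intro i _; apply subset_convexHull; fin_cases i <;> simp

/-- Otherwise a small move away from the corner `c` leaves the triangle through the side `a b`. -/
lemma triangle_le_interior (h : 0 < turn s a b c) (hz : z ∈ interior (convexHull ℝ {a, b, c})) :
    0 < turn s a b z := by
  have h0 : 0 ≤ turn s a b z := ((mem_triangle_iff h).1 (interior_subset hz)).1
  refine h0.lt_of_ne fun h0 => ?_
  have hc : Continuous fun ε : ℝ => z + ε • (c - z) := by fun_prop
  have : ∀ᶠ ε : ℝ in 𝓝[<] 0, z + ε • (c - z) ∈ interior (convexHull ℝ {a, b, c}) :=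
    (hc.tendsto 0).mono_left nhdsWithin_le_nhds <| by
      simpa using isOpen_interior.mem_nhds hz
  obtain ⟨ε, hε, hneg⟩ := (this.and self_mem_nhdsWithin).exists
  have := ((mem_triangle_iff h).1 (interior_subset hε)).1
  rw [(isAff_turn s a b).lineMap, ← h0] at this
  have hneg : ε < 0 := hneg
  nlinarith

lemma mem_interior_triangle_iff (h : 0 < turn s a b c) :
    z ∈ interior (convexHull ℝ {a, b, c}) ↔
      0 < turn s a b z ∧ 0 < turn s b c z ∧ 0 < turn s c a z := by
  have h' : 0 < turn s b c a := by rwa [← turn_cyc]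
  have h'' : 0 < turn s c a b := by rwa [← turn_cyc, ← turn_cyc]
  have e1 : ({a, b, c} : Set Pt) = {b, c, a} := by
    rw [Set.insert_comm a b, Set.pair_comm a c]
  have e2 : ({a, b, c} : Set Pt) = {c, a, b} := by
    rw [e1, Set.insert_comm b c, Set.pair_comm b a]
  constructor
  · intro hz
    exact ⟨triangle_le_interior h hz, triangle_le_interior h' (e1 ▸ hz),
      triangle_le_interior h'' (e2 ▸ hz)⟩
  · rintro ⟨h1, h2, h3⟩
    have ho : IsOpen ({z | 0 < turn s a b z} ∩ ({z | 0 < turn s b c z} ∩ {z | 0 < turn s c a z})) :=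
      (isAff_turn s a b).isOpen_pos.inter
        ((isAff_turn s b c).isOpen_pos.inter (isAff_turn s c a).isOpen_pos)
    refine interior_maximal ?_ ho ⟨h1, h2, h3⟩
    rintro x ⟨g1, g2, g3⟩
    exact (mem_triangle_iff h).2 ⟨le_of_lt g1, le_of_lt g2, le_of_lt g3⟩

end Triangle

/-! ### Triangulations -/

lemma exists_side_pos {a b c : Pt} (h : cross a b c ≠ 0) : ∃ s, 0 < turn s a b c := by
  rcases lt_or_gt_of_ne h with h | h
  · exact ⟨.right, by simpa [turn] using h⟩
  · exact ⟨.left, h⟩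

namespace SimplePolygon

variable {n : ℕ} [NeZero n] {P : SimplePolygon n} {T : Finset (Finset (Fin n))}

lemma hull_triple (P : SimplePolygon n) (i j l : Fin n) :
    P.hull {i, j, l} = convexHull ℝ {P.vert i, P.vert j, P.vert l} := by
  simp [hull, image_insert_eq]

lemma hull_pair (P : SimplePolygon n) (i j : Fin n) :
    P.hull {i, j} = segment ℝ (P.vert i) (P.vert j) := by
  simp [hull, image_insert_eq, convexHull_pair]

lemma hull_mono (P : SimplePolygon n) {t t' : Finset (Fin n)} (h : t ⊆ t') :
    P.hull t ⊆ P.hull t' :=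
  convexHull_mono (image_mono (by exact_mod_cast h))

lemma isCompact_hull (P : SimplePolygon n) (t : Finset (Fin n)) : IsCompact (P.hull t) :=
  (t.finite_toSet.image P.vert).isCompact_convexHull ℝ

lemma isClosed_hull (P : SimplePolygon n) (t : Finset (Fin n)) : IsClosed (P.hull t) :=
  (P.isCompact_hull t).isClosed

lemma convex_hull (P : SimplePolygon n) (t : Finset (Fin n)) : Convex ℝ (P.hull t) :=
  convex_convexHull ℝ _

lemma vert_mem_hull (P : SimplePolygon n) {t : Finset (Fin n)} {i : Fin n} (h : i ∈ t) :
    P.vert i ∈ P.hull t := subset_convexHull _ _ ⟨i, h, rfl⟩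

lemma GeneralPosition.turn_ne (h : P.GeneralPosition) (s : Side) {i j l : Fin n} (hij : i ≠ j)
    (hjl : j ≠ l) (hil : i ≠ l) : turn s (P.vert i) (P.vert j) (P.vert l) ≠ 0 := by
  rw [Ne, turn_eq_zero_iff, ← collinear_iff_cross]
  exact h i j l hij hjl hil

/-- The corners of a triangle, for three of its vertices. -/
lemma interior_hull_iff (P : SimplePolygon n) {s : Side} {i j l : Fin n} {z : Pt}
    (h : 0 < turn s (P.vert i) (P.vert j) (P.vert l)) :
    z ∈ interior (P.hull {i, j, l}) ↔ 0 < turn s (P.vert i) (P.vert j) z ∧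
      0 < turn s (P.vert j) (P.vert l) z ∧ 0 < turn s (P.vert l) (P.vert i) z := by
  rw [hull_triple, mem_interior_triangle_iff h]

lemma hull_iff (P : SimplePolygon n) {s : Side} {i j l : Fin n} {z : Pt}
    (h : 0 < turn s (P.vert i) (P.vert j) (P.vert l)) :
    z ∈ P.hull {i, j, l} ↔ 0 ≤ turn s (P.vert i) (P.vert j) z ∧
      0 ≤ turn s (P.vert j) (P.vert l) z ∧ 0 ≤ turn s (P.vert l) (P.vert i) z := by
  rw [hull_triple, mem_triangle_iff h]

lemma interior_hull_nonempty (P : SimplePolygon n) {s : Side} {i j l : Fin n}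
    (h : 0 < turn s (P.vert i) (P.vert j) (P.vert l)) : (interior (P.hull {i, j, l})).Nonempty := by
  refine ⟨(1/3 : ℝ) • P.vert i + (1/3 : ℝ) • P.vert j + (1/3 : ℝ) • P.vert l,
    (P.interior_hull_iff h).2 ?_⟩
  have h' := turn_cyc s (P.vert i) (P.vert j) (P.vert l)
  have h'' := turn_cyc s (P.vert j) (P.vert l) (P.vert i)
  refine ⟨?_, ?_, ?_⟩ <;> rw [(isAff_turn s _ _).comb₃ _ _ _ (by norm_num)] <;> simp <;> linarith

namespace IsTriangulation

variable (hT : P.IsTriangulation T)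
include hT

lemma triple_ne {i j l : Fin n} (h : {i, j, l} ∈ T) : i ≠ j ∧ j ≠ l ∧ i ≠ l := by
  have := hT.card_eq _ h
  refine ⟨?_, ?_, ?_⟩ <;> rintro rfl
  · have := Finset.card_le_two (a := i) (b := l); simp_all
  · have := Finset.card_le_two (a := i) (b := j); simp_all
  · have := Finset.card_le_two (a := i) (b := j)
    simp [Finset.pair_comm j i] at *; omega

lemma turn_ne (s : Side) {i j l : Fin n} (h : {i, j, l} ∈ T) :
    turn s (P.vert i) (P.vert j) (P.vert l) ≠ 0 := by
  have := hT.nondegenerate _ h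
  rw [Ne, turn_eq_zero_iff, ← collinear_iff_cross]
  simpa [image_insert_eq] using this

lemma exists_third {t : Finset (Fin n)} (ht : t ∈ T) {i j : Fin n} (hi : i ∈ t) (hj : j ∈ t)
    (hij : i ≠ j) : ∃ l, t = {i, j, l} ∧ l ≠ i ∧ l ≠ j := by
  have h1 : ((t.erase i).erase j).card = 1 := by
    rw [Finset.card_erase_of_mem (by simp [hj, hij.symm]), Finset.card_erase_of_mem hi,
      hT.card_eq t ht]
  obtain ⟨l, hl⟩ := Finset.card_eq_one.1 h1
  have hl' : l ∈ (t.erase i).erase j := by simp [hl]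
  simp at hl'
  refine ⟨l, ?_, hl'.2.1, hl'.1⟩
  rw [← hl, Finset.insert_erase (by simp [hj, hij.symm]), Finset.insert_erase hi]

lemma not_subset {t t' : Finset (Fin n)} (ht : t ∈ T) (ht' : t' ∈ T) (hne : t ≠ t') :
    ¬ t ⊆ t' := fun h =>
  hne (Finset.eq_of_subset_of_card_le h (by rw [hT.card_eq _ ht, hT.card_eq _ ht']))

lemma exists_triple {t : Finset (Fin n)} (ht : t ∈ T) :
    ∃ i j l, t = {i, j, l} ∧ i ≠ j ∧ j ≠ l ∧ i ≠ l := by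
  obtain ⟨i, j, l, h1, h2, h3, rfl⟩ := Finset.card_eq_three.1 (hT.card_eq t ht)
  exact ⟨i, j, l, rfl, h1, h3, h2⟩

lemma exists_erase {t u : Finset (Fin n)} (ht : t ∈ T) (hu : u ⊆ t) (hne : ¬ t ⊆ u) :
    ∃ i j l, t = {i, j, l} ∧ u ⊆ {i, j} := by
  obtain ⟨l, hl, hlu⟩ := Finset.not_subset.1 hne
  have h2 : (t.erase l).card = 2 := by rw [Finset.card_erase_of_mem hl, hT.card_eq t ht]
  obtain ⟨i, j, hij, he⟩ := Finset.card_eq_two.1 h2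
  refine ⟨i, j, l, ?_, ?_⟩
  · rw [← Finset.insert_erase hl, he]
    ext x; simp; tauto
  · rw [← he]; intro x hx
    exact Finset.mem_erase.2 ⟨fun h => hlu (h ▸ hx), hu hx⟩

/-- A common point lies in the hull of the common corners, hence on a side of `t`, where the
corresponding area vanishes; in the interior it is positive. -/
lemma disjoint_interior {t t' : Finset (Fin n)} (ht : t ∈ T) (ht' : t' ∈ T) (hne : t ≠ t') :
    Disjoint (interior (P.hull t)) (P.hull t') := by
  rw [Set.disjoint_left]
  intro z hz hz'
  have h : z ∈ P.hull (t ∩ t') := hT.face t ht t' ht' hne ▸ ⟨interior_subset hz, hz'⟩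
  obtain ⟨i, j, l, rfl, hu⟩ := hT.exists_erase ht (Finset.inter_subset_left (s₂ := t'))
    fun h => hT.not_subset ht ht' hne (h.trans Finset.inter_subset_right)
  have h2 := P.hull_mono hu h
  rw [P.hull_pair] at h2
  obtain ⟨s, hs⟩ := exists_side_pos ((turn_eq_zero_iff .left _ _ _).not.1 (hT.turn_ne .left ht))
  have := ((P.interior_hull_iff hs).1 hz).1
  rw [(isAff_turn s _ _).eq_zero_segment (by simp) (by simp) h2] at this
  exact lt_irrefl _ this

/-- If `i` were not a common corner, the common face would lie in the side `j l`, which contains no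
point of the open side `i j`. -/
lemma mem_of_mem_openSegment {t t' : Finset (Fin n)} (ht : t ∈ T) (ht' : t' ∈ T) {i j : Fin n}
    (hi : i ∈ t) (hj : j ∈ t) (hij : i ≠ j) {p : Pt}
    (hp : p ∈ openSegment ℝ (P.vert i) (P.vert j)) (hp' : p ∈ P.hull t') : i ∈ t' := by
  by_contra hit
  have hne : t ≠ t' := by rintro rfl; exact hit hi
  obtain ⟨l, rfl, hli, hlj⟩ := hT.exists_third ht hi hj hij
  have h1 : p ∈ P.hull ({i, j, l} ∩ t') := hT.face _ ht t' ht' hne ▸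
    ⟨(P.convex_hull _).segment_subset (P.vert_mem_hull hi) (P.vert_mem_hull hj)
      (openSegment_subset_segment _ _ _ hp), hp'⟩
  have h2 : p ∈ P.hull {j, l} := P.hull_mono (fun x hx => by
    simp only [Finset.mem_inter, Finset.mem_insert, Finset.mem_singleton] at hx ⊢
    rcases hx with ⟨rfl | h, h'⟩
    · exact absurd h' hit
    · exact h) h1
  rw [P.hull_pair] at h2
  obtain ⟨s, hs⟩ := exists_side_pos ((turn_eq_zero_iff .left _ _ _).not.1 (hT.turn_ne .left ht))
  rw [turn_cyc] at hs
  have h3 := (isAff_turn s _ _).pos_openSegment (x := P.vert j) (y := P.vert i)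
    (by simp) hs (by rwa [openSegment_symm])
  rw [(isAff_turn s _ _).eq_zero_segment (by simp) (by simp) h2] at h3
  exact lt_irrefl _ h3

/-- Distinct triangles with a common side lie on different sides of it. -/
lemma opposite {s : Side} {u w x x' : Fin n} (ht : {u, w, x} ∈ T) (ht' : {u, w, x'} ∈ T)
    (hne : x ≠ x') (h : 0 < turn s (P.vert u) (P.vert w) (P.vert x)) :
    turn s (P.vert u) (P.vert w) (P.vert x') < 0 := by
  by_contra hc
  have h' : 0 < turn s (P.vert u) (P.vert w) (P.vert x') :=
    lt_of_le_of_ne (not_lt.1 hc) (hT.turn_ne s ht').symm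
  have hne' : ({u, w, x} : Finset (Fin n)) ≠ {u, w, x'} := by
    intro he
    have h1 : x ∈ ({u, w, x'} : Finset (Fin n)) := he ▸ by simp
    have := hT.triple_ne ht
    simp only [Finset.mem_insert, Finset.mem_singleton] at h1
    rcases h1 with rfl | rfl | rfl <;> simp_all
  have c1 := turn_cyc s (P.vert u) (P.vert w) (P.vert x)
  have c2 := turn_cyc s (P.vert w) (P.vert x) (P.vert u)
  have c1' := turn_cyc s (P.vert u) (P.vert w) (P.vert x')
  have c2' := turn_cyc s (P.vert w) (P.vert x') (P.vert u)
  -- If both corners were on the same side, a point just off the midpoint of the common side,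
  -- towards `x`, would be interior to both triangles.
  set m : Pt := (1/2 : ℝ) • P.vert u + (1/2 : ℝ) • P.vert w with hm
  have hv : ∀ p q, turn s p q m = (1/2) * turn s p q (P.vert u) + (1/2) * turn s p q (P.vert w) :=
    fun p q => (isAff_turn s p q).comb _ _ (by norm_num)
  have e0 := (isAff_turn s (P.vert u) (P.vert w)).eventually_pos (x := m) (y := P.vert x)
    (Or.inr ⟨by simp [hv], h⟩)
  have e1 := (isAff_turn s (P.vert w) (P.vert x)).eventually_pos (x := m) (y := P.vert x)
    (Or.inl (by simp [hv]; linarith))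
  have e2 := (isAff_turn s (P.vert x) (P.vert u)).eventually_pos (x := m) (y := P.vert x)
    (Or.inl (by simp [hv]; linarith))
  have e1' := (isAff_turn s (P.vert w) (P.vert x')).eventually_pos (x := m) (y := P.vert x)
    (Or.inl (by simp [hv]; linarith))
  have e2' := (isAff_turn s (P.vert x') (P.vert u)).eventually_pos (x := m) (y := P.vert x)
    (Or.inl (by simp [hv]; linarith))
  obtain ⟨ε, h0, h1, h2, h1', h2'⟩ := (e0.and (e1.and (e2.and (e1'.and e2')))).exists
  exact Set.disjoint_left.1 (hT.disjoint_interior ht ht' hne')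
    ((P.interior_hull_iff h).2 ⟨h0, h1, h2⟩)
    (interior_subset ((P.interior_hull_iff h').2 ⟨h0, h1', h2'⟩))

/-- At most two triangles share a side. -/
lemma eq_of_three {u w x y z : Fin n} (hx : {u, w, x} ∈ T) (hy : {u, w, y} ∈ T)
    (hz : {u, w, z} ∈ T) (hxy : x ≠ y) (hxz : x ≠ z) : y = z := by
  by_contra hyz
  obtain ⟨s, hs⟩ := exists_side_pos ((turn_eq_zero_iff .left _ _ _).not.1 (hT.turn_ne .left hx))
  have h1 := hT.opposite hx hy hxy hs
  have h2 := hT.opposite hx hz hxz hs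
  have h3 := hT.opposite (s := s.opp) hy hz hyz (by rw [turn_opp]; linarith)
  rw [turn_opp] at h3; linarith

lemma interior_nonempty {t : Finset (Fin n)} (ht : t ∈ T) : (interior (P.hull t)).Nonempty := by
  obtain ⟨i, j, l, rfl, -⟩ := hT.exists_triple ht
  obtain ⟨s, hs⟩ := exists_side_pos ((turn_eq_zero_iff .left _ _ _).not.1 (hT.turn_ne .left ht))
  exact P.interior_hull_nonempty hs

lemma closure_interior {t : Finset (Fin n)} (ht : t ∈ T) :
    closure (interior (P.hull t)) = P.hull t := by
  rw [(P.convex_hull t).closure_interior_eq_closure_of_nonempty_interior (hT.interior_nonempty ht),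
    (P.isClosed_hull t).closure_eq]

end IsTriangulation

end SimplePolygon

namespace SimplePolygon

variable {n : ℕ} [NeZero n] {P : SimplePolygon n} {T : Finset (Finset (Fin n))}

/-! ### The curve and the exterior -/

lemma one_ne_zero' (P : SimplePolygon n) : (1 : Fin n) ≠ 0 := by
  have := P.three_le
  intro h
  have := congrArg Fin.val h
  simp [Nat.mod_eq_of_lt (show 1 < n by omega)] at this

lemma two_ne_zero' (P : SimplePolygon n) : (1 + 1 : Fin n) ≠ 0 := by
  have := P.three_le
  intro h
  have := congrArg Fin.val h
  simp [Fin.val_add, Nat.mod_eq_of_lt (show 1 < n by omega),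
    Nat.mod_eq_of_lt (show 2 < n by omega)] at this

lemma succ_ne (P : SimplePolygon n) (j : Fin n) : j + 1 ≠ j := fun h =>
  P.one_ne_zero' (by simpa using h)

lemma succ_succ_ne (P : SimplePolygon n) (j : Fin n) : j + 1 + 1 ≠ j := fun h =>
  P.two_ne_zero' (by rw [add_assoc] at h; simpa using h)

lemma ofNat_succ (m : ℕ) : Fin.ofNat n (m + 1) = Fin.ofNat n m + 1 := by
  ext; simp [Fin.val_add]

/-- A step from `j` to `j + 1` reaches every vertex. -/
lemma forall_of_succ {Q : Fin n → Prop} {i : Fin n} (hi : Q i) (h : ∀ j, Q j → Q (j + 1))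
    (j : Fin n) : Q j := by
  have key : ∀ m : ℕ, Q (i + Fin.ofNat n m) := by
    intro m
    induction m with
    | zero => simpa using hi
    | succ m ih => have := h _ ih; rwa [add_assoc, ← ofNat_succ] at this
  have := key (j - i).val
  rwa [Fin.ofNat_val_eq_self, add_sub_cancel] at this

lemma edge_subset_curve (P : SimplePolygon n) (j : Fin n) :
    segment ℝ (P.vert j) (P.vert (j + 1)) ⊆ P.curve := subset_iUnion_of_subset j Subset.rfl

lemma vert_mem_curve (P : SimplePolygon n) (j : Fin n) : P.vert j ∈ P.curve :=
  P.edge_subset_curve j (left_mem_segment ..)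

lemma isCompact_segment (x y : Pt) : IsCompact (segment ℝ x y) := by
  rw [← convexHull_pair]; exact ((Set.finite_singleton y).insert x).isCompact_convexHull ℝ

lemma isCompact_curve (P : SimplePolygon n) : IsCompact P.curve :=
  isCompact_iUnion fun _ => isCompact_segment ..

lemma isClosed_curve (P : SimplePolygon n) : IsClosed P.curve := P.isCompact_curve.isClosed

lemma vert_notMem_inside (P : SimplePolygon n) (j : Fin n) : P.vert j ∉ P.inside :=
  fun h => h.1 (P.vert_mem_curve j)

/-- The exterior of the polygon. -/
def outside (P : SimplePolygon n) : Set Pt := P.regionᶜ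

lemma mem_outside_iff {x : Pt} : x ∈ P.outside ↔ x ∉ P.curve ∧ x ∉ P.inside := by
  simp [outside, region, and_comm]

lemma subset_inside {C : Set Pt} (hC : IsPreconnected C) (hK : C ⊆ P.curveᶜ)
    (h : (C ∩ P.inside).Nonempty) : C ⊆ P.inside := by
  obtain ⟨x, hxC, hx⟩ := h
  intro y hy
  refine ⟨hK hy, ?_⟩
  have := connectedComponentIn_eq (hC.subset_connectedComponentIn hxC hK hy)
  exact this ▸ hx.2

lemma subset_outside {C : Set Pt} (hC : IsPreconnected C) (hK : C ⊆ P.curveᶜ)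
    (h : (C ∩ P.outside).Nonempty) : C ⊆ P.outside := by
  obtain ⟨x, hxC, hx⟩ := h
  intro y hy
  refine mem_outside_iff.2 ⟨hK hy, fun hy' => ?_⟩
  exact (mem_outside_iff.1 hx).2 (subset_inside hC hK ⟨y, hy, hy'⟩ hxC)

lemma exists_ball {x : Pt} (hx : x ∉ P.curve) : ∃ r > 0, Metric.ball x r ⊆ P.curveᶜ :=
  Metric.isOpen_iff.1 P.isClosed_curve.isOpen_compl x hx

lemma isOpen_inside (P : SimplePolygon n) : IsOpen P.inside := by
  refine Metric.isOpen_iff.2 fun x hx => ?_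
  obtain ⟨r, hr, h⟩ := exists_ball hx.1
  exact ⟨r, hr, subset_inside (convex_ball x r).isPreconnected h
    ⟨x, Metric.mem_ball_self hr, hx⟩⟩

lemma isOpen_outside (P : SimplePolygon n) : IsOpen P.outside := by
  refine Metric.isOpen_iff.2 fun x hx => ?_
  obtain ⟨r, hr, h⟩ := exists_ball (mem_outside_iff.1 hx).1
  exact ⟨r, hr, subset_outside (convex_ball x r).isPreconnected h
    ⟨x, Metric.mem_ball_self hr, hx⟩⟩

lemma notMem_inside_of_unbounded {C : Set Pt} {x : Pt} (hC : IsPreconnected C)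
    (hK : C ⊆ P.curveᶜ) (hu : ¬ Bornology.IsBounded C) (hx : x ∈ C) : x ∉ P.inside :=
  fun h => hu (h.2.subset (hC.subset_connectedComponentIn hx hK))

/-- A half-plane that misses a disc around the curve is connected, disjoint from the curve and
unbounded. -/
lemma outside_nonempty (P : SimplePolygon n) : P.outside.Nonempty := by
  obtain ⟨R, hR⟩ := P.isCompact_curve.isBounded.subset_closedBall 0
  have hconv : Convex ℝ {z : Pt | 0 < z 0 - R} :=
    (IsAff.convex_pos (g := fun z => z 0 - R) ⟨1, 0, -R, fun z => by ring⟩)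
  have hK : {z : Pt | 0 < z 0 - R} ⊆ P.curveᶜ := by
    intro z hz hzK
    have h1 := hR hzK
    have h2 := EuclideanSpace.norm_eq z
    rw [mem_closedBall_zero_iff] at h1
    have h3 : |z 0| ≤ ‖z‖ := by simpa using PiLp.norm_apply_le z 0
    have h4 : 0 < z 0 - R := hz
    linarith [le_abs_self (z 0)]
  refine ⟨!₂[R + 1, 0], mem_outside_iff.2 ?_⟩
  have hmem : (!₂[R + 1, 0] : Pt) ∈ {z : Pt | 0 < z 0 - R} := by simp
  refine ⟨hK hmem, notMem_inside_of_unbounded hconv.isPreconnected hK (fun hb => ?_) hmem⟩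
  obtain ⟨R', hR'⟩ := hb.subset_closedBall 0
  have h5 : (!₂[|R| + |R'| + 1, 0] : Pt) ∈ {z : Pt | 0 < z 0 - R} := by
    simp; linarith [le_abs_self R, abs_nonneg R']
  have h6 := hR' h5
  rw [mem_closedBall_zero_iff] at h6
  have h7 := PiLp.norm_apply_le (!₂[|R| + |R'| + 1, 0] : Pt) 0
  simp only [Matrix.cons_val_zero, Real.norm_eq_abs] at h7
  linarith [le_abs_self (|R| + |R'| + 1), le_abs_self R', abs_nonneg R]

lemma mem_edge_iff_of_vert {i j : Fin n}
    (h : P.vert (j + 1) ∈ segment ℝ (P.vert i) (P.vert (i + 1))) : i = j ∨ i = j + 1 := by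
  by_cases hij : i = j
  · exact Or.inl hij
  · obtain ⟨l, ⟨hl, hl'⟩, he⟩ := P.simple i j hij ⟨h, right_mem_segment ..⟩
    obtain rfl := P.injective he
    rcases hl with h | h
    · exact Or.inr h.symm
    · exact absurd (add_right_cancel h).symm hij

lemma edge_disjoint {i j : Fin n} (hij : i ≠ j) {x : Pt}
    (hx : x ∈ openSegment ℝ (P.vert j) (P.vert (j + 1))) :
    x ∉ segment ℝ (P.vert i) (P.vert (i + 1)) := by
  intro hx'
  obtain ⟨l, ⟨-, hl⟩, rfl⟩ := P.simple i j hij ⟨hx', openSegment_subset_segment _ _ _ hx⟩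
  have hne : P.vert j ≠ P.vert (j + 1) := fun h => P.succ_ne j (P.injective h).symm
  rcases hl with rfl | rfl
  · exact hne ((left_mem_openSegment_iff).1 hx)
  · exact hne ((right_mem_openSegment_iff).1 hx)

/-- Away from the edges that contain `x`, there is nothing of the curve near `x`. -/
lemma exists_radius {x : Pt} (S : Set (Fin n))
    (hS : ∀ i, x ∈ segment ℝ (P.vert i) (P.vert (i + 1)) → i ∈ S) :
    ∃ r > 0, P.curve ∩ Metric.ball x r ⊆ ⋃ i ∈ S, segment ℝ (P.vert i) (P.vert (i + 1)) := by
  have hcl : IsClosed (⋃ i ∈ Sᶜ, segment ℝ (P.vert i) (P.vert (i + 1))) :=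
    (Set.toFinite _).isClosed_biUnion fun i _ => (isCompact_segment _ _).isClosed
  obtain ⟨r, hr, h⟩ := Metric.isOpen_iff.1 hcl.isOpen_compl x (by
    simp only [mem_compl_iff, mem_iUnion, not_exists]
    exact fun i hi hx => hi (hS i hx))
  refine ⟨r, hr, ?_⟩
  rintro y ⟨hy, hyr⟩
  obtain ⟨i, hi⟩ := mem_iUnion.1 hy
  refine mem_biUnion (x := i) ?_ hi
  by_contra hiS
  exact h hyr (mem_biUnion (x := i) hiS hi)

lemma mem_closure_of_eventually {S : Set Pt} {x q : Pt}
    (h : ∀ᶠ ε : ℝ in 𝓝[>] 0, x + ε • (q - x) ∈ S) : x ∈ closure S := by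
  have hc : Continuous fun ε : ℝ => x + ε • (q - x) := by fun_prop
  have : Tendsto (fun ε : ℝ => x + ε • (q - x)) (𝓝[>] 0) (𝓝 x) := by
    simpa using (hc.tendsto 0).mono_left nhdsWithin_le_nhds
  exact mem_closure_of_tendsto this h

lemma eventually_mem_open {U : Set Pt} (hU : IsOpen U) {x : Pt} (hx : x ∈ U) (q : Pt) :
    ∀ᶠ ε : ℝ in 𝓝[>] 0, x + ε • (q - x) ∈ U := by
  have hc : Continuous fun ε : ℝ => x + ε • (q - x) := by fun_prop
  exact (hc.tendsto 0).mono_left nhdsWithin_le_nhds (by simpa using hU.mem_nhds hx)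

/-- Near a point of the curve, its complement has two sides, and the curve is in the closure of
both. -/
lemma local_structure (hP : P.GeneralPosition) {x : Pt} (hx : x ∈ P.curve) {ε : ℝ} (hε : 0 < ε) :
    ∃ r > 0, ∃ C₁ C₂ : Set Pt, IsPreconnected C₁ ∧ IsPreconnected C₂ ∧
      C₁ ∪ C₂ ⊆ P.curveᶜ ∩ Metric.ball x ε ∧ Metric.ball x r \ P.curve ⊆ C₁ ∪ C₂ ∧
      P.curve ∩ Metric.ball x r ⊆ closure C₁ ∩ closure C₂ := by
  -- At a vertex the two local sides are a convex angular sector and a union of two overlapping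
  -- half-discs; elsewhere on an edge they are two half-discs. The vertex is written as `j + 1` so
  -- that its edges are those with indices `j` and `j + 1`.
  by_cases hv : ∃ j, x = P.vert (j + 1)
  · obtain ⟨j, rfl⟩ := hv
    obtain ⟨r₀, hr₀, hball⟩ := P.exists_radius (x := P.vert (j + 1)) {j, j + 1}
      fun i hi => mem_edge_iff_of_vert hi
    set v := P.vert (j + 1)
    set a := P.vert j
    set b := P.vert (j + 1 + 1)
    have hva : v ≠ a := fun h => P.succ_ne j (P.injective h)
    have hvb : v ≠ b := fun h => P.succ_ne (j + 1) (P.injective h).symm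
    obtain ⟨s, hs⟩ := exists_side_pos ((turn_eq_zero_iff .left v a b).not.1
      (hP.turn_ne .left (P.succ_ne j) (P.succ_succ_ne j).symm (P.succ_ne (j + 1)).symm))
    -- Within this radius the rays from `v` through `a` and `b` do not reach the far ends of the
    -- edges.
    set r := min (min r₀ ε) (min (dist v a) (dist v b))
    have hr : 0 < r := by simp [r, hr₀, hε, hva, hvb]
    have hrε : r ≤ ε := (min_le_left _ _).trans (min_le_right _ _)
    have hrr : r ≤ r₀ := (min_le_left _ _).trans (min_le_left _ _)
    have hra : r ≤ dist v a := (min_le_right _ _).trans (min_le_left _ _)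
    have hrb : r ≤ dist v b := (min_le_right _ _).trans (min_le_right _ _)
    set f₁ := turn s b v
    set f₂ := turn s v a
    have hf₁ : IsAff f₁ := isAff_turn ..
    have hf₂ : IsAff f₂ := isAff_turn ..
    have f₁v : f₁ v = 0 := by simp [f₁]
    have f₂v : f₂ v = 0 := by simp [f₂]
    have f₁b : f₁ b = 0 := by simp [f₁]
    have f₂a : f₂ a = 0 := by simp [f₂]
    have f₁a : 0 < f₁ a := by simp only [f₁]; rwa [turn_cyc]
    have f₂b : 0 < f₂ b := hs
    have line₁ : ∀ z ∈ Metric.ball v r, f₁ z = 0 → 0 ≤ f₂ z → z ∈ P.curve := by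
      intro z hz h1 h2
      obtain ⟨κ, rfl⟩ := exists_of_cross_eq_zero hvb (r := z) (by
        rw [← turn_eq_zero_iff s, turn_swap]; simpa using h1)
      rw [hf₂.lineMap, f₂v, mul_zero, zero_add] at h2
      have h3 : 0 ≤ κ := nonneg_of_mul_nonneg_left h2 f₂b
      rw [Metric.mem_ball, dist_eq_norm, add_sub_cancel_left, norm_smul, Real.norm_eq_abs,
        abs_of_nonneg h3, ← dist_eq_norm, dist_comm] at hz
      have h4 : κ ≤ 1 := by
        by_contra h; push Not at h
        nlinarith [dist_nonneg (x := v) (y := b)]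
      exact P.edge_subset_curve (j + 1) ⟨1 - κ, κ, by linarith, h3, by ring, by module⟩
    have line₂ : ∀ z ∈ Metric.ball v r, f₂ z = 0 → 0 ≤ f₁ z → z ∈ P.curve := by
      intro z hz h1 h2
      obtain ⟨κ, rfl⟩ := exists_of_cross_eq_zero hva (r := z) (by
        rw [← turn_eq_zero_iff s]; simpa using h1)
      rw [hf₁.lineMap, f₁v, mul_zero, zero_add] at h2
      have h3 : 0 ≤ κ := nonneg_of_mul_nonneg_left h2 f₁a
      rw [Metric.mem_ball, dist_eq_norm, add_sub_cancel_left, norm_smul, Real.norm_eq_abs,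
        abs_of_nonneg h3, ← dist_eq_norm, dist_comm] at hz
      have h4 : κ ≤ 1 := by
        by_contra h; push Not at h
        nlinarith [dist_nonneg (x := v) (y := a)]
      exact P.edge_subset_curve j ⟨κ, 1 - κ, h3, by linarith, by ring, by module⟩
    have hK : ∀ z ∈ P.curve ∩ Metric.ball v r,
        (f₁ z = 0 ∧ 0 ≤ f₂ z) ∨ (f₂ z = 0 ∧ 0 ≤ f₁ z) := by
      rintro z ⟨hz, hzr⟩
      have := hball ⟨hz, Metric.ball_subset_ball hrr hzr⟩
      simp only [mem_iUnion, mem_insert_iff, mem_singleton_iff, exists_prop] at this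
      obtain ⟨i, rfl | rfl, hi⟩ := this
      · exact Or.inr ⟨hf₂.eq_zero_segment f₂a f₂v hi, hf₁.nonneg_segment f₁a.le f₁v.ge hi⟩
      · exact Or.inl ⟨hf₁.eq_zero_segment f₁v f₁b hi, hf₂.nonneg_segment f₂v.ge f₂b.le hi⟩
    -- `q` points into the sector from `v`, and `q'` in the opposite direction. Moving towards them
    -- leads from points of the curve into the two sides.
    set q : Pt := v + ((a - v) + (b - v))
    set q' : Pt := v - ((a - v) + (b - v))
    have hq : ∀ f : Pt → ℝ, IsAff f → f v = 0 → f q = f a + f b ∧ f q' = -(f a + f b) := by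
      rintro f ⟨x, y, c, H⟩ h
      rw [H] at h
      constructor <;> simp [q, q', H] <;> linarith
    obtain ⟨q1, q1'⟩ := hq f₁ hf₁ f₁v
    obtain ⟨q2, q2'⟩ := hq f₂ hf₂ f₂v
    rw [f₁b, add_zero] at q1 q1'
    rw [f₂a, zero_add] at q2 q2'
    have hB : IsOpen (Metric.ball v r) := Metric.isOpen_ball
    have cN₁ : Convex ℝ ({z | 0 < -f₁ z} ∩ Metric.ball v r) :=
      hf₁.neg.convex_pos.inter (convex_ball _ _)
    have cN₂ : Convex ℝ ({z | 0 < -f₂ z} ∩ Metric.ball v r) :=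
      hf₂.neg.convex_pos.inter (convex_ball _ _)
    refine ⟨r, hr, {z | 0 < f₁ z} ∩ {z | 0 < f₂ z} ∩ Metric.ball v r,
      ({z | 0 < -f₁ z} ∩ Metric.ball v r) ∪ ({z | 0 < -f₂ z} ∩ Metric.ball v r),
      ((hf₁.convex_pos.inter hf₂.convex_pos).inter (convex_ball _ _)).isPreconnected, ?_, ?_, ?_, ?_⟩
    · obtain ⟨δ, h1, h2, h3⟩ := ((hf₁.neg.eventually_pos (x := v) (y := q')
        (Or.inr ⟨by simp [f₁v], by linarith⟩)).and ((hf₂.neg.eventually_pos (x := v) (y := q')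
        (Or.inr ⟨by simp [f₂v], by linarith⟩)).and
        (eventually_mem_open hB (Metric.mem_ball_self hr) q'))).exists
      exact cN₁.isPreconnected.union _ ⟨h1, h3⟩ ⟨h2, h3⟩ cN₂.isPreconnected
    · rintro z (⟨⟨h1, h2⟩, h3⟩ | ⟨h1, h3⟩ | ⟨h1, h3⟩) <;>
      refine ⟨fun hzK => ?_, Metric.ball_subset_ball hrε h3⟩ <;>
      simp only [mem_ofPred_eq] at h1 <;>
      rcases hK z ⟨hzK, h3⟩ with ⟨h4, h5⟩ | ⟨h4, h5⟩ <;> try linarith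
      have : 0 < f₂ z := h2
      linarith
    · rintro z ⟨h1, h2⟩
      rcases lt_trichotomy (f₁ z) 0 with h | h | h
      · exact Or.inr (Or.inl ⟨by simpa using h, h1⟩)
      · rcases lt_or_ge (f₂ z) 0 with h' | h'
        · exact Or.inr (Or.inr ⟨by simpa using h', h1⟩)
        · exact absurd (line₁ z h1 h h') h2
      · rcases lt_trichotomy (f₂ z) 0 with h' | h' | h'
        · exact Or.inr (Or.inr ⟨by simpa using h', h1⟩)
        · exact absurd (line₂ z h1 h' h.le) h2
        · exact Or.inl ⟨⟨h, h'⟩, h1⟩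
    · rintro z hz
      have hz1 : 0 ≤ f₁ z := by rcases hK z hz with h | h <;> linarith
      have hz2 : 0 ≤ f₂ z := by rcases hK z hz with h | h <;> linarith
      constructor
      · refine mem_closure_of_eventually (q := q) ?_
        filter_upwards [hf₁.eventually_pos (x := z) (y := q) (by
            rcases hz1.eq_or_lt with h | h
            · exact Or.inr ⟨h.symm, by linarith⟩
            · exact Or.inl h), hf₂.eventually_pos (x := z) (y := q) (by
            rcases hz2.eq_or_lt with h | h
            · exact Or.inr ⟨h.symm, by linarith⟩
            · exact Or.inl h), eventually_mem_open hB hz.2 q] with δ h1 h2 h3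
        exact ⟨⟨h1, h2⟩, h3⟩
      · refine mem_closure_of_eventually (q := q') ?_
        rcases hK z hz with ⟨h, -⟩ | ⟨h, -⟩
        · filter_upwards [hf₁.neg.eventually_pos (x := z) (y := q')
            (Or.inr ⟨by simp [h], by linarith⟩), eventually_mem_open hB hz.2 q'] with δ h1 h3
          exact Or.inl ⟨h1, h3⟩
        · filter_upwards [hf₂.neg.eventually_pos (x := z) (y := q')
            (Or.inr ⟨by simp [h], by linarith⟩), eventually_mem_open hB hz.2 q'] with δ h1 h3
          exact Or.inr ⟨h1, h3⟩
  · push Not at hv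
    have hv' : ∀ j, x ≠ P.vert j := fun j => by simpa using hv (j - 1)
    obtain ⟨j, hj⟩ := mem_iUnion.1 hx
    have hj' : x ∈ openSegment ℝ (P.vert j) (P.vert (j + 1)) :=
      mem_openSegment_of_ne_left_right (hv' j).symm (hv' _).symm hj
    obtain ⟨r₀, hr₀, hball⟩ := P.exists_radius (x := x) {j} fun i hi => by
      by_contra h; exact edge_disjoint h hj' hi
    have hab : P.vert j ≠ P.vert (j + 1) := fun h => P.succ_ne j (P.injective h).symm
    have hxa := hv' j
    have hxb := hv' (j + 1)
    set a := P.vert j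
    set b := P.vert (j + 1)
    set r := min (min r₀ ε) (min (dist x a) (dist x b))
    have hr : 0 < r := by simp [r, hr₀, hε, hxa, hxb]
    have hrε : r ≤ ε := (min_le_left _ _).trans (min_le_right _ _)
    have hrr : r ≤ r₀ := (min_le_left _ _).trans (min_le_left _ _)
    have hra : r ≤ dist x a := (min_le_right _ _).trans (min_le_left _ _)
    have hrb : r ≤ dist x b := (min_le_right _ _).trans (min_le_right _ _)
    set f := turn .left a b
    have hf : IsAff f := isAff_turn ..
    have fa : f a = 0 := by simp [f]
    have fb : f b = 0 := by simp [f]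
    have hK : ∀ z ∈ P.curve ∩ Metric.ball x r, f z = 0 := by
      rintro z ⟨hz, hzr⟩
      have := hball ⟨hz, Metric.ball_subset_ball hrr hzr⟩
      simp only [mem_iUnion, mem_singleton_iff, exists_prop] at this
      obtain ⟨i, rfl, hi⟩ := this
      exact hf.eq_zero_segment fa fb hi
    have line : ∀ z ∈ Metric.ball x r, f z = 0 → z ∈ P.curve := by
      intro z hz h1
      obtain ⟨κ, rfl⟩ := exists_of_cross_eq_zero hab h1
      obtain ⟨α, β, hα, hβ, hαβ, rfl⟩ := hj
      obtain rfl : α = 1 - β := by linarith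
      have e1 : a + κ • (b - a) - ((1 - β) • a + β • b) = (κ - β) • (b - a) := by module
      have e2 : (1 - β) • a + β • b - a = β • (b - a) := by module
      have e3 : (1 - β) • a + β • b - b = (β - 1) • (b - a) := by module
      have hd : 0 < ‖b - a‖ := norm_pos_iff.2 (sub_ne_zero.2 hab.symm)
      rw [Metric.mem_ball, dist_eq_norm, e1, norm_smul] at hz
      rw [dist_eq_norm, e2, norm_smul] at hra
      rw [dist_eq_norm, e3, norm_smul] at hrb
      have g1 := lt_of_mul_lt_mul_right (hz.trans_le hra) hd.le
      have g2 := lt_of_mul_lt_mul_right (hz.trans_le hrb) hd.le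
      rw [Real.norm_eq_abs, Real.norm_eq_abs, abs_of_nonneg hβ, abs_lt] at g1
      rw [Real.norm_eq_abs, Real.norm_eq_abs, abs_of_nonpos (by linarith : β - 1 ≤ 0), abs_lt] at g2
      exact P.edge_subset_curve j ⟨1 - κ, κ, by linarith, by linarith, by ring, by module⟩
    obtain ⟨q, hq⟩ : ∃ q : Pt, 0 < f q := by
      refine ⟨!₂[a 0 - (b 1 - a 1), a 1 + (b 0 - a 0)], ?_⟩
      have : f !₂[a 0 - (b 1 - a 1), a 1 + (b 0 - a 0)]
          = (b 0 - a 0) ^ 2 + (b 1 - a 1) ^ 2 := by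
        simp [f, turn, cross]; ring
      rw [this]
      by_contra hc
      have h0 : b 0 - a 0 = 0 := by nlinarith [sq_nonneg (b 0 - a 0), sq_nonneg (b 1 - a 1)]
      have h1 : b 1 - a 1 = 0 := by nlinarith [sq_nonneg (b 0 - a 0), sq_nonneg (b 1 - a 1)]
      exact hab (ext_pt (by linarith) (by linarith))
    obtain ⟨q', hq'⟩ : ∃ q' : Pt, 0 < -f q' := by
      refine ⟨a - (q - a), ?_⟩
      have := hf.lineMap a q (-1)
      rw [fa] at this
      have e : a + (-1 : ℝ) • (q - a) = a - (q - a) := by module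
      rw [e] at this
      linarith
    have hB : IsOpen (Metric.ball x r) := Metric.isOpen_ball
    refine ⟨r, hr, {z | 0 < f z} ∩ Metric.ball x r, {z | 0 < -f z} ∩ Metric.ball x r,
      (hf.convex_pos.inter (convex_ball _ _)).isPreconnected,
      (hf.neg.convex_pos.inter (convex_ball _ _)).isPreconnected, ?_, ?_, ?_⟩
    · rintro z (⟨h1, h3⟩ | ⟨h1, h3⟩) <;>
      refine ⟨fun hzK => ?_, Metric.ball_subset_ball hrε h3⟩ <;>
      simp only [mem_ofPred_eq] at h1 <;> linarith [hK z ⟨hzK, h3⟩]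
    · rintro z ⟨h1, h2⟩
      rcases lt_trichotomy (f z) 0 with h | h | h
      · exact Or.inr ⟨by simpa using h, h1⟩
      · exact absurd (line z h1 h) h2
      · exact Or.inl ⟨h, h1⟩
    · rintro z hz
      constructor
      · refine mem_closure_of_eventually (q := q) ?_
        filter_upwards [hf.eventually_pos (x := z) (y := q) (Or.inr ⟨hK z hz, hq⟩),
          eventually_mem_open hB hz.2 q] with δ h1 h3
        exact ⟨h1, h3⟩
      · refine mem_closure_of_eventually (q := q') ?_
        filter_upwards [hf.neg.eventually_pos (x := z) (y := q') (Or.inr ⟨by simp [hK z hz], hq'⟩),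
          eventually_mem_open hB hz.2 q'] with δ h1 h3
        exact ⟨h1, h3⟩

/-- Every point of the curve is a limit of exterior points. -/
lemma curve_subset_closure_outside (hP : P.GeneralPosition) : P.curve ⊆ closure P.outside := by
  set Z := closure P.outside with hZ
  -- The limit points of the exterior are relatively open in the curve: one of the two local sides
  -- is exterior, and the whole curve near `x` is in its closure.
  have hO : ∀ x ∈ P.curve, x ∈ Z → x ∈ interior (Z ∪ P.curveᶜ) := by
    intro x hx hxZ
    obtain ⟨r, hr, C₁, C₂, h1, h2, h3, h4, h5⟩ := local_structure hP hx one_pos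
    obtain ⟨y, hy, hyr⟩ := mem_closure_iff.1 hxZ _ Metric.isOpen_ball (Metric.mem_ball_self hr)
    have hC : C₁ ⊆ P.outside ∨ C₂ ⊆ P.outside := by
      rcases h4 ⟨hy, (mem_outside_iff.1 hyr).1⟩ with h | h
      · exact Or.inl (subset_outside h1 (fun z hz => (h3 (Or.inl hz)).1) ⟨y, h, hyr⟩)
      · exact Or.inr (subset_outside h2 (fun z hz => (h3 (Or.inr hz)).1) ⟨y, h, hyr⟩)
    refine interior_maximal (fun z hz => ?_) Metric.isOpen_ball (Metric.mem_ball_self hr)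
    by_cases hzK : z ∈ P.curve
    · left
      rcases hC with h | h
      · exact closure_mono h (h5 ⟨hzK, hz⟩).1
      · exact closure_mono h (h5 ⟨hzK, hz⟩).2
    · exact Or.inr hzK
  -- They are also closed, so by connectedness an edge that contains one consists of them. From
  -- there the property spreads around the polygon.
  have hedge : ∀ i, (segment ℝ (P.vert i) (P.vert (i + 1)) ∩ Z).Nonempty →
      segment ℝ (P.vert i) (P.vert (i + 1)) ⊆ Z := by
    rintro i ⟨x, hx, hxZ⟩ y hy
    by_contra hyZ
    obtain ⟨z, hz, hz1, hz2⟩ := (convex_segment (𝕜 := ℝ) (P.vert i) (P.vert (i + 1))).isPreconnected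
      _ _ (isOpen_interior (s := Z ∪ P.curveᶜ)) (isClosed_closure (s := P.outside)).isOpen_compl
      (fun z hz => by
        by_cases h : z ∈ Z
        · exact Or.inl (hO z (P.edge_subset_curve i hz) h)
        · exact Or.inr h)
      ⟨x, hx, hO x (P.edge_subset_curve i hx) hxZ⟩ ⟨y, hy, hyZ⟩
    rcases interior_subset hz1 with h | h
    · exact hz2 h
    · exact h (P.edge_subset_curve i hz)
  -- Without such a point the exterior would be closed as well as open, hence the whole plane.
  have hne : ∃ x ∈ P.curve, x ∈ Z := by
    by_contra hcon
    push Not at hcon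
    have hcl : IsClosed P.outside := by
      refine isClosed_of_closure_subset fun z hz => mem_outside_iff.2 ⟨fun h => hcon z h hz, ?_⟩
      intro hin
      obtain ⟨y, hy, hy'⟩ := mem_closure_iff.1 hz _ P.isOpen_inside hin
      exact (mem_outside_iff.1 hy').2 hy
    rcases isClopen_iff.1 ⟨hcl, P.isOpen_outside⟩ with h | h
    · exact (h ▸ P.outside_nonempty).ne_empty rfl
    · exact (mem_outside_iff.1 (h ▸ mem_univ (P.vert 0))).1 (P.vert_mem_curve 0)
  obtain ⟨x, hx, hxZ⟩ := hne
  obtain ⟨i, hi⟩ := mem_iUnion.1 hx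
  have hall := forall_of_succ (Q := fun j => segment ℝ (P.vert j) (P.vert (j + 1)) ⊆ Z)
    (hedge i ⟨x, hi, hxZ⟩) fun j hj => hedge (j + 1)
      ⟨P.vert (j + 1), left_mem_segment .., hj (right_mem_segment ..)⟩
  exact iUnion_subset hall

/-- An open set that meets the curve also contains exterior points. -/
lemma disjoint_curve_of_subset_region (hP : P.GeneralPosition) {U : Set Pt} (hU : IsOpen U)
    (h : U ⊆ P.region) : U ⊆ P.inside := by
  intro x hx
  rcases h hx with h1 | h1
  · exact h1
  · obtain ⟨y, hy, hy'⟩ := mem_closure_iff.1 (curve_subset_closure_outside hP h1) U hU hx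
    exact absurd (h hy) hy'

namespace IsTriangulation

variable (hT : P.IsTriangulation T)
include hT

lemma hull_subset_region {t : Finset (Fin n)} (ht : t ∈ T) : P.hull t ⊆ P.region := by
  rw [← hT.cover]; exact subset_biUnion_of_mem (u := fun t => P.hull t) (Finset.mem_coe.2 ht)

lemma interior_subset_inside (hP : P.GeneralPosition) {t : Finset (Fin n)} (ht : t ∈ T) :
    interior (P.hull t) ⊆ P.inside :=
  disjoint_curve_of_subset_region hP isOpen_interior
    (interior_subset.trans (hT.hull_subset_region ht))

lemma exists_mem_hull {x : Pt} (hx : x ∈ P.region) : ∃ t ∈ T, x ∈ P.hull t := by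
  rw [← hT.cover] at hx; simpa using hx

/-- An edge of the polygon is a side of only one triangle. -/
lemma edge_unique (hP : P.GeneralPosition) {t t' : Finset (Fin n)} (ht : t ∈ T) (ht' : t' ∈ T)
    {j : Fin n} (h : {j, j + 1} ⊆ t) (h' : {j, j + 1} ⊆ t') : t = t' := by
  by_contra hne
  have hj := P.succ_ne j
  obtain ⟨x, rfl, -, -⟩ := hT.exists_third ht (h (by simp)) (h (by simp)) hj.symm
  obtain ⟨x', rfl, -, -⟩ := hT.exists_third ht' (h' (by simp)) (h' (by simp)) hj.symm
  have hxx : x ≠ x' := by rintro rfl; exact hne rfl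
  obtain ⟨s, hs⟩ := exists_side_pos ((turn_eq_zero_iff .left _ _ _).not.1 (hT.turn_ne .left ht))
  have hs' := hT.opposite ht ht' hxx hs
  have hs'' : 0 < turn s (P.vert (j + 1)) (P.vert j) (P.vert x') := by
    rw [turn_swap]; linarith
  have c1 := turn_cyc s (P.vert j) (P.vert (j + 1)) (P.vert x)
  have c2 := turn_cyc s (P.vert (j + 1)) (P.vert x) (P.vert j)
  have c1' := turn_cyc s (P.vert (j + 1)) (P.vert j) (P.vert x')
  have c2' := turn_cyc s (P.vert j) (P.vert x') (P.vert (j + 1))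
  set m : Pt := (1/2 : ℝ) • P.vert j + (1/2 : ℝ) • P.vert (j + 1) with hm
  have hv : ∀ p q, turn s p q m =
      (1/2) * turn s p q (P.vert j) + (1/2) * turn s p q (P.vert (j + 1)) :=
    fun p q => (isAff_turn s p q).comb _ _ (by norm_num)
  have hmK : m ∈ P.curve := P.edge_subset_curve j
    ⟨1/2, 1/2, by norm_num, by norm_num, by norm_num, rfl⟩
  -- The two triangles, on different sides of the edge, cover a neighbourhood of its midpoint; an
  -- open set in the region cannot contain this point of the curve.
  have hU : IsOpen (({z | 0 < turn s (P.vert (j + 1)) (P.vert x) z} ∩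
      {z | 0 < turn s (P.vert x) (P.vert j) z}) ∩ ({z | 0 < turn s (P.vert j) (P.vert x') z} ∩
      {z | 0 < turn s (P.vert x') (P.vert (j + 1)) z})) :=
    ((isAff_turn ..).isOpen_pos.inter (isAff_turn ..).isOpen_pos).inter
      ((isAff_turn ..).isOpen_pos.inter (isAff_turn ..).isOpen_pos)
  have hmU : m ∈ (({z | 0 < turn s (P.vert (j + 1)) (P.vert x) z} ∩
      {z | 0 < turn s (P.vert x) (P.vert j) z}) ∩ ({z | 0 < turn s (P.vert j) (P.vert x') z} ∩
      {z | 0 < turn s (P.vert x') (P.vert (j + 1)) z})) := by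
    simp only [mem_inter_iff, mem_ofPred_eq, hv, turn_self_left, turn_self_right]
    refine ⟨⟨?_, ?_⟩, ?_, ?_⟩ <;> linarith
  refine (disjoint_curve_of_subset_region hP hU ?_ hmU).1 hmK
  rintro z ⟨⟨h1, h2⟩, h3, h4⟩
  rcases le_total 0 (turn s (P.vert j) (P.vert (j + 1)) z) with h | h
  · exact hT.hull_subset_region ht ((P.hull_iff hs).2 ⟨h, le_of_lt h1, le_of_lt h2⟩)
  · have e : ({j, j + 1, x'} : Finset (Fin n)) = {j + 1, j, x'} := Finset.insert_comm ..
    rw [e] at ht'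
    exact hT.hull_subset_region ht' ((P.hull_iff hs'').2
      ⟨by rw [turn_swap]; linarith, le_of_lt h3, le_of_lt h4⟩)

end IsTriangulation

end SimplePolygon

/-! ### Winding numbers -/

def toComplex (z : Pt) : ℂ := ⟨z 0, z 1⟩

lemma continuous_toComplex : Continuous toComplex := by
  have : toComplex = fun z => ((z 0 : ℝ) : ℂ) + ((z 1 : ℝ) : ℂ) * Complex.I := by
    funext z; apply Complex.ext <;> simp [toComplex]
  rw [this]; fun_prop

lemma toComplex_injective : Function.Injective toComplex := fun x y h => by
  have := congrArg Complex.re h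
  have := congrArg Complex.im h
  exact ext_pt (by simpa [toComplex]) (by simpa [toComplex])

/-- The angle under which `z` sees the segment from `p` to `q`. -/
def viewAngle (p q z : Pt) : ℝ :=
  Complex.arg ((toComplex q - toComplex z) / (toComplex p - toComplex z))

/-- The quotient leaves the slit plane, where the principal argument is continuous, only if it is a
nonpositive real number, and then `z` is on the segment. -/
lemma continuousAt_viewAngle {p q z : Pt} (h : z ∉ segment ℝ p q) :
    ContinuousAt (viewAngle p q) z := by
  have hzp : toComplex p - toComplex z ≠ 0 := fun h0 =>
    h (toComplex_injective (sub_eq_zero.1 h0) ▸ left_mem_segment ..)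
  refine ContinuousAt.comp (f := fun z => (toComplex q - toComplex z) / (toComplex p - toComplex z))
    (g := Complex.arg) (Complex.continuousAt_arg ?_) ?_
  · by_contra hs
    rw [Complex.mem_slitPlane_iff, not_or, not_lt, not_not] at hs
    set w := (toComplex q - toComplex z) / (toComplex p - toComplex z) with hw
    have hwr : w = (w.re : ℂ) := Complex.ext (by simp) (by simpa using hs.2)
    have e : toComplex q - toComplex z = (w.re : ℂ) * (toComplex p - toComplex z) := by
      rw [← hwr, hw]; field_simp
    have e0 := congrArg Complex.re e
    have e1 := congrArg Complex.im e
    simp [toComplex] at e0 e1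
    set r := w.re
    have hr : 0 < 1 - r := by linarith [hs.1]
    refine h ⟨-r / (1 - r), 1 / (1 - r), div_nonneg (by linarith [hs.1]) hr.le,
      div_nonneg zero_le_one hr.le, by field_simp; ring, ext_pt ?_ ?_⟩ <;>
    · simp; field_simp; linarith
  · exact (continuousAt_const.sub continuous_toComplex.continuousAt).div
      (continuousAt_const.sub continuous_toComplex.continuousAt) hzp

/-- The angle swept by the closed polygon with vertices `c 0, …, c M`, seen from `z`. -/
def sweep (c : ℕ → Pt) (M : ℕ) (z : Pt) : ℝ :=
  ∑ m ∈ Finset.range M, viewAngle (c m) (c (m + 1)) z + viewAngle (c M) (c 0) z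

/-- Modulo `2π` each angle is a difference of two arguments, and these differences telescope around
the closed polygon. -/
lemma sweep_eq {c : ℕ → Pt} {M : ℕ} {z : Pt} (h : ∀ m ≤ M, c m ≠ z) :
    ∃ k : ℤ, k • (2 * Real.pi) = sweep c M z := by
  have h' : ∀ m ≤ M, toComplex (c m) - toComplex z ≠ 0 := fun m hm h0 =>
    h m hm (toComplex_injective (sub_eq_zero.1 h0))
  rw [← Real.Angle.coe_eq_zero_iff, sweep, Real.Angle.coe_add]
  have key : ∀ N ≤ M, ((∑ m ∈ Finset.range N, viewAngle (c m) (c (m + 1)) z : ℝ) : Real.Angle) =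
      Complex.arg (toComplex (c N) - toComplex z) - Complex.arg (toComplex (c 0) - toComplex z) := by
    intro N hN
    induction N with
    | zero => simp
    | succ N ih =>
      rw [Finset.sum_range_succ, Real.Angle.coe_add, ih (by omega), viewAngle,
        Complex.arg_div_coe_angle (h' _ hN) (h' _ (by omega))]
      abel
  rw [key M le_rfl, viewAngle, Complex.arg_div_coe_angle (h' _ (by omega)) (h' _ le_rfl)]
  abel

/-- The swept angle is continuous on `C` and a multiple of `2π`. If it took two values, it would
take the smaller one plus `π` as well, which is an odd multiple of `π`. -/
lemma sweep_const {c : ℕ → Pt} {M : ℕ} {C : Set Pt} (hC : IsPreconnected C)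
    (h : ∀ m < M, Disjoint C (segment ℝ (c m) (c (m + 1)))) (h' : Disjoint C (segment ℝ (c M) (c 0)))
    {x y : Pt} (hx : x ∈ C) (hy : y ∈ C) : sweep c M x = sweep c M y := by
  have hcont : ContinuousOn (sweep c M) C := fun z hz => by
    refine ContinuousAt.continuousWithinAt (ContinuousAt.add ?_
      (continuousAt_viewAngle (disjoint_left.1 h' hz)))
    exact tendsto_finsetSum _ fun m hm =>
      continuousAt_viewAngle (disjoint_left.1 (h m (Finset.mem_range.1 hm)) hz)
  have hint : ∀ z ∈ C, ∃ k : ℤ, k • (2 * Real.pi) = sweep c M z := fun z hz => by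
    refine sweep_eq fun m hm hmz => ?_
    rcases hm.lt_or_eq with hm | rfl
    · exact disjoint_left.1 (h m hm) hz (hmz ▸ left_mem_segment ..)
    · exact disjoint_left.1 h' hz (hmz ▸ left_mem_segment ..)
  have key : ∀ x ∈ C, ∀ y ∈ C, ¬ sweep c M x < sweep c M y := by
    intro x hx y hy hlt
    obtain ⟨k, hk⟩ := hint x hx
    obtain ⟨l, hl⟩ := hint y hy
    have hpi := Real.pi_pos
    simp only [zsmul_eq_mul] at hk hl
    have hkl : (k : ℝ) < l := by
      rw [← hk, ← hl] at hlt; exact lt_of_mul_lt_mul_right hlt (by positivity)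
    have hkl' : (k : ℝ) + 1 ≤ l := by exact_mod_cast hkl
    obtain ⟨z, hz, hzv⟩ := hC.intermediate_value hx hy hcont
      (show sweep c M x + Real.pi ∈ Icc _ _ from ⟨by linarith, by nlinarith⟩)
    obtain ⟨j, hj⟩ := hint z hz
    simp only [zsmul_eq_mul] at hj
    have : (2 * j : ℝ) = 2 * k + 1 := by
      have : (2 * j - (2 * k + 1) : ℝ) * Real.pi = 0 := by rw [← hj, ← hk] at hzv; linarith
      rcases mul_eq_zero.1 this with h | h
      · linarith
      · linarith
    have : (2 * j : ℤ) = 2 * k + 1 := by exact_mod_cast this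
    omega
  exact le_antisymm (not_lt.1 (key y hy x hx)) (not_lt.1 (key x hx y hy))

/-- A vector that points to the left of the direction from `p` to `q`. -/
def normalVec (p q : Pt) : Pt := !₂[-(q 1 - p 1), q 0 - p 0]

lemma turn_normalVec {p q x : Pt} (hx : cross p q x = 0) (t : ℝ) :
    turn .left p q (x + t • normalVec p q) = t * ((q 0 - p 0) ^ 2 + (q 1 - p 1) ^ 2) := by
  simp only [cross] at hx
  simp only [turn, cross, normalVec]
  simp; linear_combination hx

lemma sq_dist_pos {p q : Pt} (h : p ≠ q) : 0 < (q 0 - p 0) ^ 2 + (q 1 - p 1) ^ 2 := by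
  by_contra hc
  have h0 : q 0 - p 0 = 0 := by nlinarith [sq_nonneg (q 0 - p 0), sq_nonneg (q 1 - p 1)]
  have h1 : q 1 - p 1 = 0 := by nlinarith [sq_nonneg (q 0 - p 0), sq_nonneg (q 1 - p 1)]
  exact h (ext_pt (by linarith) (by linarith))

/-- On the perpendicular bisector the quotient runs on the unit circle. It tends to `-1` as `t`
tends to `0`, from above or below according to the sign of `t`. -/
lemma viewAngle_normal {p q : Pt} (h : p ≠ q) (t : ℝ) :
    (toComplex q - toComplex (midpoint ℝ p q + t • normalVec p q)) /
      (toComplex p - toComplex (midpoint ℝ p q + t • normalVec p q)) =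
      ⟨-(1 - 4 * t ^ 2) / (1 + 4 * t ^ 2), 4 * t / (1 + 4 * t ^ 2)⟩ := by
  have hd := sq_dist_pos h
  have hpos : 0 < 1 + 4 * t ^ 2 := by positivity
  have hne : toComplex p - toComplex (midpoint ℝ p q + t • normalVec p q) ≠ 0 := by
    intro h0
    have e0 := congrArg Complex.re h0
    have e1 := congrArg Complex.im h0
    simp [toComplex, midpoint_eq_smul_add, normalVec] at e0 e1
    nlinarith
  rw [div_eq_iff hne]
  apply Complex.ext
  · simp [toComplex, midpoint_eq_smul_add, normalVec]; field_simp; ring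
  · simp [toComplex, midpoint_eq_smul_add, normalVec]; field_simp; ring

/-- The swept angle jumps at the closing edge. -/
lemma sweep_jump {c : ℕ → Pt} {M : ℕ} (hne : c M ≠ c 0)
    (h : ∀ m < M, midpoint ℝ (c M) (c 0) ∉ segment ℝ (c m) (c (m + 1))) :
    ∀ᶠ t : ℝ in 𝓝[>] 0, sweep c M (midpoint ℝ (c M) (c 0) + t • normalVec (c M) (c 0)) ≠
      sweep c M (midpoint ℝ (c M) (c 0) + (-t) • normalVec (c M) (c 0)) := by
  set p := c M
  set q := c 0
  set x := midpoint ℝ p q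
  set ν := normalVec p q
  set F : Pt → ℝ := fun z => ∑ m ∈ Finset.range M, viewAngle (c m) (c (m + 1)) z with hF
  have hFc : ContinuousAt F x := tendsto_finsetSum _ fun m hm =>
    continuousAt_viewAngle (h m (Finset.mem_range.1 hm))
  have h0 : Tendsto (fun t : ℝ => x + t • ν) (𝓝[>] 0) (𝓝 x) := by
    have hc : Continuous fun t : ℝ => x + t • ν := by fun_prop
    simpa using (hc.tendsto 0).mono_left (nhdsWithin_le_nhds (s := Ioi 0))
  have h0' : Tendsto (fun t : ℝ => x + (-t) • ν) (𝓝[>] 0) (𝓝 x) := by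
    have hc : Continuous fun t : ℝ => x + (-t) • ν := by fun_prop
    simpa using (hc.tendsto 0).mono_left (nhdsWithin_le_nhds (s := Ioi 0))
  have hcont : Continuous fun t : ℝ => (⟨-(1 - 4 * t ^ 2) / (1 + 4 * t ^ 2),
      4 * t / (1 + 4 * t ^ 2)⟩ : ℂ) := by
    have : (fun t : ℝ => (⟨-(1 - 4 * t ^ 2) / (1 + 4 * t ^ 2), 4 * t / (1 + 4 * t ^ 2)⟩ : ℂ)) =
        fun t : ℝ => ((-(1 - 4 * t ^ 2) / (1 + 4 * t ^ 2) : ℝ) : ℂ) +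
          ((4 * t / (1 + 4 * t ^ 2) : ℝ) : ℂ) * Complex.I := by
      funext t; exact Complex.mk_eq_add_mul_I _ _
    rw [this]
    have h1 : Continuous fun t : ℝ => -(1 - 4 * t ^ 2) / (1 + 4 * t ^ 2) :=
      Continuous.div (by fun_prop) (by fun_prop) fun t => by positivity
    have h2 : Continuous fun t : ℝ => 4 * t / (1 + 4 * t ^ 2) :=
      Continuous.div (by fun_prop) (by fun_prop) fun t => by positivity
    fun_prop
  have hlim : (⟨-(1 - 4 * (0:ℝ) ^ 2) / (1 + 4 * 0 ^ 2), 4 * 0 / (1 + 4 * 0 ^ 2)⟩ : ℂ) = -1 := by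
    apply Complex.ext <;> simp
  -- The closing edge contributes `π` in the limit from one side and `-π` from the other, while the
  -- sum over the other edges is continuous there.
  have hp : Tendsto (fun t : ℝ => viewAngle p q (x + t • ν)) (𝓝[>] 0) (𝓝 Real.pi) := by
    simp only [viewAngle, viewAngle_normal hne, x, ν]
    refine (Complex.tendsto_arg_nhdsWithin_im_nonneg_of_re_neg_of_im_zero
      (z := -1) (by simp) (by simp)).comp (tendsto_nhdsWithin_iff.2 ⟨?_, ?_⟩)
    · rw [← hlim]; exact (hcont.tendsto 0).mono_left nhdsWithin_le_nhds
    · filter_upwards [self_mem_nhdsWithin] with t (ht : 0 < t)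
      show (0:ℝ) ≤ 4 * t / (1 + 4 * t ^ 2)
      positivity
  have hm : Tendsto (fun t : ℝ => viewAngle p q (x + (-t) • ν)) (𝓝[>] 0) (𝓝 (-Real.pi)) := by
    simp only [viewAngle, viewAngle_normal hne, x, ν]
    refine (Complex.tendsto_arg_nhdsWithin_im_neg_of_re_neg_of_im_zero
      (z := -1) (by simp) (by simp)).comp (tendsto_nhdsWithin_iff.2 ⟨?_, ?_⟩)
    · have := ((hcont.comp continuous_neg).tendsto 0).mono_left (nhdsWithin_le_nhds (s := Ioi 0))
      simp only [Function.comp_def, neg_zero, hlim] at this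
      exact this
    · filter_upwards [self_mem_nhdsWithin] with t (ht : 0 < t)
      show 4 * (-t) / (1 + 4 * (-t) ^ 2) < 0
      exact div_neg_of_neg_of_pos (by linarith) (by positivity)
  have hd : Tendsto (fun t : ℝ => sweep c M (x + t • ν) - sweep c M (x + (-t) • ν)) (𝓝[>] 0)
      (𝓝 ((F x + Real.pi) - (F x + -Real.pi))) :=
    ((hFc.tendsto.comp h0).add hp).sub ((hFc.tendsto.comp h0').add hm)
  have hpos : (0 : ℝ) < (F x + Real.pi) - (F x + -Real.pi) := by linarith [Real.pi_pos]
  filter_upwards [hd.eventually_const_lt hpos] with t ht heq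
  rw [heq, sub_self] at ht
  exact lt_irrefl _ ht

/-! ### Diagonals separate the triangles of a triangulation. -/

namespace SimplePolygon

variable {n : ℕ} [NeZero n] {P : SimplePolygon n} {T : Finset (Finset (Fin n))}

namespace IsTriangulation

variable (hT : P.IsTriangulation T)
include hT

/-- An edge of the polygon is a side of one triangle only, so a common side has to be a diagonal. -/
lemma openSegment_subset_inside (hP : P.GeneralPosition) {u w x x' : Fin n} (h : {u, w, x} ∈ T)
    (h' : {u, w, x'} ∈ T) (hne : x ≠ x') :
    openSegment ℝ (P.vert u) (P.vert w) ⊆ P.inside := by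
  have huw := hT.triple_ne h
  have htt : ({u, w, x} : Finset (Fin n)) ≠ {u, w, x'} := by
    intro he
    have h1 : x ∈ ({u, w, x'} : Finset (Fin n)) := he ▸ by simp
    simp only [Finset.mem_insert, Finset.mem_singleton] at h1
    rcases h1 with rfl | rfl | rfl <;> simp_all
  rcases hT.sides _ h u (by simp) w (by simp) huw.1 with rfl | rfl | h1
  · exact absurd (hT.edge_unique hP h h' (j := u) (by intro; simp; tauto) (by intro; simp; tauto)) htt
  · exact absurd (hT.edge_unique hP h h' (j := w) (by intro; simp; tauto) (by intro; simp; tauto)) htt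
  · exact h1

/-- A diagonal separates the triangles on its two sides. -/
theorem exists_coloring (hP : P.GeneralPosition) {u w x x' : Fin n} (h : {u, w, x} ∈ T)
    (h' : {u, w, x'} ∈ T) (hne : x ≠ x') :
    ∃ χ : Finset (Fin n) → ℝ, χ {u, w, x} ≠ χ {u, w, x'} ∧
      (∀ t ∈ T, ∀ t' ∈ T, χ t ≠ χ t' → t ∩ t' ⊆ {u, w}) ∧
      ∀ C : Set Pt, IsPreconnected C → C ⊆ P.inside →
        Disjoint C (segment ℝ (P.vert u) (P.vert w)) → ∀ t ∈ T, ∀ t' ∈ T,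
        (C ∩ interior (P.hull t)).Nonempty → (C ∩ interior (P.hull t')).Nonempty → χ t = χ t' := by
  have huw : u ≠ w := (hT.triple_ne h).1
  have hin := hT.openSegment_subset_inside hP h h' hne
  have htt : ({u, w, x} : Finset (Fin n)) ≠ {u, w, x'} := by
    intro he
    have h1 : x ∈ ({u, w, x'} : Finset (Fin n)) := he ▸ by simp
    have := hT.triple_ne h
    simp only [Finset.mem_insert, Finset.mem_singleton] at h1
    rcases h1 with rfl | rfl | rfl <;> simp_all
  -- The closed polygon consists of the boundary arc from `u` to `w` and the diagonal back to `u`.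
  -- The arc is on the curve, so inside the polygon its winding number changes only across the
  -- diagonal.
  set c : ℕ → Pt := fun m => P.vert (u + Fin.ofNat n m) with hc
  set M := (w - u).val with hM
  have c0 : c 0 = P.vert u := by simp [c]
  have cM : c M = P.vert w := by simp [c, M]
  have hcK : ∀ m, segment ℝ (c m) (c (m + 1)) ⊆ P.curve := fun m => by
    simp only [c, ofNat_succ, ← add_assoc]; exact P.edge_subset_curve _
  set W := sweep c M with hW
  have hconst : ∀ C : Set Pt, IsPreconnected C → C ⊆ P.inside →
      Disjoint C (segment ℝ (P.vert u) (P.vert w)) → ∀ y ∈ C, ∀ z ∈ C, W y = W z := by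
    intro C hC hCi hCd y hy z hz
    refine sweep_const hC (fun m _ => ?_) ?_ hy hz
    · exact disjoint_left.2 fun a ha ha' => (hCi ha).1 (hcK m ha')
    · rwa [c0, cM, segment_symm]
  have hint : ∀ t ∈ T, interior (P.hull t) ⊆ P.inside ∧
      Disjoint (interior (P.hull t)) (segment ℝ (P.vert u) (P.vert w)) := by
    intro t ht
    refine ⟨hT.interior_subset_inside hP ht, ?_⟩
    have hs : ∀ t', u ∈ t' → w ∈ t' → segment ℝ (P.vert u) (P.vert w) ⊆ P.hull t' :=
      fun t' hu hw => (P.convex_hull t').segment_subset (P.vert_mem_hull hu) (P.vert_mem_hull hw)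
    by_cases he : t = {u, w, x}
    · exact (hT.disjoint_interior ht h' (he ▸ htt)).mono_right (hs _ (by simp) (by simp))
    · exact (hT.disjoint_interior ht h he).mono_right (hs _ (by simp) (by simp))
  -- The color of a triangle is the angle swept around the points of its interior.
  have hχ : ∃ χ : Finset (Fin n) → ℝ, ∀ t ∈ T, ∀ z ∈ interior (P.hull t), W z = χ t := by
    classical
    refine ⟨fun t => if h : (interior (P.hull t)).Nonempty then W h.some else 0, fun t ht z hz => ?_⟩
    have hne : (interior (P.hull t)).Nonempty := ⟨z, hz⟩
    show W z = dite _ _ _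
    rw [dif_pos hne]
    exact hconst _ (P.convex_hull t).interior.isPreconnected (hint t ht).1 (hint t ht).2 z hz _
      hne.some_mem
  obtain ⟨χ, hχ⟩ := hχ
  refine ⟨χ, ?_, ?_, ?_⟩
  · obtain ⟨s, hs⟩ := exists_side_pos ((turn_eq_zero_iff .left _ _ _).not.1 (hT.turn_ne .left h))
    have hne0 : c M ≠ c 0 := by rw [c0, cM]; exact fun h => huw (P.injective h).symm
    -- The points just off the midpoint of the diagonal lie in the two given triangles, and the
    -- swept angle jumps there.
    set m := midpoint ℝ (c M) (c 0) with hm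
    have hmo : m ∈ openSegment ℝ (P.vert u) (P.vert w) := by
      rw [hm, c0, cM, openSegment_symm]
      exact ⟨1/2, 1/2, by norm_num, by norm_num, by norm_num, by
        rw [midpoint_eq_smul_add]; simp⟩
    have hj := sweep_jump hne0 fun m _ hmem => (hin hmo).1 (hcK m hmem)
    have hmz : cross (c M) (c 0) m = 0 := by
      have := (isAff_cross (c M) (c 0)).eq_zero_segment (x := c M) (y := c 0)
        (turn_self_left .left _ _) (turn_self_right .left _ _) (midpoint_mem_segment (𝕜 := ℝ) _ _)
      exact this
    set ν := normalVec (c M) (c 0)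
    have hcν : ∀ σ : ℝ, Tendsto (fun t : ℝ => m + (σ * t) • ν) (𝓝[>] 0) (𝓝 m) := fun σ => by
      have hc : Continuous fun t : ℝ => m + (σ * t) • ν := by fun_prop
      simpa using (hc.tendsto 0).mono_left (nhdsWithin_le_nhds (s := Ioi 0))
    have side : ∀ (σ : ℝ) (s : Side) (y : Fin n),
        0 < turn s (P.vert u) (P.vert w) (P.vert y) →
        (∀ t : ℝ, 0 < t → 0 < turn s (P.vert u) (P.vert w) (m + (σ * t) • ν)) →
        ∀ᶠ t : ℝ in 𝓝[>] 0, m + (σ * t) • ν ∈ interior (P.hull {u, w, y}) := by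
      intro σ s y hy hpos
      have c1 := turn_cyc s (P.vert u) (P.vert w) (P.vert y)
      have c2 := turn_cyc s (P.vert w) (P.vert y) (P.vert u)
      have g1 := (isAff_turn s (P.vert w) (P.vert y)).pos_openSegment (by simp) (by linarith)
        (by rwa [openSegment_symm] : m ∈ openSegment ℝ (P.vert w) (P.vert u))
      have g2 := (isAff_turn s (P.vert y) (P.vert u)).pos_openSegment (by simp) (by linarith) hmo
      filter_upwards [self_mem_nhdsWithin,
        (hcν σ) ((isAff_turn s (P.vert w) (P.vert y)).isOpen_pos.mem_nhds g1),
        (hcν σ) ((isAff_turn s (P.vert y) (P.vert u)).isOpen_pos.mem_nhds g2)] with t ht h1 h2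
      exact (P.interior_hull_iff hy).2 ⟨hpos t ht, h1, h2⟩
    have hd := sq_dist_pos hne0
    have hval : ∀ t : ℝ, turn .left (P.vert u) (P.vert w) (m + t • ν) =
        -(t * ((c 0 0 - c M 0) ^ 2 + (c 0 1 - c M 1) ^ 2)) := fun t => by
      rw [← turn_normalVec hmz, turn_swap, ← c0, ← cM]
    have hopp := hT.opposite h h' hne hs
    cases s with
    | left =>
      have A := side (-1) .left x hs fun t ht => by rw [hval]; nlinarith [mul_pos ht hd]
      have B := side 1 .right x' (by
        have := turn_opp .left (P.vert u) (P.vert w) (P.vert x')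
        simp only [Side.opp] at this; linarith) fun t ht => by
          have := turn_opp .left (P.vert u) (P.vert w) (m + (1 * t) • ν)
          simp only [Side.opp] at this; rw [this, hval]; nlinarith [mul_pos ht hd]
      obtain ⟨t, h1, h2, h3⟩ := (hj.and (A.and B)).exists
      rw [← hχ _ h _ h2, ← hχ _ h' _ h3]
      simpa using h1.symm
    | right =>
      have A := side 1 .right x hs fun t ht => by
          have := turn_opp .left (P.vert u) (P.vert w) (m + (1 * t) • ν)
          simp only [Side.opp] at this; rw [this, hval]; nlinarith [mul_pos ht hd]
      have B := side (-1) .left x' (by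
        have := turn_opp .right (P.vert u) (P.vert w) (P.vert x')
        simp only [Side.opp] at this; linarith) fun t ht => by
          rw [hval]; nlinarith [mul_pos ht hd]
      obtain ⟨t, h1, h2, h3⟩ := (hj.and (A.and B)).exists
      rw [← hχ _ h _ h2, ← hχ _ h' _ h3]
      simpa using h1
  -- Let `z` be a common corner off the diagonal. Near `z` the complement of the curve has two
  -- sides, and one is exterior. So the interiors of both triangles meet the other side, a connected
  -- set that avoids the diagonal.
  · intro t ht t' ht' hχne z hz
    by_contra hzuw
    simp only [Finset.mem_insert, Finset.mem_singleton, not_or] at hzuw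
    rw [Finset.mem_inter] at hz
    apply hχne
    have hzs : P.vert z ∉ segment ℝ (P.vert u) (P.vert w) := fun hmem =>
      P.vert_notMem_inside z (hin (mem_openSegment_of_ne_left_right
        (fun h => hzuw.1 (P.injective h).symm) (fun h => hzuw.2 (P.injective h).symm) hmem))
    obtain ⟨ε, hε, hball⟩ := Metric.isOpen_iff.1
      (isCompact_segment (P.vert u) (P.vert w)).isClosed.isOpen_compl _ hzs
    obtain ⟨r, hr, C₁, C₂, h1, h2, h3, h4, h5⟩ := local_structure hP (P.vert_mem_curve z) hε
    obtain ⟨y, hyr, hyo⟩ := mem_closure_iff.1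
      (curve_subset_closure_outside hP (P.vert_mem_curve z)) _ Metric.isOpen_ball
      (Metric.mem_ball_self hr)
    have near : ∀ t ∈ T, z ∈ t → ∃ y ∈ Metric.ball (P.vert z) r, y ∈ interior (P.hull t) := by
      intro t ht hzt
      have : P.vert z ∈ closure (interior (P.hull t)) := by
        rw [hT.closure_interior ht]; exact P.vert_mem_hull hzt
      obtain ⟨y, hy, hy'⟩ := mem_closure_iff.1 this _ Metric.isOpen_ball (Metric.mem_ball_self hr)
      exact ⟨y, hy, hy'⟩
    obtain ⟨p, hp, hpt⟩ := near t ht hz.1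
    obtain ⟨p', hp', hpt'⟩ := near t' ht' hz.2
    have hpi := (hint t ht).1 hpt
    have hpi' := (hint t' ht').1 hpt'
    have main : ∀ C D : Set Pt, IsPreconnected C → IsPreconnected D →
        C ⊆ P.curveᶜ ∩ Metric.ball (P.vert z) ε → D ⊆ P.curveᶜ ∩ Metric.ball (P.vert z) ε →
        Metric.ball (P.vert z) r \ P.curve ⊆ C ∪ D → y ∈ C → χ t = χ t' := by
      intro C D hC hD hC' hD' hCD hyC
      have hCo := subset_outside hC (fun a ha => (hC' ha).1) ⟨y, hyC, hyo⟩
      have inD : ∀ a ∈ Metric.ball (P.vert z) r, a ∈ P.inside → a ∈ D := fun a ha hai => by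
        rcases hCD ⟨ha, hai.1⟩ with h | h
        · exact absurd hai (mem_outside_iff.1 (hCo h)).2
        · exact h
      have hDi := subset_inside hD (fun a ha => (hD' ha).1) ⟨p, inD p hp hpi, hpi⟩
      rw [← hχ t ht p hpt, ← hχ t' ht' p' hpt']
      exact hconst D hD hDi (disjoint_left.2 fun a ha => hball (hD' ha).2) _ (inD p hp hpi) _
        (inD p' hp' hpi')
    rcases h4 ⟨hyr, (mem_outside_iff.1 hyo).1⟩ with hy | hy
    · exact main C₁ C₂ h1 h2 (subset_union_left.trans h3) (subset_union_right.trans h3) h4 hy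
    · exact main C₂ C₁ h2 h1 (subset_union_right.trans h3) (subset_union_left.trans h3)
        (union_comm C₁ C₂ ▸ h4) hy
  · rintro C hC hCi hCd t ht t' ht' ⟨y, hyC, hy⟩ ⟨z, hzC, hz⟩
    rw [← hχ t ht y hy, ← hχ t' ht' z hz]
    exact hconst C hC hCi hCd y hyC z hzC

omit hT in
/-- A connected set that meets triangles of different colors meets the separating segment. -/
lemma meets_of_coloring (hT : P.IsTriangulation T) {u w : Fin n} {χ : Finset (Fin n) → ℝ}
    (hχ : ∀ t ∈ T, ∀ t' ∈ T, χ t ≠ χ t' → t ∩ t' ⊆ {u, w}) {C : Set Pt} (hC : IsPreconnected C)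
    (hCr : C ⊆ P.region) {t t' : Finset (Fin n)} (ht : t ∈ T) (ht' : t' ∈ T) (hne : χ t ≠ χ t')
    (h : (C ∩ P.hull t).Nonempty) (h' : (C ∩ P.hull t').Nonempty) :
    (C ∩ segment ℝ (P.vert u) (P.vert w)).Nonempty := by
  classical
  -- The triangles of the color of `t` and the remaining ones form two closed sets that cover the
  -- connected set. A common point lies in a common face of triangles of different colors, hence on
  -- the diagonal.
  set A := ⋃ s ∈ T.filter (fun s => χ s = χ t), P.hull s
  set B := ⋃ s ∈ T.filter (fun s => χ s ≠ χ t), P.hull s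
  have hA : IsClosed A := isClosed_biUnion_finset fun s _ => P.isClosed_hull s
  have hB : IsClosed B := isClosed_biUnion_finset fun s _ => P.isClosed_hull s
  obtain ⟨x, hxC, hxA, hxB⟩ := isPreconnected_closed_iff.1 hC A B hA hB (fun x hx => by
      obtain ⟨s, hs, hxs⟩ := hT.exists_mem_hull (hCr hx)
      by_cases hc : χ s = χ t
      · exact Or.inl (mem_biUnion (x := s) (Finset.mem_coe.2 (by simp [hs, hc])) hxs)
      · exact Or.inr (mem_biUnion (x := s) (Finset.mem_coe.2 (by simp [hs, hc])) hxs))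
    (h.mono (inter_subset_inter_right _ fun x hx =>
      mem_biUnion (x := t) (Finset.mem_coe.2 (by simp [ht])) hx))
    (h'.mono (inter_subset_inter_right _ fun x hx =>
      mem_biUnion (x := t') (Finset.mem_coe.2 (by simp [ht', hne.symm])) hx))
  simp only [A, B, mem_iUnion, Finset.mem_filter, exists_prop] at hxA hxB
  obtain ⟨a, ⟨ha, hχa⟩, hxa⟩ := hxA
  obtain ⟨b, ⟨hb, hχb⟩, hxb⟩ := hxB
  have hab : χ a ≠ χ b := by rw [hχa]; exact hχb.symm
  have hx : x ∈ P.hull (a ∩ b) := hT.face a ha b hb (fun h => hab (h ▸ rfl)) ▸ ⟨hxa, hxb⟩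
  have := P.hull_mono (hχ a ha b hb hab) hx
  rw [P.hull_pair] at this
  exact ⟨x, hxC, this⟩

end IsTriangulation

end SimplePolygon

/-! ### Sleeves -/

namespace SimplePolygon

variable {n : ℕ} [NeZero n]

/-- The combinatorial properties of the path `t 1, …, t k` of triangles. -/
structure IsSleeve (P : SimplePolygon n) (T : Finset (Finset (Fin n))) (k : ℕ)
    (t : ℕ → Finset (Fin n)) (e : Side → ℕ → Fin n) : Prop where
  gp : P.GeneralPosition
  tri : P.IsTriangulation T
  one_le : 1 ≤ k
  mem : ∀ i, 1 ≤ i → i ≤ k → t i ∈ T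
  inj : ∀ i j, 1 ≤ i → i ≤ k → 1 ≤ j → j ≤ k → t i = t j → i = j
  ne : ∀ s, ∀ i ≤ k, e s i ≠ e s.opp i
  same : ∀ i < k, e (newSide e (i + 1)).opp (i + 1) = e (newSide e (i + 1)).opp i
  eq_triple : ∀ i < k, t (i + 1) = {e (newSide e (i + 1)) i, e (newSide e (i + 1)).opp i,
    e (newSide e (i + 1)) (i + 1)}
  turn_pos : ∀ i < k, 0 < turn (newSide e (i + 1)) (P.vert (e (newSide e (i + 1)) i))
    (P.vert (e (newSide e (i + 1)).opp i)) (P.vert (e (newSide e (i + 1)) (i + 1)))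
  color : ∀ m, 1 ≤ m → m < k → ∃ χ : Finset (Fin n) → ℝ,
    (∀ j, 1 ≤ j → j ≤ m → χ (t j) = χ (t m)) ∧
    (∀ j, m < j → j ≤ k → χ (t j) = χ (t (m + 1))) ∧ χ (t m) ≠ χ (t (m + 1)) ∧
    (∀ t ∈ T, ∀ t' ∈ T, χ t ≠ χ t' → t ∩ t' ⊆ {e .left m, e .right m}) ∧
    ∀ C : Set Pt, IsPreconnected C → C ⊆ P.inside →
        Disjoint C (segment ℝ (P.vert (e .left m)) (P.vert (e .right m))) → ∀ t ∈ T, ∀ t' ∈ T,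
        (C ∩ interior (P.hull t)).Nonempty → (C ∩ interior (P.hull t')).Nonempty → χ t = χ t'
  first_edge : ∃ α, {e .left 0, e .right 0} = ({α, α + 1} : Finset (Fin n))

variable {P : SimplePolygon n} {T : Finset (Finset (Fin n))} {α β : Fin n} {k : ℕ}
  {t : ℕ → Finset (Fin n)} {e : Side → ℕ → Fin n}

namespace IsImportant

variable (hI : P.IsImportant T α β k t e)
include hI

lemma card_pair {i : ℕ} (hi : i ≤ k) : ({e .left i, e .right i} : Finset (Fin n)).card = 2 := by
  rcases Nat.eq_zero_or_pos i with rfl | h0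
  · rw [hI.first_edge, Finset.card_pair (P.succ_ne α).symm]
  rcases hi.lt_or_eq with h | rfl
  · rw [hI.shared_edge i h0 h, hI.adj i h0 h]
  · rw [hI.last_edge, Finset.card_pair (P.succ_ne β).symm]

lemma left_ne_right {i : ℕ} (hi : i ≤ k) : e .left i ≠ e .right i := fun h => by
  have := hI.card_pair hi
  rw [h] at this; simp at this

lemma pair_subset {i : ℕ} (h0 : 1 ≤ i) (hi : i ≤ k) : {e .left i, e .right i} ⊆ t i := by
  rcases hi.lt_or_eq with h | rfl
  · rw [hI.shared_edge i h0 h]; exact Finset.inter_subset_left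
  · rw [hI.last_edge]; exact hI.last_mem

lemma pair_subset_succ {i : ℕ} (hi : i < k) : {e .left i, e .right i} ⊆ t (i + 1) := by
  rcases Nat.eq_zero_or_pos i with rfl | h0
  · rw [hI.first_edge]; exact hI.first_mem
  · rw [hI.shared_edge i h0 hi]; exact Finset.inter_subset_right

/-- The triangles of the path are distinct, and a side belongs to at most two triangles. -/
lemma no_three (hT : P.IsTriangulation T) {u w : Fin n} (huw : u ≠ w) {i j l : ℕ} (hi : 1 ≤ i)
    (hij : i < j) (hjl : j < l) (hl : l ≤ k) (h1 : {u, w} ⊆ t i) (h2 : {u, w} ⊆ t j)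
    (h3 : {u, w} ⊆ t l) : False := by
  obtain ⟨x, hx, -⟩ := hT.exists_third (hI.mem i hi (by omega)) (h1 (by simp)) (h1 (by simp)) huw
  obtain ⟨y, hy, -⟩ := hT.exists_third (hI.mem j (by omega) (by omega)) (h2 (by simp))
    (h2 (by simp)) huw
  obtain ⟨z, hz, -⟩ := hT.exists_third (hI.mem l (by omega) hl) (h3 (by simp)) (h3 (by simp)) huw
  have hxy : x ≠ y := fun h => by
    have := hI.inj i j hi (by omega) (by omega) (by omega) (by rw [hx, hy, h]); omega
  have hxz : x ≠ z := fun h => by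
    have := hI.inj i l hi (by omega) (by omega) (by omega) (by rw [hx, hz, h]); omega
  have := hT.eq_of_three (hx ▸ hI.mem i hi (by omega)) (hy ▸ hI.mem j (by omega) (by omega))
    (hz ▸ hI.mem l (by omega) hl) hxy hxz
  have := hI.inj j l (by omega) (by omega) (by omega) (by omega) (by rw [hy, hz, this]); omega

/-- Equal pairs would give `a = b`, an edge of the polygon with two triangles, or a side with three
triangles. -/
lemma pair_ne (hP : P.GeneralPosition) (hT : P.IsTriangulation T) {i : ℕ} (hi : i < k) :
    ({e .left i, e .right i} : Finset (Fin n)) ≠ {e .left (i + 1), e .right (i + 1)} := by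
  intro h
  rcases Nat.eq_zero_or_pos i with rfl | h0
  · by_cases hk : 0 + 1 = k
    · rw [hI.first_edge, hk, hI.last_edge] at h
      have h1 : α ∈ ({β, β + 1} : Finset (Fin n)) := h ▸ by simp
      have h2 : α + 1 ∈ ({β, β + 1} : Finset (Fin n)) := h ▸ by simp
      simp only [Finset.mem_insert, Finset.mem_singleton] at h1 h2
      rcases h1 with h1 | rfl
      · exact hI.edges_ne h1
      · rcases h2 with h2 | h2
        · exact P.succ_succ_ne _ h2
        · exact P.succ_ne _ h2
    · have h1 := hI.pair_subset_succ (i := 0 + 1) (by omega)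
      rw [← h, hI.first_edge] at h1
      have := hI.inj 1 2 le_rfl hI.one_le (by omega) (by omega)
        (hT.edge_unique hP (hI.mem 1 le_rfl hI.one_le) (hI.mem 2 (by omega) (by omega))
          hI.first_mem h1)
      omega
  · by_cases hk : i + 1 = k
    · have h1 := hI.pair_subset (i := i) h0 (by omega)
      rw [h, hk, hI.last_edge] at h1
      have := hI.inj i k h0 (by omega) hI.one_le le_rfl
        (hT.edge_unique hP (hI.mem i h0 (by omega)) (hI.mem k hI.one_le le_rfl)
          h1 hI.last_mem)
      omega
    · exact hI.no_three hT (hI.left_ne_right hi.le) h0 (Nat.lt_succ_self i)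
        (Nat.lt_succ_self (i + 1)) (by omega) (hI.pair_subset h0 hi.le) (hI.pair_subset_succ hi)
        (h ▸ hI.pair_subset_succ (by omega))

/-- Orientation is prescribed for the first triangle. Later, `t i` lies on the near side of the
diagonal, so `t (i + 1)` lies on the far side. -/
lemma left_turn (hT : P.IsTriangulation T) {i : ℕ} (hi : i < k) {w : Fin n}
    (hw : t (i + 1) = {e .left i, e .right i, w}) :
    0 < turn .left (P.vert (e .left i)) (P.vert (e .right i)) (P.vert w) := by
  have hmem := hI.mem (i + 1) (by omega) (by omega)
  have hne := hT.triple_ne (hw ▸ hmem)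
  rcases Nat.eq_zero_or_pos i with rfl | h0
  · exact hI.first_oriented w (hw ▸ by simp) hne.2.2.symm hne.2.1.symm
  · have hsub := hI.pair_subset h0 hi.le
    obtain ⟨w', hw', h1, h2⟩ := hT.exists_third (hI.mem i h0 hi.le) (i := e .left i)
      (j := e .right i) (hsub (by simp)) (hsub (by simp)) (hI.left_ne_right hi.le)
    have h3 := hI.oriented i h0 hi.le w' (hw' ▸ by simp) h1 h2
    rw [onSide_iff] at h3
    have hne' : w' ≠ w := by
      rintro rfl
      have := hI.inj i (i + 1) h0 hi.le (by omega) (by omega) (by rw [hw', hw]); omega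
    have := hT.opposite (hw' ▸ hI.mem i h0 hi.le) (hw ▸ hmem) hne' h3
    have h4 := turn_opp .left (P.vert (e .left i)) (P.vert (e .right i)) (P.vert w)
    simp only [Side.opp] at h4; linarith

/-- Each endpoint of the new diagonal is one of three corners. Distinctness and orientation leave
only the two cases in which one endpoint stays and keeps its side, and the other becomes the third
corner. -/
lemma step_aux (hP : P.GeneralPosition) (hT : P.IsTriangulation T) {i : ℕ} (hi : i < k) :
    e (newSide e (i + 1)).opp (i + 1) = e (newSide e (i + 1)).opp i ∧
    t (i + 1) = {e (newSide e (i + 1)) i, e (newSide e (i + 1)).opp i,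
      e (newSide e (i + 1)) (i + 1)} ∧
    0 < turn (newSide e (i + 1)) (P.vert (e (newSide e (i + 1)) i))
      (P.vert (e (newSide e (i + 1)).opp i)) (P.vert (e (newSide e (i + 1)) (i + 1))) := by
  have hs := hI.pair_subset_succ hi
  have hs' := hI.pair_subset (i := i + 1) (by omega) (by omega)
  have hlr := hI.left_ne_right hi.le
  have hlr' := hI.left_ne_right (i := i + 1) (by omega)
  obtain ⟨w, hw, hwl, hwr⟩ := hT.exists_third (hI.mem (i + 1) (by omega) (by omega))
    (hs (by simp : e .left i ∈ _)) (hs (by simp : e .right i ∈ _)) hlr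
  have ht := hI.left_turn hT hi hw
  have hor := hI.oriented (i + 1) (by omega) (by omega)
  have hpn := hI.pair_ne hP hT hi
  have hl : e .left (i + 1) ∈ t (i + 1) := hs' (by simp)
  have hr : e .right (i + 1) ∈ t (i + 1) := hs' (by simp)
  simp only [hw, Finset.mem_insert, Finset.mem_singleton] at hl hr hor
  have c1 := turn_cyc .left (P.vert (e .left i)) (P.vert (e .right i)) (P.vert w)
  have c2 := turn_cyc .left (P.vert (e .right i)) (P.vert w) (P.vert (e .left i))
  simp only [onSide_iff] at hor
  have e1 : ∀ p q r, turn .right p q r = -turn .left p q r := fun p q r => turn_opp .left p q r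
  simp only [e1] at hor
  by_cases hR : e .right (i + 1) = e .right i
  · have hns : newSide e (i + 1) = .left := by simp [newSide, hR]
    rw [hns]
    rcases hl with hl | hl | hl
    · rw [hl, hR] at hpn; exact absurd rfl hpn
    · rw [hl, hR] at hlr'; exact absurd rfl hlr'
    · exact ⟨hR, by rw [hw, ← hl]; rfl, by rw [hl]; exact ht⟩
  · have hns : newSide e (i + 1) = .right := by simp [newSide, hR]
    rw [hns]
    rcases hr with hr | hr | hr
    · exfalso
      have h1 := hor (e .right i) (by simp) (by
        intro h; rw [hr, ← h] at hpn; exact hpn (Finset.pair_comm _ _)) (Ne.symm hR)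
      rcases hl with hl | hl | hl
      · rw [hl, hr] at hlr'; exact hlr' rfl
      · rw [hl, hr] at hpn; exact hpn (Finset.pair_comm _ _)
      · rw [hl, hr] at h1; have := turn_cyc .left (P.vert w) (P.vert (e .left i)) (P.vert (e .right i)); linarith
    · exact absurd hr hR
    · rcases hl with hl | hl | hl
      · refine ⟨hl, by rw [hw, ← hr, Finset.insert_comm]; rfl, ?_⟩
        rw [hr]
        exact ((turn_opp_swap .left _ _ _).trans_gt ht)
      · exfalso
        have h1 := hor (e .left i) (by simp) (by rw [hl]; exact hlr) (by rw [hr]; exact hwl.symm)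
        rw [hl, hr] at h1
        linarith
      · exact absurd (hl.trans hr.symm) hlr'

lemma subset_of_pair {u w : Fin n} {s : Finset (Fin n)} {i : ℕ} (hi : i ≤ k)
    (h : {e .left i, e .right i} ⊆ ({u, w} : Finset (Fin n))) (hs : {e .left i, e .right i} ⊆ s) :
    {u, w} ⊆ s := by
  rwa [← Finset.eq_of_subset_of_card_le h (by rw [hI.card_pair hi]; exact Finset.card_le_two)]

theorem isSleeve (hP : P.GeneralPosition) (hT : P.IsTriangulation T) : P.IsSleeve T k t e where
  gp := hP
  tri := hT
  one_le := hI.one_le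
  mem := hI.mem
  inj := hI.inj
  ne s i hi := by
    cases s
    · exact hI.left_ne_right hi
    · exact (hI.left_ne_right hi).symm
  same i hi := (hI.step_aux hP hT hi).1
  eq_triple i hi := (hI.step_aux hP hT hi).2.1
  turn_pos i hi := (hI.step_aux hP hT hi).2.2
  first_edge := ⟨α, hI.first_edge⟩
  color m h1 hm := by
    have hs := hI.pair_subset h1 hm.le
    have hs' := hI.pair_subset_succ hm
    have huw := hI.left_ne_right hm.le
    obtain ⟨x, hx, -⟩ := hT.exists_third (hI.mem m h1 hm.le) (hs (by simp)) (hs (by simp)) huw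
    obtain ⟨x', hx', -⟩ := hT.exists_third (hI.mem (m + 1) (by omega) (by omega))
      (hs' (by simp)) (hs' (by simp)) huw
    have hxx : x ≠ x' := fun h => by
      have := hI.inj m (m + 1) h1 hm.le (by omega) (by omega) (by rw [hx, hx', h]); omega
    obtain ⟨χ, c1, c2, c3⟩ := hT.exists_coloring hP (hx ▸ hI.mem m h1 hm.le)
      (hx' ▸ hI.mem (m + 1) (by omega) (by omega)) hxx
    rw [← hx, ← hx'] at c1
    -- A change of color between `t j` and `t (j + 1)` would mean that `b_j` has the same endpoints
    -- as `b_m`, so that three triangles of the path share this side.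
    have key : ∀ j, 1 ≤ j → j < k → j ≠ m → χ (t j) = χ (t (j + 1)) := by
      intro j hj hjk hjm
      by_contra hc
      have hsub := c2 _ (hI.mem j hj hjk.le) _ (hI.mem (j + 1) (by omega) (by omega)) hc
      rw [← hI.shared_edge j hj hjk] at hsub
      have a1 := hI.subset_of_pair hjk.le hsub (hI.pair_subset hj hjk.le)
      have a2 := hI.subset_of_pair hjk.le hsub (hI.pair_subset_succ hjk)
      rcases lt_or_gt_of_ne hjm with h | h
      · exact hI.no_three hT huw hj (Nat.lt_succ_self j) (by omega : j + 1 < m + 1) hm a1 a2 hs'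
      · exact hI.no_three hT huw h1 h (Nat.lt_succ_self j) hjk hs a1 a2
    refine ⟨χ, fun j hj hjm => ?_, fun j hj hjk => ?_, c1, c2, c3⟩
    · induction hjm using Nat.decreasingInduction with
      | self => rfl
      | of_succ j hjm ih => exact (key j hj (by omega) (by omega)).trans (ih (by omega))
    · induction j, hj using Nat.le_induction with
      | base => rfl
      | succ j hj ih => exact (key j (by omega) (by omega) (by omega)).symm.trans (ih (by omega))

end IsImportant

namespace IsSleeve

variable (hS : P.IsSleeve T k t e)
include hS

omit [NeZero n] hS in
lemma pair_eq (s : Side) (i : ℕ) :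
    ({e s i, e s.opp i} : Finset (Fin n)) = {e .left i, e .right i} := by
  cases s
  · rfl
  · exact Finset.pair_comm _ _

lemma mem_succ (s : Side) {i : ℕ} (hi : i < k) : e s i ∈ t (i + 1) := by
  rw [hS.eq_triple i hi]
  rcases Side.eq_or (newSide e (i + 1)) s with rfl | rfl <;> simp

lemma mem_self (s : Side) {i : ℕ} (h0 : 1 ≤ i) (hi : i ≤ k) : e s i ∈ t i := by
  obtain ⟨i, rfl⟩ := Nat.exists_eq_add_of_le' h0
  rw [hS.eq_triple i hi]
  rcases Side.eq_or (newSide e (i + 1)) s with rfl | rfl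
  · simp
  · rw [hS.same i hi]; simp

lemma new_ne {i : ℕ} (hi : i < k) :
    e (newSide e (i + 1)) (i + 1) ≠ e (newSide e (i + 1)) i := fun h => by
  have := hS.turn_pos i hi
  rw [h] at this; simp at this

/-- Triangles before and after `bₘ` meet only in `bₘ`. -/
lemma inter_subset {m j j' : ℕ} (hj : 1 ≤ j) (hjm : j ≤ m) (hmj : m < j') (hj' : j' ≤ k) :
    t j ∩ t j' ⊆ {e .left m, e .right m} := by
  obtain ⟨χ, c1, c2, c3, c4, -⟩ := hS.color m (by omega) (by omega)
  exact c4 _ (hS.mem j hj (by omega)) _ (hS.mem j' (by omega) hj') (by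
    rw [c1 j hj hjm, c2 j' hmj hj']; exact c3)

/-- A vertex on side `s` at `m` and on the other side at `m + d` is a corner of both `t (m + 1)` and
`t (m + d)`. For `d ≥ 2` it is thus an endpoint of `b_{m+1}`, which leads to a smaller distance. -/
lemma disj (s : Side) : ∀ d m : ℕ, m + d ≤ k → e s m ≠ e s.opp (m + d) := by
  intro d
  induction d using Nat.strong_induction_on generalizing s with
  | _ d ih =>
    intro m hm h
    match d, ih, hm, h with
    | 0, _, hm, h => exact hS.ne s m hm h
    | 1, _, hm, h =>
      rcases Side.eq_or (newSide e (m + 1)) s with rfl | rfl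
      · rw [hS.same m hm] at h; exact hS.ne _ m (by omega) h
      · rw [Side.opp_opp] at h
        have := hS.tri.triple_ne (hS.eq_triple m hm ▸ hS.mem (m + 1) (by omega) (by omega))
        exact this.2.1 h
    | d + 2, ih, hm, h =>
      have h1 := hS.inter_subset (m := m + 1) (j := m + 1) (j' := m + (d + 2)) (by omega) le_rfl
        (by omega) hm (Finset.mem_inter.2 ⟨hS.mem_succ s (by omega),
          h ▸ hS.mem_self s.opp (by omega) hm⟩)
      rw [← pair_eq s, Finset.mem_insert, Finset.mem_singleton] at h1
      rcases h1 with h1 | h1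
      · refine ih (d + 1) (by omega) s (m + 1) (by omega) ?_
        rw [← h1, h]; congr 1; omega
      · exact ih 1 (by omega) s m (by omega) h1

/-- Left and right vertices are distinct. -/
lemma ne_of_le (s : Side) {m m' : ℕ} (hm : m ≤ k) (hm' : m' ≤ k) : e s m ≠ e s.opp m' := by
  rcases le_total m m' with h | h
  · obtain ⟨d, rfl⟩ := Nat.exists_eq_add_of_le h
    exact hS.disj s d m hm'
  · obtain ⟨d, rfl⟩ := Nat.exists_eq_add_of_le h
    intro he
    exact hS.disj s.opp d m' hm (by rw [Side.opp_opp]; exact he.symm)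

/-- The diagonals at a vertex are consecutive. -/
lemma fan (s : Side) {m p m' : ℕ} (h1 : m ≤ p) (h2 : p ≤ m') (hk : m' ≤ k) (h : e s m = e s m') :
    e s p = e s m := by
  rcases h1.lt_or_eq with h1 | rfl
  · rcases h2.lt_or_eq with h2 | rfl
    · have h3 := hS.inter_subset (m := p) (j := m + 1) (j' := m') (by omega) h1 h2 hk
        (Finset.mem_inter.2 ⟨hS.mem_succ s (by omega), h ▸ hS.mem_self s (by omega) hk⟩)
      rw [← pair_eq s, Finset.mem_insert, Finset.mem_singleton] at h3
      exact (h3.resolve_right (hS.ne_of_le s (by omega) (by omega))).symm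
    · exact h.symm
  · rfl

/-- A connected set in the region from a triangle before to a triangle after `bₘ` meets `bₘ`. -/
lemma meets {m j j' : ℕ} (hj : 1 ≤ j) (hjm : j ≤ m) (hmj : m < j') (hj' : j' ≤ k) {C : Set Pt}
    (hC : IsPreconnected C) (hCr : C ⊆ P.region) (h : (C ∩ P.hull (t j)).Nonempty)
    (h' : (C ∩ P.hull (t j')).Nonempty) :
    (C ∩ segment ℝ (P.vert (e .left m)) (P.vert (e .right m))).Nonempty := by
  obtain ⟨χ, c1, c2, c3, c4, -⟩ := hS.color m (by omega) (by omega)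
  exact IsTriangulation.meets_of_coloring hS.tri c4 hC hCr (hS.mem j hj (by omega))
    (hS.mem j' (by omega) hj') (by rw [c1 j hj hjm, c2 j' hmj hj']; exact c3) h h'

end IsSleeve

end SimplePolygon

/-! ### Lines that cross the diagonals of a sleeve -/

namespace SimplePolygon

variable {n : ℕ} [NeZero n]

/-- The directed line from `p` to `q` weakly separates the endpoints of `bₘ`. -/
def Stab (P : SimplePolygon n) (e : Side → ℕ → Fin n) (p q : Fin n) (m : ℕ) : Prop :=
  ∀ s, 0 ≤ turn s (P.vert p) (P.vert q) (P.vert (e s m))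

/-- The signed area of the triangle of `bₘ` and `z`, positive if `z` is beyond `bₘ`. -/
def gap (P : SimplePolygon n) (e : Side → ℕ → Fin n) (m : ℕ) (z : Pt) : ℝ :=
  turn .left (P.vert (e .left m)) (P.vert (e .right m)) z

variable {P : SimplePolygon n} {T : Finset (Finset (Fin n))} {k : ℕ}
  {t : ℕ → Finset (Fin n)} {e : Side → ℕ → Fin n}

lemma gap_eq (P : SimplePolygon n) (e : Side → ℕ → Fin n) (s : Side) (m : ℕ) (z : Pt) :
    P.gap e m z = turn s (P.vert (e s m)) (P.vert (e s.opp m)) z := by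
  cases s
  · rfl
  · exact (turn_opp_swap .left _ _ _).symm

lemma isAff_gap (P : SimplePolygon n) (e : Side → ℕ → Fin n) (m : ℕ) : IsAff (P.gap e m) :=
  isAff_turn ..

lemma Stab.opp_le {p q : Fin n} {m : ℕ} (h : P.Stab e p q m) (s : Side) :
    turn s (P.vert p) (P.vert q) (P.vert (e s.opp m)) ≤ 0 := by
  have := h s.opp
  rw [turn_opp] at this; linarith

lemma Stab.pos {p q : Fin n} {m : ℕ} (h : P.Stab e p q m) (hP : P.GeneralPosition) (s : Side)
    (hpq : p ≠ q) (hp : e s m ≠ p) (hq : e s m ≠ q) :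
    0 < turn s (P.vert p) (P.vert q) (P.vert (e s m)) :=
  (h s).lt_of_ne (hP.turn_ne s hpq hq.symm hp.symm).symm

lemma Stab.opp_neg {p q : Fin n} {m : ℕ} (h : P.Stab e p q m) (hP : P.GeneralPosition) (s : Side)
    (hpq : p ≠ q) (hp : e s.opp m ≠ p) (hq : e s.opp m ≠ q) :
    turn s (P.vert p) (P.vert q) (P.vert (e s.opp m)) < 0 :=
  (h.opp_le s).lt_of_ne (hP.turn_ne s hpq hq.symm hp.symm)

namespace IsSleeve

variable (hS : P.IsSleeve T k t e)
include hS

lemma gap_new {i : ℕ} (hi : i < k) : 0 < P.gap e i (P.vert (e (newSide e (i + 1)) (i + 1))) := by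
  rw [gap_eq P e (newSide e (i + 1))]; exact hS.turn_pos i hi

lemma gap_succ {i : ℕ} (hi : i < k) (z : Pt) :
    P.gap e (i + 1) z = turn (newSide e (i + 1)) (P.vert (e (newSide e (i + 1)) (i + 1)))
      (P.vert (e (newSide e (i + 1)).opp i)) z := by
  rw [gap_eq P e (newSide e (i + 1)), hS.same i hi]

/-- In the triangle between `b_i` and `b_{i+1}`, the pivot is the endpoint common to both. The
hypotheses place the two other corners and `z` on one side of the level line of `g` through the
pivot; there the order of the two diagonals around the pivot is fixed. -/
lemma above_step {g : Pt → ℝ} (hg : IsAff g) {i : ℕ} (hi : i < k) {z : Pt}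
    (hA : g (P.vert (e (newSide e (i + 1)).opp i)) ≤ g (P.vert (e (newSide e (i + 1)) i)))
    (hA' : g (P.vert (e (newSide e (i + 1)).opp i)) ≤ g (P.vert (e (newSide e (i + 1)) (i + 1))))
    (hz : g (P.vert (e (newSide e (i + 1)).opp i)) < g z) (h : 0 ≤ P.gap e (i + 1) z) :
    0 < P.gap e i z := by
  rw [hS.gap_succ hi] at h
  rw [gap_eq P e (newSide e (i + 1))]
  exact above_of_above hg hA hA' hz (hS.turn_pos i hi) h

lemma below_step {g : Pt → ℝ} (hg : IsAff g) {i : ℕ} (hi : i < k) {z : Pt}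
    (hA : g (P.vert (e (newSide e (i + 1)).opp i)) ≤ g (P.vert (e (newSide e (i + 1)) i)))
    (hA' : g (P.vert (e (newSide e (i + 1)).opp i)) < g (P.vert (e (newSide e (i + 1)) (i + 1))))
    (hz : g (P.vert (e (newSide e (i + 1)).opp i)) ≤ g z) (h : P.gap e i z < 0) :
    P.gap e (i + 1) z < 0 := by
  rw [hS.gap_succ hi]
  rw [gap_eq P e (newSide e (i + 1))] at h
  exact below_of_below hg hA hA' hz (hS.turn_pos i hi) h

lemma newSide_of_ne {s : Side} {i : ℕ} (hi : i < k) (h : e s (i + 1) ≠ e s i) :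
    newSide e (i + 1) = s := by
  rcases Side.eq_or (newSide e (i + 1)) s with h' | h'
  · exact h'.symm
  · exact absurd (by rw [h']; exact hS.same i hi) h

/-- The new vertex is not among the previous ones. -/
lemma new_ne_of_le {i m : ℕ} (hi : i < k) (hm : m ≤ i) (s : Side) :
    e (newSide e (i + 1)) (i + 1) ≠ e s m := by
  rcases Side.eq_or (newSide e (i + 1)) s with rfl | rfl
  · intro h
    have := hS.fan _ hm (Nat.le_succ i) hi h.symm
    exact hS.new_ne hi (h.trans this.symm)
  · exact hS.ne_of_le _ hi (by omega)

lemma eq_of_last {s : Side} {f i : ℕ} (hi : i ≤ k) (hf : f ≤ i) (h : e s f = e s i)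
    (h' : e s (f + 1) ≠ e s f) : f = i := by
  by_contra hne
  exact h' (hS.fan s (Nat.le_succ f) (by omega) hi h)

/-- The vertex at which the diagonals on one side turn away is before the next one. -/
lemma gap_last {s : Side} {f : ℕ} (hf : f < k) (h : e s (f + 1) ≠ e s f) :
    P.gap e (f + 1) (P.vert (e s f)) < 0 := by
  have hs := hS.newSide_of_ne hf h
  have := hS.turn_pos f hf
  rw [hS.gap_succ hf]
  rw [hs] at this ⊢
  rw [turn_cyc, turn_cyc, turn_swap']; linarith

/-- A vertex stays behind the diagonals that are crossed by a line through it. -/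
lemma gap_neg_of_stab {s : Side} {x y : ℕ} (hx : x ≤ k) (hy : y ≤ k) (hxy : e s x ≠ e s y)
    {a b : ℕ} (hab : a ≤ b) (hb : b ≤ k) (h : ∀ m, a ≤ m → m ≤ b → P.Stab e (e s x) (e s y) m)
    (ha : P.gap e a (P.vert (e s x)) < 0) : P.gap e b (P.vert (e s x)) < 0 := by
  induction b, hab using Nat.le_induction with
  | base => exact ha
  | succ b hab ih =>
    have hbk : b < k := hb
    specialize ih hbk.le fun m hm hm' => h m hm (by omega)
    have h1 := h b hab (by omega)
    have h2 := h (b + 1) (by omega) le_rfl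
    refine hS.below_step (isAff_turn (newSide e (b + 1)) (P.vert (e s x)) (P.vert (e s y))) hbk
      ((h1.opp_le _).trans (h1 _)) ?_ (by simpa using h1.opp_le _) ih
    rcases Side.eq_or s (newSide e (b + 1)) with hs | hs
    · rw [hs]
      exact (h1.opp_neg hS.gp s hxy (hS.ne_of_le s hx hbk.le).symm
        (hS.ne_of_le s hy hbk.le).symm).trans_le (h2 _)
    · rw [hs]
      exact (h1.opp_le _).trans_lt (h2.pos hS.gp s.opp hxy
        (hS.ne_of_le s hx hb).symm (hS.ne_of_le s hy hb).symm)

end IsSleeve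

/-! ### The invariant of the chains and the visibility lines -/

/-- A chain of vertices on side `s` up to `bᵢ`, bent to that side, whose edges cross diagonals;
those from position `σ` up to position `τ` cross all of them. -/
structure Chain (P : SimplePolygon n) (e : Side → ℕ → Fin n) (s : Side) (i : ℕ) (v : ℕ → Fin n)
    (L σ τ : ℕ) : Prop where
  σ_le : σ ≤ τ
  τ_le : τ ≤ L
  first : v 0 = e s 0
  last : v L = e s i
  edge : ∀ q < L, ∃ f g, f < g ∧ g ≤ i ∧ e s f = v q ∧ e s (f + 1) ≠ v q ∧ e s g = v (q + 1) ∧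
    e s (g - 1) ≠ v (q + 1) ∧ ∀ m ≤ i, (f ≤ m ∨ σ ≤ q ∧ q < τ) → (m ≤ g ∨ σ ≤ q) →
      P.Stab e (v q) (v (q + 1)) m
  bend : ∀ q, q + 2 ≤ L → 0 < turn s (P.vert (v q)) (P.vert (v (q + 1))) (P.vert (v (q + 2)))

/-- The line from `p` to `q` crosses all diagonals, and ends at side `s`. -/
def Line (P : SimplePolygon n) (e : Side → ℕ → Fin n) (s : Side) (i : ℕ) (p q : Fin n) : Prop :=
  (∀ m ≤ i, P.Stab e p q m) ∧ ∃ m₁ m₂, m₁ ≤ m₂ ∧ m₂ ≤ i ∧ e s.opp m₁ = p ∧ e s m₂ = q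

/-- Chains on both sides with the visibility lines of both sides. -/
structure Config (P : SimplePolygon n) (e : Side → ℕ → Fin n) (s : Side) (i : ℕ)
    (v : ℕ → Fin n) (L σ τ : ℕ) (u : ℕ → Fin n) (L' σ' τ' : ℕ) : Prop where
  chain : Chain P e s i v L σ τ
  chain' : Chain P e s.opp i u L' σ' τ'
  line : Line P e s i (u σ') (v τ)
  line' : Line P e s.opp i (v σ) (u τ')

namespace Chain

variable {s : Side} {i : ℕ} {v : ℕ → Fin n} {L σ τ : ℕ} (h : Chain P e s i v L σ τ)
include h

lemma mem {q : ℕ} (hq : q ≤ L) : ∃ m ≤ i, e s m = v q := by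
  rcases hq.lt_or_eq with hq | rfl
  · obtain ⟨f, g, h1, h2, h3, -⟩ := h.edge q hq
    exact ⟨f, by omega, h3⟩
  · exact ⟨i, le_rfl, h.last.symm⟩

lemma exists_last {q : ℕ} (hq : q ≤ L) : ∃ f ≤ i, e s f = v q ∧ (q < L → e s (f + 1) ≠ v q) := by
  rcases hq.lt_or_eq with hq | rfl
  · obtain ⟨f, g, h1, h2, h3, h4, -⟩ := h.edge q hq
    exact ⟨f, by omega, h3, fun _ => h4⟩
  · exact ⟨i, le_rfl, h.last.symm, fun h => absurd h (lt_irrefl _)⟩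

lemma stab {q : ℕ} (hσ : σ ≤ q) (hq : q < L) : P.Stab e (v q) (v (q + 1)) i := by
  obtain ⟨f, g, h1, h2, -, -, -, -, h3⟩ := h.edge q hq
  exact h3 i le_rfl (Or.inl (by omega)) (Or.inr hσ)

lemma stab_all {q m : ℕ} (hσ : σ ≤ q) (hτ : q < τ) (hm : m ≤ i) : P.Stab e (v q) (v (q + 1)) m := by
  obtain ⟨f, g, h1, h2, -, -, -, -, h3⟩ := h.edge q (hτ.trans_le h.τ_le)
  exact h3 m hm (Or.inr ⟨hσ, hτ⟩) (Or.inr hσ)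

variable (hS : P.IsSleeve T k t e) (hi : i ≤ k)
include hS hi

lemma ne_succ {q : ℕ} (hq : q < L) : v q ≠ v (q + 1) := by
  obtain ⟨f, g, h1, h2, h3, h4, h5, -⟩ := h.edge q hq
  intro he
  exact h4 (by rw [← h3]; exact hS.fan s (Nat.le_succ f) h1 (by omega) (by rw [h3, h5, he]))

lemma ne_last {q : ℕ} (hq : q < L) : v q ≠ e s i := by
  obtain ⟨f, g, h1, h2, h3, h4, h5, -⟩ := h.edge q hq
  intro he
  have := hS.eq_of_last hi (by omega) (h3.trans he) (by rwa [h3]); omega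

/-- The vertex is behind the diagonal at which its side turns away from it, and its edge crosses all
later diagonals up to `b_i`, so it stays behind them. -/
lemma below_of_le {q f m : ℕ} (hσ : σ ≤ q) (hq : q < L) (hf : e s f = v q)
    (hf' : e s (f + 1) ≠ v q) (hfm : f < m) (hm : m ≤ i) : P.gap e m (P.vert (v q)) < 0 := by
  obtain ⟨f', g, h1, h2, h3, h4, h5, -, h6⟩ := h.edge q hq
  have hff : f = f' := by
    rcases lt_trichotomy f f' with hlt | rfl | hlt
    · exact absurd (hf ▸ hS.fan s (Nat.le_succ f) hlt (by omega) (hf.trans h3.symm)) hf'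
    · rfl
    · exact absurd (h3 ▸ hS.fan s (Nat.le_succ f') hlt (by omega) (h3.trans hf.symm)) h4
  subst hff
  rw [← hf]
  refine hS.gap_neg_of_stab (y := g) (by omega) (by omega) ?_ hfm (by omega) (fun m hm1 hm2 => ?_)
    (hS.gap_last (by omega) (by rwa [hf]))
  · rw [hf, h5]; exact h.ne_succ hS hi hq
  · rw [hf, h5]; exact h6 m (by omega) (Or.inl (by omega)) (Or.inr hσ)

lemma below {q : ℕ} (hσ : σ ≤ q) (hq : q < L) : P.gap e i (P.vert (v q)) < 0 := by
  obtain ⟨f, g, h1, h2, h3, h4, -⟩ := h.edge q hq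
  exact h.below_of_le hS hi hσ hq h3 h4 (by omega) le_rfl

end Chain

end SimplePolygon

/-! ### The position of the new vertex relative to the chains and the visibility lines. -/

namespace SimplePolygon

variable {n : ℕ} [NeZero n] {P : SimplePolygon n} {T : Finset (Finset (Fin n))} {k : ℕ}
  {t : ℕ → Finset (Fin n)} {e : Side → ℕ → Fin n}

/-- If a line separates the endpoints in both directions, they all lie on it, so by general position
they are `p` or `q`. The first triangle already has a third corner. -/
lemma IsSleeve.eq_zero_of_stab_both (hS : P.IsSleeve T k t e) {p q : Fin n} {i : ℕ} (hi : i ≤ k)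
    (hpq : p ≠ q) (h : ∀ m ≤ i, P.Stab e p q m) (h' : ∀ m ≤ i, P.Stab e q p m) : i = 0 := by
  by_contra h0
  have hz : ∀ m ≤ i, ∀ s, e s m = p ∨ e s m = q := by
    intro m hm s
    by_contra hc
    rw [not_or] at hc
    have h1 := (h m hm).pos hS.gp s hpq hc.1 hc.2
    have h2 := h' m hm s
    rw [turn_swap] at h2; linarith
  have h1 : 0 < k := by omega
  have n1 := hS.new_ne_of_le h1 le_rfl (newSide e (0 + 1))
  have n2 := hS.new_ne_of_le h1 le_rfl (newSide e (0 + 1)).opp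
  have n3 := hS.ne (newSide e (0 + 1)) 0 (by omega)
  rcases hz 0 (by omega) (newSide e (0 + 1)) with a | a <;>
  rcases hz 0 (by omega) (newSide e (0 + 1)).opp with b | b <;>
  rcases hz (0 + 1) (by omega) (newSide e (0 + 1)) with c | c <;> simp_all

namespace Config

variable {s : Side} {i : ℕ} {v u : ℕ → Fin n} {L σ τ L' σ' τ' : ℕ}
  (h : Config P e s i v L σ τ u L' σ' τ') (hS : P.IsSleeve T k t e) (hi : i < k)
  (hs : newSide e (i + 1) = s)

include hS hi hs in
lemma gap_new (m : ℕ) (hm : m = i) : 0 < P.gap e m (P.vert (e s (i + 1))) := by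
  subst hm; rw [← hs]; exact hS.gap_new hi

include hS hi hs in
lemma turn_new : 0 < turn s (P.vert (e s i)) (P.vert (e s.opp i)) (P.vert (e s (i + 1))) := by
  rw [← hs]; exact hS.turn_pos i hi

include hS hi hs in
lemma new_ne {m : ℕ} (hm : m ≤ i) (s' : Side) : e s (i + 1) ≠ e s' m := by
  rw [← hs]; exact hS.new_ne_of_le hi hm s'

include hS hi hs in
lemma same_opp : e s.opp (i + 1) = e s.opp i := by rw [← hs]; exact hS.same i hi

include hS hi hs in
lemma stab_succ {p q : Fin n} (hst : P.Stab e p q i)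
    (ha : 0 ≤ turn s (P.vert p) (P.vert q) (P.vert (e s (i + 1)))) : P.Stab e p q (i + 1) := by
  intro s'
  rcases Side.eq_or s s' with rfl | rfl
  · exact ha
  · rw [same_opp hS hi hs]; exact hst _

include h

lemma stab_line : P.Stab e (u σ') (v τ) i := h.line.1 i le_rfl
lemma stab_line' : P.Stab e (v σ) (u τ') i := h.line'.1 i le_rfl

lemma source_le : σ ≤ L := h.chain.σ_le.trans h.chain.τ_le
lemma source_le' : σ' ≤ L' := h.chain'.σ_le.trans h.chain'.τ_le

lemma side {q : ℕ} (hq : q ≤ L) : ∃ m ≤ i, e s m = v q := h.chain.mem hq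
lemma side' {q : ℕ} (hq : q ≤ L') : ∃ m ≤ i, e s.opp m = u q := h.chain'.mem hq

lemma line_side {q : ℕ} (hq : q ≤ L) :
    0 ≤ turn s (P.vert (u σ')) (P.vert (v τ)) (P.vert (v q)) := by
  obtain ⟨m, hm, hq⟩ := h.side hq
  rw [← hq]; exact h.line.1 m hm s

lemma line_side' {q : ℕ} (hq : q ≤ L') :
    turn s (P.vert (u σ')) (P.vert (v τ)) (P.vert (u q)) ≤ 0 := by
  obtain ⟨m, hm, hq⟩ := h.side' hq
  rw [← hq]; exact (h.line.1 m hm).opp_le s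

lemma line'_side {q : ℕ} (hq : q ≤ L) :
    0 ≤ turn s (P.vert (v σ)) (P.vert (u τ')) (P.vert (v q)) := by
  obtain ⟨m, hm, hq⟩ := h.side hq
  rw [← hq]; exact h.line'.1 m hm s

lemma line'_side' {q : ℕ} (hq : q ≤ L') :
    turn s (P.vert (v σ)) (P.vert (u τ')) (P.vert (u q)) ≤ 0 := by
  obtain ⟨m, hm, hq⟩ := h.side' hq
  rw [← hq]; exact (h.line'.1 m hm).opp_le s

include hS hi

lemma ne_vu {q q' : ℕ} (hq : q ≤ L) (hq' : q' ≤ L') : v q ≠ u q' := by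
  obtain ⟨m, hm, h1⟩ := h.side hq
  obtain ⟨m', hm', h2⟩ := h.side' hq'
  rw [← h1, ← h2]; exact hS.ne_of_le s (by omega) (by omega)

lemma v_ne {q m : ℕ} (hq : q ≤ L) (hm : m ≤ k) : v q ≠ e s.opp m := by
  obtain ⟨m', hm', h1⟩ := h.side hq
  rw [← h1]; exact hS.ne_of_le s (by omega) (by omega)

lemma u_ne {q m : ℕ} (hq : q ≤ L') (hm : m ≤ k) : u q ≠ e s m := by
  obtain ⟨m', hm', h1⟩ := h.side' hq
  rw [← h1]; exact (hS.ne_of_le s (by omega) (by omega)).symm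

lemma below' {q : ℕ} (hσ : σ' ≤ q) (hq : q < L') : P.gap e i (P.vert (u q)) < 0 :=
  h.chain'.below hS hi.le hσ hq

lemma ne_last' {q : ℕ} (hq : q < L') : u q ≠ e s.opp i := h.chain'.ne_last hS hi.le hq

/-- The source is the last endpoint only if the target is one, too. -/
lemma source_ne_last (hτ : τ < L) : u σ' ≠ e s.opp i := by
  intro he
  have h1 := h.stab_line s
  have h2 := h.chain.below hS hi.le h.chain.σ_le hτ
  rw [gap_eq P e s] at h2
  rw [he, turn_cyc, turn_cyc] at h1; linarith

include hs

lemma v_ne_new {q : ℕ} (hq : q ≤ L) : e s (i + 1) ≠ v q := by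
  obtain ⟨m', hm', h1⟩ := h.side hq
  rw [← h1]; exact new_ne hS hi hs hm' _

lemma u_ne_new {q : ℕ} (hq : q ≤ L') : e s (i + 1) ≠ u q := by
  obtain ⟨m', hm', h1⟩ := h.side' hq
  rw [← h1]; exact new_ne hS hi hs hm' _

/-- `wrap` for the diagonal `b_i`: the chain vertex is behind it and the new vertex beyond it. -/
lemma wrap_opp {q : ℕ} (hσ : σ' ≤ q) (hq : q ≤ L') {f : Pt → ℝ} (hf : IsAff f)
    (hA : 0 ≤ f (P.vert (e s i))) (hB : f (P.vert (e s.opp i)) ≤ 0) (hw : 0 ≤ f (P.vert (u q)))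
    (ha : 0 < f (P.vert (e s (i + 1)))) (hne : u q ≠ e s.opp i) :
    0 < turn s (P.vert (u q)) (P.vert (e s.opp i)) (P.vert (e s (i + 1))) := by
  have hqL : q < L' := hq.lt_of_ne (by rintro rfl; exact hne h.chain'.last)
  have h1 := h.below' hS hi hσ hqL
  rw [gap_eq P e s] at h1
  exact wrap hf hA hB hw ha h1 (turn_new hS hi hs)

/-- The opposite chain bends away. So along it, from the source on, the new vertex changes at most
once from the opposite side to side `s` of the edges. This is why a linear search for the tangent
succeeds. -/
lemma left_of_next_opp {q : ℕ} (hσ : σ' ≤ q) (hq : q + 2 ≤ L')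
    (ha : 0 < turn s (P.vert (u q)) (P.vert (u (q + 1))) (P.vert (e s (i + 1)))) :
    0 < turn s (P.vert (u (q + 1))) (P.vert (u (q + 2))) (P.vert (e s (i + 1))) := by
  have st := h.chain'.stab hσ (by omega)
  have n1 := h.chain'.ne_succ hS hi.le (q := q) (by omega)
  have n2 := h.chain'.ne_succ hS hi.le (q := q + 1) (by omega)
  have h4 := h.wrap_opp hS hi hs (q := q + 1) (by omega) (by omega)
    (isAff_turn s (P.vert (u q)) (P.vert (u (q + 1)))) (st s) (st.opp_le s) (by simp) ha
    (h.ne_last' hS hi (by omega))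
  by_cases hx : u (q + 2) = e s.opp i
  · rwa [hx]
  have hb := h.chain'.bend q hq
  rw [turn_opp] at hb
  exact left_of_next (by linarith)
    (st.opp_neg hS.gp s n1 (h.ne_last' hS hi (by omega)).symm (h.ne_last' hS hi (by omega)).symm)
    ((h.chain'.stab (q := q + 1) (by omega) (by omega)).opp_neg hS.gp s n2
      (h.ne_last' hS hi (by omega)).symm (Ne.symm hx)) h4 ha

lemma left_of_next_opp_of_le {q q' : ℕ} (hσ : σ' ≤ q) (hqq : q ≤ q') (hq' : q' < L')
    (ha : 0 < turn s (P.vert (u q)) (P.vert (u (q + 1))) (P.vert (e s (i + 1)))) :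
    0 < turn s (P.vert (u q')) (P.vert (u (q' + 1))) (P.vert (e s (i + 1))) := by
  induction q', hqq using Nat.le_induction with
  | base => exact ha
  | succ q' hqq ih => exact h.left_of_next_opp hS hi hs (by omega) (by omega) (ih (by omega))

variable (ho : 0 < turn s (P.vert (v σ)) (P.vert (u τ')) (P.vert (e s (i + 1))))
include ho

/-- The opposite visibility line and the first edge after its target form a bend like two
consecutive edges. It follows that the search for a new source does not run past this target. -/
lemma left_at_target_opp (hτ : τ' < L') :
    0 < turn s (P.vert (u τ')) (P.vert (u (τ' + 1))) (P.vert (e s (i + 1))) := by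
  have st := h.stab_line'
  have hv := h.ne_vu hS hi h.source_le h.chain'.τ_le
  have h4 := h.wrap_opp hS hi hs h.chain'.σ_le h.chain'.τ_le
    (isAff_turn s (P.vert (v σ)) (P.vert (u τ'))) (st s) (st.opp_le s) (by simp) ho
    (h.ne_last' hS hi hτ)
  by_cases hx : u (τ' + 1) = e s.opp i
  · rwa [hx]
  have n1 := h.chain'.ne_succ hS hi.le hτ
  have hb := h.line'_side' (q := τ' + 1) hτ
  have hb' := hS.gp.turn_ne s hv n1 (h.ne_vu hS hi h.source_le hτ)
  exact left_of_next (lt_of_le_of_ne hb hb')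
    (st.opp_neg hS.gp s hv (h.v_ne hS hi h.source_le hi.le).symm (h.ne_last' hS hi hτ).symm)
    ((h.chain'.stab h.chain'.σ_le hτ).opp_neg hS.gp s n1 (h.ne_last' hS hi hτ).symm
      (Ne.symm hx)) h4 ho

lemma wrap_new {q : ℕ} (hσ : σ ≤ q) (hq : q ≤ L) :
    0 < turn s (P.vert (v q)) (P.vert (e s.opp i)) (P.vert (e s (i + 1))) := by
  rcases hq.lt_or_eq with hqL | rfl
  · have h1 := h.chain.below hS hi.le hσ hqL
    rw [gap_eq P e s] at h1
    exact wrap (isAff_turn s (P.vert (v σ)) (P.vert (u τ'))) (h.stab_line' s)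
      (h.stab_line'.opp_le s) (h.line'_side hq) ho h1 (turn_new hS hi hs)
  · rw [h.chain.last]; exact turn_new hS hi hs

/-- On the chain that is extended, the change goes the other way: once the new vertex is on the
opposite side of an edge, it is so for all later edges. Hence removing vertices from the end stops
at the tangent point. -/
lemma right_of_next_edge {q : ℕ} (hσ : σ ≤ q) (hq : q + 2 ≤ L)
    (ha : turn s (P.vert (v q)) (P.vert (v (q + 1))) (P.vert (e s (i + 1))) < 0) :
    turn s (P.vert (v (q + 1))) (P.vert (v (q + 2))) (P.vert (e s (i + 1))) < 0 := by
  have n : ∀ q ≤ L, e s.opp i ≠ v q := fun q hq => (h.v_ne hS hi hq hi.le).symm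
  exact right_of_next (h.chain.bend q hq)
    ((h.chain.stab hσ (by omega)).opp_neg hS.gp s (h.chain.ne_succ hS hi.le (by omega))
      (n _ (by omega)) (n _ (by omega)))
    ((h.chain.stab (q := q + 1) (by omega) (by omega)).opp_neg hS.gp s
      (h.chain.ne_succ hS hi.le (by omega)) (n _ (by omega)) (n _ (by omega)))
    (h.wrap_new hS hi hs ho (by omega) (by omega)) ha

lemma right_of_next_of_le {q q' : ℕ} (hσ : σ ≤ q) (hqq : q ≤ q') (hq' : q' < L)
    (ha : turn s (P.vert (v q)) (P.vert (v (q + 1))) (P.vert (e s (i + 1))) < 0) :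
    turn s (P.vert (v q')) (P.vert (v (q' + 1))) (P.vert (e s (i + 1))) < 0 := by
  induction q', hqq using Nat.le_induction with
  | base => exact ha
  | succ q' hqq ih => exact h.right_of_next_edge hS hi hs ho (by omega) (by omega) (ih (by omega))

/-- The new edge crosses the diagonals after the vertex from which it starts. -/
lemma stab_new {q f : ℕ} (hσ : σ ≤ q) (hq : q ≤ L) (hf : e s f = v q) (hf' : e s (f + 1) ≠ v q)
    (hfi : f ≤ i)
    (hr : q < L → turn s (P.vert (v q)) (P.vert (v (q + 1))) (P.vert (e s (i + 1))) < 0)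
    {m : ℕ} (hfm : f ≤ m) (hm : m ≤ i + 1) : P.Stab e (v q) (e s (i + 1)) m := by
  have hqL : f < i → q < L := fun hlt => hq.lt_of_ne (by
    rintro rfl
    have := hS.eq_of_last hi.le hfi (hf.trans h.chain.last) (by rwa [hf]); omega)
  -- The new vertex is beyond every diagonal from `b_f` on, by induction backwards from `b_i`. If
  -- side `s` moves, the opposite visibility line supplies the affine function for `above_step`;
  -- otherwise the old edge out of `v q` does.
  have hgap : ∀ m, f ≤ m → m ≤ i → 0 < P.gap e m (P.vert (e s (i + 1))) := by
    intro m hfm hm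
    induction hm using Nat.decreasingInduction with
    | self => exact gap_new hS hi hs _ rfl
    | of_succ m hm ih =>
      specialize ih (by omega)
      have hqL := hqL (by omega)
      rcases Side.eq_or s (newSide e (m + 1)) with h1 | h1
      · have l1 := h.line'.1 m (by omega)
        have l2 := h.line'.1 (m + 1) (by omega)
        have hB := l1.opp_le s
        refine hS.above_step (isAff_turn s (P.vert (v σ)) (P.vert (u τ'))) (by omega) ?_ ?_ ?_ ih.le
        all_goals rw [h1]
        · exact hB.trans (l1 s)
        · exact hB.trans (l2 s)
        · exact hB.trans_lt ho
      · obtain ⟨f', g, g1, g2, g3, g4, g5, -, g6⟩ := h.chain.edge q hqL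
        have hff : f = f' := by
          rcases lt_trichotomy f f' with hlt | rfl | hlt
          · exact absurd (hf ▸ hS.fan s (Nat.le_succ f) hlt (by omega) (hf.trans g3.symm)) hf'
          · rfl
          · exact absurd (g3 ▸ hS.fan s (Nat.le_succ f') hlt (by omega) (g3.trans hf.symm)) g4
        subst hff
        have l1 := g6 m (by omega) (Or.inl hfm) (Or.inr hσ)
        have l2 := g6 (m + 1) (by omega) (Or.inl (by omega)) (Or.inr hσ)
        have hB := l1 s
        have hr := hr hqL
        refine hS.above_step (isAff_turn s.opp (P.vert (v q)) (P.vert (v (q + 1)))) (by omega)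
          ?_ ?_ ?_ ih.le
        all_goals rw [h1, Side.opp_opp]
        · rw [turn_opp]; exact le_trans (by linarith) (l1 s.opp)
        · rw [turn_opp]; exact le_trans (by linarith) (l2 s.opp)
        · rw [turn_opp, turn_opp]; linarith
  -- Opposite endpoints: `v q` is behind `b_m` and the new vertex beyond it, and both are on side
  -- `s` of the opposite visibility line.
  have hB : ∀ m, f ≤ m → m ≤ i →
      0 < turn s (P.vert (v q)) (P.vert (e s.opp m)) (P.vert (e s (i + 1))) := by
    intro m hfm hm
    have h1 := hgap m hfm hm
    rw [gap_eq P e s] at h1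
    rcases hfm.lt_or_eq with hlt | rfl
    · have h2 := h.chain.below_of_le hS hi.le hσ (hqL (by omega)) hf hf' hlt hm
      rw [gap_eq P e s] at h2
      have l1 := h.line'.1 m hm
      exact wrap (isAff_turn s (P.vert (v σ)) (P.vert (u τ'))) (l1 s) (l1.opp_le s)
        (h.line'_side hq) ho h2 h1
    · rwa [hf] at h1
  -- Endpoints on side `s`: the same argument with sides exchanged, and the old edge out of `v q` as
  -- the line.
  have hA : ∀ m, f ≤ m → m ≤ i →
      0 ≤ turn s (P.vert (v q)) (P.vert (e s (i + 1))) (P.vert (e s m)) := by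
    intro m hfm hm
    rcases hfm.lt_or_eq with hlt | rfl
    · have hqL := hqL (by omega)
      have h1 := hgap m hfm hm
      have h2 := h.chain.below_of_le hS hi.le hσ hqL hf hf' hlt hm
      rw [gap_eq P e s.opp, Side.opp_opp] at h1 h2
      obtain ⟨f', g, g1, g2, g3, g4, g5, -, g6⟩ := h.chain.edge q hqL
      have hff : f' ≤ f := by
        by_contra hc
        exact absurd (hf ▸ hS.fan s (Nat.le_succ f) (by omega) (by omega) (hf.trans g3.symm)) hf'
      have l1 := g6 m hm (Or.inl (by omega)) (Or.inr hσ)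
      have hr := hr hqL
      have l2 : turn s.opp (P.vert (v q)) (P.vert (v (q + 1))) (P.vert (e s m)) ≤ 0 := by
        have := l1 s; rw [turn_opp]; linarith
      have := wrap (isAff_turn s.opp (P.vert (v q)) (P.vert (v (q + 1)))) (l1 s.opp) l2
        (by simp) (by rw [turn_opp]; linarith) h2 h1
      rw [turn_opp, turn_swap'] at this; linarith
    · rw [hf]; simp
  rcases hm.lt_or_eq with hm | rfl
  · intro s'
    rcases Side.eq_or s s' with rfl | rfl
    · exact hA m hfm (by omega)
    · rw [turn_opp, turn_swap']; have := hB m hfm (by omega); linarith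
  · intro s'
    rcases Side.eq_or s s' with rfl | rfl
    · simp
    · rw [same_opp hS hi hs, turn_opp, turn_swap']; have := hB i hfi le_rfl; linarith

section Update

variable (hu : turn s (P.vert (u σ')) (P.vert (v τ)) (P.vert (e s (i + 1))) < 0)
include hu

/-- The visibility line and the first edge after its target bend to side `s` like two consecutive
edges. Consequently the removals go back at least to the target. -/
lemma right_of_update {q : ℕ} (hτ : τ ≤ q) (hq : q < L) :
    turn s (P.vert (v q)) (P.vert (v (q + 1))) (P.vert (e s (i + 1))) < 0 := by
  have hτL : τ < L := by omega
  refine h.right_of_next_of_le hS hi hs ho h.chain.σ_le hτ hq ?_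
  have n1 := h.chain.ne_succ hS hi.le hτL
  have hv := (h.ne_vu hS hi hτL.le h.source_le').symm
  have n2 := h.source_ne_last hS hi hτL
  have hx := hS.gp.turn_ne s hv n1 (h.ne_vu hS hi (q := τ + 1) hτL h.source_le').symm
  exact right_of_next ((h.line_side hτL).lt_of_ne hx.symm)
    (h.stab_line.opp_neg hS.gp s hv n2.symm (h.v_ne hS hi hτL.le hi.le).symm)
    ((h.chain.stab h.chain.σ_le hτL).opp_neg hS.gp s n1 (h.v_ne hS hi hτL.le hi.le).symm
      (h.v_ne hS hi hτL hi.le).symm)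
    (h.wrap_new hS hi hs ho h.chain.σ_le hτL.le) hu

omit hs in
-- The new vertex lies in the cone between the visibility lines, which is on side `s` of the edge
-- that enters the source of the opposite line. Consequently the removals do not go back beyond that
-- source.
lemma left_of_update {q : ℕ} (hq : q + 1 = σ) :
    0 ≤ turn s (P.vert (v q)) (P.vert (v σ)) (P.vert (e s (i + 1))) := by
  have hσ := h.source_le
  obtain ⟨f, g, h1, h2, h3, h4, h5, h6, h7⟩ := h.chain.edge q (by omega)
  have l1 := h7 g h2 (Or.inl h1.le) (Or.inl le_rfl)
  rw [hq] at l1 h5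
  have n1 := h.chain.ne_succ hS hi.le (q := q) (by omega)
  rw [hq] at n1
  have hvt : turn s.opp (P.vert (v σ)) (P.vert (u τ')) (P.vert (v q)) ≤ 0 := by
    rw [turn_opp]; have := h.line'_side (q := q) (by omega); linarith
  have hAt : e s.opp g ≠ u τ' := by
    intro he
    have h8 := l1 s.opp
    rw [he, turn_cyc] at h8
    exact hS.gp.turn_ne s.opp (h.ne_vu hS hi hσ h.chain'.τ_le)
      (h.ne_vu hS hi (by omega) h.chain'.τ_le).symm n1.symm (le_antisymm hvt h8)
  have := right_of_previous (f := fun z => -turn s (P.vert (u σ')) (P.vert (v τ)) z)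
    (isAff_turn _ _ _).neg (s := s.opp) (v := P.vert (v q)) (w := P.vert (v σ))
    (t := P.vert (u τ')) (A := P.vert (e s.opp g)) (a := P.vert (e s (i + 1)))
    (by have := h.line_side hσ; linarith) (by have := h.line_side' h.chain'.τ_le; linarith)
    (by have := (h.line.1 g h2).opp_le s; linarith) (by linarith) (l1 s.opp)
    ((h.line'.1 g h2).pos hS.gp s.opp (h.ne_vu hS hi hσ h.chain'.τ_le)
      (h.v_ne hS hi hσ (by omega)).symm hAt)
    (by rw [turn_opp]; linarith) hvt
  rw [turn_opp] at this; linarith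

omit hs in
/-- At the source of the line, the previous vertex is not beyond the new line. -/
lemma previous_of_update {q : ℕ} (hq : q + 1 = σ') :
    turn s (P.vert (u σ')) (P.vert (e s (i + 1))) (P.vert (u q)) ≤ 0 := by
  have hσ := h.source_le'
  obtain ⟨f, g, h1, h2, h3, h4, h5, h6, h7⟩ := h.chain'.edge q (by omega)
  have l1 := h7 g h2 (Or.inl h1.le) (Or.inl le_rfl)
  rw [hq] at l1 h5
  have n1 := h.chain'.ne_succ hS hi.le (q := q) (by omega)
  rw [hq] at n1
  have hvt : turn s (P.vert (u σ')) (P.vert (v τ)) (P.vert (u q)) ≤ 0 :=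
    h.line_side' (q := q) (by omega)
  have hAt : e s g ≠ v τ := by
    intro he
    have h8 := l1 s
    rw [he, turn_cyc] at h8
    exact hS.gp.turn_ne s (h.ne_vu hS hi h.chain.τ_le hσ).symm
      (h.ne_vu hS hi h.chain.τ_le (by omega)) n1.symm (le_antisymm hvt h8)
  have := right_of_previous (isAff_turn s (P.vert (v σ)) (P.vert (u τ')))
    (s := s) (v := P.vert (u q)) (w := P.vert (u σ'))
    (t := P.vert (v τ)) (A := P.vert (e s g)) (a := P.vert (e s (i + 1)))
    (h.line'_side' hσ) (h.line'_side h.chain.τ_le) (h.line'.1 g h2 s) ho (l1 s)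
    ((h.line.1 g h2).pos hS.gp s (h.ne_vu hS hi h.chain.τ_le hσ).symm
      (h.u_ne hS hi hσ (by omega)).symm hAt) hu hvt
  rw [turn_cyc, turn_cyc]; exact this

end Update

end Config

end SimplePolygon

/-! ### Segments inside a sleeve, and lines between two lines that cross all diagonals. -/

/-- The point `y` need not be between `p` and `q`: if it is not, one of the two segments contains
the whole of `p q`. -/
lemma segment_subset_union {p q y : Pt} (h : cross p q y = 0) :
    segment ℝ p q ⊆ segment ℝ p y ∪ segment ℝ y q := by
  rcases eq_or_ne p q with rfl | hpq
  · rw [segment_same]; rintro _ rfl; exact Or.inl (left_mem_segment ..)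
  obtain ⟨κ, rfl⟩ := exists_of_cross_eq_zero hpq h
  intro z hz
  rw [segment_eq_image'] at hz
  obtain ⟨μ, ⟨h0, h1⟩, rfl⟩ := hz
  simp only [segment_eq_image', mem_union, mem_image]
  rcases le_or_gt μ κ with hκ | hκ
  · left
    rcases eq_or_ne κ 0 with rfl | hκ0
    · obtain rfl : μ = 0 := le_antisymm hκ h0
      exact ⟨0, by simp, by simp⟩
    · have : 0 < κ := lt_of_le_of_ne (h0.trans hκ) hκ0.symm
      refine ⟨μ / κ, ⟨by positivity, by rw [div_le_one this]; exact hκ⟩, ?_⟩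
      rw [add_sub_cancel_left, smul_smul, div_mul_cancel₀ _ hκ0]
  · right
    have h2 : 0 < 1 - κ := by linarith
    refine ⟨(μ - κ) / (1 - κ), ⟨div_nonneg (by linarith) h2.le, by
      rw [div_le_one h2]; linarith⟩, ?_⟩
    have : q - (p + κ • (q - p)) = (1 - κ) • (q - p) := by module
    rw [this, smul_smul, div_mul_cancel₀ _ h2.ne']
    module

lemma IsAff.cross_eq_zero {g : Pt → ℝ} (hg : IsAff g) {x p q y : Pt} (hx : g x ≠ 0) (hp : g p = 0)
    (hq : g q = 0) (hy : g y = 0) : cross p q y = 0 := by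
  have := hg.bary .left p q y x
  rw [hp, hq, hy] at this
  simp only [mul_zero, add_zero, mul_eq_zero, hx, or_false] at this
  exact this

/-- The reflection of `p` in `w` serves as a fictitious next vertex, so that facts about consecutive
edges apply to a line that arrives in `w`. -/
lemma turn_reflect (s : Side) (w p z : Pt) : turn s w (w + (1 : ℝ) • (w - p)) z = turn s p w z := by
  cases s <;> simp [turn, cross] <;> ring

namespace SimplePolygon

variable {n : ℕ} [NeZero n] {P : SimplePolygon n} {T : Finset (Finset (Fin n))} {k : ℕ}
  {t : ℕ → Finset (Fin n)} {e : Side → ℕ → Fin n}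

/-- The diagonal `bₘ`. -/
def diag (P : SimplePolygon n) (e : Side → ℕ → Fin n) (m : ℕ) : Set Pt :=
  segment ℝ (P.vert (e .left m)) (P.vert (e .right m))

lemma diag_eq (P : SimplePolygon n) (e : Side → ℕ → Fin n) (s : Side) (m : ℕ) :
    P.diag e m = segment ℝ (P.vert (e s m)) (P.vert (e s.opp m)) := by
  cases s
  · rfl
  · exact segment_symm ..

lemma vert_mem_diag (P : SimplePolygon n) (e : Side → ℕ → Fin n) (s : Side) (m : ℕ) :
    P.vert (e s m) ∈ P.diag e m := by
  rw [diag_eq P e s]; exact left_mem_segment ..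

lemma convex_diag (P : SimplePolygon n) (e : Side → ℕ → Fin n) (m : ℕ) : Convex ℝ (P.diag e m) :=
  convex_segment _ _

namespace IsSleeve

variable (hS : P.IsSleeve T k t e)
include hS

lemma diag_subset {m : ℕ} (h1 : 1 ≤ m) (hm : m ≤ k) : P.diag e m ⊆ P.hull (t m) :=
  (P.convex_hull _).segment_subset (P.vert_mem_hull (hS.mem_self .left h1 hm))
    (P.vert_mem_hull (hS.mem_self .right h1 hm))

lemma diag_subset_succ {m : ℕ} (hm : m < k) : P.diag e m ⊆ P.hull (t (m + 1)) :=
  (P.convex_hull _).segment_subset (P.vert_mem_hull (hS.mem_succ .left hm))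
    (P.vert_mem_hull (hS.mem_succ .right hm))

/-- A line that crosses the diagonals from `b_f` to `b_l` stays in the triangles between them. -/
lemma segment_subset {g : Pt → ℝ} (hg : IsAff g) {x : Pt} (hx : g x ≠ 0) {s : Side} {f l : ℕ}
    (hfl : f ≤ l) (hl : l ≤ k)
    (h : ∀ m, f ≤ m → m ≤ l → 0 ≤ g (P.vert (e s m)) ∧ g (P.vert (e s.opp m)) ≤ 0)
    {p q : Pt} (hp : p ∈ P.diag e f) (hq : q ∈ P.diag e l) (hgp : g p = 0) (hgq : g q = 0) :
    ∀ z ∈ segment ℝ p q, z ∈ P.diag e f ∨ ∃ j, f < j ∧ j ≤ l ∧ z ∈ P.hull (t j) := by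
  induction hfl using Nat.decreasingInduction generalizing p with
  | self => exact fun z hz => Or.inl ((P.convex_diag e _).segment_subset hp hq hz)
  | of_succ f hfl ih =>
    intro z hz
    obtain ⟨h1, h2⟩ := h (f + 1) (by omega) hfl
    obtain ⟨y, hy, hgy⟩ := hg.exists_zero h1 h2
    rw [← diag_eq] at hy
    rcases segment_subset_union (hg.cross_eq_zero hx hgp hgq hgy) hz with hz | hz
    · exact Or.inr ⟨f + 1, by omega, hfl, (P.convex_hull _).segment_subset
        (hS.diag_subset_succ (by omega) hp) (hS.diag_subset (by omega) (by omega) hy) hz⟩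
    · rcases ih (fun m hm hm' => h m (by omega) hm') hy hgy z hz with h3 | ⟨j, h3, h4, h5⟩
      · exact Or.inr ⟨f + 1, by omega, hfl, hS.diag_subset (by omega) (by omega) h3⟩
      · exact Or.inr ⟨j, by omega, h4, h5⟩

end IsSleeve

lemma Stab.between {p₁ q₁ p₂ q₂ w a : Fin n} {m : ℕ} {s : Side}
    (h1 : turn s (P.vert p₁) (P.vert q₁) (P.vert w) = 0)
    (h2 : turn s (P.vert p₂) (P.vert q₂) (P.vert w) = 0)
    (hD : turn s (P.vert p₁) (P.vert q₁) (P.vert q₂) < turn s (P.vert p₁) (P.vert q₁) (P.vert p₂))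
    (ha1 : turn s (P.vert p₁) (P.vert q₁) (P.vert a) ≤ 0)
    (ha2 : 0 ≤ turn s (P.vert p₂) (P.vert q₂) (P.vert a))
    (st1 : P.Stab e p₁ q₁ m) (st2 : P.Stab e p₂ q₂ m) : P.Stab e w a m := by
  intro s'
  rcases Side.eq_or s s' with rfl | rfl
  · exact (FirstWindow.between h1 h2 hD ha1 ha2 _).1 (st1 _) (st2 _)
  · rw [turn_opp]
    have := (FirstWindow.between h1 h2 hD ha1 ha2 (P.vert (e s.opp m))).2 (st1.opp_le s)
      (st2.opp_le s)
    linarith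

namespace Config

variable {s : Side} {i : ℕ} {v u : ℕ → Fin n} {L σ τ L' σ' τ' : ℕ}
  (h : Config P e s i v L σ τ u L' σ' τ') (hS : P.IsSleeve T k t e) (hi : i < k)
  (hs : newSide e (i + 1) = s)

include h hS hi hs

lemma exists_last_new {q : ℕ} (hq : q ≤ L) :
    ∃ f ≤ i, e s f = v q ∧ e s (f + 1) ≠ v q := by
  obtain ⟨f, hf, h1, h2⟩ := h.chain.exists_last hq
  rcases hq.lt_or_eq with hq | rfl
  · exact ⟨f, hf, h1, h2 hq⟩
  · exact ⟨i, le_rfl, h.chain.last.symm, h.v_ne_new hS hi hs le_rfl⟩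

variable (ho : 0 < turn s (P.vert (v σ)) (P.vert (u τ')) (P.vert (e s (i + 1))))
include ho

/-- If the new vertex were on the opposite side of an earlier edge, it would also be so for the edge
that enters `v r`. -/
lemma left_before {r : ℕ} (hr : r ≤ L)
    (hleft : ∀ q, q + 1 = r → 0 ≤ turn s (P.vert (v q)) (P.vert (v r)) (P.vert (e s (i + 1))))
    {q : ℕ} (hσ : σ ≤ q) (hq : q < r) :
    0 ≤ turn s (P.vert (v q)) (P.vert (v (q + 1))) (P.vert (e s (i + 1))) := by
  by_contra hc
  have h1 := h.right_of_next_of_le hS hi hs ho hσ (q' := r - 1) (by omega) (by omega) (not_le.1 hc)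
  have h2 := hleft (r - 1) (by omega)
  rw [show r - 1 + 1 = r by omega] at h1; linarith

section Keep

variable (hk : 0 < turn s (P.vert (u σ')) (P.vert (v τ)) (P.vert (e s (i + 1))))
include hk

/-- This protects the target: if the visibility line does not move, the removals must not delete its
target `v τ`. -/
lemma not_right_of_keep {q : ℕ} (hq : q + 1 = τ) (hall : ∀ q', q ≤ q' → q' < L →
    turn s (P.vert (v q')) (P.vert (v (q' + 1))) (P.vert (e s (i + 1))) < 0) : False := by
  have hτ := h.chain.τ_le
  have ha := hall q le_rfl (by omega)
  have n1 := h.chain.ne_succ hS hi.le (q := q) (by omega)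
  rw [hq] at ha n1
  have nS := h.ne_vu hS hi hτ h.source_le'
  have nS' := h.ne_vu hS hi (q := q) (by omega) h.source_le'
  have hBS : u σ' ≠ e s.opp i := by
    intro he
    rcases hτ.lt_or_eq with hlt | rfl
    · exact h.source_ne_last hS hi hlt he
    · have := turn_new hS hi hs
      rw [he, h.chain.last, turn_swap] at hk; linarith
  rcases le_or_gt σ q with hσ | hσ
  · have st := fun m (hm : m ≤ i) => h.chain.stab_all hσ (q := q) (by omega) hm
    rw [hq] at st
    obtain ⟨m, hm, hmS⟩ := h.side' h.source_le'
    have hvS := (st m hm).opp_neg hS.gp s n1 (by rw [hmS]; exact nS'.symm) (by rw [hmS]; exact nS.symm)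
    rw [hmS] at hvS
    -- The edge into the target crosses all diagonals here. It is followed by the prolongation of
    -- the visibility line, with the reflected source as its far end, so the new vertex would also
    -- be on the wrong side of that line.
    have := right_of_next (s := s) (v := P.vert (v q)) (w := P.vert (v τ))
      (x := P.vert (v τ) + (1 : ℝ) • (P.vert (v τ) - P.vert (u σ'))) (B := P.vert (e s.opp i))
      (a := P.vert (e s (i + 1))) (by rw [(isAff_turn s _ _).ray]; simp; exact hvS)
      ((st i le_rfl).opp_neg hS.gp s n1 (h.v_ne hS hi (by omega) hi.le).symm
        (h.v_ne hS hi hτ hi.le).symm)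
      (by rw [turn_reflect]; exact h.stab_line.opp_neg hS.gp s nS.symm hBS.symm
            (h.v_ne hS hi hτ hi.le).symm)
      (h.wrap_new hS hi hs ho h.chain.σ_le hτ) ha
    rw [turn_reflect] at this; linarith
  -- Here the edge enters the source of the opposite line, which is also the target. It stays in
  -- triangles up to `b_f`, the last diagonal at `v τ`; but it will turn out to start from `v τ`
  -- into the interior of the triangle after `b_f`.
  · have hστ : σ = τ := by have := h.chain.σ_le; omega
    obtain ⟨f, hf, hft, hft'⟩ := h.exists_last_new hS hi hs hτ
    have hn := h.stab_new hS hi hs ho h.chain.σ_le hτ hft hft' hf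
      (fun hlt => hall τ (by omega) hlt) (m := f + 1) (by omega) (by omega)
    have x1 : 0 < turn s (P.vert (u σ')) (P.vert (v τ)) (P.vert (v q)) :=
      (h.line_side (by omega)).lt_of_ne (hS.gp.turn_ne s nS.symm n1.symm nS'.symm).symm
    have x2 := (h.line.1 f hf).opp_le s
    have x3 : 0 < turn s (P.vert (u σ')) (P.vert (v τ)) (P.vert (e s (f + 1))) := by
      rcases hf.lt_or_eq with hlt | rfl
      · exact (h.line.1 (f + 1) hlt).pos hS.gp s nS.symm
          (h.u_ne hS hi h.source_le' (by omega)).symm hft'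
      · exact hk
    have x4 := hn s
    have hns : newSide e (f + 1) = s := hS.newSide_of_ne (by omega) (by rwa [hft])
    have x6 := hS.turn_pos f (by omega)
    have htri := hS.eq_triple f (by omega)
    rw [hns, hft] at x6 htri
    have p1 := plucker s (P.vert (v τ)) (P.vert (u σ')) (P.vert (v q)) (P.vert (e s (i + 1)))
      (P.vert (e s (f + 1)))
    have p2 := plucker s (P.vert (v τ)) (P.vert (u σ')) (P.vert (v q)) (P.vert (e s.opp f))
      (P.vert (e s (f + 1)))
    rw [turn_swap] at x1 x2 x3 ha hk
    -- Together, `y1` and `y2` say that, seen from `v τ`, the previous vertex lies within the angle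
    -- of the triangle after `b_f`.
    have y1 : 0 < turn s (P.vert (v τ)) (P.vert (v q)) (P.vert (e s (f + 1))) := by
      by_contra hc
      push Not at hc
      nlinarith [mul_nonneg (neg_nonneg.2 hc) hk.le, mul_nonneg x1.le x4,
        mul_pos x3 (by linarith :
          0 < turn s (P.vert (v τ)) (P.vert (v q)) (P.vert (e s (i + 1))))]
    have y2 : turn s (P.vert (v τ)) (P.vert (v q)) (P.vert (e s.opp f)) < 0 := by
      by_contra hc
      push Not at hc
      have x6' := mul_pos x1 x6
      have x7 := mul_nonneg hc x3.le
      have x8 : 0 ≤ turn s (P.vert (v τ)) (P.vert (u σ')) (P.vert (e s.opp f)) := by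
        linarith
      nlinarith [mul_nonneg x8 y1.le]
    rw [turn_swap'] at y2
    obtain ⟨f', g, g1, g2, g3, g4, g5, -, g6⟩ := h.chain.edge q (by omega)
    rw [hq] at g5 g6
    have hgf : g ≤ f := by
      by_contra hc
      exact hft' (hft ▸ hS.fan s (Nat.le_succ f) (by omega) (by omega) (hft.trans g5.symm))
    have e0 := (isAff_turn s (P.vert (v τ)) (P.vert (e s.opp f))).eventually_pos
      (x := P.vert (v τ)) (y := P.vert (v q)) (Or.inr ⟨by simp, by linarith⟩)
    have e1 := (isAff_turn s (P.vert (e s (f + 1))) (P.vert (v τ))).eventually_pos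
      (x := P.vert (v τ)) (y := P.vert (v q)) (Or.inr ⟨by simp, by rw [turn_cyc]; exact y1⟩)
    have e2 := (isAff_turn s (P.vert (e s.opp f)) (P.vert (e s (f + 1)))).eventually_pos
      (x := P.vert (v τ)) (y := P.vert (v q)) (Or.inl (by rw [← turn_cyc]; exact x6))
    have e3 : ∀ᶠ ε : ℝ in 𝓝[>] 0, ε ≤ 1 := by
      filter_upwards [Ioc_mem_nhdsGT (zero_lt_one' ℝ)] with ε hε using hε.2
    obtain ⟨ε, ⟨h0, h1, h2, h3⟩, hε⟩ :=
      ((e0.and (e1.and (e2.and e3))).and self_mem_nhdsWithin).exists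
    have hε : 0 < ε := hε
    set z := P.vert (v τ) + ε • (P.vert (v q) - P.vert (v τ)) with hz
    have hzi : z ∈ interior (P.hull (t (f + 1))) := by
      rw [htri]; exact (P.interior_hull_iff x6).2 ⟨h0, h2, h1⟩
    have hzs : z ∈ segment ℝ (P.vert (v q)) (P.vert (v τ)) := by
      rw [segment_symm, segment_eq_image']; exact ⟨ε, ⟨hε.le, h3⟩, rfl⟩
    have hdiff : ∀ j, 1 ≤ j → j ≤ f → z ∉ P.hull (t j) := fun j hj hjf hzj =>
      disjoint_left.1 (hS.tri.disjoint_interior (hS.mem (f + 1) (by omega) (by omega))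
        (hS.mem j hj (by omega)) fun he => by
          have := hS.inj _ _ (by omega) (by omega) hj (by omega) he; omega) hzi hzj
    have hx : turn s (P.vert (v q)) (P.vert (v τ)) (P.vert (u σ')) ≠ 0 :=
      hS.gp.turn_ne s n1 nS nS'
    rcases hS.segment_subset (isAff_turn s (P.vert (v q)) (P.vert (v τ))) hx (s := s) g1.le
      (by omega) (fun m hm hm' => by
        have := g6 m (by omega) (Or.inl hm) (Or.inl hm')
        exact ⟨this s, this.opp_le s⟩)
      (g3 ▸ P.vert_mem_diag e s f') (g5 ▸ P.vert_mem_diag e s g) (by simp) (by simp) z hzs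
      with hd | ⟨j, hj, hj', hzj⟩
    · exact hdiff (f' + 1) (by omega) (by omega) (hS.diag_subset_succ (by omega) hd)
    · exact hdiff j (by omega) (by omega) hzj

omit ho in
-- If the visibility line stays, so does its source. The chain edges from the source on have to
-- cross the new diagonal, and by monotonicity only the first of them needs to be examined.
lemma left_at_source_opp (hσ : σ' < L') :
    0 < turn s (P.vert (u σ')) (P.vert (u (σ' + 1))) (P.vert (e s (i + 1))) := by
  have hτ := h.chain.τ_le
  have st := h.stab_line
  have nB := h.ne_last' hS hi hσ
  have h4 := h.wrap_opp hS hi hs le_rfl hσ.le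
    (isAff_turn s (P.vert (u σ')) (P.vert (v τ))) (st s) (st.opp_le s) (by simp) hk nB
  by_cases hx : u (σ' + 1) = e s.opp i
  · rwa [hx]
  have hBx := (h.chain'.stab le_rfl hσ).opp_neg hS.gp s (h.chain'.ne_succ hS hi.le hσ) nB.symm
    (Ne.symm hx)
  have hBt := st.opp_le s
  obtain ⟨m₁, m₂, h1, h2, h3, h5⟩ := h.line.2
  obtain ⟨f, g, g1, g2, g3, g4, g5, -, g6⟩ := h.chain'.edge σ' hσ
  -- Otherwise the diagonals would still turn around the source after reaching the target. The next
  -- vertex on side `s` would then be on the wrong side of the visibility line.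
  have hfm : f ≤ m₂ := by
    by_contra hc
    have f1 := hS.fan s.opp h1 (by omega : m₂ ≤ f) (by omega) (h3.trans g3.symm)
    have f2 := hS.fan s.opp (by omega : m₁ ≤ m₂ + 1) (by omega : m₂ + 1 ≤ f) (by omega)
      (h3.trans g3.symm)
    have hns : newSide e (m₂ + 1) = s := by
      rcases Side.eq_or s (newSide e (m₂ + 1)) with h | h
      · exact h
      · have := hS.new_ne (i := m₂) (by omega)
        rw [h] at this; exact absurd (f2.trans f1.symm) this
    have hp := hS.turn_pos m₂ (by omega)
    rw [hns, h5, f1, h3] at hp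
    have := h.line.1 (m₂ + 1) (by omega) s
    rw [turn_swap] at this; linarith
  have hxt := g6 m₂ h2 (Or.inl hfm) (Or.inr le_rfl) s
  rw [h5] at hxt
  have pl := plucker s (P.vert (u σ')) (P.vert (e s.opp i)) (P.vert (u (σ' + 1))) (P.vert (v τ))
    (P.vert (e s (i + 1)))
  rw [turn_swap'] at hBx hBt
  by_contra hc
  push Not at hc
  nlinarith [mul_pos (by linarith : 0 < turn s (P.vert (u σ')) (P.vert (e s.opp i))
    (P.vert (u (σ' + 1)))) hk, mul_nonneg (by linarith : 0 ≤ turn s (P.vert (u σ'))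
    (P.vert (e s.opp i)) (P.vert (v τ))) (neg_nonneg.2 hc), mul_nonneg h4.le hxt]

end Keep

section Update

variable (hu : turn s (P.vert (u σ')) (P.vert (v τ)) (P.vert (e s (i + 1))) < 0)
include hu

/-- The new edge from `v r` lies between two lines through `v r` that cross all diagonals: the chain
edges before and after `v r`, replaced by the opposite visibility line at `r = σ` and by the moving
one at `r = τ`. -/
lemma stab_new_of_update {r : ℕ} (hσ : σ ≤ r) (hτ : r ≤ τ)
    (hright : r < τ → turn s (P.vert (v r)) (P.vert (v (r + 1))) (P.vert (e s (i + 1))) < 0)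
    (hleft : ∀ q, q + 1 = r → 0 ≤ turn s (P.vert (v q)) (P.vert (v r)) (P.vert (e s (i + 1))))
    {m : ℕ} (hm : m ≤ i) : P.Stab e (v r) (e s (i + 1)) m := by
  have hL := h.chain.τ_le
  rcases hτ.lt_or_eq with hτ' | rfl
  · have s1 := fun m (hm : m ≤ i) => h.chain.stab_all hσ hτ' hm
    have n1 := h.chain.ne_succ hS hi.le (q := r) (by omega)
    rcases hσ.lt_or_eq with hσ' | rfl
    · obtain ⟨q, rfl⟩ : ∃ q, r = q + 1 := ⟨r - 1, by omega⟩
      have hb := h.chain.bend q (by omega)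
      rw [turn_cyc] at hb
      exact Stab.between (by simp) (by simp) (by simpa using hb) (hright hτ').le (hleft q rfl)
        (s1 m hm) (h.chain.stab_all (by omega) (by omega) hm)
    · obtain ⟨m', hm', hT⟩ := h.side' h.chain'.τ_le
      have := (s1 m' hm').opp_neg hS.gp s n1 (hT ▸ (h.ne_vu hS hi (by omega) h.chain'.τ_le).symm)
        (hT ▸ (h.ne_vu hS hi (by omega) h.chain'.τ_le).symm)
      rw [hT] at this
      exact Stab.between (by simp) (by simp) (by simpa using this) (hright hτ').le ho.le
        (s1 m hm) (h.line'.1 m hm)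
  · have nS := h.ne_vu hS hi hL h.source_le'
    rcases hσ.lt_or_eq with hσ' | rfl
    · obtain ⟨q, rfl⟩ : ∃ q, r = q + 1 := ⟨r - 1, by omega⟩
      have := (h.line_side (q := q) (by omega)).lt_of_ne (hS.gp.turn_ne s nS.symm
        (h.chain.ne_succ hS hi.le (q := q) (by omega)).symm
        (h.ne_vu hS hi (by omega) h.source_le').symm).symm
      exact Stab.between (by simp) (by simp) (by simpa using this) hu.le (hleft q rfl)
        (h.line.1 m hm) (h.chain.stab_all (by omega) (by omega) hm)
    -- For `r = σ = τ` the two lines are both visibility lines. If they join the same two vertices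
    -- in opposite directions, they bound no cone; this happens only at the start.
    · by_cases hST : u σ' = u τ'
      · have h0 := hS.eq_zero_of_stab_both hi.le nS.symm h.line.1 (hST ▸ h.line'.1)
        subst h0
        obtain rfl : m = 0 := by omega
        obtain ⟨m', hm', hv⟩ := h.side hL
        obtain rfl : m' = 0 := by omega
        have := turn_new hS hi hs
        rw [← hv]
        intro s'
        rcases Side.eq_or s s' with rfl | rfl
        · simp
        · rw [turn_opp, turn_swap']; linarith
      · have := (h.line_side' h.chain'.τ_le).lt_of_ne (hS.gp.turn_ne s nS.symm
          (h.ne_vu hS hi hL h.chain'.τ_le) hST)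
        exact Stab.between (by simp) (by simp) (by simpa using this) hu.le ho.le
          (h.line.1 m hm) (h.line'.1 m hm)

/-- The same for the new visibility line from `u j`: it lies between the chain edges at `u j`, with
the old visibility lines in their place at the two ends `σ'` and `τ'`. -/
lemma stab_line_of_update {j : ℕ} (hσ : σ' ≤ j) (hτ : j ≤ τ')
    (hright : ∀ q, σ' ≤ q → q + 1 = j →
      turn s (P.vert (u q)) (P.vert (u j)) (P.vert (e s (i + 1))) ≤ 0)
    (hleft : j < L' → 0 ≤ turn s (P.vert (u j)) (P.vert (u (j + 1))) (P.vert (e s (i + 1))))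
    {m : ℕ} (hm : m ≤ i) : P.Stab e (u j) (e s (i + 1)) m := by
  have hL := h.chain'.τ_le
  have nvu : ∀ q ≤ L, ∀ q' ≤ L', v q ≠ u q' := fun q hq q' hq' => h.ne_vu hS hi hq hq'
  rcases hτ.lt_or_eq with hτ' | rfl
  · have s1 := fun m (hm : m ≤ i) => h.chain'.stab_all hσ hτ' hm
    have n1 := h.chain'.ne_succ hS hi.le (q := j) (by omega)
    rcases hσ.lt_or_eq with hσ' | rfl
    · obtain ⟨q, rfl⟩ : ∃ q, j = q + 1 := ⟨j - 1, by omega⟩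
      have hb := h.chain'.bend q (by omega)
      rw [turn_opp] at hb
      exact Stab.between (by simp) (by simp) (by simp; linarith) (hright q (by omega) rfl)
        (hleft (by omega)) (h.chain'.stab_all (by omega) (by omega) hm) (s1 m hm)
    · have := (h.line_side' (q := σ' + 1) (by omega)).lt_of_ne (hS.gp.turn_ne s
        (nvu _ h.chain.τ_le _ (by omega)).symm (nvu _ h.chain.τ_le _ (by omega)) n1)
      exact Stab.between (by simp) (by simp) (by simpa using this) hu.le (hleft (by omega))
        (h.line.1 m hm) (s1 m hm)
  · rcases hσ.lt_or_eq with hσ' | rfl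
    · obtain ⟨q, rfl⟩ : ∃ q, j = q + 1 := ⟨j - 1, by omega⟩
      have s1 := fun m (hm : m ≤ i) => h.chain'.stab_all (q := q) (by omega) (by omega) hm
      obtain ⟨m', hm', hv⟩ := h.side h.source_le
      have := (s1 m' hm').pos hS.gp s (h.chain'.ne_succ hS hi.le (q := q) (by omega))
        (hv ▸ nvu _ h.source_le _ (by omega)) (hv ▸ nvu _ h.source_le _ (by omega))
      rw [hv] at this
      exact Stab.between (by simp) (by simp) (by simpa using this) (hright q (by omega) rfl)
        ho.le (s1 m hm) (h.line'.1 m hm)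
    · have nS := nvu _ h.chain.τ_le _ hL
      by_cases hST : v σ = v τ
      · have h0 := hS.eq_zero_of_stab_both hi.le nS.symm h.line.1 (hST ▸ h.line'.1)
        subst h0
        obtain rfl : m = 0 := by omega
        obtain ⟨m', hm', hv⟩ := h.side' hL
        obtain rfl : m' = 0 := by omega
        have := turn_new hS hi hs
        rw [← hv]
        intro s'
        rcases Side.eq_or s s' with rfl | rfl
        · rw [turn_cyc] at this; exact this.le
        · simp
      · have := (h.line_side h.source_le).lt_of_ne (hS.gp.turn_ne s nS.symm
          (Ne.symm hST) (nvu _ h.source_le _ hL).symm).symm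
        exact Stab.between (by simp) (by simp) (by simpa using this) hu.le ho.le
          (h.line.1 m hm) (h.line'.1 m hm)

end Update

end Config

end SimplePolygon

/-! ### Preservation of the invariant. -/

namespace SimplePolygon

variable {n : ℕ} [NeZero n] {P : SimplePolygon n} {T : Finset (Finset (Fin n))} {k : ℕ}
  {t : ℕ → Finset (Fin n)} {e : Side → ℕ → Fin n}

lemma Line.succ {s : Side} {i : ℕ} {p q : Fin n} (h : Line P e s i p q)
    (h' : P.Stab e p q (i + 1)) : Line P e s (i + 1) p q := by
  obtain ⟨h1, m₁, m₂, h2, h3, h4, h5⟩ := h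
  refine ⟨fun m hm => ?_, m₁, m₂, h2, by omega, h4, h5⟩
  rcases hm.lt_or_eq with hm | rfl
  · exact h1 m (by omega)
  · exact h'

namespace Config

variable {s : Side} {i : ℕ} {v u : ℕ → Fin n} {L σ τ L' σ' τ' : ℕ}
  (h : Config P e s i v L σ τ u L' σ' τ')

include h in
lemma symm : Config P e s.opp i u L' σ' τ' v L σ τ where
  chain := h.chain'
  chain' := by rw [Side.opp_opp]; exact h.chain
  line := h.line'
  line' := by rw [Side.opp_opp]; exact h.line

variable (hS : P.IsSleeve T k t e) (hi : i < k) (hs : newSide e (i + 1) = s)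
include h hS hi hs

/-- Advancing the source weakens the requirements on earlier edges. Only the crossing of the new
diagonal by the edges from `j` on has to be added. -/
lemma chain_opp_succ {j : ℕ} (hσ : σ' ≤ j) (hτ : j ≤ τ')
    (hleft : j < L' → 0 < turn s (P.vert (u j)) (P.vert (u (j + 1))) (P.vert (e s (i + 1)))) :
    Chain P e s.opp (i + 1) u L' j τ' where
  σ_le := hτ
  τ_le := h.chain'.τ_le
  first := h.chain'.first
  last := by rw [same_opp hS hi hs]; exact h.chain'.last
  bend := h.chain'.bend
  edge q hq := by
    obtain ⟨f, g, g1, g2, g3, g4, g5, g6, g7⟩ := h.chain'.edge q hq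
    refine ⟨f, g, g1, by omega, g3, g4, g5, g6, fun m hm hf hg => ?_⟩
    rcases hm.lt_or_eq with hm | rfl
    · exact g7 m (by omega) (by omega) (by omega)
    · exact stab_succ hS hi hs (h.chain'.stab (by omega) hq)
        (h.left_of_next_opp_of_le hS hi hs hσ (by omega) hq (hleft (by omega))).le

variable (ho : 0 < turn s (P.vert (v σ)) (P.vert (u τ')) (P.vert (e s (i + 1))))
include ho

/-- The removals stop at position `r`, and the new vertex takes position `r + 1`. The parameter `ρ`
is the new target position: the old `τ` if the line is kept, and `r + 1` if the new vertex becomes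
the target. -/
lemma chain_append {w : ℕ → Fin n} {r ρ : ℕ} (hr : r ≤ L) (hσ : σ ≤ r) (hρ : σ ≤ ρ)
    (hρr : ρ ≤ r + 1)
    (hw : ∀ q ≤ r, w q = v q) (hw' : w (r + 1) = e s (i + 1))
    (hleft : ∀ q, q + 1 = r → 0 < turn s (P.vert (v q)) (P.vert (v r)) (P.vert (e s (i + 1))))
    (hright : r < L → turn s (P.vert (v r)) (P.vert (v (r + 1))) (P.vert (e s (i + 1))) < 0)
    (hρτ : ∀ q, q < r → q < ρ → q < τ) (hall : r < ρ → ∀ m ≤ i, P.Stab e (v r) (e s (i + 1)) m) :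
    Chain P e s (i + 1) w (r + 1) σ ρ where
  σ_le := hρ
  τ_le := hρr
  first := by rw [hw 0 (Nat.zero_le _)]; exact h.chain.first
  last := hw'
  bend q hq := by
    rcases (by omega : q + 2 ≤ r ∨ q + 1 = r) with hq | hq
    · rw [hw _ (by omega), hw _ (by omega), hw _ hq]; exact h.chain.bend q (by omega)
    · have := hleft q hq
      subst hq
      rw [hw _ (by omega), hw _ (by omega), hw']; exact this
  edge q hq := by
    rcases (by omega : q < r ∨ q = r) with hq | rfl
    · rw [hw _ hq.le, hw _ (by omega)]
      obtain ⟨f, g, g1, g2, g3, g4, g5, g6, g7⟩ := h.chain.edge q (by omega)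
      refine ⟨f, g, g1, by omega, g3, g4, g5, g6, fun m hm hf hg => ?_⟩
      rcases hm.lt_or_eq with hm | rfl
      · have := hρτ q hq
        exact g7 m (by omega) (by omega) hg
      · exact stab_succ hS hi hs (h.chain.stab (by omega) (by omega))
          (h.left_before hS hi hs ho hr (fun q hq => (hleft q hq).le) (by omega) hq)
    · rw [hw _ le_rfl, hw']
      obtain ⟨f, hf, h1, h2⟩ := h.exists_last_new hS hi hs hr
      refine ⟨f, i + 1, by omega, le_rfl, h1, h2, rfl, ?_, fun m hm hf' _ => ?_⟩
      · exact (new_ne hS hi hs (by omega) s).symm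
      · have st : ∀ {m}, f ≤ m → m ≤ i + 1 → P.Stab e (v q) (e s (i + 1)) m :=
          h.stab_new hS hi hs ho hσ hr h1 h2 hf hright
        rcases hf' with hf' | ⟨-, hf'⟩
        · exact st hf' hm
        · rcases hm.lt_or_eq with hm | rfl
          · exact hall hf' m (by omega)
          · exact st (by omega) le_rfl

/-- The removals stop at or after the target, so sources and targets of both lines keep their
positions. -/
theorem keep (hk : 0 < turn s (P.vert (u σ')) (P.vert (v τ)) (P.vert (e s (i + 1))))
    {w : ℕ → Fin n} {r : ℕ} (hr : r ≤ L) (hw : ∀ q ≤ r, w q = v q) (hw' : w (r + 1) = e s (i + 1))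
    (hleft : ∀ q, q + 1 = r → 0 < turn s (P.vert (v q)) (P.vert (v r)) (P.vert (e s (i + 1))))
    (hright : ∀ q, r ≤ q → q < L →
      turn s (P.vert (v q)) (P.vert (v (q + 1))) (P.vert (e s (i + 1))) < 0) :
    Config P e s (i + 1) w (r + 1) σ τ u L' σ' τ' := by
  have hσ := h.chain.σ_le
  have hτr : τ ≤ r := by
    by_contra hc
    exact h.not_right_of_keep hS hi hs ho hk (q := τ - 1) (by omega)
      fun q' h1 h2 => hright q' (by omega) h2
  have hτL := h.chain'.τ_le
  refine ⟨h.chain_append hS hi hs ho hr (by omega) hσ (by omega) hw hw' hleft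
    (fun h => hright r le_rfl h) (fun q _ h => h) (fun hc => by omega),
    h.chain_opp_succ hS hi hs le_rfl h.chain'.σ_le (fun hσ' =>
      h.left_at_source_opp hS hi hs hk hσ'), ?_, ?_⟩
  · rw [hw _ hτr]
    exact h.line.succ (stab_succ hS hi hs h.stab_line hk.le)
  · rw [hw _ (by omega)]
    exact h.line'.succ (stab_succ hS hi hs h.stab_line' ho.le)

/-- The removals stop between source and target, `σ ≤ r ≤ τ`, and the new source satisfies `σ' ≤ j ≤
τ'`. In these ranges the chain edges cross all diagonals, which is what the new edge and the new
line need. -/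
theorem update (hu : turn s (P.vert (u σ')) (P.vert (v τ)) (P.vert (e s (i + 1))) < 0)
    {w : ℕ → Fin n} {r : ℕ} (hr : r ≤ L) (hw : ∀ q ≤ r, w q = v q) (hw' : w (r + 1) = e s (i + 1))
    (hleft : ∀ q, q + 1 = r → 0 < turn s (P.vert (v q)) (P.vert (v r)) (P.vert (e s (i + 1))))
    (hright : ∀ q, r ≤ q → q < L →
      turn s (P.vert (v q)) (P.vert (v (q + 1))) (P.vert (e s (i + 1))) < 0)
    {j : ℕ} (hσj : σ' ≤ j) (hj : j ≤ L')
    (hjleft : j < L' → 0 < turn s (P.vert (u j)) (P.vert (u (j + 1))) (P.vert (e s (i + 1))))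
    (hjright : ∀ q, σ' ≤ q → q < j →
      turn s (P.vert (u q)) (P.vert (u (q + 1))) (P.vert (e s (i + 1))) < 0) :
    Config P e s (i + 1) w (r + 1) σ (r + 1) u L' j τ' := by
  have hσ := h.chain.σ_le
  have hσ' := h.chain'.σ_le
  have hrτ : r ≤ τ := by
    by_contra hc
    obtain ⟨q, rfl⟩ : ∃ q, r = q + 1 := ⟨r - 1, by omega⟩
    have h1 := hleft q rfl
    have h2 := h.right_of_update hS hi hs ho hu (q := q) (by omega) (by omega)
    linarith
  have hσr : σ ≤ r := by
    by_contra hc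
    have h1 := hright (σ - 1) (by omega) (by have := h.source_le; omega)
    have h2 := h.left_of_update hS hi ho hu (q := σ - 1) (by omega)
    rw [show σ - 1 + 1 = σ by omega] at h1; linarith
  have hjτ : j ≤ τ' := by
    by_contra hc
    have h1 := hjright τ' hσ' (by omega)
    have h2 := h.left_at_target_opp hS hi hs ho (by omega)
    linarith
  have st : ∀ m ≤ i, P.Stab e (v r) (e s (i + 1)) m := fun m hm =>
    h.stab_new_of_update hS hi hs ho hu hσr hrτ (fun hlt => hright r le_rfl
      (by have := h.chain.τ_le; omega)) (fun q hq => (hleft q hq).le) hm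
  have st' : ∀ m ≤ i, P.Stab e (u j) (e s (i + 1)) m := fun m hm =>
    h.stab_line_of_update hS hi hs ho hu hσj hjτ (fun q h1 h2 => by
      have := hjright q h1 (by omega); rw [h2] at this; exact this.le)
      (fun hlt => (hjleft hlt).le) hm
  refine ⟨h.chain_append hS hi hs ho hr hσr (by omega) (by omega) hw hw' hleft
    (fun h => hright r le_rfl h) (fun q h1 _ => by omega) (fun _ => st),
    h.chain_opp_succ hS hi hs hσj hjτ hjleft, ?_, ?_⟩
  · rw [hw']
    obtain ⟨m, hm, hmj⟩ := h.side' hj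
    refine ⟨fun m hm => ?_, m, i + 1, by omega, le_rfl, hmj, rfl⟩
    rcases hm.lt_or_eq with hm | rfl
    · exact st' m (by omega)
    · exact stab_succ hS hi hs (st' i le_rfl) (by simp)
  · rw [hw _ hσr]
    exact h.line'.succ (stab_succ hS hi hs h.stab_line' ho.le)

end Config

end SimplePolygon

/-! ### The machine -/

variable {n : ℕ} [NeZero n] {P : SimplePolygon n} {T : Finset (Finset (Fin n))} {k : ℕ}
  {t : ℕ → Finset (Fin n)} {e : Side → ℕ → Fin n}

lemma lastBend_append (P : SimplePolygon n) (d : Side) (l : List (Fin n)) (p q r : Fin n) :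
    LastBend P d (l ++ [p, q, r]) ↔ OnSide d (P.vert p) (P.vert q) (P.vert r) := by
  simp [LastBend]

omit [NeZero n] in
lemma removeSecondToLast_append (l : List (Fin n)) (q r : Fin n) :
    removeSecondToLast (l ++ [q, r]) = l ++ [r] := by
  simp [removeSecondToLast]

lemma take_succ_getD {c : List (Fin n)} {r : ℕ} (hr : r < c.length) :
    c.take (r + 1) = c.take r ++ [c.getD r 0] := by
  rw [List.take_add_one, List.getElem?_eq_getElem hr, List.getD_eq_getElem _ _ hr]; rfl

lemma getD_take_append {c : List (Fin n)} {r q : ℕ} (hr : r < c.length) (hq : q ≤ r) (a : Fin n) :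
    (c.take (r + 1) ++ [a]).getD q 0 = c.getD q 0 := by
  rw [List.getD_append _ _ _ _ (by simp; omega), List.getD_eq_getElem _ _ (by simp; omega),
    List.getElem_take, List.getD_eq_getElem _ _ (by omega)]

lemma getD_take_append_last {c : List (Fin n)} {r : ℕ} (hr : r < c.length) (a : Fin n) :
    (c.take (r + 1) ++ [a]).getD (r + 1) 0 = a := by
  rw [List.getD_append_right _ _ _ _ (by simp)]
  simp [Nat.min_eq_left (show r + 1 ≤ c.length by omega)]

/-- The state while the path `c` is extended by `a`. -/
def scanState (st : State n) (s : Side) (c : List (Fin n)) (a : Fin n) (r : ℕ) : State n :=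
  { st with phase := .scan s, path := Function.update st.path s (c.take (r + 1) ++ [a]) }

lemma lastBend_iff {c : List (Fin n)} {r : ℕ} (hr : r < c.length) (d : Side) (a : Fin n) :
    LastBend P d (c.take (r + 1) ++ [a]) ↔
      ∃ q, q + 1 = r ∧ OnSide d (P.vert (c.getD q 0)) (P.vert (c.getD r 0)) (P.vert a) := by
  cases r with
  | zero => rw [take_succ_getD hr]; simp [LastBend]
  | succ r =>
    rw [take_succ_getD hr, take_succ_getD (by omega), List.append_assoc, List.append_assoc]
    simp only [List.cons_append, List.nil_append, lastBend_append]
    simp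

section Step

variable (P : SimplePolygon n) (k : ℕ) (e : Side → ℕ → Fin n) {st : State n} {s : Side}

lemma step_loop (h : st.phase = .loop) (hk : st.i ≤ k) (hs : newSide e st.i = s)
    (hb : ¬ st.OnSideOfLine P s.opp s.opp (e s st.i)) :
    st.step P k e = { st with
      phase := .scan s
      path := Function.update st.path s (st.path s ++ [e s st.i]) } := by
  subst hs
  simp only [State.step, h]
  rw [if_neg (not_lt.2 hk), if_neg hb]

lemma step_loop_window (h : st.phase = .loop) (hk : st.i ≤ k) (hs : newSide e st.i = s)
    (hb : st.OnSideOfLine P s.opp s.opp (e s st.i)) :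
    st.step P k e = { st with
      phase := .window s
        (firstHit P.curve (P.vert (st.source s.opp)) (P.vert (st.tgt s.opp))) } := by
  subst hs
  simp only [State.step, h]
  rw [if_neg (not_lt.2 hk), if_pos hb]

lemma step_loop_finished (h : st.phase = .loop) (hk : k < st.i) :
    st.step P k e = { st with phase := .finished } := by
  simp only [State.step, h]
  rw [if_pos hk]

lemma step_scan (h : st.phase = .scan s) (hb : LastBend P s.opp (st.path s)) :
    st.step P k e =
      { st with path := Function.update st.path s (removeSecondToLast (st.path s)) } := by
  simp only [State.step, h]
  rw [if_pos hb]

lemma step_scan_neg (h : st.phase = .scan s) (hb : ¬ LastBend P s.opp (st.path s)) :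
    st.step P k e = { st with phase := .cone s } := by
  simp only [State.step, h]
  rw [if_neg hb]

lemma step_cone (h : st.phase = .cone s) (hb : st.OnSideOfLine P s.opp s (e s st.i)) :
    st.step P k e =
      { st with phase := .tangent s, tgt := Function.update st.tgt s (e s st.i) } := by
  simp only [State.step, h]
  rw [if_pos hb]

lemma step_cone_neg (h : st.phase = .cone s) (hb : ¬ st.OnSideOfLine P s.opp s (e s st.i)) :
    st.step P k e = { st with phase := .loop, i := st.i + 1 } := by
  simp only [State.step, h]
  rw [if_neg hb]

lemma step_tangent (h : st.phase = .tangent s)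
    (hb : ¬ st.IsTangent P s ∧ st.src s + 1 < (st.path s.opp).length) :
    st.step P k e = { st with src := Function.update st.src s (st.src s + 1) } := by
  simp only [State.step, h]
  rw [if_pos hb]

lemma step_tangent_neg (h : st.phase = .tangent s)
    (hb : ¬ (¬ st.IsTangent P s ∧ st.src s + 1 < (st.path s.opp).length)) :
    st.step P k e = { st with phase := .loop, i := st.i + 1 } := by
  simp only [State.step, h]
  rw [if_neg hb]

end Step

/-- The count is `r - r'` removals and one failing test. -/
lemma exists_iterate_scan (P : SimplePolygon n) (k : ℕ) (e : Side → ℕ → Fin n) (st : State n)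
    (s : Side) (c : List (Fin n)) (a : Fin n) : ∀ r < c.length, ∃ r' ≤ r,
      (State.step P k e)^[r - r' + 1] (scanState st s c a r) =
        { scanState st s c a r' with phase := .cone s } ∧
      (∀ q, r' ≤ q → q < r →
        OnSide s.opp (P.vert (c.getD q 0)) (P.vert (c.getD (q + 1) 0)) (P.vert a)) ∧
      ∀ q, q + 1 = r' →
        ¬ OnSide s.opp (P.vert (c.getD q 0)) (P.vert (c.getD r' 0)) (P.vert a) := by
  have halt : ∀ r < c.length, (∀ q, q + 1 = r →
        ¬ OnSide s.opp (P.vert (c.getD q 0)) (P.vert (c.getD r 0)) (P.vert a)) →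
      State.step P k e (scanState st s c a r) =
        { scanState st s c a r with phase := .cone s } := by
    intro r hr hlast
    refine step_scan_neg P k e rfl ?_
    simp only [scanState, Function.update_self]
    rw [lastBend_iff hr]; rintro ⟨q, h1, h2⟩; exact hlast q h1 h2
  intro r
  induction r with
  | zero =>
    intro hr
    exact ⟨0, le_rfl, halt 0 hr (by omega), by omega, by omega⟩
  | succ r ih =>
    intro hr
    by_cases hp : OnSide s.opp (P.vert (c.getD r 0)) (P.vert (c.getD (r + 1) 0)) (P.vert a)
    · obtain ⟨r', h1, h2, h3, h4⟩ := ih (by omega)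
      refine ⟨r', by omega, ?_, fun q hq hq' => ?_, h4⟩
      · rw [show r + 1 - r' + 1 = (r - r' + 1) + 1 by omega, Function.iterate_succ_apply, ← h2]
        congr 1
        have hb' : LastBend P s.opp (c.take (r + 1 + 1) ++ [a]) :=
          (lastBend_iff hr _ _).2 ⟨r, rfl, hp⟩
        have hrem : removeSecondToLast (c.take (r + 1 + 1) ++ [a]) = c.take (r + 1) ++ [a] := by
          rw [take_succ_getD hr, List.append_assoc]
          exact removeSecondToLast_append _ _ _
        have hb : LastBend P s.opp ((scanState st s c a (r + 1)).path s) := by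
          simpa only [scanState, Function.update_self] using hb'
        rw [step_scan P k e rfl hb]
        simp only [scanState, Function.update_self, Function.update_idem, hrem]
      · rcases (by omega : q < r ∨ q = r) with hq' | rfl
        · exact h3 q hq hq'
        · exact hp
    · refine ⟨r + 1, le_rfl, ?_, by omega, ?_⟩
      · rw [Nat.sub_self]
        exact halt _ hr (fun q hq => by obtain rfl : q = r := by omega
                                        exact hp)
      · intro q hq
        obtain rfl : q = r := by omega
        exact hp

/-- The state while the source of the visibility line is at position `j`. -/
def tangentState (st : State n) (s : Side) (j : ℕ) : State n :=
  { st with phase := .tangent s, src := Function.update st.src s j }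

/-- Only the successor of the source matters. That the predecessor does not violate tangency is
assumed at the start, and after an advance it follows from the test that caused the advance, as the
predecessor is then the old source. -/
lemma exists_iterate_tangent (P : SimplePolygon n) (k : ℕ) (e : Side → ℕ → Fin n) (st : State n)
    (s : Side) {L' : ℕ} (hlen : (st.path s.opp).length = L' + 1) (d : ℕ) : ∀ j, j + d = L' →
      (∀ q, q + 1 = j → ¬ OnSide s (P.vert ((st.path s.opp).getD j 0)) (P.vert (st.tgt s))
        (P.vert ((st.path s.opp).getD q 0))) → ∃ j', j ≤ j' ∧ j' ≤ L' ∧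
      (State.step P k e)^[j' - j + 1] (tangentState st s j) =
        { st with phase := .loop, i := st.i + 1, src := Function.update st.src s j' } ∧
      (∀ q, j ≤ q → q < j' → OnSide s (P.vert ((st.path s.opp).getD q 0)) (P.vert (st.tgt s))
        (P.vert ((st.path s.opp).getD (q + 1) 0))) ∧
      (j' < L' → ¬ OnSide s (P.vert ((st.path s.opp).getD j' 0)) (P.vert (st.tgt s))
        (P.vert ((st.path s.opp).getD (j' + 1) 0))) := by
  have halt : ∀ j, (j < L' → (tangentState st s j).IsTangent P s) →
      State.step P k e (tangentState st s j) =
        { st with phase := .loop, i := st.i + 1, src := Function.update st.src s j } := by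
    intro j hj
    rw [step_tangent_neg P k e (s := s) rfl]
    · rfl
    · rintro ⟨h1, h2⟩
      simp only [tangentState, Function.update_self] at h2
      exact h1 (hj (by omega))
  induction d with
  | zero =>
    intro j hj _
    refine ⟨j, le_rfl, by omega, ?_, by omega, by omega⟩
    rw [Nat.sub_self]
    exact halt j (by omega)
  | succ d ih =>
    intro j hj hprev
    have hget : (st.path s.opp)[j + 1]? = some ((st.path s.opp).getD (j + 1) 0) := by
      rw [List.getD_eq_getElem _ _ (by omega), List.getElem?_eq_getElem]
    by_cases hp : OnSide s (P.vert ((st.path s.opp).getD j 0)) (P.vert (st.tgt s))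
        (P.vert ((st.path s.opp).getD (j + 1) 0))
    · obtain ⟨j', h1, h2, h3, h4, h5⟩ := ih (j + 1) (by omega) (by
        intro q hq
        obtain rfl : q = j := by omega
        rw [onSide_iff] at hp ⊢
        rw [turn_cyc, turn_cyc, turn_swap', turn_cyc] at hp
        rw [turn_cyc]; linarith)
      refine ⟨j', by omega, h2, ?_, fun q hq hq' => ?_, h5⟩
      · rw [show j' - j + 1 = (j' - (j + 1) + 1) + 1 by omega, Function.iterate_succ_apply, ← h3,
          step_tangent P k e (s := s) rfl]
        · simp only [tangentState, Function.update_self, Function.update_idem]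
        refine ⟨fun ht => ?_, by simp only [tangentState, Function.update_self]; omega⟩
        refine ht.1 ((st.path s.opp).getD (j + 1) 0) ?_ ?_
        · simpa [tangentState] using hget
        · simpa [State.OnSideOfLine, State.source, tangentState] using hp
      · rcases hq.lt_or_eq with hq | rfl
        · exact h4 q (by omega) hq'
        · exact hp
    · refine ⟨j, le_rfl, by omega, ?_, by omega, fun _ => hp⟩
      rw [Nat.sub_self]
      refine halt j fun _ => ⟨fun q hq => ?_, fun l q hl hq => ?_⟩
      · simp only [tangentState, Function.update_self, hget, Option.some.injEq] at hq
        subst hq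
        simpa [State.OnSideOfLine, State.source, tangentState] using hp
      · simp only [tangentState, Function.update_self] at hl hq
        have := hprev l hl
        rw [List.getD_eq_getElem?_getD (i := l), hq] at this
        simpa [State.OnSideOfLine, State.source, tangentState] using this

/-! ### The loop invariant and the amortized number of steps. -/

/-- The invariant of the main loop. -/
structure State.Inv (P : SimplePolygon n) (e : Side → ℕ → Fin n) (i : ℕ) (st : State n)
    (L τ : Side → ℕ) : Prop where
  phase : st.phase = .loop
  idx : st.i = i + 1
  len : ∀ s, (st.path s).length = L s + 1
  tgt : ∀ s, st.tgt s = (st.path s).getD (τ s) 0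
  config : ∀ s, P.Config e s i (fun q => (st.path s).getD q 0) (L s) (st.src s.opp) (τ s)
    (fun q => (st.path s.opp).getD q 0) (L s.opp) (st.src s) (τ s.opp)

lemma inv_init (P : SimplePolygon n) (e : Side → ℕ → Fin n) :
    State.Inv P e 0 (State.init e) (fun _ => 0) (fun _ => 0) where
  phase := rfl
  idx := rfl
  len _ := rfl
  tgt _ := rfl
  config s := by
    have chain : ∀ s, SimplePolygon.Chain P e s 0 (fun q => [e s 0].getD q 0) 0 0 0 := fun s =>
      ⟨le_rfl, le_rfl, rfl, rfl, by omega, by omega⟩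
    have line : ∀ s, SimplePolygon.Line P e s 0 (e s.opp 0) (e s 0) := fun s => by
      refine ⟨fun m hm s' => ?_, 0, 0, le_rfl, le_rfl, rfl, rfl⟩
      obtain rfl : m = 0 := by omega
      rcases Side.eq_or s s' with rfl | rfl <;> simp
    refine ⟨chain s, chain s.opp, line s, ?_⟩
    have := line s.opp
    rwa [Side.opp_opp] at this

omit [NeZero n] in
lemma sum_side (F : Side → ℕ) (s : Side) : F .left + F .right = F s + F s.opp := by
  cases s
  · rfl
  · exact add_comm _ _

/-- The line test of the main loop. -/
def State.Blocked (P : SimplePolygon n) (e : Side → ℕ → Fin n) (st : State n) (i : ℕ) : Prop :=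
  st.OnSideOfLine P (newSide e (i + 1)).opp (newSide e (i + 1)).opp (e (newSide e (i + 1)) (i + 1))

lemma State.Inv.of_side {i : ℕ} {st : State n} {L τ : Side → ℕ} (s : Side)
    (phase : st.phase = .loop) (idx : st.i = i + 1)
    (len : ∀ s, (st.path s).length = L s + 1) (tgt : ∀ s, st.tgt s = (st.path s).getD (τ s) 0)
    (config : P.Config e s i (fun q => (st.path s).getD q 0) (L s) (st.src s.opp) (τ s)
      (fun q => (st.path s.opp).getD q 0) (L s.opp) (st.src s) (τ s.opp)) :
    st.Inv P e i L τ where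
  phase := phase
  idx := idx
  len := len
  tgt := tgt
  config s' := by
    rcases Side.eq_or s s' with rfl | rfl
    · exact config
    · have := config.symm
      rwa [Side.opp_opp]

lemma forall_side {Q : Side → Prop} (s : Side) (h : Q s) (h' : Q s.opp) (s' : Side) : Q s' := by
  rcases Side.eq_or s s' with rfl | rfl <;> assumption

/-- The potential is the sum of the chain lengths minus the source positions. The iteration takes at
most four steps besides removals and advances, and appending one vertex raises the potential by one,
hence the constant `5`. -/
theorem State.Inv.next (hS : P.IsSleeve T k t e) {i : ℕ} (hi : i < k) {st : State n}
    {L τ : Side → ℕ} (h : st.Inv P e i L τ) (hb : ¬ st.Blocked P e i) :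
    ∃ m L' τ', ((State.step P k e)^[m] st).Inv P e (i + 1) L' τ' ∧
      m + (L' .left + L' .right) + (st.src .left + st.src .right) ≤ 5 + (L .left + L .right) +
        (((State.step P k e)^[m] st).src .left + ((State.step P k e)^[m] st).src .right) := by
  obtain ⟨s, hs⟩ : ∃ s, newSide e (i + 1) = s := ⟨_, rfl⟩
  have hc := h.config s
  simp only [State.Blocked, hs] at hb
  have hone : s.opp ≠ s := (Side.ne_opp s).symm
  set a := e s (i + 1) with ha
  set c := st.path s with hcdef
  have hlen : c.length = L s + 1 := h.len s
  have hlen' := h.len s.opp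
  have hsrc : st.source s.opp = c.getD (st.src s.opp) 0 := by rw [State.source, Side.opp_opp]
  -- The failed test gives a weak inequality; general position makes it strict.
  have ho : 0 < turn s (P.vert (c.getD (st.src s.opp) 0))
      (P.vert ((st.path s.opp).getD (τ s.opp) 0)) (P.vert a) := by
    rw [State.OnSideOfLine, onSide_iff, turn_opp, hsrc, h.tgt] at hb
    exact (by linarith : (0 : ℝ) ≤ _).lt_of_ne (hS.gp.turn_ne s
      (hc.ne_vu hS hi hc.source_le hc.chain'.τ_le)
      (hc.u_ne_new hS hi hs hc.chain'.τ_le).symm (hc.v_ne_new hS hi hs hc.source_le).symm).symm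
  -- the first step and the pops
  have st1 : State.step P k e st = scanState st s c a (L s) := by
    rw [step_loop P k e h.phase (by rw [h.idx]; omega) (s := s) (by rw [h.idx, hs])
      (by rw [h.idx]; exact hb), scanState, List.take_of_length_le (by omega), h.idx]
  obtain ⟨r, hr, st2, hright, hleft⟩ := exists_iterate_scan P k e st s c a (L s) (by omega)
  have hright' : ∀ q, r ≤ q → q < L s →
      turn s (P.vert (c.getD q 0)) (P.vert (c.getD (q + 1) 0)) (P.vert a) < 0 := fun q hq hq' => by
    have := hright q hq hq'
    rw [onSide_iff, turn_opp] at this; linarith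
  have hleft' : ∀ q, q + 1 = r →
      0 < turn s (P.vert (c.getD q 0)) (P.vert (c.getD r 0)) (P.vert a) := fun q hq => by
    have h1 := hleft q hq
    rw [onSide_iff, turn_opp] at h1
    subst hq
    exact (by linarith : (0 : ℝ) ≤ _).lt_of_ne (hS.gp.turn_ne s
      (hc.chain.ne_succ hS hi.le (q := q) (by omega))
      (hc.v_ne_new hS hi hs (by omega)).symm (hc.v_ne_new hS hi hs (by omega)).symm).symm
  have hwr : ∀ q ≤ r, (c.take (r + 1) ++ [a]).getD q 0 = c.getD q 0 := fun q hq =>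
    getD_take_append (by omega) hq a
  have hwr' := getD_take_append_last (c := c) (r := r) (by omega) a
  have hwlen : (c.take (r + 1) ++ [a]).length = r + 1 + 1 := by simp; omega
  set stc : State n := { scanState st s c a r with phase := .cone s } with hstc
  have hsrcS : stc.source s = (st.path s.opp).getD (st.src s) 0 := by
    simp [stc, scanState, State.source, Function.update_of_ne hone]
  have hcone : stc.OnSideOfLine P s.opp s (e s stc.i) ↔
      turn s (P.vert ((st.path s.opp).getD (st.src s) 0)) (P.vert (c.getD (τ s) 0))
        (P.vert a) < 0 := by
    have h1 : stc.tgt s = c.getD (τ s) 0 := h.tgt s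
    have h2 : stc.i = i + 1 := h.idx
    rw [State.OnSideOfLine, onSide_iff, turn_opp, hsrcS, h1, h2]
    constructor <;> intro h <;> linarith
  have hpre : (State.step P k e)^[(L s - r + 1) + 1] st = stc := by
    rw [Function.iterate_succ_apply, st1, st2]
  by_cases hu : turn s (P.vert ((st.path s.opp).getD (st.src s) 0)) (P.vert (c.getD (τ s) 0))
        (P.vert a) < 0
  · -- the line of side `s` moves
    set stt : State n := { stc with phase := .tangent s, tgt := Function.update stc.tgt s a }
      with hstt
    have st3 : State.step P k e stc = tangentState stt s (st.src s) := by
      have h2 : e s stc.i = a := by rw [ha, ← h.idx]; rfl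
      rw [step_cone P k e rfl (hcone.2 hu), h2, tangentState]
      congr
      exact (Function.update_eq_self s st.src).symm
    have hpo : stt.path s.opp = st.path s.opp := by
      simp [stt, stc, scanState, Function.update_of_ne hone]
    have htg : stt.tgt s = a := by simp [stt]
    obtain ⟨j, hj1, hj2, st4, hj3, hj4⟩ := exists_iterate_tangent P k e stt s
      (L' := L s.opp) (by rw [hpo]; exact hlen') (L s.opp - st.src s) (st.src s)
      (by have := hc.source_le'; omega) (by
        intro q hq
        rw [onSide_iff, hpo, htg, not_lt]
        exact hc.previous_of_update hS hi ho hu hq)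
    rw [hpo, htg] at hj3 hj4
    have hjr : ∀ q, st.src s ≤ q → q < j → turn s (P.vert ((st.path s.opp).getD q 0))
        (P.vert ((st.path s.opp).getD (q + 1) 0)) (P.vert a) < 0 := fun q h1 h2 => by
      have := hj3 q h1 h2
      rw [onSide_iff, turn_swap'] at this; linarith
    have hjl : j < L s.opp → 0 < turn s (P.vert ((st.path s.opp).getD j 0))
        (P.vert ((st.path s.opp).getD (j + 1) 0)) (P.vert a) := fun h1 => by
      have h2 := hj4 h1
      rw [onSide_iff, turn_swap'] at h2
      exact (by linarith : (0 : ℝ) ≤ _).lt_of_ne (hS.gp.turn_ne s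
        (hc.chain'.ne_succ hS hi.le h1) (hc.u_ne_new hS hi hs h1).symm
        (hc.u_ne_new hS hi hs h1.le).symm).symm
    have hfin : (State.step P k e)^[(j - st.src s + 1) + (1 + ((L s - r + 1) + 1))] st =
        { stt with phase := .loop, i := stt.i + 1, src := Function.update stt.src s j } := by
      rw [Function.iterate_add_apply, Function.iterate_add_apply _ 1, hpre, Function.iterate_one,
        st3, st4]
    refine ⟨(j - st.src s + 1) + (1 + ((L s - r + 1) + 1)), Function.update L s (r + 1),
      Function.update τ s (r + 1), ?_, ?_⟩
    · rw [hfin]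
      have hcf := hc.update hS hi hs ho hu (w := fun q => (c.take (r + 1) ++ [a]).getD q 0) hr hwr
        hwr' hleft' hright' hj1 hj2 hjl hjr
      refine State.Inv.of_side s rfl (by simp [stt, stc, scanState, h.idx])
        (forall_side s ?_ ?_) (forall_side s ?_ ?_) ?_
      · simpa [stt, stc, scanState] using hwlen
      · simpa [stt, stc, scanState, Function.update_of_ne hone] using hlen'
      · simp only [stt, stc, scanState, Function.update_self]; exact hwr'.symm
      · simp only [stt, stc, scanState, Function.update_of_ne hone]; exact h.tgt s.opp
      · simpa only [stt, stc, scanState, Function.update_self, Function.update_of_ne hone] using hcf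
    · rw [hfin, sum_side (Function.update L s (r + 1)) s, sum_side st.src s, sum_side L s,
        sum_side _ s]
      simp only [stt, stc, scanState, Function.update_self, Function.update_of_ne hone]
      omega
  · have hk : 0 < turn s (P.vert ((st.path s.opp).getD (st.src s) 0)) (P.vert (c.getD (τ s) 0))
        (P.vert a) :=
      (not_lt.1 hu).lt_of_ne (hS.gp.turn_ne s
        (hc.ne_vu hS hi hc.chain.τ_le hc.source_le').symm
        (hc.v_ne_new hS hi hs hc.chain.τ_le).symm (hc.u_ne_new hS hi hs hc.source_le').symm).symm
    have st3 : State.step P k e stc = { stc with phase := .loop, i := stc.i + 1 } :=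
      step_cone_neg P k e rfl fun h => hu (hcone.1 h)
    have hfin : (State.step P k e)^[1 + ((L s - r + 1) + 1)] st =
        { stc with phase := .loop, i := stc.i + 1 } := by
      rw [Function.iterate_add_apply, hpre, Function.iterate_one, st3]
    refine ⟨1 + ((L s - r + 1) + 1), Function.update L s (r + 1), τ, ?_, ?_⟩
    · rw [hfin]
      have hcf := hc.keep hS hi hs ho hk (w := fun q => (c.take (r + 1) ++ [a]).getD q 0) hr hwr
        hwr' hleft' hright'
      have hτr : τ s ≤ r := by
        by_contra hcon
        exact hc.not_right_of_keep hS hi hs ho hk (q := τ s - 1) (by omega)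
          fun q' h1 h2 => hright' q' (by omega) h2
      refine State.Inv.of_side s rfl (by simp [stc, scanState, h.idx])
        (forall_side s ?_ ?_) (forall_side s ?_ ?_) ?_
      · simpa [stc, scanState] using hwlen
      · simpa [stc, scanState, Function.update_of_ne hone] using hlen'
      · simp only [stc, scanState, Function.update_self]
        rw [hwr _ hτr]; exact h.tgt s
      · simp only [stc, scanState, Function.update_of_ne hone]; exact h.tgt s.opp
      · simpa only [stc, scanState, Function.update_self, Function.update_of_ne hone] using hcf
    · rw [hfin, sum_side (Function.update L s (r + 1)) s, sum_side st.src s, sum_side L s,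
        sum_side _ s]
      simp only [stc, scanState, Function.update_self, Function.update_of_ne hone]
      omega

/-- The machine reaches the next iterations until it finds a window. -/
theorem exists_run_inv (hS : P.IsSleeve T k t e) {i : ℕ} (hi : i ≤ k)
    (hb : ∀ j < i, ∀ M L τ, (run P k e M).Inv P e j L τ → ¬ (run P k e M).Blocked P e j) :
    ∃ M L τ, M ≤ 5 * i ∧ (run P k e M).Inv P e i L τ := by
  -- The potential starts at zero and stays nonnegative, because each source position is at most the
  -- length of the chain it refers to.
  suffices ∃ M L τ, M + (L Side.left + L .right) ≤
      5 * i + ((run P k e M).src .left + (run P k e M).src .right) ∧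
      (run P k e M).Inv P e i L τ by
    obtain ⟨M, L, τ, h1, h2⟩ := this
    have := (h2.config .left).source_le
    have := (h2.config .right).source_le
    refine ⟨M, L, τ, ?_, h2⟩
    simp only [Side.opp] at *
    omega
  induction i with
  | zero => exact ⟨0, _, _, by simp [run], inv_init P e⟩
  | succ i ih =>
    obtain ⟨M, L, τ, h1, h2⟩ := ih (by omega) fun j hj => hb j (by omega)
    obtain ⟨m, L', τ', h3, h4⟩ := h2.next hS hi (hb i (by omega) M L τ h2)
    have hrun : run P k e (m + M) = (State.step P k e)^[m] (run P k e M) :=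
      Function.iterate_add_apply _ _ _ _
    refine ⟨m + M, L', τ', ?_, hrun ▸ h3⟩
    rw [hrun]; omega

/-! ### Shortest paths in a sleeve -/

lemma inner_eq (x y : Pt) : inner ℝ x y = x 0 * y 0 + x 1 * y 1 := by
  simp [PiLp.inner_apply, Fin.sum_univ_two]; ring

lemma norm_sq_eq (x : Pt) : ‖x‖ ^ 2 = x 0 ^ 2 + x 1 ^ 2 := by
  rw [← real_inner_self_eq_norm_sq, inner_eq]; ring

lemma pathLength_cons_cons (p q : Pt) (c : List Pt) :
    pathLength (p :: q :: c) = dist p q + pathLength (q :: c) := by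
  simp [pathLength]

lemma pathLength_singleton (p : Pt) : pathLength [p] = 0 := by simp [pathLength]

lemma pathLength_append (c : List Pt) (p q : Pt) (h : c.getLast? = some p) :
    pathLength (c ++ [q]) = pathLength c + dist p q := by
  induction c with
  | nil => simp at h
  | cons x c ih =>
    cases c with
    | nil =>
      obtain rfl : x = p := by simpa using h
      simp [pathLength]
    | cons y c =>
      have := ih (by simpa using h)
      simp only [List.cons_append] at this ⊢
      rw [pathLength_cons_cons, pathLength_cons_cons, this]; ring

lemma pathLength_nonneg (c : List Pt) : 0 ≤ pathLength c := by
  induction c with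
  | nil => simp [pathLength]
  | cons x c ih =>
    cases c with
    | nil => simp [pathLength]
    | cons y c => rw [pathLength_cons_cons]; positivity

lemma IsPathIn.singleton {S : Set Pt} {p : Pt} (h : p ∈ S) : IsPathIn S p p [p] := by
  refine ⟨rfl, rfl, ?_, by simp⟩
  simpa using h

lemma IsPathIn.append {S : Set Pt} {p q r : Pt} {c : List Pt} (h : IsPathIn S p q c)
    (hqr : segment ℝ q r ⊆ S) : IsPathIn S p r (c ++ [r]) := by
  obtain ⟨h1, h2, h3, h4⟩ := h
  refine ⟨?_, by simp, ?_, ?_⟩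
  · rw [List.head?_append, h1]; rfl
  · intro x hx
    rw [List.mem_append, List.mem_singleton] at hx
    rcases hx with hx | rfl
    · exact h3 x hx
    · exact hqr (right_mem_segment ..)
  · rw [List.isChain_append]
    refine ⟨h4, by simp, ?_⟩
    intro x hx y hy
    rw [h2, Option.mem_def, Option.some_inj] at hx
    simp only [List.head?_cons, Option.mem_def, Option.some_inj] at hy
    subst hx hy
    exact hqr

lemma IsPathIn.mono {S S' : Set Pt} (hS : S ⊆ S') {p q : Pt} {c : List Pt} (h : IsPathIn S p q c) :
    IsPathIn S' p q c :=
  ⟨h.1, h.2.1, fun x hx => hS (h.2.2.1 x hx), h.2.2.2.imp fun _ _ h => h.trans hS⟩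

lemma IsPathIn.cons {S : Set Pt} {p q r : Pt} {c : List Pt} (h : IsPathIn S q r c)
    (hpq : segment ℝ p q ⊆ S) : IsPathIn S p r (p :: c) := by
  obtain ⟨h1, h2, h3, h4⟩ := h
  cases c with
  | nil => simp at h1
  | cons y c =>
    obtain rfl : y = q := by simpa using h1
    refine ⟨rfl, by simpa using h2, ?_, ?_⟩
    · intro x hx
      rcases List.mem_cons.1 hx with rfl | hx
      · exact hpq (left_mem_segment ..)
      · exact h3 x hx
    · exact List.isChain_cons_cons.2 ⟨hpq, h4⟩

lemma IsPathIn.tail {S : Set Pt} {p q r x : Pt} {c : List Pt} (h : IsPathIn S p r (x :: q :: c)) :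
    x = p ∧ segment ℝ p q ⊆ S ∧ IsPathIn S q r (q :: c) := by
  obtain ⟨h1, h2, h3, h4⟩ := h
  obtain rfl : x = p := by simpa using h1
  obtain ⟨h5, h6⟩ := List.isChain_cons_cons.1 h4
  exact ⟨rfl, h5, rfl, by simpa using h2, fun y hy => h3 y (List.mem_cons_of_mem _ hy), h6⟩

lemma IsPathIn.dist_le {S : Set Pt} {p q : Pt} {c : List Pt} (h : IsPathIn S p q c) :
    dist p q ≤ pathLength c := by
  induction c generalizing p with
  | nil => simp [IsPathIn] at h
  | cons x c ih =>
    cases c with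
    | nil =>
      obtain ⟨h1, h2, -⟩ := h
      obtain rfl : x = p := by simpa using h1
      obtain rfl : x = q := by simpa using h2
      simp [pathLength]
    | cons y c =>
      obtain ⟨rfl, -, h3⟩ := h.tail
      rw [pathLength_cons_cons]
      exact (dist_triangle _ y _).trans (by linarith [ih h3])

/-- The part of a path up to its first point in `B`. -/
lemma IsPathIn.exists_prefix {A B : Set Pt} (hA : IsClosed A) (hB : IsClosed B) {p q : Pt}
    {c : List Pt} (h : IsPathIn (A ∪ B) p q c) (hp : p ∈ A) (hq : q ∈ B) :
    ∃ x ∈ A ∩ B, ∃ c', IsPathIn A p x c' ∧ pathLength c' + dist x q ≤ pathLength c := by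
  induction c generalizing p with
  | nil => simp [IsPathIn] at h
  | cons y c ih =>
    cases c with
    | nil =>
      obtain ⟨h1, h2, -⟩ := h
      obtain rfl : y = p := by simpa using h1
      obtain rfl : y = q := by simpa using h2
      exact ⟨y, ⟨hp, hq⟩, [y], IsPathIn.singleton hp, by simp⟩
    | cons z c =>
      obtain ⟨rfl, h2, h3⟩ := h.tail
      rw [pathLength_cons_cons]
      -- The parameters at which the first segment is in `B`. If there are none, the segment stays
      -- in `A` and induction applies; otherwise the least one gives the point sought.
      set K : Set ℝ := Icc 0 1 ∩ (fun κ : ℝ => y + κ • (z - y)) ⁻¹' B with hK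
      have hcont : Continuous fun κ : ℝ => y + κ • (z - y) := by fun_prop
      have hKc : IsCompact K := isCompact_Icc.inter_right (hB.preimage hcont)
      rcases K.eq_empty_or_nonempty with hKe | hKn
      · have hsub : segment ℝ y z ⊆ A := by
          intro a ha
          rcases h2 ha with h | h
          · exact h
          · rw [segment_eq_image'] at ha
            obtain ⟨κ, hκ, rfl⟩ := ha
            exact absurd (show κ ∈ K from ⟨hκ, h⟩) (hKe ▸ notMem_empty _)
        obtain ⟨x, hx, c', hc', hle⟩ := ih h3 (hsub (right_mem_segment ..))
        refine ⟨x, hx, y :: c', hc'.cons hsub, ?_⟩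
        obtain ⟨w, c'', rfl⟩ : ∃ w c'', c' = w :: c'' := by
          cases c' with
          | nil => simp [IsPathIn] at hc'
          | cons w c'' => exact ⟨w, c'', rfl⟩
        obtain rfl : w = z := by simpa using hc'.1
        rw [pathLength_cons_cons]; linarith
      · obtain ⟨κ, ⟨⟨h0, h1⟩, hκB⟩, hmin⟩ := hKc.exists_isLeast hKn
        have hlt : ∀ μ, 0 ≤ μ → μ < κ → y + μ • (z - y) ∈ A := by
          intro μ hμ hμκ
          have hs : y + μ • (z - y) ∈ segment ℝ y z := by
            rw [segment_eq_image']; exact ⟨μ, ⟨hμ, by linarith⟩, rfl⟩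
          rcases h2 hs with h | h
          · exact h
          · exact absurd (hmin ⟨⟨hμ, by linarith⟩, h⟩) (not_le.2 hμκ)
        have hκA : y + κ • (z - y) ∈ A := by
          rcases h0.eq_or_lt with rfl | h0
          · simpa using hp
          · have : Tendsto (fun μ : ℝ => y + μ • (z - y)) (𝓝[<] κ) (𝓝 (y + κ • (z - y))) :=
              (hcont.tendsto κ).mono_left nhdsWithin_le_nhds
            refine hA.mem_of_tendsto this ?_
            filter_upwards [Ioo_mem_nhdsLT h0] with μ hμ using hlt μ hμ.1.le hμ.2
        set x := y + κ • (z - y) with hx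
        have hseg : segment ℝ y x ⊆ A := by
          intro a ha
          rw [segment_eq_image'] at ha
          obtain ⟨μ, ⟨hμ0, hμ1⟩, rfl⟩ := ha
          have : y + μ • (x - y) = y + (μ * κ) • (z - y) := by rw [hx]; module
          simp only [this]
          rcases (mul_le_of_le_one_left h0 hμ1).lt_or_eq with hlt' | heq
          · exact hlt _ (by positivity) hlt'
          · rw [heq]; exact hκA
        refine ⟨x, ⟨hκA, hκB⟩, [y, x], (IsPathIn.singleton hκA).cons hseg, ?_⟩
        rw [pathLength_cons_cons, pathLength_singleton]
        have e1 : dist y x = κ * dist y z := by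
          rw [hx, dist_eq_norm, dist_eq_norm, ← norm_neg, show -(y - (y + κ • (z - y))) = κ • (z - y) by module,
            norm_smul, Real.norm_of_nonneg h0, ← norm_neg (y - z), neg_sub]
        have e2 : dist x z = (1 - κ) * dist y z := by
          rw [hx, dist_eq_norm, dist_eq_norm, show y + κ • (z - y) - z = (1 - κ) • (y - z) by module,
            norm_smul, Real.norm_of_nonneg (by linarith)]
        have := dist_triangle x z q
        have := h3.dist_le
        nlinarith

/-- The unit vector from `p` to `q`. -/
def dirVec (p q : Pt) : Pt := (dist p q)⁻¹ • (q - p)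

lemma norm_dirVec {p q : Pt} (h : p ≠ q) : ‖dirVec p q‖ = 1 := by
  have : dist p q ≠ 0 := dist_ne_zero.2 h
  rw [dirVec, norm_smul, ← dist_eq_norm, dist_comm q p, norm_inv, Real.norm_of_nonneg dist_nonneg,
    inv_mul_cancel₀ this]

lemma inner_dirVec {p q : Pt} (h : p ≠ q) : inner ℝ (dirVec p q) (q - p) = dist p q := by
  have : dist p q ≠ 0 := dist_ne_zero.2 h
  rw [dirVec, inner_smul_left, real_inner_self_eq_norm_sq, ← dist_eq_norm, dist_comm q p]
  simp; field_simp

lemma turn_dirVec (s : Side) (p q z : Pt) :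
    turn s 0 (dirVec p q) (z - q) = (dist p q)⁻¹ * turn s p q z := by
  cases s <;> simp [turn, cross, dirVec] <;> ring

lemma turn_dirVec_dirVec (s : Side) (p q r : Pt) :
    turn s 0 (dirVec p q) (dirVec q r) = (dist p q)⁻¹ * (dist q r)⁻¹ * turn s p q r := by
  cases s <;> simp [turn, cross, dirVec] <;> ring

namespace SimplePolygon

variable {n : ℕ} [NeZero n] {P : SimplePolygon n} {T : Finset (Finset (Fin n))} {k : ℕ}
  {t : ℕ → Finset (Fin n)} {e : Side → ℕ → Fin n}

/-- A linear lower bound for the length of the paths from `p` to the points of `bᵢ`. -/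
def LowerBound (P : SimplePolygon n) (e : Side → ℕ → Fin n) (t : ℕ → Finset (Fin n)) (p : Pt)
    (i : ℕ) (ℓ : ℝ) (z u : Pt) : Prop :=
  ∀ q ∈ P.diag e i, ∀ c, IsPathIn (sleeve P e t i) p q c → ℓ + inner ℝ u (q - z) ≤ pathLength c

lemma isClosed_sleeve (P : SimplePolygon n) (e : Side → ℕ → Fin n) (t : ℕ → Finset (Fin n))
    (i : ℕ) : IsClosed (sleeve P e t i) :=
  (isCompact_segment _ _).isClosed.union (isClosed_biUnion_finset fun _ _ => P.isClosed_hull _)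

lemma diag_zero_subset_sleeve (i : ℕ) : P.diag e 0 ⊆ sleeve P e t i := subset_union_left

lemma sleeve_succ (i : ℕ) : sleeve P e t (i + 1) = sleeve P e t i ∪ P.hull (t (i + 1)) := by
  ext x
  simp only [sleeve, mem_union, mem_iUnion, Finset.mem_Icc, exists_prop]
  constructor
  · rintro (h | ⟨j, ⟨h1, h2⟩, h3⟩)
    · exact Or.inl (Or.inl h)
    · rcases h2.lt_or_eq with h2 | rfl
      · exact Or.inl (Or.inr ⟨j, ⟨h1, by omega⟩, h3⟩)
      · exact Or.inr h3
  · rintro ((h | ⟨j, ⟨h1, h2⟩, h3⟩) | h)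
    · exact Or.inl h
    · exact Or.inr ⟨j, ⟨h1, by omega⟩, h3⟩
    · exact Or.inr ⟨i + 1, ⟨by omega, le_rfl⟩, h⟩

lemma hull_subset_sleeve {i j : ℕ} (h1 : 1 ≤ j) (h2 : j ≤ i) :
    P.hull (t j) ⊆ sleeve P e t i := by
  intro x hx
  exact Or.inr (mem_biUnion (x := j) (Finset.mem_coe.2 (Finset.mem_Icc.2 ⟨h1, h2⟩)) hx)

lemma sleeve_mono {i j : ℕ} (h : i ≤ j) : sleeve P e t i ⊆ sleeve P e t j := by
  rintro x (hx | hx)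
  · exact Or.inl hx
  · simp only [mem_iUnion, Finset.mem_Icc, exists_prop] at hx
    obtain ⟨l, ⟨h1, h2⟩, hx⟩ := hx
    exact hull_subset_sleeve h1 (h2.trans h) hx

namespace IsSleeve

variable (hS : P.IsSleeve T k t e)
include hS

lemma diag_subset_sleeve {i j : ℕ} (h : i ≤ j) (hi : i ≤ k) : P.diag e i ⊆ sleeve P e t j := by
  rcases Nat.eq_zero_or_pos i with rfl | h0
  · exact diag_zero_subset_sleeve j
  · exact (hS.diag_subset h0 hi).trans (hull_subset_sleeve h0 h)

lemma sleeve_inter {i : ℕ} (hi : i < k) : sleeve P e t i ∩ P.hull (t (i + 1)) ⊆ P.diag e i := by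
  rintro x ⟨hx | hx, hx'⟩
  · rcases Nat.eq_zero_or_pos i with rfl | h0
    · exact hx
    · have h1 := hS.diag_subset_succ (m := 0) (by omega) hx
      have h2 : x ∈ P.hull (t 1 ∩ t (i + 1)) := by
        rw [← hS.tri.face _ (hS.mem 1 le_rfl (by omega)) _ (hS.mem (i + 1) (by omega) hi) fun h => by
          have := hS.inj _ _ le_rfl (by omega) (by omega) hi h; omega]
        exact ⟨h1, hx'⟩
      have := P.hull_mono (hS.inter_subset (m := i) le_rfl h0 (Nat.lt_succ_self i) hi) h2
      rwa [P.hull_pair] at this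
  · simp only [mem_iUnion, Finset.mem_Icc, exists_prop] at hx
    obtain ⟨l, ⟨h1, h2⟩, hx⟩ := hx
    have h2' : x ∈ P.hull (t l ∩ t (i + 1)) := by
      rw [← hS.tri.face _ (hS.mem l h1 (by omega)) _ (hS.mem (i + 1) (by omega) hi) fun h => by
        have := hS.inj _ _ h1 (by omega) (by omega) hi h; omega]
      exact ⟨hx, hx'⟩
    have := P.hull_mono (hS.inter_subset (m := i) h1 h2 (Nat.lt_succ_self i) hi) h2'
    rwa [P.hull_pair] at this

/-- A path to a later diagonal crosses `b_j` at some `x`. After `x` its length is at least the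
distance, and an affine function with gradient of norm at most one grows no faster. -/
lemma lowerBound_mono {p z u : Pt} {ℓ : ℝ} (hp : p ∈ P.diag e 0) (hu : ‖u‖ ≤ 1) {i j : ℕ}
    (hij : i ≤ j) (hj : j ≤ k) (h : LowerBound P e t p i ℓ z u) :
    LowerBound P e t p j ℓ z u := by
  induction j, hij using Nat.le_induction with
  | base => exact h
  | succ j hij ih =>
    intro q hq c hc
    rw [sleeve_succ] at hc
    obtain ⟨x, hx, c', hc', hle⟩ := hc.exists_prefix (isClosed_sleeve ..) (P.isClosed_hull _)
      (diag_zero_subset_sleeve _ hp) (hS.diag_subset (by omega) hj hq)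
    have h1 := ih (by omega) x (hS.sleeve_inter hj hx) c' hc'
    have h2 : inner ℝ u (q - x) ≤ dist x q := by
      rw [dist_comm, dist_eq_norm]
      exact (real_inner_le_norm _ _).trans (mul_le_of_le_one_left (norm_nonneg _) hu)
    have h3 : inner ℝ u (q - z) = inner ℝ u (q - x) + inner ℝ u (x - z) := by
      rw [← inner_add_right]; congr 1; abel
    linarith

omit hS in
lemma lowerBound_zero {p u : Pt} (hu : ‖u‖ ≤ 1) : LowerBound P e t p 0 0 p u := by
  intro q _ c hc
  have h2 : inner ℝ u (q - p) ≤ dist p q := by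
    rw [dist_comm, dist_eq_norm]
    exact (real_inner_le_norm _ _).trans (mul_le_of_le_one_left (norm_nonneg _) hu)
  linarith [hc.dist_le]

omit hS in
lemma lowerBound_rebase {p z w u : Pt} {ℓ : ℝ} {i : ℕ} (h : LowerBound P e t p i ℓ z u) :
    LowerBound P e t p i (ℓ + inner ℝ u (w - z)) w u := by
  intro q hq c hc
  have h3 : inner ℝ u (q - z) = inner ℝ u (q - w) + inner ℝ u (w - z) := by
    rw [← inner_add_right]; congr 1; abel
  linarith [h q hq c hc]

/-- At a vertex of a shortest path, the direction turns while the sleeve turns around the vertex. -/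
lemma lowerBound_fan {p u u' : Pt} {ℓ : ℝ} (hp : p ∈ P.diag e 0) (hu : ‖u‖ = 1) (hu' : ‖u'‖ = 1)
    {s : Side} {w : Fin n} {a d : ℕ} (had : a ≤ d) (hd : d ≤ k) (ha : e s a = w) (hw : e s d = w)
    (h1 : turn s 0 u (P.vert (e s.opp a) - P.vert w) ≤ 0)
    (h2 : turn s 0 u' (P.vert (e s.opp d) - P.vert w) ≤ 0) (h3 : 0 < turn s 0 u u')
    (h : LowerBound P e t p a ℓ (P.vert w) u) : LowerBound P e t p d ℓ (P.vert w) u' := by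
  have hfan : ∀ m, a ≤ m → m ≤ d → e s m = w := fun m h1 h2 =>
    (hS.fan s h1 h2 hd (ha.trans hw.symm)).trans ha
  set X : ℕ → Pt := fun m => P.vert (e s.opp m) - P.vert w with hX
  have nu : u 0 ^ 2 + u 1 ^ 2 = 1 := by rw [← norm_sq_eq, hu]; norm_num
  have nu' : u' 0 ^ 2 + u' 1 ^ 2 = 1 := by rw [← norm_sq_eq, hu']; norm_num
  have huD : inner ℝ u (u' - u) < 0 := by
    have hsq : (u 0 * u' 0 + u 1 * u' 1) ^ 2 + (turn s 0 u u') ^ 2 = 1 := by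
      have : (u 0 ^ 2 + u 1 ^ 2) * (u' 0 ^ 2 + u' 1 ^ 2) = 1 := by rw [nu, nu']; norm_num
      cases s <;> simp only [turn, cross, PiLp.zero_apply] <;> linarith
    rw [inner_eq, PiLp.sub_apply, PiLp.sub_apply]
    nlinarith [mul_pos h3 h3]
  -- The gradient is exchanged at a diagonal along which `u'` grows no faster than `u`. If there
  -- were none, the diagonals would stay on the same side of `u` while turning around `w`, and the
  -- last one would contradict `h2`.
  obtain ⟨m, hm1, hm2, hm⟩ : ∃ m, a ≤ m ∧ m ≤ d ∧ inner ℝ (u' - u) (X m) ≤ 0 := by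
    by_contra hc
    push Not at hc
    have key : ∀ m, a ≤ m → m ≤ d → turn s 0 u (X m) ≤ 0 := by
      intro m hm
      induction m, hm using Nat.le_induction with
      | base => exact fun _ => h1
      | succ m hm ih =>
        intro hmd
        specialize ih (by omega)
        have hns : newSide e (m + 1) = s.opp := by
          rcases Side.eq_or s (newSide e (m + 1)) with h | h
          · have := hS.new_ne (i := m) (by omega)
            rw [h, hfan _ (by omega) hmd, hfan _ hm (by omega)] at this
            exact absurd rfl this
          · exact h
        have ht := hS.turn_pos m (by omega)
        rw [hns, Side.opp_opp, hfan m hm (by omega), turn_opp_swap] at ht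
        have ht' : 0 < turn s 0 (X m) (X (m + 1)) := by
          have : turn s 0 (X m) (X (m + 1)) = turn s (P.vert w) (P.vert (e s.opp m))
              (P.vert (e s.opp (m + 1))) := by
            cases s <;> simp [X, turn, cross]
          rwa [this]
        have e1 : turn s 0 u (X (m + 1)) * inner ℝ (u' - u) (X m) =
            turn s 0 u (X m) * inner ℝ (u' - u) (X (m + 1)) +
              inner ℝ u (u' - u) * turn s 0 (X m) (X (m + 1)) := by
          simp only [inner_eq, PiLp.sub_apply]
          cases s <;> simp only [turn, cross, PiLp.zero_apply] <;> ring
        by_contra hcon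
        push Not at hcon
        nlinarith [mul_pos hcon (hc m hm (by omega)),
          mul_nonneg (neg_nonneg.2 ih) (hc (m + 1) (by omega) hmd).le, mul_pos (neg_pos.2 huD) ht']
    have h4 := key d had le_rfl
    have h5 := hc d had le_rfl
    have h2' : turn s 0 u' (X d) ≤ 0 := h2
    have e1 : turn s 0 u u' * inner ℝ (u' - u) (X d) =
        turn s 0 u' (X d) * -inner ℝ u (u' - u) + turn s 0 u (X d) * inner ℝ u' (u' - u) := by
      simp only [inner_eq, PiLp.sub_apply]
      cases s <;> simp only [turn, cross, PiLp.zero_apply] <;> ring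
    have huD' : 0 < inner ℝ u' (u' - u) := by
      have : inner ℝ u' (u' - u) = -inner ℝ u (u' - u) := by
        simp only [inner_eq, PiLp.sub_apply]; linarith
      linarith
    nlinarith [mul_pos h3 h5, mul_nonneg (neg_nonneg.2 h2') (neg_pos.2 huD).le,
      mul_nonneg (neg_nonneg.2 h4) huD'.le]
  -- All points of this diagonal are `w` plus a nonnegative multiple of `X m`, so the bound with
  -- `u'` is implied by the one with `u`.
  have hb : LowerBound P e t p m ℓ (P.vert w) u' := by
    intro q hq c hc
    have h4 := hS.lowerBound_mono hp hu.le hm1 (by omega) h q hq c hc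
    rw [diag_eq P e s, hfan m hm1 hm2, segment_eq_image'] at hq
    obtain ⟨θ, ⟨hθ, -⟩, rfl⟩ := hq
    rw [add_sub_cancel_left, inner_smul_right] at h4 ⊢
    have h5 : inner ℝ u' (X m) ≤ inner ℝ u (X m) := by
      rw [inner_sub_left] at hm; linarith
    have := mul_le_mul_of_nonneg_left h5 hθ
    simp only [X] at this
    linarith
  exact hS.lowerBound_mono hp hu'.le hm2 hd hb

/-- The edge between two vertices whose line crosses the diagonals between them. -/
lemma segment_subset_sleeve {s s' : Side} {v w : Fin n} {d a : ℕ} (hda : d ≤ a) (ha : a ≤ k)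
    (hv : e s d = v) (hw : e s' a = w) (h : ∀ m, d ≤ m → m ≤ a → P.Stab e v w m) :
    segment ℝ (P.vert v) (P.vert w) ⊆ sleeve P e t a := by
  rcases eq_or_ne v w with rfl | hvw
  · rw [segment_same, singleton_subset_iff]
    exact hS.diag_subset_sleeve le_rfl ha (hw ▸ P.vert_mem_diag e s' a)
  by_cases hd : e s.opp d = w
  · rw [← hv, ← hd, ← diag_eq]
    exact hS.diag_subset_sleeve hda (by omega)
  have hx := hS.gp.turn_ne s hvw (Ne.symm hd) (by rw [← hv]; exact hS.ne s d (by omega))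
  intro z hz
  rcases hS.segment_subset (isAff_turn s (P.vert v) (P.vert w)) hx hda ha (s := s)
    (fun m h1 h2 => ⟨h m h1 h2 s, (h m h1 h2).opp_le s⟩) (hv ▸ P.vert_mem_diag e s d)
    (hw ▸ P.vert_mem_diag e s' a) (by simp) (by simp) z hz with h1 | ⟨j, h1, h2, h3⟩
  · exact hS.diag_subset_sleeve hda (by omega) h1
  · exact hull_subset_sleeve (by omega) h2 h3

end IsSleeve

/-- The path `l` from `p` arrives at `w` on side `s`, coming from `v`, at `bₐ`. -/
structure Arrives (P : SimplePolygon n) (e : Side → ℕ → Fin n) (t : ℕ → Finset (Fin n))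
    (p : Fin n) (l : List (Fin n)) (v w : Fin n) (s : Side) (a : ℕ) : Prop where
  mem : P.vert p ∈ P.diag e 0
  path : IsPathIn (sleeve P e t a) (P.vert p) (P.vert w) (l.map P.vert)
  ne : v ≠ w
  idx : e s a = w
  opp : turn s (P.vert v) (P.vert w) (P.vert (e s.opp a)) ≤ 0
  lb : LowerBound P e t (P.vert p) a (pathLength (l.map P.vert)) (P.vert w)
    (dirVec (P.vert v) (P.vert w))

namespace Arrives

variable (hS : P.IsSleeve T k t e)
include hS

lemma start {s s₀ : Side} {p w : Fin n} {d a : ℕ} (hda : d ≤ a) (ha : a ≤ k) (hp : e s₀ 0 = p)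
    (hd : e s₀ d = p) (hw : e s a = w) (hpw : p ≠ w)
    (h : ∀ m, d ≤ m → m ≤ a → P.Stab e p w m) : Arrives P e t p [p, w] p w s a := by
  have hmem : P.vert p ∈ P.diag e 0 := hp ▸ P.vert_mem_diag e s₀ 0
  have hne : P.vert p ≠ P.vert w := fun h => hpw (P.injective h)
  refine ⟨hmem, ?_, hpw, hw, (h a hda le_rfl).opp_le s, ?_⟩
  · have := (IsPathIn.singleton (diag_zero_subset_sleeve (t := t) a hmem)).append
      (hS.segment_subset_sleeve hda ha hd hw h)
    simpa using this
  · have h1 := hS.lowerBound_mono hmem (norm_dirVec hne).le (Nat.zero_le a) ha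
      (IsSleeve.lowerBound_zero (P := P) (e := e) (t := t) (p := P.vert p) (norm_dirVec hne).le)
    have h2 := IsSleeve.lowerBound_rebase (w := P.vert w) h1
    rw [inner_dirVec hne] at h2
    simpa [pathLength] using h2

/-- The bend at `w` is towards the side on which `w` lies, that is, in the sense in which the sleeve
turns around `w`. So the gradient may be rotated from the old to the new direction. -/
lemma extend {s s' : Side} {p v w w' : Fin n} {l : List (Fin n)} {a d a' : ℕ}
    (hA : Arrives P e t p l v w s a) (had : a ≤ d) (hda : d ≤ a') (ha : a' ≤ k) (hd : e s d = w)
    (hw : e s' a' = w') (hne : w ≠ w') (h : ∀ m, d ≤ m → m ≤ a' → P.Stab e w w' m)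
    (hb : 0 < turn s (P.vert v) (P.vert w) (P.vert w')) :
    Arrives P e t p (l ++ [w']) w w' s' a' := by
  have hvw : P.vert v ≠ P.vert w := fun h => hA.ne (P.injective h)
  have hww : P.vert w ≠ P.vert w' := fun h => hne (P.injective h)
  have i1 : 0 < (dist (P.vert v) (P.vert w))⁻¹ := inv_pos.2 (dist_pos.2 hvw)
  have i2 : 0 < (dist (P.vert w) (P.vert w'))⁻¹ := inv_pos.2 (dist_pos.2 hww)
  refine ⟨hA.mem, ?_, hne, hw, (h a' hda le_rfl).opp_le s', ?_⟩
  · have := (hA.path.mono (sleeve_mono (had.trans hda))).append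
      (hS.segment_subset_sleeve hda ha hd hw h)
    simpa using this
  · have h1 := hS.lowerBound_fan hA.mem (norm_dirVec hvw) (norm_dirVec hww) had (by omega) hA.idx hd
      (by rw [turn_dirVec]; exact mul_nonpos_of_nonneg_of_nonpos i1.le hA.opp)
      (by
        have h2 : turn s 0 (dirVec (P.vert w) (P.vert w')) (P.vert (e s.opp d) - P.vert w) =
            (dist (P.vert w) (P.vert w'))⁻¹ * turn s (P.vert w) (P.vert w')
              (P.vert (e s.opp d)) := by
          cases s <;> simp [turn, cross, dirVec] <;> ring
        rw [h2]
        exact mul_nonpos_of_nonneg_of_nonpos i2.le ((h d le_rfl hda).opp_le s))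
      (by rw [turn_dirVec_dirVec]; positivity) hA.lb
    have h2 := IsSleeve.lowerBound_rebase (w := P.vert w')
      (hS.lowerBound_mono hA.mem (norm_dirVec hww).le hda ha h1)
    rw [inner_dirVec hww] at h2
    rwa [List.map_append, List.map_singleton, pathLength_append _ _ _ hA.path.2.1]

/-- The affine bound is exact at `w`, where it equals the length of the path `l`. -/
lemma isShortestPath {s : Side} {p v w : Fin n} {l : List (Fin n)} {a i : ℕ}
    (hA : Arrives P e t p l v w s a) (hai : a ≤ i) (hi : i ≤ k) (hw : e s i = w) :
    IsShortestPath (sleeve P e t i) (P.vert p) (P.vert w) (l.map P.vert) := by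
  have hvw : P.vert v ≠ P.vert w := fun h => hA.ne (P.injective h)
  refine ⟨hA.path.mono (sleeve_mono hai), fun c hc => ?_⟩
  have := hS.lowerBound_mono hA.mem (norm_dirVec hvw).le hai hi hA.lb (P.vert w)
    (hw ▸ P.vert_mem_diag e s i) c hc
  simpa using this

end Arrives

end SimplePolygon

lemma take_eq_map_range {n : ℕ} [NeZero n] {c : List (Fin n)} {r : ℕ} (hr : r < c.length) :
    c.take (r + 1) = (List.range (r + 1)).map fun q => c.getD q 0 := by
  apply List.ext_getElem
  · simp; omega
  · intro q h1 h2
    have : q < c.length := by simp at h1; omega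
    simp [this]

lemma drop_eq_map_range {n : ℕ} [NeZero n] {c : List (Fin n)} {r L : ℕ} (hL : c.length = L + 1)
    (hr : r ≤ L) :
    c.drop r = c.getD r 0 :: (List.range' (r + 1) (L - r)).map fun q => c.getD q 0 := by
  rw [← List.map_cons (f := fun q => c.getD q 0), ← List.range'_succ]
  apply List.ext_getElem
  · simp; omega
  · intro q h1 h2
    have : r + q < c.length := by simp at h1; omega
    simp [this]

/-! ### Shortest paths along the chains and across the visibility lines. -/

namespace SimplePolygon

variable {n : ℕ} [NeZero n] {P : SimplePolygon n} {T : Finset (Finset (Fin n))} {k : ℕ}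
  {t : ℕ → Finset (Fin n)} {e : Side → ℕ → Fin n}

namespace Chain

variable {s : Side} {i : ℕ} {v : ℕ → Fin n} {L σ τ : ℕ} (h : Chain P e s i v L σ τ)
  (hS : P.IsSleeve T k t e) (hi : i ≤ k)
include h hS hi

lemma arrives_succ {p v' : Fin n} {l : List (Fin n)} {q a : ℕ} (hq : q < L) (ha : a ≤ i)
    (hA : Arrives P e t p l v' (v q) s a)
    (hb : 0 < turn s (P.vert v') (P.vert (v q)) (P.vert (v (q + 1)))) :
    ∃ a' ≤ i, e s (a' - 1) ≠ v (q + 1) ∧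
      Arrives P e t p (l ++ [v (q + 1)]) (v q) (v (q + 1)) s a' := by
  obtain ⟨f, g, h1, h2, h3, h4, h5, h6, h7⟩ := h.edge q hq
  refine ⟨g, h2, h6, hA.extend hS ?_ h1.le (h2.trans hi) h3 h5 (h.ne_succ hS hi hq)
    (fun m hm hm' => h7 m (by omega) (Or.inl hm) (Or.inl hm')) hb⟩
  by_contra hc
  exact h4 ((hS.fan s (Nat.le_succ f) (by omega) (ha.trans hi) (h3.trans hA.idx.symm)).trans h3)

lemma arrives_append {p v' : Fin n} {l : List (Fin n)} {q a : ℕ} (ha : a ≤ i)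
    (hA : Arrives P e t p l v' (v q) s a)
    (hb : q < L → 0 < turn s (P.vert v') (P.vert (v q)) (P.vert (v (q + 1)))) :
    ∀ d, q + d ≤ L → ∃ v'' a', a' ≤ i ∧
      Arrives P e t p (l ++ (List.range' (q + 1) d).map v) v'' (v (q + d)) s a' ∧
      (q + d < L → 0 < turn s (P.vert v'') (P.vert (v (q + d))) (P.vert (v (q + d + 1)))) := by
  intro d
  induction d with
  | zero => exact fun _ => ⟨v', a, ha, by simpa using hA, hb⟩
  | succ d ih =>
    intro hd
    obtain ⟨v'', a', ha', hA', hb'⟩ := ih (by omega)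
    obtain ⟨a'', h1, -, h2⟩ := h.arrives_succ hS hi (by omega) ha' hA' (hb' (by omega))
    refine ⟨v (q + d), a'', h1, ?_, fun hL => h.bend (q + d) (by omega)⟩
    rw [List.range'_1_concat, List.map_append, ← List.append_assoc, List.map_singleton,
      show q + 1 + d = q + d + 1 by omega]
    exact h2

lemma arrives : ∀ q < L, ∃ a ≤ i, e s (a - 1) ≠ v (q + 1) ∧
    Arrives P e t (v 0) ((List.range (q + 2)).map v) (v q) (v (q + 1)) s a := by
  intro q hq
  induction q with
  | zero =>
    obtain ⟨f, g, h1, h2, h3, h4, h5, h6, h7⟩ := h.edge 0 hq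
    refine ⟨g, h2, h6, ?_⟩
    have := Arrives.start hS h1.le (h2.trans hi) h.first.symm h3 h5 (h.ne_succ hS hi hq)
      (fun m hm hm' => h7 m (by omega) (Or.inl hm) (Or.inl hm'))
    simpa [List.range_succ] using this
  | succ q ih =>
    obtain ⟨a, h1, -, h2⟩ := ih (by omega)
    have := h.arrives_succ hS hi hq h1 h2 (h.bend q (by omega))
    rwa [List.range_succ, List.map_append, List.map_singleton]

lemma isShortestPath : IsShortestPath (sleeve P e t i) (P.vert (e s 0)) (P.vert (e s i))
    (((List.range (L + 1)).map v).map P.vert) := by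
  rcases Nat.eq_zero_or_pos L with rfl | hL
  · have h1 : v 0 = e s 0 := h.first
    have h2 : v 0 = e s i := h.last
    simp only [zero_add, List.range_one, List.map_cons, List.map_nil, ← h1, ← h2]
    refine ⟨IsPathIn.singleton ?_, fun c _ => ?_⟩
    · rw [h2]; exact hS.diag_subset_sleeve le_rfl hi (P.vert_mem_diag e s i)
    · rw [pathLength_singleton]; exact pathLength_nonneg c
  · obtain ⟨q, rfl⟩ := Nat.exists_eq_add_of_le' hL
    obtain ⟨a, h1, -, h2⟩ := h.arrives hS hi q (Nat.lt_succ_self q)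
    have := h2.isShortestPath hS h1 hi h.last.symm
    rwa [h.first, h.last] at this

end Chain

/-- The opposite chain and the chain of side `s` are calibrated already. At the source and at the
target of the visibility line, the bends have the correct sense because each chain lies on its own
side of that line. -/
lemma Config.isShortestPath {s : Side} {i : ℕ} {v u : ℕ → Fin n} {L σ τ L' σ' τ' : ℕ}
    (h : Config P e s i v L σ τ u L' σ' τ') (hS : P.IsSleeve T k t e) (hi : i ≤ k) :
    IsShortestPath (sleeve P e t i) (P.vert (e s.opp 0)) (P.vert (e s i))
      (((List.range (σ' + 1)).map u ++ v τ :: (List.range' (τ + 1) (L - τ)).map v).map P.vert) := by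
  have hτ := h.chain.τ_le
  have hσ := h.source_le'
  have nvu : ∀ q ≤ L, ∀ q' ≤ L', v q ≠ u q' := by
    intro q hq q' hq'
    obtain ⟨m, hm, h1⟩ := h.side hq
    obtain ⟨m', hm', h2⟩ := h.side' hq'
    rw [← h1, ← h2]; exact hS.ne_of_le s (by omega) (by omega)
  obtain ⟨hst, m₁, m₂, hm, hmi, e1, e2⟩ := h.line
  obtain ⟨v', hA⟩ : ∃ v', Arrives P e t (u 0) ((List.range (σ' + 1)).map u ++ [v τ]) v' (v τ) s m₂ ∧
      v' = u σ' := by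
    rcases Nat.eq_zero_or_pos σ' with rfl | h0
    · refine ⟨u 0, ?_, rfl⟩
      have := Arrives.start hS hm (hmi.trans hi) (s₀ := s.opp) h.chain'.first.symm e1 e2
        (nvu τ hτ 0 hσ).symm fun m _ hm' => hst m (by omega)
      simpa using this
    · obtain ⟨q, rfl⟩ := Nat.exists_eq_add_of_le' h0
      obtain ⟨a, h1, h2, h3⟩ := h.chain'.arrives hS hi q (by omega)
      refine ⟨u (q + 1), h3.extend hS ?_ hm (hmi.trans hi) e1 e2 (nvu τ hτ _ hσ).symm
        (fun m _ hm' => hst m (by omega)) ?_, rfl⟩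
      · by_contra hc
        exact h2 ((hS.fan s.opp (m := m₁) (p := a - 1) (m' := a) (by omega) (by omega) (by omega)
          (e1.trans h3.idx.symm)).trans e1)
      · have h4 := (h.line_side' (q := q) (by omega)).lt_of_ne
          (hS.gp.turn_ne s (nvu τ hτ _ hσ).symm (nvu τ hτ _ (by omega))
            (h.chain'.ne_succ hS hi (by omega)).symm)
        rw [turn_opp, turn_cyc]; linarith
  obtain ⟨hA, rfl⟩ := hA
  obtain ⟨v'', a', h1, h2, -⟩ := h.chain.arrives_append hS hi hmi hA (fun hL => by
    refine (h.line_side (q := τ + 1) (by omega)).lt_of_ne (hS.gp.turn_ne s (nvu τ hτ _ hσ).symm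
      (h.chain.ne_succ hS hi hL) (nvu _ hL _ hσ).symm).symm) (L - τ) (by omega)
  rw [show τ + (L - τ) = L by omega] at h2
  have := h2.isShortestPath hS h1 hi h.chain.last.symm
  rw [h.chain'.first, h.chain.last] at this
  simpa using this

end SimplePolygon

theorem State.Inv.holds {n : ℕ} [NeZero n] {P : SimplePolygon n} {T : Finset (Finset (Fin n))}
    {k : ℕ} {t : ℕ → Finset (Fin n)} {e : Side → ℕ → Fin n} (hS : P.IsSleeve T k t e) {i : ℕ}
    (hi : i ≤ k) {st : State n} {L τ : Side → ℕ} (h : st.Inv P e i L τ) : st.Holds P e t i := by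
  refine ⟨h.phase, h.idx, fun s => ?_⟩
  have hc := h.config s
  have hτ := hc.chain.τ_le
  have hσ := hc.source_le'
  have hl := h.len s
  have hl' := h.len s.opp
  refine ⟨?_, by omega, τ s, ?_, ?_⟩
  · have := hc.chain.isShortestPath hS hi
    rwa [← take_eq_map_range (by omega), ← hl, List.take_length] at this
  · rw [h.tgt s, List.getD_eq_getElem _ _ (by omega), List.getElem?_eq_getElem]
  · have := hc.isShortestPath hS hi
    rwa [← take_eq_map_range (by omega), ← drop_eq_map_range hl hτ] at this

/-! ### Lines that separate the two sides of a sleeve -/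

lemma mem_openSegment_of_cross {g : Pt → ℝ} (hg : IsAff g) {p q z : Pt} (h : cross p q z = 0)
    (hp : 0 < g p) (hq : g q < 0) (hz : g z = 0) : z ∈ openSegment ℝ p q := by
  have hpq : p ≠ q := by rintro rfl; linarith
  obtain ⟨κ, rfl⟩ := exists_of_cross_eq_zero hpq h
  rw [hg.lineMap] at hz
  rw [openSegment_eq_image']
  refine ⟨κ, ⟨?_, ?_⟩, rfl⟩
  · by_contra hc
    push Not at hc
    nlinarith [mul_nonneg (neg_nonneg.2 hc) (neg_pos.2 hq).le]
  · by_contra hc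
    push Not at hc
    nlinarith [mul_nonneg (sub_nonneg.2 hc) hp.le]

namespace SimplePolygon

variable {n : ℕ} [NeZero n]

/-- The line `g = 0` separates the endpoints of the diagonals from `b_f` to `b_M`. -/
structure Sep (P : SimplePolygon n) (e : Side → ℕ → Fin n) (s : Side) (g : Pt → ℝ) (f M : ℕ) :
    Prop where
  aff : IsAff g
  pos : ∀ m, f ≤ m → m ≤ M → 0 < g (P.vert (e s m))
  neg : ∀ m, f < m → m ≤ M → g (P.vert (e s.opp m)) < 0
  nonpos : g (P.vert (e s.opp f)) ≤ 0

variable {P : SimplePolygon n} {T : Finset (Finset (Fin n))} {k : ℕ}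
  {t : ℕ → Finset (Fin n)} {e : Side → ℕ → Fin n} {s : Side} {g : Pt → ℝ} {f M : ℕ}

lemma GeneralPosition.vert_notMem_openSegment (hP : P.GeneralPosition) {i j : Fin n} (hij : i ≠ j)
    (l : Fin n) : P.vert l ∉ openSegment ℝ (P.vert i) (P.vert j) := by
  intro h
  have hne : P.vert i ≠ P.vert j := fun h => hij (P.injective h)
  by_cases hi : i = l
  · subst hi
    exact hne (left_mem_openSegment_iff.1 h)
  by_cases hj : j = l
  · subst hj
    exact hne (right_mem_openSegment_iff.1 h)
  have := (isAff_turn .left (P.vert i) (P.vert j)).eq_zero_segment (by simp) (by simp)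
    (openSegment_subset_segment _ _ _ h)
  exact hP.turn_ne .left hij hj hi this

lemma Sep.mono (h : P.Sep e s g f M) {M' : ℕ} (hM : M' ≤ M) : P.Sep e s g f M' :=
  ⟨h.aff, fun m h1 h2 => h.pos m h1 (h2.trans hM), fun m h1 h2 => h.neg m h1 (h2.trans hM),
    h.nonpos⟩

namespace IsSleeve

variable (hS : P.IsSleeve T k t e)
include hS

lemma openSegment_subset_inside {m : ℕ} (h1 : 1 ≤ m) (hm : m < k) (s : Side) :
    openSegment ℝ (P.vert (e s m)) (P.vert (e s.opp m)) ⊆ P.inside := by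
  obtain ⟨x, hx, -⟩ := hS.tri.exists_third (hS.mem m h1 hm.le) (hS.mem_self s h1 hm.le)
    (hS.mem_self s.opp h1 hm.le) (hS.ne s m hm.le)
  obtain ⟨x', hx', -⟩ := hS.tri.exists_third (hS.mem (m + 1) (by omega) hm) (hS.mem_succ s hm)
    (hS.mem_succ s.opp hm) (hS.ne s m hm.le)
  refine hS.tri.openSegment_subset_inside hS.gp (hx ▸ hS.mem m h1 hm.le)
    (hx' ▸ hS.mem (m + 1) (by omega) hm) ?_
  rintro rfl
  have := hS.inj m (m + 1) h1 hm.le (by omega) hm (by rw [hx, hx'])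
  omega

/-- Between `b_i` and `b_{i+1}`, the point could fail to be interior only by lying on or beyond the
third side. There `g` could not vanish, in view of its signs at the corners. -/
lemma mem_interior_of_gap {i : ℕ} (hi : i < k) {g : Pt → ℝ} (hg : IsAff g)
    (hB : g (P.vert (e (newSide e (i + 1)).opp i)) < 0)
    (hA : 0 ≤ g (P.vert (e (newSide e (i + 1)) i)))
    (hA' : 0 < g (P.vert (e (newSide e (i + 1)) (i + 1)))) {z : Pt} (hz : g z = 0)
    (h : 0 < P.gap e i z) (h' : P.gap e (i + 1) z < 0) : z ∈ interior (P.hull (t (i + 1))) := by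
  rw [gap_eq P e (newSide e (i + 1))] at h
  rw [hS.gap_succ hi, turn_swap] at h'
  rw [hS.eq_triple i hi, P.interior_hull_iff (hS.turn_pos i hi)]
  refine ⟨h, by linarith, ?_⟩
  have := hg.bary (newSide e (i + 1)) (P.vert (e (newSide e (i + 1)) i))
    (P.vert (e (newSide e (i + 1)).opp i)) (P.vert (e (newSide e (i + 1)) (i + 1))) z
  rw [hz, mul_zero] at this
  by_contra hc
  push Not at hc
  nlinarith [mul_nonneg (neg_nonneg.2 hc) (neg_pos.2 hB).le, mul_pos h hA',
    mul_nonneg (by linarith : (0:ℝ) ≤ turn (newSide e (i + 1))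
      (P.vert (e (newSide e (i + 1)).opp i)) (P.vert (e (newSide e (i + 1)) (i + 1))) z) hA]

/-- A normal form in a single triangle: up to sign, the line has the pivot strictly on one side, and
the two other corners on the other side, the old one possibly on the line. -/
lemma sep_step (h : P.Sep e s g f M) (hM : M ≤ k) {m : ℕ} (h1 : f ≤ m) (h2 : m < M) :
    ∃ g', IsAff g' ∧ (∀ z, g z = 0 → g' z = 0) ∧
      g' (P.vert (e (newSide e (m + 1)).opp m)) < 0 ∧
      0 ≤ g' (P.vert (e (newSide e (m + 1)) m)) ∧
      0 < g' (P.vert (e (newSide e (m + 1)) (m + 1))) := by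
  have hs := hS.same m (by omega)
  rcases Side.eq_or s (newSide e (m + 1)) with h' | h'
  · rw [h'] at hs ⊢
    exact ⟨g, h.aff, fun _ => id, hs ▸ h.neg (m + 1) (by omega) h2, (h.pos m h1 h2.le).le,
      h.pos (m + 1) (by omega) h2⟩
  · rw [h', Side.opp_opp] at hs ⊢
    refine ⟨fun z => -g z, h.aff.neg, fun z hz => by simp [hz], ?_, ?_, ?_⟩
    · have := h.pos m h1 h2.le; linarith
    · rcases h1.eq_or_lt with rfl | h1
      · have := h.nonpos; linarith
      · have := h.neg m h1 h2.le; linarith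
    · have := h.neg (m + 1) (by omega) h2; linarith

/-- Along a separating line the diagonals are met in their order, by `above_step` in each triangle.
-/
lemma above_of_sep (h : P.Sep e s g f M) (hM : M ≤ k) {z : Pt} (hz : g z = 0)
    (hM0 : 0 ≤ P.gap e M z) {m : ℕ} (h1 : f ≤ m) (h2 : m < M) : 0 < P.gap e m z := by
  have key : ∀ d m, m + d + 1 = M → f ≤ m → 0 < P.gap e m z := by
    intro d
    induction d with
    | zero =>
      intro m hm hf
      obtain ⟨g', a1, a2, a3, a4, a5⟩ := hS.sep_step h hM hf (by omega)
      exact hS.above_step a1 (by omega) (by linarith) (by linarith) (by rw [a2 z hz]; exact a3)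
        (by rw [← hm] at hM0; simpa using hM0)
    | succ d ih =>
      intro m hm hf
      obtain ⟨g', a1, a2, a3, a4, a5⟩ := hS.sep_step h hM hf (by omega)
      exact hS.above_step a1 (by omega) (by linarith) (by linarith) (by rw [a2 z hz]; exact a3)
        (ih (m + 1) (by omega) (by omega)).le
  exact key (M - m - 1) m (by omega) h1

lemma below_of_sep (h : P.Sep e s g f M) (hM : M ≤ k) {z : Pt} (hz : g z = 0) {m : ℕ}
    (h1 : f ≤ m) (h2 : m ≤ M) (hm0 : P.gap e m z < 0) : P.gap e M z < 0 := by
  induction M, h2 using Nat.le_induction with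
  | base => exact hm0
  | succ M hm ih =>
    obtain ⟨g', a1, a2, a3, a4, a5⟩ := hS.sep_step h hM (m := M) (by omega) (by omega)
    exact hS.below_step a1 (by omega) (by linarith) (by linarith) (by rw [a2 z hz]; exact a3.le)
      (ih (h.mono (by omega)) (by omega))

omit hS in
lemma mem_openSegment_of_gap (hg : IsAff g) {m : ℕ} (hp : 0 < g (P.vert (e s m)))
    (hq : g (P.vert (e s.opp m)) < 0) {z : Pt} (hz : g z = 0) (h : P.gap e m z = 0) :
    z ∈ openSegment ℝ (P.vert (e s m)) (P.vert (e s.opp m)) :=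
  mem_openSegment_of_cross hg ((turn_eq_zero_iff s _ _ _).1 (gap_eq P e s m z ▸ h)) hp hq hz

/-- A separating line stays inside between the diagonals. -/
lemma inside_of_sep (h : P.Sep e s g f M) (hM : M ≤ k) {z : Pt} (hz : g z = 0)
    (hf : 0 < P.gap e f z) (hM0 : P.gap e M z < 0) (hfM : f ≤ M) : z ∈ P.inside := by
  induction M, hfM using Nat.le_induction with
  | base => linarith
  | succ M hm ih =>
    rcases lt_trichotomy (P.gap e M z) 0 with h0 | h0 | h0
    · exact ih (h.mono (by omega)) (by omega) h0
    · have hlt : f < M := hm.lt_of_ne (by rintro rfl; linarith)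
      exact hS.openSegment_subset_inside (by omega) (by omega) s
        (mem_openSegment_of_gap h.aff (h.pos M hm (by omega)) (h.neg M hlt (by omega)) hz h0)
    · obtain ⟨g', a1, a2, a3, a4, a5⟩ := hS.sep_step h hM (m := M) hm (by omega)
      exact hS.tri.interior_subset_inside hS.gp (hS.mem (M + 1) (by omega) hM)
        (hS.mem_interior_of_gap (by omega) a1 a3 a4 a5 (a2 z hz) h0 hM0)

end IsSleeve

/-- Since `φ` decreases from `c` to its zero `y`, a point at which it is still positive comes before
`y`. -/
lemma mem_openSegment_of_pos {φ : Pt → ℝ} (hφ : IsAff φ) {c q z y : Pt}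
    (hz : z ∈ openSegment ℝ c q) (hy : y ∈ segment ℝ c q) (hc : 0 < φ c) (hφz : 0 < φ z)
    (hφy : φ y = 0) : z ∈ openSegment ℝ c y := by
  rw [openSegment_eq_image'] at hz ⊢
  rw [segment_eq_image'] at hy
  obtain ⟨κ, ⟨h0, h1⟩, rfl⟩ := hz
  obtain ⟨μ, ⟨h2, h3⟩, rfl⟩ := hy
  simp only [hφ.lineMap] at hφz hφy
  have h4 : 0 < μ := h2.lt_of_ne (by rintro rfl; linarith)
  have h5 : κ < μ := by
    have : φ q < φ c := by
      by_contra hc'; push Not at hc'; nlinarith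
    nlinarith
  refine ⟨κ / μ, ⟨by positivity, by rwa [div_lt_one h4]⟩, ?_⟩
  simp only [add_sub_cancel_left, smul_smul]
  rw [div_mul_cancel₀ _ h4.ne']

namespace IsSleeve

variable (hS : P.IsSleeve T k t e)
include hS

lemma diag_zero_subset_curve : P.diag e 0 ⊆ P.curve := by
  obtain ⟨α, hα⟩ := hS.first_edge
  have : P.diag e 0 = P.hull {e .left 0, e .right 0} := (P.hull_pair _ _).symm
  rw [this, hα, P.hull_pair]
  exact P.edge_subset_curve α

/-- A point in the triangle after `b_M` on a strictly separating line is visible from the point in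
which the line meets `b₀`. -/
lemma openSegment_subset_inside_of_sep (h : P.Sep e s g 0 M)
    (h0 : g (P.vert (e s.opp 0)) < 0) (hM : M < k) {c q : Pt}
    (hc : c ∈ interior (P.hull (t (M + 1)))) (hgc : g c = 0) (hq : q ∈ P.diag e 0) (hgq : g q = 0) :
    openSegment ℝ c q ⊆ P.inside := by
  intro z hz
  have hcM : 0 < P.gap e M c := by
    rw [hS.eq_triple M hM, P.interior_hull_iff (hS.turn_pos M hM)] at hc
    rw [gap_eq P e (newSide e (M + 1))]; exact hc.1
  have hc0 : 0 < P.gap e 0 c := by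
    rcases Nat.eq_zero_or_pos M with rfl | hM0
    · exact hcM
    · exact hS.above_of_sep h hM.le hgc hcM.le le_rfl hM0
  have hq0 : P.gap e 0 q = 0 := (P.isAff_gap e 0).eq_zero_segment (by simp [gap]) (by simp [gap]) hq
  have hgz : g z = 0 := h.aff.eq_zero_segment hgc hgq (openSegment_subset_segment _ _ _ hz)
  have hz0 : 0 < P.gap e 0 z := (P.isAff_gap e 0).pos_openSegment hq0.ge hc0
    (by rwa [openSegment_symm])
  have hqM : P.gap e M q ≤ 0 := by
    rcases Nat.eq_zero_or_pos M with rfl | hM0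
    · exact hq0.le
    · by_contra hcon
      push Not at hcon
      have := hS.above_of_sep h hM.le hgq hcon.le le_rfl hM0
      linarith
  rcases lt_trichotomy (P.gap e M z) 0 with h1 | h1 | h1
  · exact hS.inside_of_sep h hM.le hgz hz0 h1 (Nat.zero_le _)
  · have hlt : 0 < M := Nat.pos_of_ne_zero (by rintro rfl; linarith)
    exact hS.openSegment_subset_inside hlt hM s
      (mem_openSegment_of_gap h.aff (h.pos M (Nat.zero_le _) le_rfl) (h.neg M hlt le_rfl) hgz h1)
  -- Beyond `b_M`, the point lies between the interior point `c` and a point `y` of `b_M`, both of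
  -- the same convex triangle.
  · obtain ⟨y, hy, hy0⟩ := (P.isAff_gap e M).exists_zero hcM.le hqM
    have hgy : g y = 0 := h.aff.eq_zero_segment hgc hgq hy
    have hyo : y ∈ openSegment ℝ (P.vert (e s M)) (P.vert (e s.opp M)) := by
      refine mem_openSegment_of_gap h.aff (h.pos M (Nat.zero_le _) le_rfl) ?_ hgy hy0
      rcases Nat.eq_zero_or_pos M with rfl | hM0
      · exact h0
      · exact h.neg M hM0 le_rfl
    have hyh : y ∈ P.hull (t (M + 1)) := hS.diag_subset_succ hM (by
      rw [diag_eq P e s]; exact openSegment_subset_segment _ _ _ hyo)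
    exact hS.tri.interior_subset_inside hS.gp (hS.mem (M + 1) (by omega) hM)
      ((P.convex_hull _).openSegment_interior_self_subset_interior hc hyh
        (mem_openSegment_of_pos (P.isAff_gap e M) hz hy hcM h1 hy0))

/-- A strictly separating line is a line of sight between `b₀` and `b_M`. -/
lemma exists_openSegment_of_sep (h : P.Sep e s g 0 M) (h0 : g (P.vert (e s.opp 0)) < 0)
    (hM0 : 0 < M) (hM : M ≤ k) :
    ∃ q ∈ openSegment ℝ (P.vert (e s 0)) (P.vert (e s.opp 0)), ∃ p ∈ openSegment ℝ
      (P.vert (e s M)) (P.vert (e s.opp M)), openSegment ℝ p q ⊆ P.inside := by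
  obtain ⟨q, hq, hgq⟩ := h.aff.exists_zero_open (h.pos 0 le_rfl (Nat.zero_le _)) h0
  obtain ⟨p, hp, hgp⟩ := h.aff.exists_zero_open (h.pos M (Nat.zero_le _) le_rfl) (h.neg M hM0 le_rfl)
  refine ⟨q, hq, p, hp, fun z hz => ?_⟩
  have gp : ∀ m, ∀ x ∈ openSegment ℝ (P.vert (e s m)) (P.vert (e s.opp m)), P.gap e m x = 0 :=
    fun m x hx => (P.isAff_gap e m).eq_zero_segment (by simp [gap_eq P e s])
      (by simp [gap_eq P e s]) (openSegment_subset_segment _ _ _ hx)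
  have hp0 := hS.above_of_sep h hM hgp (gp M p hp).ge le_rfl hM0
  have hgz : g z = 0 := h.aff.eq_zero_segment hgp hgq (openSegment_subset_segment _ _ _ hz)
  have hz0 : 0 < P.gap e 0 z := (P.isAff_gap e 0).pos_openSegment (gp 0 q hq).ge hp0
    (by rwa [openSegment_symm])
  -- The point `q`, relatively interior to `b_0`, is strictly behind `b_1`; then it is behind all
  -- later diagonals.
  have hqM : P.gap e M q < 0 := by
    refine hS.below_of_sep h hM hgq (m := 1) (by omega) hM0 ?_
    rw [hS.gap_succ (by omega)]
    rcases Side.eq_or s (newSide e (0 + 1)) with hs | hs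
    · have ht := hS.turn_pos 0 (by omega)
      rw [hs] at ht ⊢
      have := (isAff_turn s (P.vert (e s (0 + 1))) (P.vert (e s.opp 0))).neg.pos_openSegment
        (x := P.vert (e s.opp 0)) (y := P.vert (e s 0)) (z := q) (by simp)
        (by rw [turn_cyc, turn_cyc, turn_swap'] at ht; exact ht) (by rwa [openSegment_symm])
      linarith
    · have ht := hS.turn_pos 0 (by omega)
      rw [hs, Side.opp_opp] at ht ⊢
      have := (isAff_turn s.opp (P.vert (e s.opp (0 + 1))) (P.vert (e s 0))).neg.pos_openSegment
        (x := P.vert (e s 0)) (y := P.vert (e s.opp 0)) (z := q) (by simp)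
        (by rw [turn_cyc, turn_cyc, turn_swap'] at ht; exact ht) hq
      linarith
  have hzM : P.gap e M z < 0 := by
    have := (P.isAff_gap e M).neg.pos_openSegment (x := p) (y := q) (z := z)
      (by have := gp M p hp; linarith) (by linarith) hz
    linarith
  exact hS.inside_of_sep h hM hgz hz0 hzM (Nat.zero_le _)

end IsSleeve

end SimplePolygon

/-! ### Lines of sight -/

lemma IsAff.pos_of_segment {g : Pt → ℝ} (hg : IsAff g) {x y z : Pt} (hz : z ∈ segment ℝ x y)
    (h0 : g z = 0) (hne : z ≠ x) (hy : g y < 0) : 0 < g x := by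
  obtain ⟨a, b, ha, hb, hab, rfl⟩ := hz
  rw [hg.comb x y hab] at h0
  have hb' : 0 < b := hb.lt_of_ne (by
    rintro rfl
    obtain rfl : a = 1 := by linarith
    exact hne (by simp))
  by_contra hc
  push Not at hc
  nlinarith [mul_pos hb' (neg_pos.2 hy), mul_nonneg ha (neg_nonneg.2 hc)]

/-- Near `q`, such a segment runs inside the segment `a b`. Thus no line of sight leaves an edge
along its own line. -/
lemma exists_mem_openSegment_of_cross {p q a b : Pt} (hab : a ≠ b) (hq : q ∈ openSegment ℝ a b)
    (hp : cross a b p = 0) : (openSegment ℝ p q ∩ segment ℝ a b).Nonempty := by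
  obtain ⟨κ, rfl⟩ := exists_of_cross_eq_zero hab hp
  rw [openSegment_eq_image'] at hq
  obtain ⟨θ, ⟨h0, h1⟩, rfl⟩ := hq
  have h2 : ∀ᶠ ε : ℝ in 𝓝[>] 0, θ + ε * (κ - θ) ∈ Ioo (0 : ℝ) 1 := by
    have hc : Continuous fun ε : ℝ => θ + ε * (κ - θ) := by fun_prop
    exact (hc.tendsto 0).mono_left nhdsWithin_le_nhds (by
      simpa using isOpen_Ioo.mem_nhds (⟨h0, h1⟩ : θ ∈ Ioo (0 : ℝ) 1))
  obtain ⟨ε, h3, h4⟩ := (h2.and (Ioo_mem_nhdsGT one_pos)).exists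
  refine ⟨a + (θ + ε * (κ - θ)) • (b - a), ?_, ?_⟩
  · rw [openSegment_symm, openSegment_eq_image']
    exact ⟨ε, h4, by module⟩
  · rw [segment_eq_image']
    exact ⟨_, ⟨h3.1.le, h3.2.le⟩, rfl⟩

namespace SimplePolygon

variable {n : ℕ} [NeZero n] {P : SimplePolygon n} {T : Finset (Finset (Fin n))} {k : ℕ}
  {t : ℕ → Finset (Fin n)} {e : Side → ℕ → Fin n} {s : Side} {g : Pt → ℝ} {M : ℕ}

/-- A strictly separating line. -/
def StrictSep (P : SimplePolygon n) (e : Side → ℕ → Fin n) (s : Side) (g : Pt → ℝ) (M : ℕ) : Prop :=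
  P.Sep e s g 0 M ∧ g (P.vert (e s.opp 0)) < 0

lemma strictSep_iff (P : SimplePolygon n) (e : Side → ℕ → Fin n) (s : Side) (g : Pt → ℝ) (M : ℕ) :
    P.StrictSep e s g M ↔
      IsAff g ∧ ∀ m ≤ M, 0 < g (P.vert (e s m)) ∧ g (P.vert (e s.opp m)) < 0 := by
  constructor
  · rintro ⟨h, h0⟩
    refine ⟨h.aff, fun m hm => ⟨h.pos m (Nat.zero_le _) hm, ?_⟩⟩
    rcases Nat.eq_zero_or_pos m with rfl | hm0
    · exact h0
    · exact h.neg m hm0 hm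
  · rintro ⟨h1, h2⟩
    exact ⟨⟨h1, fun m _ hm => (h2 m hm).1, fun m _ hm => (h2 m hm).2, (h2 0 (Nat.zero_le _)).2.le⟩,
      (h2 0 (Nat.zero_le _)).2⟩

lemma StrictSep.symm (h : P.StrictSep e s g M) : P.StrictSep e s.opp (fun z => -g z) M := by
  rw [strictSep_iff] at *
  refine ⟨h.1.neg, fun m hm => ?_⟩
  rw [Side.opp_opp]
  exact ⟨by linarith [(h.2 m hm).2], by linarith [(h.2 m hm).1]⟩

lemma StrictSep.mono (h : P.StrictSep e s g M) {M' : ℕ} (hM : M' ≤ M) : P.StrictSep e s g M' :=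
  ⟨h.1.mono hM, h.2⟩

lemma StrictSep.to_side (h : P.StrictSep e .left g M) (s : Side) : ∃ g', P.StrictSep e s g' M ∧
    ∀ z, g z = 0 → g' z = 0 := by
  cases s
  · exact ⟨g, h, fun _ => id⟩
  · exact ⟨_, h.symm, fun z hz => by simp [hz]⟩

namespace IsSleeve

variable (hS : P.IsSleeve T k t e)
include hS

/-- A line of sight from `b₀` separates the endpoints of the diagonals that it meets. -/
lemma exists_strictSep {p q : Pt} (hM : M ≤ k)
    (hq : q ∈ openSegment ℝ (P.vert (e .left 0)) (P.vert (e .right 0))) (hp : ∀ l, p ≠ P.vert l)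
    (hpq : openSegment ℝ p q ⊆ P.inside)
    (h : ∀ m, 1 ≤ m → m ≤ M → (segment ℝ p q ∩ P.diag e m).Nonempty) :
    ∃ g, P.StrictSep e .left g M ∧ g p = 0 ∧ g q = 0 := by
  have hLR := hS.ne .left 0 (Nat.zero_le _)
  have hne : P.vert (e .left 0) ≠ P.vert (e .right 0) := fun h => hLR (P.injective h)
  have hqv : ∀ l, q ≠ P.vert l := fun l hl =>
    hS.gp.vert_notMem_openSegment hLR l (hl ▸ hq)
  have hv : ∀ z ∈ segment ℝ p q, ∀ l, z ≠ P.vert l := by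
    intro z hz l
    rw [← insert_endpoints_openSegment] at hz
    rcases hz with rfl | rfl | hz
    · exact hp l
    · exact hqv l
    · rintro rfl
      exact P.vert_notMem_inside l (hpq hz)
  have h1 : turn .left p q (P.vert (e .left 0)) ≠ 0 := by
    intro h0
    have hR : turn .left p q (P.vert (e .right 0)) = 0 := by
      obtain ⟨a, b, ha, hb, hab, rfl⟩ := hq
      have := (isAff_turn .left p (a • P.vert (e .left 0) + b • P.vert (e .right 0))).comb
        (P.vert (e .left 0)) (P.vert (e .right 0)) hab
      rw [h0, turn_self_right] at this
      rcases mul_eq_zero.1 (by linarith : b * turn .left p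
        (a • P.vert (e .left 0) + b • P.vert (e .right 0)) (P.vert (e .right 0)) = 0) with h | h
      · exact absurd h hb.ne'
      · exact h
    have hcr : cross (P.vert (e .left 0)) (P.vert (e .right 0)) p = 0 := by
      by_cases hpq' : p = q
      · have := hpq (by rw [hpq', openSegment_same]; rfl : q ∈ openSegment ℝ p q)
        exact absurd (hS.diag_zero_subset_curve (openSegment_subset_segment _ _ _ hq)) this.1
      obtain ⟨κ, hκ⟩ := exists_of_cross_eq_zero hpq' h0
      obtain ⟨μ, hμ⟩ := exists_of_cross_eq_zero hpq' hR
      rw [hκ, hμ]; simp [cross]; ring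
    obtain ⟨z, hz, hz'⟩ := exists_mem_openSegment_of_cross hne hq hcr
    exact (hpq hz).1 (hS.diag_zero_subset_curve hz')
  obtain ⟨g, hg, hgp, hgq, hgL⟩ : ∃ g, IsAff g ∧ g p = 0 ∧ g q = 0 ∧
      0 < g (P.vert (e .left 0)) := by
    rcases lt_or_gt_of_ne h1 with h1 | h1
    · exact ⟨fun z => -turn .left p q z, (isAff_turn ..).neg, by simp, by simp, by linarith⟩
    · exact ⟨turn .left p q, isAff_turn .., by simp, by simp, h1⟩
  refine ⟨g, (strictSep_iff ..).2 ⟨hg, fun m => ?_⟩, hgp, hgq⟩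
  -- The endpoint common to successive diagonals keeps its sign. The line meets the next diagonal,
  -- but not in a vertex, so the other endpoint has the opposite sign.
  induction m with
  | zero =>
    intro _
    refine ⟨hgL, ?_⟩
    have := hg.neg.pos_of_segment (x := P.vert (e .right 0)) (y := P.vert (e .left 0))
      (by rw [segment_symm]; exact openSegment_subset_segment _ _ _ hq) (by simp [hgq]) (hqv _)
      (by linarith)
    exact (by linarith : g (P.vert (e .right 0)) < 0)
  | succ m ih =>
    intro hm
    obtain ⟨ih1, ih2⟩ := ih (by omega)
    obtain ⟨z, hz, hzd⟩ := h (m + 1) (by omega) hm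
    have hgz : g z = 0 := hg.eq_zero_segment hgp hgq hz
    have hs := hS.same m (by omega)
    rcases hs' : newSide e (m + 1) with _ | _
    · rw [hs'] at hs
      simp only [Side.opp] at hs ih2 ⊢
      rw [hs]
      refine ⟨hg.pos_of_segment (y := P.vert (e .right (m + 1))) hzd hgz (hv z hz _) (hs ▸ ih2),
        ih2⟩
    · rw [hs'] at hs
      simp only [Side.opp] at hs ⊢
      rw [hs]
      refine ⟨ih1, ?_⟩
      have := hg.neg.pos_of_segment (x := P.vert (e .right (m + 1)))
        (y := P.vert (e .left (m + 1))) (by rw [segment_symm]; exact hzd) (by simp [hgz])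
        (hv z hz _) (by rw [hs]; linarith)
      linarith

omit hS in
lemma segment_subset_region {p q : Pt} (hp : p ∈ P.region) (hq : q ∈ P.region)
    (hpq : openSegment ℝ p q ⊆ P.inside) : segment ℝ p q ⊆ P.region := by
  intro z hz
  rw [← insert_endpoints_openSegment] at hz
  rcases hz with rfl | rfl | hz
  · exact hp
  · exact hq
  · exact Or.inl (hpq hz)

/-- A line of sight to a triangle beyond `b_M`. -/
lemma exists_strictSep_of_mem {p q : Pt} {j : ℕ} (hMj : M < j) (hj : j ≤ k)
    (hq : q ∈ openSegment ℝ (P.vert (e .left 0)) (P.vert (e .right 0))) (hp : ∀ l, p ≠ P.vert l)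
    (hpq : openSegment ℝ p q ⊆ P.inside) (hpj : p ∈ P.hull (t j)) :
    (∃ g, P.StrictSep e .left g M ∧ g p = 0 ∧ g q = 0) ∧
      ∀ m, 1 ≤ m → m ≤ M → (segment ℝ p q ∩ P.diag e m).Nonempty := by
  have hq' : q ∈ P.diag e 0 := openSegment_subset_segment _ _ _ hq
  have key : ∀ m, 1 ≤ m → m ≤ M → (segment ℝ p q ∩ P.diag e m).Nonempty := by
    intro m h1 hm
    exact hS.meets (j := 1) le_rfl h1 (by omega) hj (convex_segment p q).isPreconnected
      (segment_subset_region (hS.tri.hull_subset_region (hS.mem j (by omega) hj) hpj)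
        (Or.inr (hS.diag_zero_subset_curve hq')) hpq)
      ⟨q, right_mem_segment .., hS.diag_subset_succ (by omega) hq'⟩ ⟨p, left_mem_segment .., hpj⟩
  exact ⟨hS.exists_strictSep (by omega) hq hp hpq key, key⟩

/-- A line of sight to `bₖ`. -/
lemma exists_strictSep_of_last {p q : Pt}
    (hq : q ∈ openSegment ℝ (P.vert (e .left 0)) (P.vert (e .right 0)))
    (hp : p ∈ openSegment ℝ (P.vert (e .left k)) (P.vert (e .right k)))
    (hpq : openSegment ℝ p q ⊆ P.inside) : ∃ g, P.StrictSep e .left g k := by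
  have hk := hS.one_le
  have hp' : p ∈ P.diag e k := openSegment_subset_segment _ _ _ hp
  have hpv : ∀ l, p ≠ P.vert l := fun l hl =>
    hS.gp.vert_notMem_openSegment (hS.ne .left k le_rfl) l (hl ▸ hp)
  have h1 := (hS.exists_strictSep_of_mem (M := k - 1) (by omega) le_rfl hq hpv hpq
    (hS.diag_subset hk le_rfl hp')).2
  obtain ⟨g, hg, -⟩ := hS.exists_strictSep le_rfl hq hpv hpq fun m hm hmk => by
    rcases hmk.lt_or_eq with hmk | rfl
    · exact h1 m hm (by omega)
    · exact ⟨p, left_mem_segment .., hp'⟩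
  exact ⟨g, hg⟩

omit hS in
/-- A visibility line has the visible points beyond it on one side. -/
lemma turn_pos_of_strictSep (h : P.StrictSep e s g M) {S Q : Fin n} {m₁ m₂ : ℕ} (h1 : m₁ ≤ m₂)
    (h2 : m₂ ≤ M) (hS1 : e s m₁ = S) (hS2 : e s.opp m₂ = Q) (hst : P.Stab e S Q m₂) {p : Pt}
    (hgp : g p = 0) (hp : 0 < P.gap e m₂ p) : 0 < turn s (P.vert S) (P.vert Q) p := by
  obtain ⟨hg, h⟩ := (strictSep_iff ..).1 h
  by_contra hc
  rw [gap_eq P e s, hS2] at hp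
  exact blocked hg (hst s) hp (not_lt.1 hc) (hS1 ▸ (h m₁ (by omega)).1) (h m₂ h2).1.le hgp.ge
    (hS2 ▸ (h m₂ h2).2)

end IsSleeve

/-- A small change of a weakly separating line separates strictly. -/
lemma eventually_strictSep {g₀ l : Pt → ℝ} (hg : IsAff g₀) (hl : IsAff l)
    (h : ∀ m ≤ M, 0 < g₀ (P.vert (e s m)) ∨ g₀ (P.vert (e s m)) = 0 ∧ 0 < l (P.vert (e s m)))
    (h' : ∀ m ≤ M, g₀ (P.vert (e s.opp m)) < 0 ∨
      g₀ (P.vert (e s.opp m)) = 0 ∧ l (P.vert (e s.opp m)) < 0) :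
    ∀ᶠ δ : ℝ in 𝓝[>] 0, P.StrictSep e s (fun z => g₀ z + δ * l z) M := by
  have key : ∀ a b : ℝ, 0 < a ∨ a = 0 ∧ 0 < b → ∀ᶠ δ : ℝ in 𝓝[>] 0, 0 < a + δ * b := by
    rintro a b (h | ⟨rfl, h⟩)
    · have hc : Continuous fun δ : ℝ => a + δ * b := by fun_prop
      exact (hc.tendsto 0).mono_left nhdsWithin_le_nhds (isOpen_Ioi.mem_nhds (by simpa using h))
    · filter_upwards [self_mem_nhdsWithin] with δ hδ
      have := mul_pos (mem_Ioi.1 hδ) h; linarith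
  have h1 : ∀ᶠ δ : ℝ in 𝓝[>] 0, ∀ m ∈ Finset.range (M + 1),
      0 < g₀ (P.vert (e s m)) + δ * l (P.vert (e s m)) :=
    (Finset.eventually_all _).2 fun m hm => key _ _ (h m (by simpa [Nat.lt_succ_iff] using hm))
  have h2 : ∀ᶠ δ : ℝ in 𝓝[>] 0, ∀ m ∈ Finset.range (M + 1),
      0 < -g₀ (P.vert (e s.opp m)) + δ * -l (P.vert (e s.opp m)) :=
    (Finset.eventually_all _).2 fun m hm => key _ _ (by
      rcases h' m (by simpa [Nat.lt_succ_iff] using hm) with h | ⟨h, h'⟩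
      · exact Or.inl (by linarith)
      · exact Or.inr ⟨by linarith, by linarith⟩)
  filter_upwards [h1, h2] with δ h1 h2
  refine (strictSep_iff ..).2 ⟨hg.add (hl.smul δ), fun m hm => ⟨h1 m (by simp; omega), ?_⟩⟩
  have := h2 m (by simp; omega)
  linarith

namespace Line

variable {i : ℕ} {S Q S' Q' : Fin n}

lemma ne_source (hl : P.Line e s.opp i S Q) (hS : P.IsSleeve T k t e) (hi : i ≤ k) {m : ℕ}
    (hm : m ≤ k) : e s.opp m ≠ S := by
  obtain ⟨-, m₁, m₂, h1, h2, h3, h4⟩ := hl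
  rw [← h3, Side.opp_opp]; exact (hS.ne_of_le s (by omega) hm).symm

lemma ne_target (hl : P.Line e s.opp i S Q) (hS : P.IsSleeve T k t e) (hi : i ≤ k) {m : ℕ}
    (hm : m ≤ k) : e s m ≠ Q := by
  obtain ⟨-, m₁, m₂, h1, h2, h3, h4⟩ := hl
  rw [← h4]; exact hS.ne_of_le s hm (by omega)

lemma ne (hl : P.Line e s.opp i S Q) (hS : P.IsSleeve T k t e) (hi : i ≤ k) : S ≠ Q := by
  obtain ⟨m₁, h2, h3⟩ : ∃ m₁ ≤ i, e s m₁ = S := by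
    obtain ⟨-, m₁, m₂, h1, h2, h3, h4⟩ := hl
    exact ⟨m₁, by omega, by rw [← h3, Side.opp_opp]⟩
  rw [← h3]; exact hl.ne_target hS hi (by omega)

lemma pos (hl : P.Line e s.opp i S Q) (hS : P.IsSleeve T k t e) (hi : i ≤ k) {m : ℕ} (hm : m ≤ i)
    (hne : e s m ≠ S) : 0 < turn s (P.vert S) (P.vert Q) (P.vert (e s m)) :=
  (hl.1 m hm).pos hS.gp s (hl.ne hS hi) hne (hl.ne_target hS hi (by omega))

lemma neg (hl : P.Line e s.opp i S Q) (hS : P.IsSleeve T k t e) (hi : i ≤ k) {m : ℕ} (hm : m ≤ i)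
    (hne : e s.opp m ≠ Q) : turn s (P.vert S) (P.vert Q) (P.vert (e s.opp m)) < 0 :=
  (hl.1 m hm).opp_neg hS.gp s (hl.ne hS hi) (hl.ne_source hS hi (by omega)) hne

/-- The two visibility lines are not both tight on both sides. -/
lemma pos_or_neg (hl : P.Line e s.opp i S Q) (hl' : P.Line e s i S' Q')
    (hS : P.IsSleeve T k t e) (h0 : i ≠ 0) (hi : i ≤ k) :
    (∀ m ≤ i, 0 < turn s (P.vert S) (P.vert Q) (P.vert (e s m)) ∨
        0 < turn s (P.vert S') (P.vert Q') (P.vert (e s m))) ∨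
      ∀ m ≤ i, turn s (P.vert S) (P.vert Q) (P.vert (e s.opp m)) < 0 ∨
        turn s (P.vert S') (P.vert Q') (P.vert (e s.opp m)) < 0 := by
  by_contra hc
  rw [not_or] at hc
  push Not at hc
  obtain ⟨⟨m, hm, c1, c1'⟩, m', hm', c2, c2'⟩ := hc
  have hl'' : P.Line e s.opp.opp i S' Q' := by rwa [Side.opp_opp]
  have b1 : e s m = S := by
    by_contra hne
    exact c1.not_gt (hl.pos hS hi hm hne)
  have b2 : e s.opp m' = Q := by
    by_contra hne
    exact c2.not_gt (hl.neg hS hi hm' hne)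
  have b3 : e s.opp m' = S' := by
    by_contra hne
    have := hl''.pos hS hi hm' hne
    rw [turn_opp] at this; linarith
  have b4 : e s m = Q' := by
    by_contra hne
    have := hl''.neg (m := m) hS hi hm (by rwa [Side.opp_opp])
    rw [turn_opp, Side.opp_opp] at this; linarith
  refine h0 (hS.eq_zero_of_stab_both hi (hl.ne hS hi) hl.1 fun m hm => ?_)
  rw [← b1, ← b2, b3, b4]; exact hl'.1 m hm

/-- Positive combinations of the two visibility lines separate, up to a small change. -/
lemma eventually_strictSep (hl : P.Line e s.opp i S Q) (hl' : P.Line e s i S' Q')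
    (hS : P.IsSleeve T k t e) (h0 : i ≠ 0) (hi : i ≤ k) {a b : ℝ} (ha : 0 < a) (hb : 0 < b) :
    ∃ c : ℝ, ∀ᶠ δ : ℝ in 𝓝[>] 0, P.StrictSep e s (fun z => a * turn s (P.vert S) (P.vert Q) z +
      b * turn s (P.vert S') (P.vert Q') z + δ * c) i := by
  have n1 : ∀ m ≤ i, 0 ≤ turn s (P.vert S) (P.vert Q) (P.vert (e s m)) := fun m hm => hl.1 m hm s
  have n2 : ∀ m ≤ i, 0 ≤ turn s (P.vert S') (P.vert Q') (P.vert (e s m)) :=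
    fun m hm => hl'.1 m hm s
  have n3 : ∀ m ≤ i, turn s (P.vert S) (P.vert Q) (P.vert (e s.opp m)) ≤ 0 :=
    fun m hm => (hl.1 m hm).opp_le s
  have n4 : ∀ m ≤ i, turn s (P.vert S') (P.vert Q') (P.vert (e s.opp m)) ≤ 0 :=
    fun m hm => (hl'.1 m hm).opp_le s
  have hA := ((isAff_turn s (P.vert S) (P.vert Q)).smul a).add
    ((isAff_turn s (P.vert S') (P.vert Q')).smul b)
  have p1 : ∀ m ≤ i, 0 ≤ a * turn s (P.vert S) (P.vert Q) (P.vert (e s m)) +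
      b * turn s (P.vert S') (P.vert Q') (P.vert (e s m)) := fun m hm =>
    add_nonneg (mul_nonneg ha.le (n1 m hm)) (mul_nonneg hb.le (n2 m hm))
  have p2 : ∀ m ≤ i, a * turn s (P.vert S) (P.vert Q) (P.vert (e s.opp m)) +
      b * turn s (P.vert S') (P.vert Q') (P.vert (e s.opp m)) ≤ 0 := fun m hm =>
    add_nonpos (mul_nonpos_of_nonneg_of_nonpos ha.le (n3 m hm))
      (mul_nonpos_of_nonneg_of_nonpos hb.le (n4 m hm))
  rcases hl.pos_or_neg hl' hS h0 hi with h | h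
  · refine ⟨-1, SimplePolygon.eventually_strictSep hA (isAff_const (-1)) (fun m hm => Or.inl ?_)
      fun m hm => (p2 m hm).lt_or_eq.imp_right fun h => ⟨h, by norm_num⟩⟩
    rcases h m hm with h | h
    · exact add_pos_of_pos_of_nonneg (mul_pos ha h) (mul_nonneg hb.le (n2 m hm))
    · exact add_pos_of_nonneg_of_pos (mul_nonneg ha.le (n1 m hm)) (mul_pos hb h)
  · refine ⟨1, SimplePolygon.eventually_strictSep hA (isAff_const 1)
      (fun m hm => (p1 m hm).lt_or_eq.imp_right fun h => ⟨h.symm, by norm_num⟩)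
      fun m hm => Or.inl ?_⟩
    rcases h m hm with h | h
    · exact add_neg_of_neg_of_nonpos (mul_neg_of_pos_of_neg ha h)
        (mul_nonpos_of_nonneg_of_nonpos hb.le (n4 m hm))
    · exact add_neg_of_nonpos_of_neg (mul_nonpos_of_nonneg_of_nonpos ha.le (n3 m hm))
        (mul_neg_of_pos_of_neg hb h)

end Line

end SimplePolygon

namespace State.Inv

variable {n : ℕ} [NeZero n] {P : SimplePolygon n} {T : Finset (Finset (Fin n))}
    {k : ℕ} {t : ℕ → Finset (Fin n)} {e : Side → ℕ → Fin n} {i : ℕ} {st : State n}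
    {L τ : Side → ℕ} (h : st.Inv P e i L τ)
include h

lemma line (s : Side) : P.Line e s i (st.source s) (st.tgt s) := by
  have := (h.config s).line
  rw [h.tgt s]; exact this

/-- The invariant alone makes `b_i` visible: the sum of the equations of the two visibility lines
separates, after a small shift by a constant. -/
lemma exists_strictSep (hS : P.IsSleeve T k t e) (h0 : i ≠ 0) (hi : i ≤ k) (s : Side) :
    ∃ g, P.StrictSep e s g i := by
  obtain ⟨c, hc⟩ := (h.line s.opp).eventually_strictSep (h.line s) hS h0 hi one_pos one_pos
  exact ⟨_, hc.exists.choose_spec⟩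

/-- When the window test succeeds, the next diagonal is not visible. -/
lemma not_strictSep_of_blocked (hS : P.IsSleeve T k t e) (hi : i < k) (hb : st.Blocked P e i)
    {g : Pt → ℝ} : ¬ P.StrictSep e .left g (i + 1) := by
  intro hg
  set s := newSide e (i + 1) with hs
  obtain ⟨g', hg', -⟩ := hg.to_side s
  obtain ⟨hst, m₁, m₂, h1, h2, h3, h4⟩ := h.line s.opp
  rw [Side.opp_opp] at h3
  have hsep := (P.strictSep_iff e s g' (i + 1)).1 hg'
  -- The point in which the separating line would meet the next diagonal. It would be strictly on
  -- side `s` of the opposite visibility line, while neither endpoint of that diagonal is.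
  obtain ⟨y, hy, hgy⟩ := hsep.1.exists_zero (hsep.2 (i + 1) le_rfl).1.le
    (hsep.2 (i + 1) le_rfl).2.le
  have hgap : P.gap e (i + 1) y = 0 := (P.isAff_gap e _).eq_zero_segment
    (by simp [SimplePolygon.gap_eq P e s]) (by simp [SimplePolygon.gap_eq P e s]) hy
  have h5 := SimplePolygon.IsSleeve.turn_pos_of_strictSep hg' h1 (by omega) h3 h4 (hst m₂ h2) hgy
    (hS.above_of_sep hg'.1 hi hgy hgap.ge (Nat.zero_le _) (by omega))
  have h6 : turn s (P.vert (st.source s.opp)) (P.vert (st.tgt s.opp)) (P.vert (e s (i + 1))) ≤ 0 := by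
    have hb' := (onSide_iff ..).1 hb
    rw [← hs, turn_opp] at hb'; linarith
  have h7 : turn s (P.vert (st.source s.opp)) (P.vert (st.tgt s.opp))
      (P.vert (e s.opp (i + 1))) ≤ 0 := by
    rw [hS.same i hi]; exact (hst i le_rfl).opp_le s
  have := (isAff_turn s _ _).nonpos_segment h6 h7 hy
  linarith

end State.Inv

namespace SimplePolygon

variable {n : ℕ} [NeZero n] {P : SimplePolygon n} {T : Finset (Finset (Fin n))} {k : ℕ}
  {t : ℕ → Finset (Fin n)} {e : Side → ℕ → Fin n} {s : Side} {g : Pt → ℝ} {M : ℕ}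

/-! ### Rays that leave the polygon -/

lemma exists_mem_openSegment_edge {x : Pt} (hx : x ∈ P.curve) (hv : ∀ l, x ≠ P.vert l) :
    ∃ i, x ∈ openSegment ℝ (P.vert i) (P.vert (i + 1)) := by
  obtain ⟨i, hi⟩ := mem_iUnion.1 hx
  refine ⟨i, ?_⟩
  rw [← insert_endpoints_openSegment] at hi
  rcases hi with hi | hi | hi
  · exact absurd hi (hv _)
  · exact absurd hi (hv _)
  · exact hi

/-- A ray that hits the relative interior of an edge from inside leaves the polygon. -/
lemma eventually_mem_outside (hP : P.GeneralPosition) {x z : Pt} (hx : x ∈ P.curve)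
    (hv : ∀ l, x ≠ P.vert l) (hz : openSegment ℝ z x ⊆ P.inside) :
    ∀ᶠ ε : ℝ in 𝓝[>] 0, x + ε • (x - z) ∈ P.outside := by
  obtain ⟨i, hi⟩ := exists_mem_openSegment_edge hx hv
  have hne : P.vert i ≠ P.vert (i + 1) := fun h => P.succ_ne i (P.injective h).symm
  obtain ⟨s, hs⟩ : ∃ s, 0 < turn s (P.vert i) (P.vert (i + 1)) z := by
    refine exists_side_pos fun h0 => ?_
    obtain ⟨y, hy, hy'⟩ := exists_mem_openSegment_of_cross hne hi h0
    exact (hz hy).1 (P.edge_subset_curve i hy')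
  set φ := turn s (P.vert i) (P.vert (i + 1)) with hφ
  have aφ : IsAff φ := isAff_turn ..
  have φe : ∀ y ∈ segment ℝ (P.vert i) (P.vert (i + 1)), φ y = 0 := fun y hy =>
    aφ.eq_zero_segment (by simp [hφ]) (by simp [hφ]) hy
  have φx : φ x = 0 := φe x (openSegment_subset_segment _ _ _ hi)
  obtain ⟨r, hr, hball⟩ := P.exists_radius (x := x) {i} fun j hj => by
    by_contra hji
    exact P.edge_disjoint (by simpa using hji) hi hj
  have hball' : ∀ y ∈ Metric.ball x r, φ y ≠ 0 → y ∈ P.curveᶜ := fun y hy hφy hyc => by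
    have := hball ⟨hyc, hy⟩
    simp only [mem_singleton_iff, iUnion_iUnion_eq_left] at this
    exact hφy (φe y this)
  have hin : Metric.ball x r ∩ {y | 0 < φ y} ⊆ P.inside := by
    refine subset_inside ((convex_ball x r).inter aφ.convex_pos).isPreconnected
      (fun y hy => hball' y hy.1 (ne_of_gt hy.2)) ?_
    have h1 := eventually_mem_open Metric.isOpen_ball (Metric.mem_ball_self hr : x ∈ Metric.ball x r) z
    obtain ⟨ε, h1, h2⟩ := (h1.and (Ioo_mem_nhdsGT one_pos)).exists
    have h3 : x + ε • (z - x) ∈ openSegment ℝ z x := by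
      rw [openSegment_symm, openSegment_eq_image']; exact ⟨ε, h2, rfl⟩
    exact ⟨_, ⟨h1, aφ.pos_openSegment φx.ge hs (by rwa [openSegment_symm])⟩, hz h3⟩
  -- The half-disc beyond the edge contains exterior points: they exist near `x`, not in the other
  -- half-disc, and one on the line of the edge can be moved across, the exterior being open.
  have hout : Metric.ball x r ∩ {y | 0 < -φ y} ⊆ P.outside := by
    refine subset_outside ((convex_ball x r).inter aφ.neg.convex_pos).isPreconnected
      (fun y hy => hball' y hy.1 (by have : 0 < -φ y := hy.2; exact (neg_pos.1 this).ne)) ?_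
    obtain ⟨o, ho, ho'⟩ := mem_closure_iff.1 (curve_subset_closure_outside hP hx) _
      Metric.isOpen_ball (Metric.mem_ball_self hr)
    have h1 := eventually_mem_open (Metric.isOpen_ball.inter P.isOpen_outside) ⟨ho, ho'⟩
      (o + (x - z))
    have hw : φ (o + (x - z)) = φ o - φ z := by
      obtain ⟨a, b, c, H⟩ := aφ
      have := H x
      rw [φx] at this
      simp only [H, PiLp.add_apply, PiLp.sub_apply]; linarith
    rcases lt_trichotomy (φ o) 0 with h0 | h0 | h0
    · exact ⟨o, ⟨ho, by simpa using h0⟩, ho'⟩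
    · obtain ⟨ε, h1, h2⟩ := (h1.and (Ioo_mem_nhdsGT one_pos)).exists
      refine ⟨_, ⟨h1.1, ?_⟩, h1.2⟩
      simp only [mem_ofPred_eq, aφ.lineMap, hw, h0]
      have := mul_pos h2.1 hs; linarith
    · exact absurd (hin ⟨ho, h0⟩) (mem_outside_iff.1 ho').2
  have h1 := eventually_mem_open Metric.isOpen_ball (Metric.mem_ball_self hr : x ∈ Metric.ball x r)
    (x + (x - z))
  filter_upwards [h1, Ioo_mem_nhdsGT one_pos] with ε h1 h2
  rw [add_sub_cancel_left] at h1
  refine hout ⟨h1, ?_⟩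
  simp only [mem_ofPred_eq, aφ.ray, φx]
  have := mul_pos h2.1 hs; linarith

lemma visPolygon_subset {u w : Fin n} {z : Pt} (h : z ∈ P.visPolygon u w) : z ∉ P.outside := by
  intro ho
  obtain ⟨y, hy, hy'⟩ := mem_closure_iff.1 h _ P.isOpen_outside ho
  exact (mem_outside_iff.1 hy).2 hy'.1

/-! ### Points of the visibility polygon -/

namespace IsSleeve

variable (hS : P.IsSleeve T k t e)
include hS

/-- The line of sight from `y` is covered by the segment to `c`, inside by hypothesis, and the one
from `c` to `a` along the separating line. -/
lemma visible_of_strictSep (h : P.StrictSep e s g M) (hM : M < k) {c y : Pt}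
    (hc : c ∈ interior (P.hull (t (M + 1)))) (hgc : g c = 0) (hgy : g y = 0)
    (hcy : segment ℝ y c ⊆ P.inside) : y ∈ P.visible (e .left 0) (e .right 0) := by
  obtain ⟨q, hq, hgq⟩ := h.1.aff.exists_zero_open (h.1.pos 0 le_rfl (Nat.zero_le _)) h.2
  have hqd : q ∈ P.diag e 0 := by
    rw [diag_eq P e s]; exact openSegment_subset_segment _ _ _ hq
  have hqc := hS.diag_zero_subset_curve hqd
  have hyi : y ∈ P.inside := hcy (left_mem_segment ..)
  refine ⟨hyi, q, ?_, fun z hz => ?_⟩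
  · cases s
    · exact hq
    · rwa [openSegment_symm]
  · have h1 := hS.openSegment_subset_inside_of_sep h.1 h.2 hM hc hgc hqd hgq
    have h2 := segment_subset_union (h.1.aff.cross_eq_zero (h.1.pos 0 le_rfl (Nat.zero_le _)).ne'
      hgy hgq hgc) (openSegment_subset_segment _ _ _ hz)
    rcases h2 with h2 | h2
    · exact hcy h2
    · rw [← insert_endpoints_openSegment] at h2
      rcases h2 with rfl | h2 | h2
      · exact hcy (right_mem_segment ..)
      · have h2 : z = q := h2
        subst h2
        have : y = z := right_mem_openSegment_iff.1 hz
        exact absurd hqc (this ▸ hyi).1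
      · exact h1 h2

/-- A point on a limit of separating lines is in the visibility polygon. -/
lemma mem_visPolygon_of_eventually {g₀ l : Pt → ℝ} (hg : IsAff g₀) (hl : IsAff l) (hM : M < k)
    (h : ∀ᶠ δ : ℝ in 𝓝[>] 0, P.StrictSep e s (fun z => g₀ z + δ * l z) M) {w c y : Pt}
    (hw : 0 < g₀ w) (hc : c ∈ interior (P.hull (t (M + 1)))) (hgc : g₀ c = 0) (hgy : g₀ y = 0)
    (hcy : segment ℝ y c ⊆ P.inside) : y ∈ P.visPolygon (e .left 0) (e .right 0) := by
  -- Near a zero `x` of `g₀` there are points of both signs, on the line towards `w`. Both signs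
  -- survive a small perturbation, which then has a zero between them.
  have key : ∀ x, g₀ x = 0 → ∀ r > 0, ∀ᶠ δ : ℝ in 𝓝[>] 0, ∃ x' ∈ Metric.ball x r,
      g₀ x' + δ * l x' = 0 := by
    intro x hx r hr
    have hb := Metric.mem_ball_self (x := x) hr
    obtain ⟨ε, ⟨h1, h2⟩, h3⟩ := ((eventually_mem_open Metric.isOpen_ball hb w).and
      (eventually_mem_open Metric.isOpen_ball hb (x - (w - x))) |>.and
      (Ioo_mem_nhdsGT one_pos)).exists
    set x₁ := x + ε • (w - x)
    set x₂ := x + ε • (x - (w - x) - x)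
    have g1 : 0 < g₀ x₁ := by
      have := mul_pos h3.1 hw
      simp only [x₁, hg.lineMap, hx]; linarith
    have g2 : 0 < -g₀ x₂ := by
      have e1 : x₂ = x + (-ε) • (w - x) := by simp only [x₂]; module
      have := mul_pos h3.1 hw
      simp only [e1, hg.lineMap, hx]; linarith
    have ev : ∀ a b : ℝ, 0 < a → ∀ᶠ δ : ℝ in 𝓝[>] 0, 0 < a + δ * b := by
      intro a b h
      have hc : Continuous fun δ : ℝ => a + δ * b := by fun_prop
      exact (hc.tendsto 0).mono_left nhdsWithin_le_nhds (isOpen_Ioi.mem_nhds (by simpa using h))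
    filter_upwards [ev _ (l x₁) g1, ev _ (-l x₂) g2] with δ d1 d2
    obtain ⟨x', hx', h0⟩ := (hg.add (hl.smul δ)).exists_zero d1.le (y := x₂) (by linarith)
    exact ⟨x', (convex_ball x r).segment_subset h1 h2 hx', h0⟩
  -- A whole neighbourhood of the segment from `y` to `c` is inside, so the segment between the
  -- perturbed points is inside too.
  obtain ⟨ε, hε, hth⟩ := (isCompact_segment y c).exists_thickening_subset_open P.isOpen_inside hcy
  obtain ⟨ε', hε', hci⟩ := Metric.isOpen_iff.1 isOpen_interior c hc
  refine Metric.mem_closure_iff.2 fun r hr => ?_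
  obtain ⟨δ, ⟨hδ, y', hy', hgy'⟩, c', hc', hgc'⟩ := (h.and (key y hgy (min r ε) (lt_min hr hε)) |>.and
    (key c hgc (min ε' ε) (lt_min hε' hε))).exists
  refine ⟨y', hS.visible_of_strictSep hδ hM
    (hci (Metric.ball_subset_ball (min_le_left _ _) hc')) hgc' hgy' ?_, ?_⟩
  · refine (((convex_segment y c).thickening ε).segment_subset ?_ ?_).trans hth
    · exact Metric.mem_thickening_iff.2 ⟨y, left_mem_segment ..,
        (Metric.mem_ball.1 hy').trans_le (min_le_right _ _)⟩
    · exact Metric.mem_thickening_iff.2 ⟨c, right_mem_segment ..,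
        (Metric.mem_ball.1 hc').trans_le (min_le_right _ _)⟩
  · rw [dist_comm]
    exact (Metric.mem_ball.1 hy').trans_le (min_le_left _ _)

end IsSleeve

namespace Line

variable {j : ℕ} {S Q S' Q' : Fin n} (hl : P.Line e s.opp j S Q) (hS : P.IsSleeve T k t e)
include hl hS

/-- The last diagonal at the target of a visibility line. -/
lemma exists_sep (hj : j < k) : ∃ f ≤ j, e s.opp f = Q ∧ (f < j → e s.opp (f + 1) ≠ Q) ∧
    (∃ m₁ ≤ f, e s m₁ = S) ∧
    (P.Sep e s (turn s (P.vert S) (P.vert Q)) f j ∨ f = j ∧ e s j = S) := by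
  have hne := fun {m} => hl.ne_source hS hj.le (m := m)
  obtain ⟨hst, m₁, m₂, h1, h2, h3, h4⟩ := id hl
  rw [Side.opp_opp] at h3
  -- `b_f` is the last diagonal at the target. Beyond it, the line separates the opposite endpoints
  -- strictly.
  obtain ⟨f, hf, hmax⟩ := ((Finset.range (j + 1)).filter fun m => e s.opp m = Q).exists_max_image id
    ⟨m₂, by simp [h4]; omega⟩
  simp only [Finset.mem_filter, Finset.mem_range, id] at hf hmax
  have hm₂ := hmax m₂ ⟨by omega, h4⟩
  have hlast : ∀ m, f < m → m ≤ j → e s.opp m ≠ Q := fun m hm hmj he => by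
    have := hmax m ⟨by omega, he⟩; omega
  refine ⟨f, by omega, hf.2, fun h => hlast _ (by omega) h, ⟨m₁, by omega, h3⟩, ?_⟩
  -- In the degenerate case the visibility line is the line of `b_f` itself, and the next diagonal
  -- cannot turn away at the target.
  by_cases hfS : e s f = S
  · right
    refine (and_iff_left_of_imp fun h => by rw [← h]; exact hfS).2 ?_
    by_contra hfj
    have hn := hlast (f + 1) (by omega) (by omega)
    have hns := hS.newSide_of_ne (s := s.opp) (i := f) (by omega) (by rwa [hf.2])
    have ht := hS.turn_pos f (by omega)
    rw [hns, Side.opp_opp, hf.2, hfS, turn_opp_swap] at ht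
    have := (hst (f + 1) (by omega)).opp_le s
    linarith
  · left
    refine ⟨isAff_turn .., fun m h5 h6 => hl.pos hS hj.le h6 fun he => hfS ?_,
      fun m h5 h6 => hl.neg hS hj.le h6 (hlast m h5 h6), ?_⟩
    · exact (hS.fan s (m := m₁) (p := f) (m' := m) (by omega) h5 (by omega) (h3.trans he.symm)).trans h3
    · rw [hf.2]; simp

/-- The visible points of the triangle after `b_j` lie on one side of a visibility line. -/
lemma turn_pos_of_visible (hj : j < k) {p : Pt} (hp : p ∈ P.visible (e .left 0) (e .right 0))
    (hpj : p ∈ interior (P.hull (t (j + 1)))) : 0 < turn s (P.vert S) (P.vert Q) p := by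
  obtain ⟨hpi, q, hq, hpq⟩ := hp
  obtain ⟨g, hg, hgp, -⟩ := (hS.exists_strictSep_of_mem (M := j) (Nat.lt_succ_self j) hj hq
    (fun l hl => P.vert_notMem_inside l (hl ▸ hpi)) hpq (interior_subset hpj)).1
  obtain ⟨g', hg', h0⟩ := hg.to_side s
  obtain ⟨hst, m₁, m₂, h1, h2, h3, h4⟩ := hl
  rw [Side.opp_opp] at h3
  refine IsSleeve.turn_pos_of_strictSep hg' h1 h2 h3 h4 (hst m₂ h2) (h0 p hgp) ?_
  have hpg : 0 < P.gap e j p := by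
    rw [hS.eq_triple j hj, P.interior_hull_iff (hS.turn_pos j hj)] at hpj
    rw [gap_eq P e (newSide e (j + 1))]; exact hpj.1
  rcases h2.lt_or_eq with h2 | rfl
  · exact hS.above_of_sep hg'.1 hj.le (h0 p hgp) hpg.le (Nat.zero_le _) h2
  · exact hpg

lemma turn_nonneg_of_mem_visPolygon (hj : j < k) {p : Pt}
    (hp : p ∈ P.visPolygon (e .left 0) (e .right 0))
    (hpj : p ∈ interior (P.hull (t (j + 1)))) : 0 ≤ turn s (P.vert S) (P.vert Q) p := by
  by_contra hc
  have ho : IsOpen {z | 0 < -turn s (P.vert S) (P.vert Q) z} := (isAff_turn ..).neg.isOpen_pos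
  obtain ⟨z, ⟨hz1, hz2⟩, hz⟩ := mem_closure_iff.1 hp _ (isOpen_interior.inter ho)
    ⟨hpj, show 0 < -turn s (P.vert S) (P.vert Q) p by linarith⟩
  have := hl.turn_pos_of_visible hS hj hz hz1
  have : 0 < -turn s (P.vert S) (P.vert Q) z := hz2
  linarith

/-- The cone between the visibility lines is visible. -/
lemma mem_visPolygon (hl' : P.Line e s j S' Q') (h0 : j ≠ 0) (hj : j < k) {c : Pt}
    (hc : c ∈ interior (P.hull (t (j + 1)))) (h1 : 0 < turn s (P.vert S) (P.vert Q) c)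
    (h2 : turn s (P.vert S') (P.vert Q') c < 0) : c ∈ P.visPolygon (e .left 0) (e .right 0) := by
  -- The coefficients are chosen such that the combination of the two visibility lines vanishes at
  -- `c`; they are positive because `c` is in the cone.
  obtain ⟨b, hb⟩ := hl.eventually_strictSep hl' hS h0 hj.le (neg_pos.2 h2) h1
  have hA := ((isAff_turn s (P.vert S) (P.vert Q)).smul (-turn s (P.vert S') (P.vert Q') c)).add
    ((isAff_turn s (P.vert S') (P.vert Q')).smul (turn s (P.vert S) (P.vert Q) c))
  rcases hl.pos_or_neg hl' hS h0 hj.le with h | h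
  · refine hS.mem_visPolygon_of_eventually hA (isAff_const b) hj hb (w := P.vert (e s 0)) ?_ hc
      (by ring) (by ring) ?_
    · have a1 := hl.1 0 (by omega) s
      have a2 := hl'.1 0 (by omega) s
      rcases h 0 (by omega) with h | h
      · nlinarith [mul_pos (neg_pos.2 h2) h, mul_nonneg h1.le a2]
      · nlinarith [mul_pos h1 h, mul_nonneg (neg_pos.2 h2).le a1]
    · rw [segment_same, singleton_subset_iff]
      exact hS.tri.interior_subset_inside hS.gp (hS.mem (j + 1) (by omega) hj) hc
  · have hneg : (-turn s (P.vert S') (P.vert Q') c) * turn s (P.vert S) (P.vert Q)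
        (P.vert (e s.opp 0)) + turn s (P.vert S) (P.vert Q) c *
          turn s (P.vert S') (P.vert Q') (P.vert (e s.opp 0)) < 0 := by
      have a1 := (hl.1 0 (by omega)).opp_le s
      have a2 := (hl'.1 0 (by omega)).opp_le s
      rcases h 0 (by omega) with h | h
      · nlinarith [mul_pos (neg_pos.2 h2) (neg_pos.2 h), mul_nonneg h1.le (neg_nonneg.2 a2)]
      · nlinarith [mul_pos h1 (neg_pos.2 h), mul_nonneg (neg_pos.2 h2).le (neg_nonneg.2 a1)]
    -- The witness is the reflection in the zero `c` of a point with negative value, so its value is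
    -- positive.
    refine hS.mem_visPolygon_of_eventually hA (isAff_const b) hj hb
      (w := c + (-1 : ℝ) • (P.vert (e s.opp 0) - c)) ?_ hc (by ring) (by ring) ?_
    · rw [hA.lineMap]
      linarith
    · rw [segment_same, singleton_subset_iff]
      exact hS.tri.interior_subset_inside hS.gp (hS.mem (j + 1) (by omega) hj) hc

end Line

end SimplePolygon

/-! ### Rays -/

/-- The points of the ray from `y` away from `p`. -/
def ray (p y : Pt) (κ : ℝ) : Pt := y + κ • (y - p)

lemma ray_zero (p y : Pt) : ray p y 0 = y := by simp [ray]

lemma continuous_ray (p y : Pt) : Continuous (ray p y) := by unfold ray; fun_prop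

lemma apply_ray {g : Pt → ℝ} (hg : IsAff g) (p y : Pt) (κ : ℝ) :
    g (ray p y κ) = g y + κ * (g y - g p) := hg.ray p y κ

lemma ray_injective {p y : Pt} (h : p ≠ y) : Function.Injective (ray p y) := by
  intro a b hab
  have : (a - b) • (y - p) = 0 := by
    rw [sub_smul, sub_eq_zero]; exact add_left_cancel hab
  rcases smul_eq_zero.1 this with h' | h'
  · linarith
  · exact absurd (sub_eq_zero.1 h').symm h

lemma exists_ray {s : Side} {p y z : Pt} (h : p ≠ y) (hz : turn s p y z = 0) :
    ∃ κ, z = ray p y κ := by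
  obtain ⟨κ, rfl⟩ := exists_of_cross_eq_zero h ((turn_eq_zero_iff ..).1 hz)
  exact ⟨κ - 1, by simp only [ray]; module⟩

lemma segment_ray (p y : Pt) {a b : ℝ} (h : a ≤ b) :
    segment ℝ (ray p y a) (ray p y b) = ray p y '' Icc a b := by
  rw [← segment_eq_Icc h, segment_eq_image', segment_eq_image', image_image]
  refine image_congr fun θ _ => ?_
  simp only [ray, smul_eq_mul]; module

lemma openSegment_ray (p y : Pt) {a b : ℝ} (h : a < b) :
    openSegment ℝ (ray p y a) (ray p y b) = ray p y '' Ioo a b := by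
  rw [← openSegment_eq_Ioo h, openSegment_eq_image', openSegment_eq_image', image_image]
  refine image_congr fun θ _ => ?_
  simp only [ray, smul_eq_mul]; module

lemma IsAff.eq_zero_of_two_zeros {g : Pt → ℝ} (hg : IsAff g) {p q c d : Pt}
    (hc : c ∈ segment ℝ p q) (hd : d ∈ segment ℝ p q) (hcd : c ≠ d) (hgc : g c = 0)
    (hgd : g d = 0) : ∀ z ∈ segment ℝ p q, g z = 0 := by
  rw [segment_eq_image'] at hc hd
  obtain ⟨α, -, rfl⟩ := hc
  obtain ⟨β, -, rfl⟩ := hd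
  rw [hg.lineMap] at hgc hgd
  have hne : α - β ≠ 0 := fun h => hcd (by rw [show α = β by linarith])
  have hp : g p = 0 := mul_left_cancel₀ hne (by linear_combination α * hgd - β * hgc)
  have hq : g q = 0 := mul_left_cancel₀ hne (by linear_combination (1 - β) * hgc - (1 - α) * hgd)
  exact fun z hz => hg.eq_zero_segment hp hq hz

lemma segment_eq_ray (p y : Pt) {b : ℝ} (h : 0 ≤ b) :
    segment ℝ y (ray p y b) = ray p y '' Icc 0 b := by
  have := segment_ray p y h
  rwa [ray_zero] at this

lemma openSegment_eq_ray (p y : Pt) {b : ℝ} (h : 0 < b) :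
    openSegment ℝ y (ray p y b) = ray p y '' Ioo 0 b := by
  have := openSegment_ray p y h
  rwa [ray_zero] at this

lemma ray_of_ray (p y : Pt) (a ε : ℝ) :
    ray p y a + ε • (ray p y a - y) = ray p y (a + ε * a) := by
  simp only [ray]; module

namespace SimplePolygon

variable {n : ℕ} [NeZero n] {P : SimplePolygon n} {T : Finset (Finset (Fin n))} {k : ℕ}
  {t : ℕ → Finset (Fin n)} {e : Side → ℕ → Fin n}

/-- A ray that starts inside hits the boundary. -/
lemma exists_isFirstHit {p y : Pt} (hpy : p ≠ y) {a : ℝ} (ha : 0 < a)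
    (h : ∀ κ, 0 < κ → κ < a → ray p y κ ∈ P.inside) : ∃ x, IsFirstHit P.curve p y x := by
  set K : Set ℝ := Ici a ∩ ray p y ⁻¹' P.curve with hK
  have hKc : IsClosed K := isClosed_Ici.inter (P.isClosed_curve.preimage (continuous_ray p y))
  have hKn : K.Nonempty := by
    by_contra hKe
    rw [not_nonempty_iff_eq_empty] at hKe
    have h1 : ray p y '' Ici (a / 2) ⊆ P.curveᶜ := by
      rintro _ ⟨κ, hκ, rfl⟩ hc
      have hκ : a / 2 ≤ κ := hκ
      rcases lt_or_ge κ a with h2 | h2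
      · exact (h κ (by linarith) h2).1 hc
      · exact (hKe ▸ (⟨h2, hc⟩ : κ ∈ K) : κ ∈ (∅ : Set ℝ))
    -- A ray that never meets the curve would be an unbounded connected set in its complement, but
    -- it contains points inside.
    refine notMem_inside_of_unbounded (x := ray p y (a / 2))
      ((convex_Ici _).isPreconnected.image _ (continuous_ray p y).continuousOn) h1 (fun hb => ?_)
      ⟨_, mem_Ici.2 le_rfl, rfl⟩ (h _ (by linarith) (by linarith))
    obtain ⟨R, hR⟩ := hb.subset_closedBall y
    have hd : 0 < dist y p := dist_pos.2 hpy.symm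
    set κ := max (a / 2) (R / dist y p + 1) with hκ
    have h2 := hR ⟨κ, mem_Ici.2 (le_max_left _ _), rfl⟩
    have h0 : 0 ≤ κ := le_trans (by linarith) (le_max_left _ _)
    rw [Metric.mem_closedBall, ray, dist_eq_norm, add_sub_cancel_left, norm_smul,
      Real.norm_of_nonneg h0, ← dist_eq_norm] at h2
    have h3 : R / dist y p + 1 ≤ κ := le_max_right _ _
    have h4 := mul_le_mul_of_nonneg_right h3 hd.le
    rw [add_mul, div_mul_cancel₀ _ hd.ne'] at h4
    linarith
  have hmem := hKc.csInf_mem hKn ⟨a, fun κ hκ => hκ.1⟩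
  have h0 : a ≤ sInf K := hmem.1
  refine ⟨_, sInf K, by linarith, rfl, hmem.2, fun κ h1 h2 hc => ?_⟩
  rcases lt_or_ge κ a with h3 | h3
  · exact (h κ h1 h3).1 hc
  · exact absurd (csInf_le ⟨a, fun κ hκ => hκ.1⟩ (⟨h3, hc⟩ : κ ∈ K)) (not_le.2 h2)

/-! ### The visibility line that carries the window. -/

/-- The visibility lines when the window test succeeds after `b_j`. -/
structure Window (P : SimplePolygon n) (e : Side → ℕ → Fin n) (k : ℕ) (s : Side) (j : ℕ)
    (S Q S' Q' : Fin n) : Prop where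
  lt : j < k
  side : newSide e (j + 1) = s
  line : P.Line e s.opp j S Q
  line' : P.Line e s j S' Q'
  neg : turn s (P.vert S) (P.vert Q) (P.vert (e s (j + 1))) < 0

namespace Window

variable {s : Side} {j : ℕ} {S Q S' Q' : Fin n} (W : P.Window e k s j S Q S' Q')
  (hS : P.IsSleeve T k t e)
include W hS

/-- In the degenerate case the line is that of `b_j`, and the new vertex is on side `s` of it,
contrary to the successful test. -/
lemma exists_sep : ∃ f ≤ j, e s.opp f = Q ∧ (f < j → e s.opp (f + 1) ≠ Q) ∧
    (∃ m₁ ≤ f, e s m₁ = S) ∧ P.Sep e s (turn s (P.vert S) (P.vert Q)) f j := by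
  obtain ⟨f, h1, h2, h3, h4, h5 | ⟨rfl, h6⟩⟩ := W.line.exists_sep hS W.lt
  · exact ⟨f, h1, h2, h3, h4, h5⟩
  · have h7 := hS.turn_pos f W.lt
    have h8 := W.neg
    rw [W.side, h6, h2] at h7
    linarith

lemma ne : P.vert S ≠ P.vert Q := fun h => W.line.ne hS W.lt.le (P.injective h)

lemma pos_left : 0 < turn s (P.vert S) (P.vert Q) (P.vert (e s j)) := by
  obtain ⟨f, h1, -, -, -, h5⟩ := W.exists_sep hS
  exact h5.pos j h1 le_rfl

/-- At `b_0` the source would be the endpoint on side `s`, which lies on the line and not strictly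
beside it. -/
lemma ne_zero : j ≠ 0 := by
  obtain ⟨f, h1, -, -, ⟨m₁, h4, h6⟩, h5⟩ := W.exists_sep hS
  rintro rfl
  have := h5.pos 0 h1 le_rfl
  obtain rfl : m₁ = 0 := by omega
  rw [h6] at this; simp at this

lemma turn_pos : 0 < turn s (P.vert (e s j)) (P.vert (e s.opp j)) (P.vert (e s (j + 1))) := by
  have := hS.turn_pos j W.lt
  rwa [W.side] at this

lemma eq_triple : t (j + 1) = {e s j, e s.opp j, e s (j + 1)} := by
  have := hS.eq_triple j W.lt
  rwa [W.side] at this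

lemma mem_interior_iff {z : Pt} : z ∈ interior (P.hull (t (j + 1))) ↔
    0 < P.gap e j z ∧ 0 < turn s (P.vert (e s.opp j)) (P.vert (e s (j + 1))) z ∧
      0 < turn s (P.vert (e s (j + 1))) (P.vert (e s j)) z := by
  rw [W.eq_triple hS, P.interior_hull_iff (W.turn_pos hS), gap_eq P e s]

lemma mem_hull_iff {z : Pt} : z ∈ P.hull (t (j + 1)) ↔
    0 ≤ P.gap e j z ∧ 0 ≤ turn s (P.vert (e s.opp j)) (P.vert (e s (j + 1))) z ∧
      0 ≤ turn s (P.vert (e s (j + 1))) (P.vert (e s j)) z := by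
  rw [W.eq_triple hS, P.hull_iff (W.turn_pos hS), gap_eq P e s]

lemma hull_mem : t (j + 1) ∈ T := hS.mem (j + 1) (by omega) W.lt

/-- The target lies on `b_f`; if later diagonals turn away from it, it remains behind them. -/
lemma gap_target_nonpos : P.gap e j (P.vert Q) ≤ 0 := by
  obtain ⟨f, hfj, hfQ, hlast, -, hsep⟩ := W.exists_sep hS
  have hlt := W.lt
  rcases hfj.eq_or_lt with rfl | hlt'
  · rw [← hfQ, gap_eq P e s]; simp
  · have h1 := hS.gap_last (s := s.opp) (f := f) (by omega) (by rw [hfQ]; exact hlast hlt')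
    rw [hfQ] at h1
    exact (hS.below_of_sep hsep hlt.le (by simp) (by omega) hlt' h1).le

/-- The ray along the visibility line from its target to the exit from the triangle. -/
lemma exists_exit : ∃ f ≤ j, e s.opp f = Q ∧ (∃ m₁ ≤ f, e s m₁ = S) ∧
    (∀ κ, 0 < κ → 0 < P.gap e f (ray (P.vert S) (P.vert Q) κ)) ∧ ∃ κ₁, 0 < κ₁ ∧
      ray (P.vert S) (P.vert Q) κ₁ ∈ openSegment ℝ (P.vert (e s j)) (P.vert (e s (j + 1))) ∧
      (∀ κ, 0 < κ → κ < κ₁ → ray (P.vert S) (P.vert Q) κ ∈ P.inside) ∧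
      (∀ κ, ray (P.vert S) (P.vert Q) κ ∈ P.hull (t (j + 1)) → 0 ≤ κ ∧ κ ≤ κ₁) ∧
      (∀ κ, ray (P.vert S) (P.vert Q) κ ∈ interior (P.hull (t (j + 1))) → 0 < κ ∧ κ < κ₁) ∧
      ∃ κ, ray (P.vert S) (P.vert Q) κ ∈ interior (P.hull (t (j + 1))) := by
  obtain ⟨f, hfj, hfQ, hlast, hm₁, hsep⟩ := W.exists_sep hS
  have hlt := W.lt
  set F := turn s (P.vert S) (P.vert Q) with hF
  have aF : IsAff F := isAff_turn ..
  have hFr : ∀ κ, F (ray (P.vert S) (P.vert Q) κ) = 0 := fun κ => by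
    rw [apply_ray aF]; simp [hF]
  have hA := W.pos_left hS
  have hAf : 0 < F (P.vert (e s f)) := hsep.pos f le_rfl hfj
  have hB : F (P.vert (e s.opp j)) ≤ 0 := (W.line.1 j le_rfl).opp_le s
  have hN : F (P.vert (e s (j + 1))) < 0 := W.neg
  -- the diagonal at the target
  have gapf : ∀ κ, P.gap e f (ray (P.vert S) (P.vert Q) κ) = κ * F (P.vert (e s f)) := fun κ => by
    rw [apply_ray (P.isAff_gap e f), gap_eq P e s, gap_eq P e s, hfQ, hF]
    rw [turn_self_right, turn_swap' s _ _ (P.vert S), turn_cyc s _ (P.vert S)]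
    ring
  have gapjQ := W.gap_target_nonpos hS
  -- the exit
  obtain ⟨y, hy, hFy⟩ := aF.exists_zero_open hA hN
  have gapjy : 0 < P.gap e j y := (P.isAff_gap e j).pos_openSegment (by simp [gap_eq P e s])
    (by rw [gap_eq P e s]; exact W.turn_pos hS) hy
  obtain ⟨κ₁, rfl⟩ := exists_ray (W.ne hS) hFy
  have hκ₁ : 0 < κ₁ := by
    have h1 : 0 < P.gap e f (ray (P.vert S) (P.vert Q) κ₁) := by
      rcases hfj.eq_or_lt with h | h
      · rw [h]; exact gapjy
      · exact hS.above_of_sep hsep hlt.le hFy gapjy.le le_rfl h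
    rw [gapf] at h1
    exact pos_of_mul_pos_left h1 hAf.le
  set ψ := turn s (P.vert (e s (j + 1))) (P.vert (e s j)) with hψ
  have aψ : IsAff ψ := isAff_turn ..
  have ψy : ψ (ray (P.vert S) (P.vert Q) κ₁) = 0 := aψ.eq_zero_segment (by simp [hψ])
    (by simp [hψ]) (openSegment_subset_segment _ _ _ hy)
  -- the entry
  obtain ⟨y₁, hy₁, gapy₁⟩ := (P.isAff_gap e j).exists_zero gapjy.le gapjQ
  have hFy₁ : F y₁ = 0 := aF.eq_zero_segment hFy (by simp [hF]) hy₁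
  have ψB : 0 < ψ (P.vert (e s.opp j)) := by
    have := W.turn_pos hS
    rwa [turn_cyc, turn_cyc] at this
  have ψy₁ : 0 < ψ y₁ := by
    have hD := W.turn_pos hS
    have h1 := aF.bary s (P.vert (e s j)) (P.vert (e s.opp j)) (P.vert (e s (j + 1))) y₁
    have h2 := turn_sum s (P.vert (e s j)) (P.vert (e s.opp j)) (P.vert (e s (j + 1))) y₁
    rw [hFy₁, ← gap_eq P e s j y₁, gapy₁] at h1
    rw [← gap_eq P e s j y₁, gapy₁] at h2
    by_contra hc
    have hc : turn s (P.vert (e s (j + 1))) (P.vert (e s j)) y₁ ≤ 0 := not_lt.1 hc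
    nlinarith [mul_pos (by linarith : 0 < turn s (P.vert (e s.opp j)) (P.vert (e s (j + 1))) y₁) hA,
      mul_nonneg (neg_nonneg.2 hc) (neg_nonneg.2 hB)]
  have ψQ : 0 < ψ (P.vert Q) := by
    rw [segment_eq_image'] at hy₁
    obtain ⟨μ, ⟨h0, h1⟩, rfl⟩ := hy₁
    rw [aψ.lineMap, ψy] at ψy₁
    exact pos_of_mul_pos_right (by linarith) h0
  -- Along the ray, `ψ` is an affine function of the parameter with zero at the exit `κ₁`. Thus its
  -- sign tells whether the side has been passed.
  have ψr : ∀ κ, κ₁ * ψ (ray (P.vert S) (P.vert Q) κ) = (κ₁ - κ) * ψ (P.vert Q) := fun κ => by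
    rw [apply_ray aψ] at ψy ⊢
    linear_combination κ * ψy
  have hint : ∀ κ, κ < κ₁ → 0 < P.gap e j (ray (P.vert S) (P.vert Q) κ) →
      ray (P.vert S) (P.vert Q) κ ∈ interior (P.hull (t (j + 1))) := by
    intro κ hκ hg
    have h1 : 0 < ψ (ray (P.vert S) (P.vert Q) κ) := by
      have := ψr κ
      have h2 := mul_pos (sub_pos.2 hκ) ψQ
      rw [← this] at h2
      exact pos_of_mul_pos_right h2 hκ₁.le
    refine (W.mem_interior_iff hS).2 ⟨hg, ?_, h1⟩
    have h2 := aF.bary s (P.vert (e s j)) (P.vert (e s.opp j)) (P.vert (e s (j + 1)))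
      (ray (P.vert S) (P.vert Q) κ)
    rw [hFr, ← gap_eq P e s j (ray (P.vert S) (P.vert Q) κ)] at h2
    by_contra hc
    push Not at hc
    nlinarith [mul_nonneg (neg_nonneg.2 hc) hA.le, mul_nonneg h1.le (neg_nonneg.2 hB),
      mul_pos hg (neg_pos.2 hN)]
  refine ⟨f, hfj, hfQ, hm₁, fun κ h => by rw [gapf]; positivity, κ₁, hκ₁, hy, ?_, ?_, ?_, ?_⟩
  · intro κ h0 h1
    rcases lt_trichotomy (P.gap e j (ray (P.vert S) (P.vert Q) κ)) 0 with h2 | h2 | h2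
    · exact hS.inside_of_sep hsep hlt.le (hFr κ) (by rw [gapf]; positivity) h2 hfj
    · have hfj' : f < j := hfj.lt_of_ne (by
        rintro rfl
        rw [gapf] at h2; exact (mul_pos h0 hAf).ne' h2)
      exact hS.openSegment_subset_inside (by omega) hlt s
        (IsSleeve.mem_openSegment_of_gap aF hA (hsep.neg j hfj' le_rfl) (hFr κ) h2)
    · exact hS.tri.interior_subset_inside hS.gp (W.hull_mem hS) (hint κ h1 h2)
  · intro κ hκ
    have h1 := (W.mem_hull_iff hS).1 hκ
    constructor
    · have h2 : 0 ≤ P.gap e f (ray (P.vert S) (P.vert Q) κ) := by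
        rcases hfj.eq_or_lt with h | h
        · rw [h]; exact h1.1
        · exact (hS.above_of_sep hsep hlt.le (hFr κ) h1.1 le_rfl h).le
      rw [gapf] at h2
      exact nonneg_of_mul_nonneg_left h2 hAf
    · have h2 := mul_nonneg hκ₁.le h1.2.2
      rw [ψr] at h2
      linarith [nonneg_of_mul_nonneg_left h2 ψQ]
  · intro κ hκ
    have h1 := (W.mem_interior_iff hS).1 hκ
    constructor
    · have h2 : 0 < P.gap e f (ray (P.vert S) (P.vert Q) κ) := by
        rcases hfj.eq_or_lt with h | h
        · rw [h]; exact h1.1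
        · exact hS.above_of_sep hsep hlt.le (hFr κ) h1.1.le le_rfl h
      rw [gapf] at h2
      exact pos_of_mul_pos_left h2 hAf.le
    · have h2 := mul_pos hκ₁ h1.2.2
      rw [ψr] at h2
      linarith [pos_of_mul_pos_left h2 ψQ.le]
  · have hc : ∀ᶠ κ in 𝓝[<] κ₁, 0 < P.gap e j (ray (P.vert S) (P.vert Q) κ) := by
      have : Continuous fun κ => P.gap e j (ray (P.vert S) (P.vert Q) κ) :=
        (P.isAff_gap e j).continuous.comp (continuous_ray _ _)
      exact (this.tendsto κ₁).mono_left nhdsWithin_le_nhds (isOpen_Ioi.mem_nhds gapjy)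
    obtain ⟨κ, h1, h2⟩ := (hc.and self_mem_nhdsWithin).exists
    exact ⟨κ, hint κ h2 h1⟩

end Window

end SimplePolygon

/-! ### The segment of the visibility line as an edge of the visibility polygon. -/

namespace SimplePolygon

variable {n : ℕ} [NeZero n] {P : SimplePolygon n} {T : Finset (Finset (Fin n))} {k : ℕ}
  {t : ℕ → Finset (Fin n)} {e : Side → ℕ → Fin n}

namespace Window

variable {s : Side} {j : ℕ} {S Q S' Q' : Fin n} (W : P.Window e k s j S Q S' Q')
  (hS : P.IsSleeve T k t e)
include W hS

lemma exists_firstHit : IsFirstHit P.curve (P.vert S) (P.vert Q)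
    (firstHit P.curve (P.vert S) (P.vert Q)) := by
  obtain ⟨-, -, -, -, -, κ₁, h1, -, h2, -⟩ := W.exists_exit hS
  exact Classical.epsilon_spec (exists_isFirstHit (W.ne hS) h1 h2)

variable {x : Pt} (hx : IsFirstHit P.curve (P.vert S) (P.vert Q) x)
include hx

/-- Up to its exit from the triangle the ray is inside, so the first hit is not earlier and bounds
all parameters in the triangle. -/
lemma hit : ∃ κx, 0 < κx ∧ x = ray (P.vert S) (P.vert Q) κx ∧ x ∈ P.curve ∧
    (∀ κ, 0 < κ → κ < κx → ray (P.vert S) (P.vert Q) κ ∈ P.inside) ∧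
    (∀ κ, ray (P.vert S) (P.vert Q) κ ∈ P.hull (t (j + 1)) → 0 ≤ κ ∧ κ ≤ κx) ∧
    (∀ κ, ray (P.vert S) (P.vert Q) κ ∈ interior (P.hull (t (j + 1))) → 0 < κ ∧ κ < κx) := by
  obtain ⟨f, -, -, -, -, κ₁, h1, -, h2, h3, h4, -⟩ := W.exists_exit hS
  obtain ⟨κx, k1, rfl, k2, k3⟩ := hx
  have hle : κ₁ ≤ κx := by
    by_contra hc
    exact (h2 κx k1 (not_le.1 hc)).1 k2
  have key : ray (P.vert S) (P.vert Q) '' Ioo 0 κx ⊆ P.inside := by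
    refine subset_inside (isPreconnected_Ioo.image _ (continuous_ray _ _).continuousOn) ?_ ?_
    · rintro _ ⟨κ, hκ, rfl⟩
      exact k3 κ hκ.1 hκ.2
    · exact ⟨_, ⟨κ₁ / 2, ⟨by linarith, by linarith⟩, rfl⟩, h2 _ (by linarith) (by linarith)⟩
  refine ⟨κx, k1, rfl, k2, fun κ h h' => key ⟨κ, ⟨h, h'⟩, rfl⟩, fun κ h => ?_, fun κ h => ?_⟩
  · exact ⟨(h3 κ h).1, (h3 κ h).2.trans hle⟩
  · exact ⟨(h4 κ h).1, (h4 κ h).2.trans_le hle⟩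

omit W hS hx in
lemma turn_ray (κ : ℝ) :
    turn s (P.vert S) (P.vert Q) (ray (P.vert S) (P.vert Q) κ) = 0 := by
  rw [apply_ray (isAff_turn ..)]; simp

/-- Points near the window beyond the visibility line are not visible. -/
lemma exists_ball_notMem_visible {κx : ℝ} (hκx : x = ray (P.vert S) (P.vert Q) κx) {κ : ℝ}
    (h0 : 0 < κ) (h1 : κ < κx) : ∃ r > 0, ∀ z ∈ Metric.ball (ray (P.vert S) (P.vert Q) κ) r,
      turn s (P.vert S) (P.vert Q) z < 0 → z ∉ P.visible (e .left 0) (e .right 0) := by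
  have hlt := W.lt
  obtain ⟨κx', k1, rfl, k2, k3, k4, k5⟩ := W.hit hS hx
  obtain rfl := ray_injective (W.ne hS) hκx.symm
  obtain ⟨f, hfj, hfQ, ⟨m₁, hm₁, hm₁S⟩, hgap, -, -, -, -, -, -, κc, hκc⟩ := W.exists_exit hS
  obtain ⟨hc0, hc1⟩ := k5 κc hκc
  set y := ray (P.vert S) (P.vert Q) κ with hy
  have hopen : IsOpen (P.inside ∩ {z | 0 < P.gap e f z}) :=
    P.isOpen_inside.inter (P.isAff_gap e f).isOpen_pos
  obtain ⟨r, hr, hball⟩ := Metric.isOpen_iff.1 hopen y ⟨k3 κ h0 h1, hgap κ h0⟩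
  refine ⟨r, hr, fun z hz hneg hvis => ?_⟩
  obtain ⟨hzi, q, hq, hzq⟩ := hvis
  have hzv : ∀ l, z ≠ P.vert l := fun l hl => P.vert_notMem_inside l (hl ▸ hzi)
  have hqd : q ∈ P.diag e 0 := openSegment_subset_segment _ _ _ hq
  have hqc := hS.diag_zero_subset_curve hqd
  have hreg := IsSleeve.segment_subset_region (Or.inl hzi) (Or.inr hqc) hzq
  have hmeet : ∀ m, 1 ≤ m → m ≤ f → (segment ℝ z q ∩ P.diag e m).Nonempty := by
    intro m hm hmf
    -- The disc and the ray join `z` to the last triangle without meeting `b_f`. So `z` is in a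
    -- triangle of the color beyond `b_f`, and its line of sight to `a` must cross `b_f`.
    have hf : (segment ℝ z q ∩ P.diag e f).Nonempty := by
      obtain ⟨χ, c1, c2, c3, c4, c5⟩ := hS.color f (by omega) (by omega)
      obtain ⟨t', ht', hzt'⟩ := hS.tri.exists_mem_hull (Or.inl hzi)
      have hzcl := hzt'
      rw [← hS.tri.closure_interior ht'] at hzcl
      obtain ⟨z', hz', hz't⟩ := mem_closure_iff.1 hzcl _ Metric.isOpen_ball hz
      have hχ := c5 (ray (P.vert S) (P.vert Q) '' Ioo 0 κx ∪ Metric.ball y r)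
        ((isPreconnected_Ioo.image _ (continuous_ray _ _).continuousOn).union y ⟨κ, ⟨h0, h1⟩, rfl⟩
          (Metric.mem_ball_self hr) (convex_ball y r).isPreconnected)
        (union_subset (by rintro _ ⟨a, ha, rfl⟩; exact k3 a ha.1 ha.2) fun w hw => (hball hw).1)
        (by
          rw [Set.disjoint_left]
          intro w hw hwd
          have h1 : P.gap e f w = 0 := (P.isAff_gap e f).eq_zero_segment (by simp [gap])
            (by simp [gap]) hwd
          have h2 : 0 < P.gap e f w := by
            rcases hw with ⟨a, ha, rfl⟩ | hw
            · exact hgap a ha.1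
            · exact (hball hw).2
          linarith) t' ht' (t (j + 1)) (W.hull_mem hS) ⟨z', Or.inr hz', hz't⟩
          ⟨_, Or.inl ⟨κc, ⟨hc0, hc1⟩, rfl⟩, hκc⟩
      refine IsTriangulation.meets_of_coloring hS.tri c4 (convex_segment z q).isPreconnected hreg
        ht' (hS.mem 1 le_rfl (by omega)) ?_ ⟨z, left_mem_segment .., hzt'⟩
        ⟨q, right_mem_segment .., hS.diag_subset_succ (by omega) hqd⟩
      rw [hχ, c1 1 le_rfl (by omega), c2 (j + 1) (by omega) (by omega)]
      exact c3.symm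
    rcases hmf.eq_or_lt with rfl | hmf
    · exact hf
    · obtain ⟨w, hw, hwd⟩ := hf
      have hsub : segment ℝ w q ⊆ segment ℝ z q :=
        (convex_segment z q).segment_subset hw (right_mem_segment ..)
      obtain ⟨w', hw', hw'd⟩ := hS.meets (m := m) (j := 1) (j' := f) le_rfl hm hmf (by omega)
        (convex_segment w q).isPreconnected (hsub.trans hreg)
        ⟨q, right_mem_segment .., hS.diag_subset_succ (by omega) hqd⟩
        ⟨w, left_mem_segment .., hS.diag_subset (by omega) (by omega) hwd⟩
      exact ⟨w', hsub hw', hw'd⟩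
  obtain ⟨g, hg, hgz, -⟩ := hS.exists_strictSep (by omega) hq hzv hzq hmeet
  obtain ⟨g', hg', h0'⟩ := hg.to_side s
  have := IsSleeve.turn_pos_of_strictSep hg' hm₁ le_rfl hm₁S hfQ (W.line.1 f hfj) (h0' z hgz)
    (hball hz).2
  linarith

/-- The window belongs to the visibility polygon. -/
lemma ray_mem_visPolygon {κx : ℝ} (hκx : x = ray (P.vert S) (P.vert Q) κx) {κ : ℝ}
    (h0 : 0 < κ) (h1 : κ < κx) :
    ray (P.vert S) (P.vert Q) κ ∈ P.visPolygon (e .left 0) (e .right 0) := by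
  have hlt := W.lt
  obtain ⟨κx', k1, rfl, k2, k3, k4, k5⟩ := W.hit hS hx
  obtain rfl := ray_injective (W.ne hS) hκx.symm
  obtain ⟨-, -, -, -, -, -, -, -, -, -, -, κc, hκc⟩ := W.exists_exit hS
  obtain ⟨hc0, hc1⟩ := k5 κc hκc
  -- The function `l` vanishes on the perpendicular bisector of `S Q`. Adding a small multiple turns
  -- the visibility line about the midpoint, which moves `S` and `Q` strictly to their own sides.
  obtain ⟨l, hl, hlS, hlQ⟩ : ∃ l, IsAff l ∧ 0 < l (P.vert S) ∧ l (P.vert Q) < 0 := by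
    have hd := sq_dist_pos (W.ne hS)
    refine ⟨fun z => -((P.vert Q 0 - P.vert S 0) * (z 0 - (P.vert S 0 + P.vert Q 0) / 2) +
      (P.vert Q 1 - P.vert S 1) * (z 1 - (P.vert S 1 + P.vert Q 1) / 2)), ?_, ?_, ?_⟩
    · exact ⟨-(P.vert Q 0 - P.vert S 0), -(P.vert Q 1 - P.vert S 1),
        (P.vert Q 0 - P.vert S 0) * ((P.vert S 0 + P.vert Q 0) / 2) +
          (P.vert Q 1 - P.vert S 1) * ((P.vert S 1 + P.vert Q 1) / 2), fun z => by ring⟩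
    · nlinarith
    · nlinarith
  refine hS.mem_visPolygon_of_eventually (s := s) (isAff_turn s (P.vert S) (P.vert Q)) hl hlt
    (eventually_strictSep (isAff_turn ..) hl (fun m hm => ?_) fun m hm => ?_) (W.pos_left hS) hκc
    (turn_ray κc) (turn_ray κ) ?_
  · by_cases he : e s m = S
    · exact Or.inr ⟨by rw [he]; simp, by rwa [he]⟩
    · exact Or.inl (W.line.pos hS hlt.le hm he)
  · by_cases he : e s.opp m = Q
    · exact Or.inr ⟨by rw [he]; simp, by rwa [he]⟩
    · exact Or.inl (W.line.neg hS hlt.le hm he)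
  · intro z hz
    rcases le_total κ κc with h | h
    · rw [segment_ray _ _ h] at hz
      obtain ⟨a, ha, rfl⟩ := hz
      exact k3 a (by linarith [ha.1]) (by linarith [ha.2])
    · rw [segment_symm, segment_ray _ _ h] at hz
      obtain ⟨a, ha, rfl⟩ := hz
      exact k3 a (by linarith [ha.1]) (by linarith [ha.2])

/-- The relatively interior points belong to the visibility polygon, but close to them there is
nothing visible on the side of the new vertex. -/
lemma segment_subset_frontier :
    segment ℝ (P.vert Q) x ⊆ frontier (P.visPolygon (e .left 0) (e .right 0)) := by
  obtain ⟨κx, k1, hκx, k2, k3, k4, k5⟩ := W.hit hS hx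
  have hopen : openSegment ℝ (P.vert Q) x ⊆ frontier (P.visPolygon (e .left 0) (e .right 0)) := by
    rw [hκx, openSegment_eq_ray _ _ k1]
    rintro _ ⟨κ, ⟨h0, h1⟩, rfl⟩
    refine ⟨subset_closure (W.ray_mem_visPolygon hS hx hκx h0 h1), fun hint => ?_⟩
    obtain ⟨r, hr, hball⟩ := W.exists_ball_notMem_visible hS hx hκx h0 h1
    have hA := isAff_turn s (P.vert S) (P.vert Q)
    obtain ⟨ε, ⟨e1, e2⟩, e3⟩ := ((eventually_mem_open isOpen_interior hint
      (P.vert (e s (j + 1)))).and (eventually_mem_open Metric.isOpen_ball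
        (Metric.mem_ball_self hr) (P.vert (e s (j + 1)))) |>.and (Ioo_mem_nhdsGT one_pos)).exists
    have e4 : 0 < -turn s (P.vert S) (P.vert Q) (ray (P.vert S) (P.vert Q) κ +
        ε • (P.vert (e s (j + 1)) - ray (P.vert S) (P.vert Q) κ)) := by
      rw [hA.lineMap, turn_ray]
      have := mul_pos e3.1 (neg_pos.2 W.neg); linarith
    obtain ⟨z, ⟨z1, z2⟩, z3⟩ := mem_closure_iff.1 (interior_subset e1) _
      (Metric.isOpen_ball.inter hA.neg.isOpen_pos) ⟨e2, e4⟩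
    exact hball z z1 (by have : 0 < -turn s (P.vert S) (P.vert Q) z := z2; linarith) z3
  rw [← closure_openSegment]
  exact closure_minimal hopen isClosed_frontier

lemma openSegment_subset_inside : openSegment ℝ (P.vert Q) x ⊆ P.inside := by
  obtain ⟨κx, k1, hκx, k2, k3, k4, k5⟩ := W.hit hS hx
  rw [hκx, openSegment_eq_ray _ _ k1]
  rintro _ ⟨κ, ⟨h0, h1⟩, rfl⟩
  exact k3 κ h0 h1

lemma isBoundarySegment :
    P.IsBoundarySegment (P.visPolygon (e .left 0) (e .right 0)) (segment ℝ (P.vert Q) x) := by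
  refine ⟨P.vert Q, x, ?_, rfl, W.segment_subset_frontier hS hx, fun i hi =>
    P.vert_notMem_inside i (W.openSegment_subset_inside hS hx hi)⟩
  obtain ⟨κx, k1, hκx, -⟩ := W.hit hS hx
  intro h
  rw [hκx] at h
  exact k1.ne (ray_injective (W.ne hS) ((ray_zero _ _).trans h))

omit W hS in
lemma eventually_outside (hP : P.GeneralPosition) (hi : openSegment ℝ (P.vert Q) x ⊆ P.inside)
    (hv : ∀ l, x ≠ P.vert l) :
    ∀ᶠ ε : ℝ in 𝓝[>] 0, x + ε • (x - P.vert Q) ∈ P.outside := by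
  obtain ⟨-, -, -, hc, -⟩ := hx
  exact P.eventually_mem_outside hP hc hv hi

/-- A boundary segment of the visibility polygon on the visibility line is part of the window. -/
lemma subset_of_isBoundarySegment {w : Set Pt}
    (hw : P.IsBoundarySegment (P.visPolygon (e .left 0) (e .right 0)) w)
    (hw0 : ∀ z ∈ w, turn s (P.vert S) (P.vert Q) z = 0) {c : Pt} (hcw : c ∈ w)
    (hc : c ∈ openSegment ℝ (P.vert Q) x) : w ⊆ segment ℝ (P.vert Q) x := by
  obtain ⟨κx, k1, hκx, k2, k3, k4, k5⟩ := W.hit hS hx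
  have hne := W.ne hS
  have hins := W.openSegment_subset_inside hS hx
  obtain ⟨p, q, hpq, rfl, hfr, hvert⟩ := hw
  obtain ⟨a, rfl⟩ := exists_ray hne (hw0 p (left_mem_segment ..))
  obtain ⟨b, rfl⟩ := exists_ray hne (hw0 q (right_mem_segment ..))
  have hout := eventually_outside hx hS.gp hins
  rw [hκx] at hc ⊢ hout
  rw [openSegment_eq_ray _ _ k1] at hc
  rw [segment_eq_ray _ _ k1.le]
  obtain ⟨γ, hγ, rfl⟩ := hc
  wlog hab : a ≤ b generalizing a b
  · rw [segment_symm] at hcw hfr hw0 ⊢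
    exact this b a hpq.symm hw0 hfr (fun i => by rw [openSegment_symm]; exact hvert i) hcw
      (by linarith)
  have hab' : a < b := hab.lt_of_ne (by rintro rfl; exact hpq rfl)
  rw [segment_ray _ _ hab] at hcw hfr ⊢
  rw [openSegment_ray _ _ hab'] at hvert
  obtain ⟨γ', hγ', he⟩ := hcw
  obtain rfl := ray_injective hne he
  refine image_mono (Icc_subset_Icc ?_ ?_)
  · by_contra hlt
    push Not at hlt
    -- A segment reaching back beyond the target would have the vertex `Q` in its relative interior.
    exact hvert Q ⟨0, ⟨hlt, by linarith [hγ.1, hγ'.2]⟩, ray_zero ..⟩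
  · by_contra hlt
    push Not at hlt
    -- A segment reaching beyond `x` would pass through a vertex there or contain exterior points.
    have hxv : ∀ l, ray (P.vert S) (P.vert Q) κx ≠ P.vert l := fun l hl =>
      hvert l ⟨κx, ⟨by linarith [hγ.2, hγ'.1], hlt⟩, hl⟩
    have h1 : ∀ᶠ ε : ℝ in 𝓝[>] 0, κx + ε * κx < b := by
      have hc : Continuous fun ε : ℝ => κx + ε * κx := by fun_prop
      exact (hc.tendsto 0).mono_left nhdsWithin_le_nhds (isOpen_Iio.mem_nhds (by simpa using hlt))
    obtain ⟨ε, ⟨e1, e2⟩, e3⟩ := ((hout hxv).and h1 |>.and self_mem_nhdsWithin).exists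
    rw [ray_of_ray] at e1
    have e4 := mul_pos (mem_Ioi.1 e3) k1
    have e5 : ray (P.vert S) (P.vert Q) (κx + ε * κx) ∈
        frontier (P.visPolygon (e .left 0) (e .right 0)) :=
      hfr ⟨_, ⟨by linarith [hγ.2, hγ'.1], e2.le⟩, rfl⟩
    exact P.visPolygon_subset (isClosed_closure.frontier_subset e5) e1

/-- A larger boundary segment contains `Q` and `x`, hence lies on the same line, where nothing
larger is possible. -/
lemma isEdgeOf : P.IsEdgeOf (P.visPolygon (e .left 0) (e .right 0)) (segment ℝ (P.vert Q) x) := by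
  refine ⟨W.isBoundarySegment hS hx, fun w hw hsub => Subset.antisymm ?_ hsub⟩
  obtain ⟨c, hc⟩ : (openSegment ℝ (P.vert Q) x).Nonempty := ⟨_, midpoint_mem_openSegment ..⟩
  have hcw := hsub (openSegment_subset_segment _ _ _ hc)
  refine W.subset_of_isBoundarySegment hS hx hw ?_ hcw hc
  have hA := isAff_turn s (P.vert S) (P.vert Q)
  obtain ⟨κx, k1, hκx, -⟩ := W.hit hS hx
  have h0 : ∀ z ∈ segment ℝ (P.vert Q) x, turn s (P.vert S) (P.vert Q) z = 0 := fun z hz =>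
    hA.eq_zero_segment (by simp) (by rw [hκx]; exact turn_ray κx) hz
  obtain ⟨p, q, hpq, rfl, -⟩ := hw
  have hne : P.vert Q ≠ x := by
    obtain ⟨p', q', h1, h2, -⟩ := W.isBoundarySegment hS hx
    rintro rfl
    rw [segment_same] at h2
    have e1 : p' = P.vert Q := by
      have : p' ∈ ({P.vert Q} : Set Pt) := h2 ▸ left_mem_segment ..
      simpa using this
    have e2 : q' = P.vert Q := by
      have : q' ∈ ({P.vert Q} : Set Pt) := h2 ▸ right_mem_segment ..
      simpa using this
    exact h1 (e1.trans e2.symm)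
  exact hA.eq_zero_of_two_zeros (hsub (left_mem_segment ..)) (hsub (right_mem_segment ..)) hne
    (h0 _ (left_mem_segment ..)) (h0 _ (right_mem_segment ..))

end Window

end SimplePolygon

/-! ### Uniqueness of the window. -/

namespace SimplePolygon

variable {n : ℕ} [NeZero n] {P : SimplePolygon n} {T : Finset (Finset (Fin n))} {k : ℕ}
  {t : ℕ → Finset (Fin n)} {e : Side → ℕ → Fin n}

namespace Window

variable {s : Side} {j : ℕ} {S Q S' Q' : Fin n} (W : P.Window e k s j S Q S' Q')
  (hS : P.IsSleeve T k t e)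
include W hS

/-- Beyond `b_j`, the visibility lines do not meet. -/
lemma turn_pos_of_line' {p c : Pt} (hp : p ∈ P.hull (t (j + 1)))
    (hc : c ∈ interior (P.hull (t (j + 1)))) (hp0 : turn s (P.vert S') (P.vert Q') p = 0)
    (hc0 : turn s (P.vert S') (P.vert Q') c = 0) : 0 < turn s (P.vert S) (P.vert Q) p := by
  have hlt := W.lt
  have hl' : P.Line e s.opp.opp j S' Q' := by rw [Side.opp_opp]; exact W.line'
  have gp := ((W.mem_hull_iff hS).1 hp).1
  have gc := ((W.mem_interior_iff hS).1 hc).1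
  have hA := isAff_turn s (P.vert S) (P.vert Q)
  obtain ⟨f, hfj, hfQ, -, ⟨m₁, hm₁, hmS⟩, hsep | ⟨rfl, hS'⟩⟩ := hl'.exists_sep hS hlt
  · rw [Side.opp_opp] at hfQ
    have hμ := hsep.pos f le_rfl hfj
    rw [turn_opp] at hμ
    obtain ⟨κ, rfl⟩ := exists_ray (fun h => hl'.ne hS hlt.le (P.injective h)) hp0
    have hgap : P.gap e f (ray (P.vert S') (P.vert Q') κ) =
        κ * -turn s (P.vert S') (P.vert Q') (P.vert (e s.opp f)) := by
      rw [apply_ray (P.isAff_gap e f), gap_eq P e s, gap_eq P e s, hfQ]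
      rw [turn_self_left, ← turn_cyc s (P.vert S')]
      ring
    have hκ : 0 ≤ κ := by
      have h2 : 0 ≤ P.gap e f (ray (P.vert S') (P.vert Q') κ) := by
        rcases hfj.eq_or_lt with h | h
        · rw [h]; exact gp
        · exact (hS.above_of_sep hsep hlt.le (by rw [turn_opp, hp0, neg_zero]) gp le_rfl h).le
      rw [hgap] at h2
      exact nonneg_of_mul_nonneg_left h2 hμ
    have hQ0 : 0 ≤ turn s (P.vert S) (P.vert Q) (P.vert Q') := hfQ ▸ W.line.1 f hfj s
    have hS0 : turn s (P.vert S) (P.vert Q) (P.vert S') ≤ 0 :=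
      hmS ▸ (W.line.1 m₁ (by omega)).opp_le s
    by_contra hcon
    push Not at hcon
    rw [apply_ray hA] at hcon
    have hQS : Q' = S := by
      by_contra hne
      have := W.line.pos hS hlt.le hfj (by rwa [hfQ])
      rw [hfQ] at this
      nlinarith
    rcases hκ.eq_or_lt with rfl | hκ
    · rcases hfj.eq_or_lt with rfl | h
      · have := W.pos_left hS
        rw [hfQ, hQS] at this; simp at this
      · have := hS.above_of_sep hsep hlt.le (by rw [turn_opp, hp0, neg_zero]) gp le_rfl h
        rw [hgap] at this; simp at this
    · have hSQ : S' = Q := by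
        by_contra hne
        have := W.line.neg hS hlt.le (m := m₁) (by omega) (by rwa [hmS])
        rw [hmS] at this
        nlinarith
      exact W.ne_zero hS (hS.eq_zero_of_stab_both hlt.le (W.line.ne hS hlt.le) W.line.1
        fun m hm => hQS ▸ hSQ ▸ W.line'.1 m hm)
  · rw [Side.opp_opp] at hfQ
    rw [← hS', ← hfQ, turn_swap, ← gap_eq P e s] at hc0
    linarith

variable {x : Pt} (hx : IsFirstHit P.curve (P.vert S) (P.vert Q) x)
include hx

lemma mem_segment_of_turn_eq_zero {z : Pt} (hz : z ∈ P.hull (t (j + 1)))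
    (h0 : turn s (P.vert S) (P.vert Q) z = 0) : z ∈ segment ℝ (P.vert Q) x := by
  obtain ⟨κx, k1, rfl, k2, k3, k4, k5⟩ := W.hit hS hx
  obtain ⟨κ, rfl⟩ := exists_ray (W.ne hS) h0
  rw [segment_eq_ray _ _ k1.le]
  exact ⟨κ, k4 κ hz, rfl⟩

lemma mem_openSegment_of_turn_eq_zero {z : Pt} (hz : z ∈ interior (P.hull (t (j + 1))))
    (h0 : turn s (P.vert S) (P.vert Q) z = 0) : z ∈ openSegment ℝ (P.vert Q) x := by
  obtain ⟨κx, k1, rfl, k2, k3, k4, k5⟩ := W.hit hS hx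
  obtain ⟨κ, rfl⟩ := exists_ray (W.ne hS) h0
  rw [openSegment_eq_ray _ _ k1]
  exact ⟨κ, k5 κ hz, rfl⟩

omit hx in
/-- Edges of the visibility polygon in the last triangle are on the visible side. -/
lemma turn_nonneg_of_isEdgeOf {w : Set Pt}
    (hw : P.IsEdgeOf (P.visPolygon (e .left 0) (e .right 0)) w)
    (hwi : (w ∩ interior (P.hull (t (j + 1)))).Nonempty) {p : Pt} (hp : p ∈ w)
    (hp' : p ∈ P.hull (t (j + 1))) : 0 ≤ turn s (P.vert S) (P.vert Q) p := by
  obtain ⟨⟨a, b, -, rfl, hfr, -⟩, -⟩ := hw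
  obtain ⟨c, hcw, hci⟩ := hwi
  have hsub : openSegment ℝ c p ⊆ {z | 0 ≤ turn s (P.vert S) (P.vert Q) z} := by
    intro z hz
    exact W.line.turn_nonneg_of_mem_visPolygon hS W.lt (isClosed_closure.frontier_subset (hfr
      ((convex_segment a b).openSegment_subset hcw hp hz)))
      ((P.convex_hull _).openSegment_interior_self_subset_interior hci hp' hz)
  have hcl : p ∈ closure (openSegment ℝ c p) := by
    rw [closure_openSegment]; exact right_mem_segment ..
  exact closure_minimal hsub (isClosed_le continuous_const (isAff_turn ..).continuous) hcl

omit hx in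
lemma turn_nonpos_of_mem_diag {z : Pt} (hz : z ∈ P.diag e (j + 1)) :
    turn s (P.vert S) (P.vert Q) z ≤ 0 := by
  rw [diag_eq P e s] at hz
  refine (isAff_turn s _ _).nonpos_segment W.neg.le ?_ hz
  have := hS.same j W.lt
  rw [W.side] at this
  rw [this]
  exact (W.line.1 j le_rfl).opp_le s

/-- Every other edge is on the visible side of the line, and the diagonal is on the other side. So
each connection from that edge to the diagonal passes through the window within the triangle, and
the rest of it is no longer. -/
lemma isWindow : P.IsWindow (e .left 0) (e .right 0) (t (j + 1)) (e .left (j + 1))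
    (e .right (j + 1)) (segment ℝ (P.vert Q) x) := by
  have hA := isAff_turn s (P.vert S) (P.vert Q)
  refine ⟨W.isEdgeOf hS hx, ?_, fun w hw hwi p' hp' z' hz' => ?_⟩
  · obtain ⟨-, -, -, -, -, -, -, -, -, -, -, κ, hκ⟩ := W.exists_exit hS
    exact ⟨_, openSegment_subset_segment _ _ _
      (W.mem_openSegment_of_turn_eq_zero hS hx hκ (turn_ray κ)), hκ⟩
  · obtain ⟨p, hp, hp0⟩ := hA.exists_zero (W.turn_nonneg_of_isEdgeOf hS hw hwi hp'.1 hp'.2)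
      (W.turn_nonpos_of_mem_diag hS hz')
    have hph : p ∈ P.hull (t (j + 1)) := (P.convex_hull _).segment_subset hp'.2
      (hS.diag_subset (by omega) W.lt hz') hp
    refine ⟨p, ⟨W.mem_segment_of_turn_eq_zero hS hx hph hp0, hph⟩, z', hz', ?_⟩
    rw [← dist_add_dist_of_mem_segment hp]
    linarith [dist_nonneg (x := p') (y := p)]

omit hx in
/-- The edge of the visibility polygon through a triangle that touches the visibility line. -/
lemma turn_eq_zero_of_isEdgeOf {w : Set Pt}
    (hw : P.IsEdgeOf (P.visPolygon (e .left 0) (e .right 0)) w) {p c : Pt} (hp : p ∈ w)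
    (hp' : p ∈ P.hull (t (j + 1))) (hp0 : turn s (P.vert S) (P.vert Q) p = 0) (hc : c ∈ w)
    (hc' : c ∈ interior (P.hull (t (j + 1)))) : turn s (P.vert S) (P.vert Q) c = 0 := by
  have hA := isAff_turn s (P.vert S) (P.vert Q)
  have hA' := isAff_turn s (P.vert S') (P.vert Q')
  have hc1 := W.turn_nonneg_of_isEdgeOf hS hw ⟨c, hc, hc'⟩ hc (interior_subset hc')
  by_contra hne
  have hc2 : 0 < turn s (P.vert S) (P.vert Q) c := hc1.lt_of_ne (Ne.symm hne)
  obtain ⟨⟨a, b, -, rfl, hfr, -⟩, -⟩ := hw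
  have hl' : P.Line e s.opp.opp j S' Q' := by rw [Side.opp_opp]; exact W.line'
  -- Strictly between the two visibility lines, points of the triangle are interior to the
  -- visibility polygon. A frontier point strictly on the visible side of the first line is
  -- therefore on the second one.
  have key : ∀ z ∈ segment ℝ a b, z ∈ interior (P.hull (t (j + 1))) →
      0 < turn s (P.vert S) (P.vert Q) z → turn s (P.vert S') (P.vert Q') z = 0 := by
    intro z hz hzi hz1
    have h1 := hl'.turn_nonneg_of_mem_visPolygon hS W.lt
      (isClosed_closure.frontier_subset (hfr hz)) hzi
    rw [turn_opp] at h1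
    by_contra h0
    have h2 : 0 < -turn s (P.vert S') (P.vert Q') z := h1.lt_of_ne (by
      intro h; exact h0 (by linarith))
    have hopen : IsOpen (interior (P.hull (t (j + 1))) ∩
        ({y | 0 < turn s (P.vert S) (P.vert Q) y} ∩ {y | 0 < -turn s (P.vert S') (P.vert Q') y})) :=
      isOpen_interior.inter (hA.isOpen_pos.inter hA'.neg.isOpen_pos)
    exact (hfr hz).2 (interior_maximal (fun y hy => W.line.mem_visPolygon hS W.line' (W.ne_zero hS)
      W.lt hy.1 hy.2.1 (neg_pos.1 hy.2.2)) hopen ⟨hzi, hz1, h2⟩)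
  have hm := midpoint_mem_openSegment (𝕜 := ℝ) c p
  have hm0 := key _ ((convex_segment a b).openSegment_subset hc hp hm)
    ((P.convex_hull _).openSegment_interior_self_subset_interior hc' hp' hm)
    (hA.pos_openSegment hp0.ge hc2 (by rwa [openSegment_symm]))
  have hc0 := key c hc hc' hc2
  have hne' : c ≠ midpoint ℝ c p := fun h => by
    have := (midpoint_eq_left_iff (R := ℝ) (x := c) (y := p)).1 h.symm
    rw [this, hp0] at hc2
    exact lt_irrefl _ hc2
  have hp1 := hA'.eq_zero_of_two_zeros (left_mem_segment ℝ c p)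
    (openSegment_subset_segment _ _ _ hm) hne' hc0 hm0 p (right_mem_segment ..)
  have := W.turn_pos_of_line' hS hp' hc' hp1 hc0
  linarith

/-- The segment of the visibility line is the only window. -/
theorem isWindow_iff (w : Set Pt) : P.IsWindow (e .left 0) (e .right 0) (t (j + 1))
    (e .left (j + 1)) (e .right (j + 1)) w ↔ w = segment ℝ (P.vert Q) x := by
  constructor
  swap
  · rintro rfl
    exact W.isWindow hS hx
  intro hw
  obtain ⟨hwe, hwi, hmin⟩ := hw
  obtain ⟨hse, hsi, -⟩ := W.isWindow hS hx
  have hA := isAff_turn s (P.vert S) (P.vert Q)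
  -- the edge touches the visibility line
  obtain ⟨p, hpw, hph, hp0⟩ : ∃ p ∈ w, p ∈ P.hull (t (j + 1)) ∧
      turn s (P.vert S) (P.vert Q) p = 0 := by
    -- A pair that realizes the distance from the window to the diagonal. The competing edge has a
    -- point at most as far away; its connection to the diagonal crosses the line, so by minimality
    -- the point itself is on the line.
    have hK : IsCompact ((segment ℝ (P.vert Q) x ∩ P.hull (t (j + 1))) ×ˢ P.diag e (j + 1)) :=
      ((isCompact_segment _ _).inter_right (P.isClosed_hull _)).prod (isCompact_segment _ _)
    obtain ⟨⟨p', z'⟩, ⟨hp', hz'⟩, hle⟩ := hK.exists_isMinOn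
      (f := fun q : Pt × Pt => dist q.1 q.2) (by
        obtain ⟨c, hc1, hc2⟩ := hsi
        exact ⟨(c, P.vert (e s (j + 1))), ⟨hc1, interior_subset hc2⟩, P.vert_mem_diag e s _⟩)
      continuous_dist.continuousOn
    obtain ⟨p, hp, z, hz, hd⟩ := hmin _ hse hsi p' hp' z' hz'
    refine ⟨p, hp.1, hp.2, ?_⟩
    have h1 := W.turn_nonneg_of_isEdgeOf hS hwe hwi hp.1 hp.2
    obtain ⟨y, hy, hy0⟩ := hA.exists_zero h1 (W.turn_nonpos_of_mem_diag hS hz)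
    have hyh : y ∈ P.hull (t (j + 1)) := (P.convex_hull _).segment_subset hp.2
      (hS.diag_subset (by omega) W.lt hz) hy
    have h2 := isMinOn_iff.1 hle (y, z) ⟨⟨W.mem_segment_of_turn_eq_zero hS hx hyh hy0, hyh⟩, hz⟩
    simp only at h2
    have h3 := dist_add_dist_of_mem_segment hy
    have h4 : dist p y = 0 := le_antisymm (by linarith) dist_nonneg
    rwa [dist_eq_zero.1 h4]
  -- A second point of the edge, interior to the triangle; the two points determine the line of the
  -- edge.
  obtain ⟨c, hc, hci, hcp⟩ : ∃ c ∈ w, c ∈ interior (P.hull (t (j + 1))) ∧ c ≠ p := by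
    obtain ⟨c, hcw, hci⟩ := hwi
    by_cases hcp : c = p
    · obtain ⟨⟨a, b, hab, rfl, -⟩, -⟩ := hwe
      obtain ⟨d, hd, hdc⟩ : ∃ d ∈ segment ℝ a b, d ≠ c := by
        by_cases ha : a = c
        · exact ⟨b, right_mem_segment .., fun h => hab (ha.trans h.symm)⟩
        · exact ⟨a, left_mem_segment .., ha⟩
      obtain ⟨ε, h1, h2⟩ := ((eventually_mem_open isOpen_interior hci d).and
        (Ioo_mem_nhdsGT one_pos)).exists
      refine ⟨_, (convex_segment a b).segment_subset hcw hd ?_, h1, fun h => ?_⟩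
      · rw [segment_eq_image']; exact ⟨ε, ⟨h2.1.le, h2.2.le⟩, rfl⟩
      · rw [← hcp, add_eq_left, smul_eq_zero, sub_eq_zero] at h
        exact h.elim h2.1.ne' hdc
    · exact ⟨c, hcw, hci, hcp⟩
  have hc0 := W.turn_eq_zero_of_isEdgeOf hS hwe hpw hph hp0 hc hci
  have hsub := W.subset_of_isBoundarySegment hS hx hwe.1 (by
    obtain ⟨⟨a, b, -, rfl, -⟩, -⟩ := hwe
    exact hA.eq_zero_of_two_zeros hc hpw hcp hc0 hp0) hc
    (W.mem_openSegment_of_turn_eq_zero hS hx hci hc0)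
  exact (hwe.2 _ (W.isBoundarySegment hS hx) hsub).symm

end Window

end SimplePolygon

/-! ### The walk through the triangulation -/

section Walk

variable {n : ℕ} [NeZero n] {P : SimplePolygon n} {T : Finset (Finset (Fin n))}

omit [NeZero n] in
lemma apex_eq_none {l r o : Fin n} (h : apex T l r o = none) {z : Fin n} (hl : z ≠ l) (hr : z ≠ r)
    (ho : z ≠ o) : {l, r, z} ∉ T := by
  intro hz
  rw [apex, List.head?_eq_none_iff, Finset.toList_eq_nil] at h
  have : z ∈ (∅ : Finset (Fin n)) := h ▸ Finset.mem_filter.2 ⟨Finset.mem_univ z, hl, hr, ho, hz⟩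
  simp at this

omit [NeZero n] in
lemma apex_eq_some {l r o z : Fin n} (h : apex T l r o = some z) :
    z ≠ l ∧ z ≠ r ∧ z ≠ o ∧ {l, r, z} ∈ T := by
  rw [apex] at h
  have := List.mem_of_mem_head? (Option.mem_def.2 h)
  rw [Finset.mem_toList, Finset.mem_filter] at this
  exact this.2

lemma iterate_step_done (p y x : Pt) (N : ℕ) : (Walk.step P T p y)^[N] (.done x) = .done x :=
  Function.iterate_fixed rfl N

/-- The side of a line is an affine function of the parameter of a ray. Its slope is written in
terms of the sides on which `a` and `b` lie, so that its sign is known during the walk. -/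
lemma cross_ray {p y a b : Pt} {κ₀ : ℝ} (h : cross a b (ray p y κ₀) = 0) (κ : ℝ) :
    cross a b (ray p y κ) = (κ - κ₀) * (cross p y a - cross p y b) := by
  simp only [cross, ray, PiLp.add_apply, PiLp.smul_apply, PiLp.sub_apply, smul_eq_mul] at h ⊢
  linear_combination h

lemma exists_ray_mem_openSegment {p y a b : Pt} (hpy : p ≠ y) (ha : 0 < cross p y a)
    (hb : cross p y b < 0) : ∃ κ, ray p y κ ∈ openSegment ℝ a b := by
  obtain ⟨z, hz, h0⟩ := (isAff_cross p y).exists_zero_open ha hb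
  obtain ⟨κ, rfl⟩ := exists_ray (s := .left) hpy h0
  exact ⟨κ, hz⟩

lemma cross_eq_zero_of_mem {a b z : Pt} (h : z ∈ openSegment ℝ a b) : cross a b z = 0 :=
  (isAff_cross a b).eq_zero_segment (by simp [cross]) (by simp [cross]; ring)
    (openSegment_subset_segment _ _ _ h)

open Classical in
/-- The triangles that the ray meets between two points. -/
def rayTriangles (P : SimplePolygon n) (T : Finset (Finset (Fin n))) (p y : Pt) (a b : ℝ) :
    Finset (Finset (Fin n)) :=
  T.filter fun t' => ∃ κ, a < κ ∧ κ < b ∧ ray p y κ ∈ interior (P.hull t')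

lemma mem_rayTriangles {p y : Pt} {a b : ℝ} {t' : Finset (Fin n)} :
    t' ∈ rayTriangles P T p y a b ↔
      t' ∈ T ∧ ∃ κ, a < κ ∧ κ < b ∧ ray p y κ ∈ interior (P.hull t') := by
  simp only [rayTriangles, Finset.mem_filter]

/-- A point of the triangle `l r o` is not beyond `l r`. -/
lemma cross_nonpos_of_mem_hull {l r o : Fin n}
    (ho : cross (P.vert l) (P.vert r) (P.vert o) < 0) {z : Pt} (hz : z ∈ P.hull {l, r, o}) :
    cross (P.vert l) (P.vert r) z ≤ 0 := by
  have h1 : 0 < turn .right (P.vert l) (P.vert r) (P.vert o) := neg_pos.2 ho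
  have h2 := ((P.hull_iff h1).1 hz).1
  simpa [turn] using h2

/-- The triangle beyond a side through which a ray leaves. -/
lemma ray_mem_interior {p y : Pt} {l r z : Fin n} (hz : 0 < cross (P.vert l) (P.vert r) (P.vert z))
    {κ₀ κ₁ : ℝ} (h0 : ray p y κ₀ ∈ openSegment ℝ (P.vert l) (P.vert r))
    (h1 : ray p y κ₁ ∈ openSegment ℝ (P.vert z) (P.vert r) ∨
      ray p y κ₁ ∈ openSegment ℝ (P.vert l) (P.vert z)) {κ : ℝ} (hκ₀ : κ₀ < κ) (hκ₁ : κ < κ₁) :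
    ray p y κ ∈ interior (P.hull {l, r, z}) := by
  have hseg : ray p y κ ∈ openSegment ℝ (ray p y κ₀) (ray p y κ₁) := by
    rw [openSegment_ray p y (hκ₀.trans hκ₁)]; exact ⟨κ, ⟨hκ₀, hκ₁⟩, rfl⟩
  have z1 : 0 < turn .left (P.vert l) (P.vert r) (P.vert z) := hz
  have z2 : 0 < turn .left (P.vert r) (P.vert z) (P.vert l) := by rwa [← turn_cyc]
  have z3 : 0 < turn .left (P.vert z) (P.vert l) (P.vert r) := by rwa [← turn_cyc, ← turn_cyc]
  have A1 := isAff_turn .left (P.vert l) (P.vert r)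
  have A2 := isAff_turn .left (P.vert r) (P.vert z)
  have A3 := isAff_turn .left (P.vert z) (P.vert l)
  have b1 : 0 < turn .left (P.vert r) (P.vert z) (ray p y κ₀) :=
    A2.pos_openSegment (turn_self_left ..).ge z2 (by rwa [openSegment_symm])
  have b2 : 0 < turn .left (P.vert z) (P.vert l) (ray p y κ₀) :=
    A3.pos_openSegment (by simp) z3 h0
  have b3 : 0 ≤ turn .left (P.vert l) (P.vert r) (ray p y κ₀) :=
    A1.nonneg_segment (by simp) (by simp) (openSegment_subset_segment _ _ _ h0)
  rw [P.interior_hull_iff z1]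
  rcases h1 with h1 | h1
  · have c1 : 0 < turn .left (P.vert l) (P.vert r) (ray p y κ₁) :=
      A1.pos_openSegment (turn_self_right ..).ge z1 (by rwa [openSegment_symm])
    have c2 : 0 ≤ turn .left (P.vert r) (P.vert z) (ray p y κ₁) :=
      A2.nonneg_segment (by simp) (by simp) (openSegment_subset_segment _ _ _ h1)
    have c3 : 0 < turn .left (P.vert z) (P.vert l) (ray p y κ₁) :=
      A3.pos_openSegment (by simp) z3 h1
    exact ⟨A1.pos_openSegment b3 c1 hseg,
      A2.pos_openSegment c2 b1 (by rwa [openSegment_symm]), A3.pos_openSegment b2.le c3 hseg⟩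
  · have c1 : 0 < turn .left (P.vert l) (P.vert r) (ray p y κ₁) :=
      A1.pos_openSegment (by simp) z1 h1
    have c2 : 0 < turn .left (P.vert r) (P.vert z) (ray p y κ₁) :=
      A2.pos_openSegment (turn_self_right ..).ge z2 (by rwa [openSegment_symm])
    have c3 : 0 ≤ turn .left (P.vert z) (P.vert l) (ray p y κ₁) :=
      A3.nonneg_segment (by simp) (by simp) (openSegment_subset_segment _ _ _ h1)
    exact ⟨A1.pos_openSegment b3 c1 hseg,
      A2.pos_openSegment b1.le c2 hseg, A3.pos_openSegment c3 b2 (by rwa [openSegment_symm])⟩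

/-- A ray that leaves a triangle and stays inside enters another triangle at the same side. -/
lemma exists_next (hT : P.IsTriangulation T) {p y : Pt} {l r o : Fin n} (ht : {l, r, o} ∈ T)
    {κ₀ κx : ℝ} (h0 : ray p y κ₀ ∈ openSegment ℝ (P.vert l) (P.vert r)) (hlt : κ₀ < κx)
    (hin : ∀ κ, κ₀ < κ → κ < κx → ray p y κ ∈ P.inside) (hl : 0 < cross p y (P.vert l))
    (hr : cross p y (P.vert r) < 0) (ho : cross (P.vert l) (P.vert r) (P.vert o) < 0) :
    ∃ z, z ≠ l ∧ z ≠ r ∧ z ≠ o ∧ {l, r, z} ∈ T := by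
  have hcr := cross_eq_zero_of_mem h0
  have hne := hT.triple_ne ht
  have hev : ∀ᶠ κ in 𝓝[>] κ₀, ∃ t' ∈ T, ray p y κ ∈ P.hull t' := by
    filter_upwards [Ioo_mem_nhdsGT hlt] with κ hκ
    exact hT.exists_mem_hull (Or.inl (hin κ hκ.1 hκ.2))
  -- There are finitely many triangles, so a single one contains points of the ray arbitrarily soon
  -- after the exit, and by closedness the exit itself.
  obtain ⟨t', ht', hfr⟩ : ∃ t' ∈ T, ∃ᶠ κ in 𝓝[>] κ₀, ray p y κ ∈ P.hull t' := by
    by_contra hc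
    push Not at hc
    have h1 : ∀ᶠ κ in 𝓝[>] κ₀, ∀ t' ∈ T, ray p y κ ∉ P.hull t' :=
      (Finset.eventually_all T).2 hc
    obtain ⟨κ, ⟨t', ht', h2⟩, h3⟩ := (hev.and h1).exists
    exact h3 t' ht' h2
  have hmem : ray p y κ₀ ∈ P.hull t' := by
    refine (P.isClosed_hull t').mem_of_frequently_of_tendsto hfr ?_
    exact ((continuous_ray p y).tendsto κ₀).mono_left nhdsWithin_le_nhds
  have hl' := hT.mem_of_mem_openSegment ht ht' (i := l) (j := r) (by simp) (by simp) hne.1 h0 hmem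
  have hr' := hT.mem_of_mem_openSegment ht ht' (i := r) (j := l) (by simp) (by simp) hne.1.symm
    (by rwa [openSegment_symm]) hmem
  obtain ⟨z, rfl, hzl, hzr⟩ := hT.exists_third ht' hl' hr' hne.1
  refine ⟨z, hzl, hzr, ?_, ht'⟩
  rintro rfl
  obtain ⟨κ, h1, h2⟩ := (hfr.and_eventually self_mem_nhdsWithin).exists
  have h3 := cross_nonpos_of_mem_hull ho h1
  rw [cross_ray hcr] at h3
  have h2 : κ₀ < κ := h2
  nlinarith [mul_pos (sub_pos.2 h2) (by linarith : 0 < cross p y (P.vert l) - cross p y (P.vert r))]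

/-- Induction on the number of triangles that the ray still meets before `x`. Each step before the
last one leaves one of them behind. -/
theorem walk_aux (hP : P.GeneralPosition) (hT : P.IsTriangulation T) {S Q : Fin n} (hSQ : S ≠ Q)
    {κx : ℝ} (hxc : ray (P.vert S) (P.vert Q) κx ∈ P.curve)
    (hin : ∀ κ, 0 < κ → κ < κx → ray (P.vert S) (P.vert Q) κ ∈ P.inside) (N : ℕ) :
    ∀ (l r o : Fin n) (κ₀ : ℝ), {l, r, o} ∈ T → 0 < κ₀ → κ₀ ≤ κx →
      ray (P.vert S) (P.vert Q) κ₀ ∈ openSegment ℝ (P.vert l) (P.vert r) →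
      0 < cross (P.vert S) (P.vert Q) (P.vert l) → cross (P.vert S) (P.vert Q) (P.vert r) < 0 →
      cross (P.vert l) (P.vert r) (P.vert o) < 0 →
      (rayTriangles P T (P.vert S) (P.vert Q) κ₀ κx).card ≤ N →
      (Walk.step P T (P.vert S) (P.vert Q))^[N + 1] (.run l r o) =
        .done (ray (P.vert S) (P.vert Q) κx) := by
  set p := P.vert S
  set y := P.vert Q
  have hpy : p ≠ y := fun h => hSQ (P.injective h)
  induction N with
  | zero => ?_
  | succ N ih => ?_
  all_goals
    intro l r o κ₀ ht hκ₀ hκx h0 hl hr ho hcard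
    have hcr := cross_eq_zero_of_mem h0
    have hpos : 0 < cross p y (P.vert l) - cross p y (P.vert r) := by linarith
    rw [Function.iterate_succ_apply]
    rcases hap : apex T l r o with _ | z
    · have heq : κ₀ = κx := by
        by_contra hne
        obtain ⟨z, h1, h2, h3, h4⟩ := exists_next hT ht h0 (hκx.lt_of_ne hne)
          (fun κ h1 h2 => hin κ (hκ₀.trans h1) h2) hl hr ho
        exact apex_eq_none hap h1 h2 h3 h4
      have hstep : Walk.step P T p y (.run l r o) = .done (ray p y κx) := by
        simp only [Walk.step, hap, Walk.done.injEq]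
        rw [← heq]
        rw [openSegment_eq_image'] at h0
        obtain ⟨θ, -, hθ⟩ := h0
        have h1 : cross p y (ray p y κ₀) = 0 := SimplePolygon.Window.turn_ray (s := .left) κ₀
        rw [← hθ, (isAff_cross p y).lineMap] at h1
        rw [← hθ]
        congr 2
        rw [div_eq_iff hpos.ne']; linarith
      rw [hstep, iterate_step_done]
    · obtain ⟨hzl, hzr, hzo, hzT⟩ := apex_eq_some hap
      have hzpos : 0 < cross (P.vert l) (P.vert r) (P.vert z) := by
        have := hT.opposite (s := .right) ht hzT hzo.symm (by simpa [turn] using ho)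
        simpa [turn] using this
      have hlt : κ₀ < κx := hκx.lt_of_ne (by
        rintro rfl
        exact (hT.openSegment_subset_inside hP ht hzT hzo.symm h0).1 hxc)
      -- By general position, the line contains no vertices besides `S` and `Q`. They have
      -- parameters `-1` and `0`, hence are not ahead.
      have hz0 : cross p y (P.vert z) ≠ 0 := by
        intro hz
        obtain ⟨κ, hκ⟩ := exists_ray (s := .left) hpy hz
        rw [hκ, cross_ray hcr] at hzpos
        have hκ' : κ₀ < κ := by linarith [pos_of_mul_pos_left hzpos hpos.le]
        refine hP.turn_ne .left hSQ (j := Q) (l := z) ?_ ?_ hz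
        · rintro rfl
          have := ray_injective hpy ((ray_zero p y).trans hκ); linarith
        · rintro rfl
          have h2 : ray p y (-1) = p := by simp only [ray]; module
          have := ray_injective hpy (h2.trans hκ); linarith
      -- The ray crosses the interior of the new triangle up to its next exit and never returns to
      -- it, so the number of triangles ahead drops.
      have hsub : ∀ κ₁, κ₀ < κ₁ → (∀ κ, κ₀ < κ → κ < κ₁ → ray p y κ ∈ interior (P.hull {l, r, z})) →
          (∀ κ, κ₁ < κ → ray p y κ ∉ P.hull {l, r, z}) → κ₁ ≤ κx ∧
          (rayTriangles P T p y κ₁ κx).card < (rayTriangles P T p y κ₀ κx).card := by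
        intro κ₁ h1 h2 h3
        have hle : κ₁ ≤ κx := by
          by_contra hc
          exact (hT.interior_subset_inside hP hzT (h2 κx hlt (not_le.1 hc))).1 hxc
        refine ⟨hle, Finset.card_lt_card (Finset.ssubset_iff.2 ⟨{l, r, z}, ?_, ?_⟩)⟩
        · intro hm
          obtain ⟨κ, h4, -, h5⟩ := (mem_rayTriangles.1 hm).2
          exact h3 κ h4 (interior_subset h5)
        · refine Finset.insert_subset (mem_rayTriangles.2 ⟨hzT, (κ₀ + κ₁) / 2, by linarith,
            by linarith, h2 _ (by linarith) (by linarith)⟩) fun t' ht' => ?_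
          obtain ⟨h4, κ, h5, h6, h7⟩ := mem_rayTriangles.1 ht'
          exact mem_rayTriangles.2 ⟨h4, κ, h1.trans h5, h6, h7⟩
      have hnext : ∃ l' r' o' κ₁, Walk.step P T p y (.run l r o) = .run l' r' o' ∧ {l', r', o'} ∈ T ∧
          κ₀ < κ₁ ∧ κ₁ ≤ κx ∧ ray p y κ₁ ∈ openSegment ℝ (P.vert l') (P.vert r') ∧
          0 < cross p y (P.vert l') ∧ cross p y (P.vert r') < 0 ∧
          cross (P.vert l') (P.vert r') (P.vert o') < 0 ∧
          (rayTriangles P T p y κ₁ κx).card < (rayTriangles P T p y κ₀ κx).card := by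
        have out : ∀ l' r' o', 0 < cross p y (P.vert l') → cross p y (P.vert r') < 0 →
            cross (P.vert l') (P.vert r') (P.vert o') < 0 → ∀ κ₁,
            ray p y κ₁ ∈ openSegment ℝ (P.vert l') (P.vert r') → ∀ κ, κ₁ < κ →
            ray p y κ ∉ P.hull {l', r', o'} := by
          intro l' r' o' a1 a2 a3 κ₁ a4 κ a5 a6
          have a7 := cross_nonpos_of_mem_hull a3 a6
          rw [cross_ray (cross_eq_zero_of_mem a4)] at a7
          nlinarith [mul_pos (sub_pos.2 a5)
            (by linarith : 0 < cross p y (P.vert l') - cross p y (P.vert r'))]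
        rcases lt_or_gt_of_ne hz0 with hz | hz
        · obtain ⟨κ₁, h1⟩ := exists_ray_mem_openSegment hpy hl hz
          have a1 : cross (P.vert l) (P.vert z) (P.vert r) < 0 := by
            have := turn_swap' .left (P.vert l) (P.vert r) (P.vert z)
            simp only [turn] at this; linarith
          have hset : ({l, z, r} : Finset (Fin n)) = {l, r, z} := by
            rw [Finset.pair_comm]
          have h2 : 0 < cross (P.vert l) (P.vert r) (ray p y κ₁) :=
            (isAff_cross _ _).pos_openSegment (by simp [cross]) hzpos h1
          rw [cross_ray hcr] at h2
          have h3 : κ₀ < κ₁ := by linarith [pos_of_mul_pos_left h2 hpos.le]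
          obtain ⟨h4, h5⟩ := hsub κ₁ h3 (fun κ b1 b2 => ray_mem_interior hzpos h0 (Or.inr h1) b1 b2)
            (hset ▸ out l z r hl hz a1 κ₁ h1)
          refine ⟨l, z, r, κ₁, ?_, by rwa [hset], h3, h4, h1, hl, hz, a1, h5⟩
          simp only [Walk.step, hap]
          exact if_neg hz.not_gt
        · obtain ⟨κ₁, h1⟩ := exists_ray_mem_openSegment hpy hz hr
          have a1 : cross (P.vert z) (P.vert r) (P.vert l) < 0 := by
            have e1 := turn_cyc .left (P.vert z) (P.vert r) (P.vert l)
            have e2 := turn_swap .left (P.vert l) (P.vert r) (P.vert z)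
            simp only [turn] at e1 e2; linarith
          have hset : ({z, r, l} : Finset (Fin n)) = {l, r, z} := by
            ext a; simp only [Finset.mem_insert, Finset.mem_singleton]; tauto
          have h2 : 0 < cross (P.vert l) (P.vert r) (ray p y κ₁) :=
            (isAff_cross _ _).pos_openSegment (x := P.vert r) (by simp [cross]; linarith) hzpos
              (by rwa [openSegment_symm])
          rw [cross_ray hcr] at h2
          have h3 : κ₀ < κ₁ := by linarith [pos_of_mul_pos_left h2 hpos.le]
          obtain ⟨h4, h5⟩ := hsub κ₁ h3 (fun κ b1 b2 => ray_mem_interior hzpos h0 (Or.inl h1) b1 b2)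
            (hset ▸ out z r l hz hr a1 κ₁ h1)
          refine ⟨z, r, l, κ₁, ?_, by rwa [hset], h3, h4, h1, hz, hr, a1, h5⟩
          simp only [Walk.step, hap]
          exact if_pos hz
      obtain ⟨l', r', o', κ₁, h1, h2, h3, h4, h5, h6, h7, h8, h9⟩ := hnext
      -- In the base case of the induction a further triangle contradicts the bound; otherwise the
      -- induction hypothesis applies.
      first
        | omega
        | exact h1 ▸ ih l' r' o' κ₁ h2 (hκ₀.trans h3) h4 h5 h6 h7 h8 (by omega)

lemma card_le_crossed {t : ℕ → Finset (Fin n)} {i : ℕ} {w : Set Pt}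
    {A : Finset (Finset (Fin n))} (hA : ∀ t' ∈ A, t' ∈ T ∧ (∀ j, 1 ≤ j → j ≤ i → t j ≠ t') ∧
      (w ∩ interior (P.hull t')).Nonempty) : A.card ≤ crossed P T t i w :=
  Finset.card_le_card fun t' ht' => by simpa only [Finset.mem_filter] using hA t' ht'

end Walk

namespace SimplePolygon.Window

variable {n : ℕ} [NeZero n] {P : SimplePolygon n} {T : Finset (Finset (Fin n))} {k : ℕ}
  {t : ℕ → Finset (Fin n)} {e : Side → ℕ → Fin n}
  {s : Side} {j : ℕ} {S Q S' Q' : Fin n} (W : P.Window e k s j S Q S' Q')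
  (hS : P.IsSleeve T k t e)
include W hS

/-- The walk finds the end of the window. -/
theorem walk {x : Pt} (hx : IsFirstHit P.curve (P.vert S) (P.vert Q) x) :
    (Walk.step P T (P.vert S) (P.vert Q))^[crossed P T t (j + 1) (segment ℝ (P.vert Q) x) + 1]
      (Walk.start e (j + 1) s) = .done x := by
  have hlt := W.lt
  have hj0 := W.ne_zero hS
  obtain ⟨κx, k1, rfl, k2, k3, k4, k5⟩ := W.hit hS hx
  obtain ⟨f, -, -, -, -, κ₁, h1, h2, h3, h4, h5, κc, h6⟩ := W.exists_exit hS
  have hle : κ₁ ≤ κx := by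
    by_contra hc
    exact (h3 κx k1 (not_le.1 hc)).1 k2
  have hcard : (rayTriangles P T (P.vert S) (P.vert Q) κ₁ κx).card ≤
      crossed P T t (j + 1) (segment ℝ (P.vert Q) (ray (P.vert S) (P.vert Q) κx)) := by
    refine card_le_crossed fun t' ht' => ?_
    obtain ⟨a1, κ, a2, a3, a4⟩ := mem_rayTriangles.1 ht'
    refine ⟨a1, fun m hm hmj => ?_, ray (P.vert S) (P.vert Q) κ, ?_, a4⟩
    · rintro rfl
      rcases hmj.eq_or_lt with rfl | hmj
      · exact absurd (h4 κ (interior_subset a4)).2 (not_le.2 a2)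
      -- No earlier triangle of the path is met after the exit: the ray is already beyond `b_j` and
      -- moves away from it, so its color remains that of the triangles beyond.
      · obtain ⟨χ, c1, c2, c3, c4, c5⟩ := hS.color j (by omega) (by omega)
        have hgc := ((W.mem_interior_iff hS).1 h6).1
        have hκc := h5 κc h6
        have hgQ := W.gap_target_nonpos hS
        have hgap : ∀ μ, κc ≤ μ → 0 < P.gap e j (ray (P.vert S) (P.vert Q) μ) := by
          intro μ hμ
          rw [apply_ray (P.isAff_gap e j)] at hgc ⊢
          have : 0 < P.gap e j (P.vert Q) - P.gap e j (P.vert S) := by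
            by_contra hc
            push Not at hc
            nlinarith [mul_nonneg hκc.1.le (neg_nonneg.2 hc)]
          nlinarith
        have := c5 (ray (P.vert S) (P.vert Q) '' Icc κc κ)
          (isPreconnected_Icc.image _ (continuous_ray _ _).continuousOn) (by
            rintro _ ⟨μ, hμ, rfl⟩
            exact k3 μ (by linarith [hμ.1, hκc.1]) (by linarith [hμ.2])) (by
            rw [Set.disjoint_left]
            rintro _ ⟨μ, hμ, rfl⟩ hd
            have b1 : P.gap e j (ray (P.vert S) (P.vert Q) μ) = 0 :=
              (P.isAff_gap e j).eq_zero_segment (by simp [gap]) (by simp [gap]) hd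
            exact (hgap μ hμ.1).ne' b1) (t m) a1 (t (j + 1)) (W.hull_mem hS)
          ⟨_, ⟨κ, ⟨by linarith [hκc.2], le_rfl⟩, rfl⟩, a4⟩
          ⟨_, ⟨κc, ⟨le_rfl, by linarith [hκc.2]⟩, rfl⟩, h6⟩
        rw [c1 m hm (by omega), c2 (j + 1) (by omega) (by omega)] at this
        exact c3 this
    · rw [segment_eq_ray _ _ k1.le]
      exact ⟨κ, ⟨by linarith, a3.le⟩, rfl⟩
  have htri := W.hull_mem hS
  rw [W.eq_triple hS] at htri
  have hA := W.pos_left hS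
  have hN := W.neg
  have hD := W.turn_pos hS
  have hsame := hS.same j hlt
  rw [W.side] at hsame
  cases s
  · simp only [Walk.start, Nat.add_sub_cancel]
    simp only [Side.opp] at hsame htri hD
    rw [hsame]
    refine walk_aux hS.gp hS.tri (W.line.ne hS hlt.le) k2 k3 _ _ _ _ κ₁ ?_ h1 hle h2 hA hN ?_ hcard
    · rwa [Finset.pair_comm]
    · have := turn_swap' .left (P.vert (e .left j)) (P.vert (e .right j)) (P.vert (e .left (j + 1)))
      simp only [turn] at this hD; linarith
  · simp only [Walk.start, Nat.add_sub_cancel]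
    simp only [Side.opp, turn] at hsame htri hD hA hN
    rw [hsame]
    refine walk_aux hS.gp hS.tri (W.line.ne hS hlt.le) k2 k3 _ _ _ _ κ₁ ?_ h1 hle ?_
      (by linarith) (by linarith) ?_ hcard
    · convert htri using 1
      ext a; simp only [Finset.mem_insert, Finset.mem_singleton]; tauto
    · rwa [openSegment_symm]
    · have := turn_cyc .left (P.vert (e .right (j + 1))) (P.vert (e .right j)) (P.vert (e .left j))
      simp only [turn] at this; linarith

end SimplePolygon.Window

/-! ### Runs of the machine and the visible diagonals. -/

section Run

variable {n : ℕ} [NeZero n] {P : SimplePolygon n} {T : Finset (Finset (Fin n))} {k : ℕ}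
  {t : ℕ → Finset (Fin n)} {e : Side → ℕ → Fin n}

lemma run_succ (M : ℕ) : run P k e (M + 1) = (run P k e M).step P k e :=
  Function.iterate_succ_apply' _ _ _

/-- The machine stays in a state that its step fixes. -/
lemma run_eq_of_step_eq {M N : ℕ} (hMN : M ≤ N)
    (h : (run P k e M).step P k e = run P k e M) : run P k e N = run P k e M := by
  obtain ⟨d, rfl⟩ := Nat.exists_eq_add_of_le' hMN
  exact (Function.iterate_add_apply _ _ _ _).trans (Function.iterate_fixed h d)

/-- The window test fails before a visible diagonal. -/
lemma State.Inv.not_blocked (hS : P.IsSleeve T k t e) {g : Pt → ℝ} {i j : ℕ}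
    (hg : P.StrictSep e .left g i) (hj : j < i) (hi : i ≤ k) {st : State n} {L τ : Side → ℕ}
    (h : st.Inv P e j L τ) : ¬ st.Blocked P e j := fun hb =>
  h.not_strictSep_of_blocked hS (by omega) hb (hg.mono hj)

lemma exists_run_inv_of_strictSep (hS : P.IsSleeve T k t e) {g : Pt → ℝ} {i : ℕ}
    (hg : P.StrictSep e .left g i) (hi : i ≤ k) :
    ∃ M L τ, M ≤ 5 * i ∧ (run P k e M).Inv P e i L τ :=
  exists_run_inv hS hi fun _ hj _ _ _ h => h.not_blocked hS hg hj hi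

namespace SimplePolygon.IsSleeve

variable (hS : P.IsSleeve T k t e)
include hS

lemma edgeVisible_of_strictSep {g : Pt → ℝ} (hg : P.StrictSep e .left g k) :
    P.EdgeVisible (e .left 0) (e .right 0) (e .left k) (e .right k) :=
  hS.exists_openSegment_of_sep hg.1 hg.2 hS.one_le le_rfl

/-- The end of a line of sight on `b_i` is a visible point of the next triangle, since the open
diagonal is inside the polygon. -/
lemma visible_inter_of_strictSep {g : Pt → ℝ} {i : ℕ} (h0 : 0 < i) (hi : i < k)
    (hg : P.StrictSep e .left g i) :
    (P.hull (t (i + 1)) ∩ P.visible (e .left 0) (e .right 0)).Nonempty := by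
  obtain ⟨q, hq, p, hp, hpq⟩ := hS.exists_openSegment_of_sep hg.1 hg.2 h0 hi.le
  exact ⟨p, hS.diag_subset_succ hi (openSegment_subset_segment _ _ _ hp),
    hS.openSegment_subset_inside h0 hi .left hp, q, hq, hpq⟩

lemma exists_strictSep_of_visible {i : ℕ} (hi : i < k)
    (h : (P.hull (t (i + 1)) ∩ P.visible (e .left 0) (e .right 0)).Nonempty) :
    ∃ g, P.StrictSep e .left g i := by
  obtain ⟨p, hp, hin, q, hq, hpq⟩ := h
  obtain ⟨⟨g, hg, -⟩, -⟩ := hS.exists_strictSep_of_mem (Nat.lt_succ_self i) hi hq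
    (by rintro l rfl; exact hin.1 (P.vert_mem_curve l)) hpq hp
  exact ⟨g, hg⟩

lemma exists_strictSep_of_edgeVisible
    (h : P.EdgeVisible (e .left 0) (e .right 0) (e .left k) (e .right k)) :
    ∃ g, P.StrictSep e .left g k := by
  obtain ⟨q, hq, p, hp, hpq⟩ := h
  exact hS.exists_strictSep_of_last hq hp hpq

/-- If the goal edge is not visible, the window test succeeds at the last visible triangle. -/
lemma blocked_of_not_edgeVisible
    (hv : ¬ P.EdgeVisible (e .left 0) (e .right 0) (e .left k) (e .right k)) {i : ℕ} (hi : i < k)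
    (hlast : ∀ m, i + 1 < m → m ≤ k →
      ¬ (P.hull (t m) ∩ P.visible (e .left 0) (e .right 0)).Nonempty)
    {st : State n} {L τ : Side → ℕ} (h : st.Inv P e i L τ) : st.Blocked P e i := by
  by_contra hb
  -- After a failed test the invariant would hold at the next diagonal and make it visible: then
  -- either a later triangle has a visible point, or this diagonal is the goal edge.
  obtain ⟨m, L', τ', h', -⟩ := h.next hS hi hb
  obtain ⟨g, hg⟩ := h'.exists_strictSep hS (Nat.succ_ne_zero i) hi .left
  rcases Nat.lt_or_ge (i + 1) k with hlt | hge
  · exact hlast (i + 2) (by omega) hlt (hS.visible_inter_of_strictSep (Nat.succ_pos i) hlt hg)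
  · obtain rfl : i + 1 = k := by omega
    exact hv (hS.edgeVisible_of_strictSep hg)

end SimplePolygon.IsSleeve

/-- A successful window test yields a window. -/
lemma State.Inv.window {i : ℕ} (hi : i < k) {st : State n} {L τ : Side → ℕ}
    (h : st.Inv P e i L τ) (hb : st.Blocked P e i) :
    P.Window e k (newSide e (i + 1)) i (st.source (newSide e (i + 1)).opp)
      (st.tgt (newSide e (i + 1)).opp) (st.source (newSide e (i + 1)))
      (st.tgt (newSide e (i + 1))) where
  lt := hi
  side := rfl
  line := h.line _
  line' := h.line _
  neg := by
    have := (onSide_iff ..).1 hb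
    rw [turn_opp] at this; linarith

end Run

end FirstWindow

end

/-! ### Assembly of the result. -/

open FirstWindow in
theorem lemma4 :
    ∃ C : ℕ, ∀ (n : ℕ) [NeZero n] (P : SimplePolygon n) (T : Finset (Finset (Fin n)))
      (α β : Fin n) (k : ℕ) (t : ℕ → Finset (Fin n)) (e : Side → ℕ → Fin n) (h : ℕ),
      P.GeneralPosition → P.IsTriangulation T → P.IsImportant T α β k t e →
      IsGreatest {i | 1 ≤ i ∧ i ≤ k ∧
        (P.hull (t i) ∩ P.visible (e .left 0) (e .right 0)).Nonempty} h →
      ∃ N ≤ C * h,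
        -- if the goal edge is not visible, the machine returns the window ...
        (¬ P.EdgeVisible (e .left 0) (e .right 0) (e .left k) (e .right k) →
          ∃ (s : Side) (x : Pt), (run P k e N).phase = .window s x ∧
            (∀ w : Set Pt,
              P.IsWindow (e .left 0) (e .right 0) (t h) (e .left h) (e .right h) w ↔
                w = segment ℝ (P.vert ((run P k e N).tgt s.opp)) x) ∧
            -- ... whose end a walk finds, in one step per further triangle it crosses, plus one
            (Walk.step P T (P.vert ((run P k e N).source s.opp))
                (P.vert ((run P k e N).tgt s.opp)))^[
                  crossed P T t h (segment ℝ (P.vert ((run P k e N).tgt s.opp)) x) + 1]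
              (Walk.start e h s) = .done x) ∧
        -- if it is visible, the machine finishes without a window
        (P.EdgeVisible (e .left 0) (e .right 0) (e .left k) (e .right k) →
          h = k ∧ (run P k e N).phase = .finished) ∧
        -- on its way, it maintains the shortest paths and the visibility lines
        (∀ i, i < h ∨
            i = h ∧ P.EdgeVisible (e .left 0) (e .right 0) (e .left k) (e .right k) →
          ∃ M ≤ N, (run P k e M).Holds P e t i) := by
  -- At most `5` steps per iteration on average, and one more for the halting step, which is paid
  -- for since `h ≥ 1`.
  refine ⟨6, fun n _ P T α β k t e h hP hT hI hh => ⟨6 * h, le_rfl, ?_⟩⟩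
  have hS := hI.isSleeve hP hT
  obtain ⟨⟨h1, hk, hvis⟩, hmax⟩ := hh
  obtain ⟨j, rfl⟩ := Nat.exists_eq_add_of_le' h1
  obtain ⟨g, hg⟩ := hS.exists_strictSep_of_visible hk hvis
  have hlast : ∀ m, j + 1 < m → m ≤ k →
      ¬ (P.hull (t m) ∩ P.visible (e .left 0) (e .right 0)).Nonempty := fun m hm hmk hne =>
    absurd (hmax ⟨by omega, hmk, hne⟩) (not_le.2 hm)
  have hend : P.EdgeVisible (e .left 0) (e .right 0) (e .left k) (e .right k) →
      j + 1 = k ∧ ∃ M L τ, M ≤ 5 * k ∧ (run P k e M).Inv P e k L τ := by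
    intro hv
    obtain ⟨g', hg'⟩ := hS.exists_strictSep_of_edgeVisible hv
    refine ⟨hk.eq_of_not_lt fun hlt => ?_, exists_run_inv_of_strictSep hS hg' le_rfl⟩
    exact hlast (j + 2) (by omega) hlt
      (hS.visible_inter_of_strictSep (Nat.succ_pos j) hlt (hg'.mono hlt.le))
  refine ⟨fun hv => ?_, fun hv => ?_, fun i hi => ?_⟩
  · obtain ⟨M, L, τ, hM, hInv⟩ := exists_run_inv_of_strictSep hS hg (Nat.le_of_succ_le hk)
    have hb := hS.blocked_of_not_edgeVisible hv hk hlast hInv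
    have W := hInv.window hk hb
    obtain ⟨s, hs⟩ : ∃ s, newSide e (j + 1) = s := ⟨_, rfl⟩
    rw [hs] at W
    have hb' := hb
    rw [State.Blocked, hs] at hb'
    have hstep := (run_succ (P := P) (k := k) (e := e) M).trans
      (step_loop_window P k e hInv.phase (hInv.idx.trans_le hk) (hInv.idx ▸ hs) (hInv.idx ▸ hb'))
    -- The halting state is fixed by further steps, so the state after exactly `6 * h` steps is the
    -- one returned.
    have hN : run P k e (6 * (j + 1)) = run P k e (M + 1) :=
      run_eq_of_step_eq (by omega) (by rw [hstep]; rfl)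
    rw [hN, hstep]
    exact ⟨s, _, rfl, fun w => W.isWindow_iff hS (W.exists_firstHit hS) w,
      W.walk hS (W.exists_firstHit hS)⟩
  · obtain ⟨rfl, M, L, τ, hM, hInv⟩ := hend hv
    have hstep := (run_succ (P := P) (k := j + 1) (e := e) M).trans
      (step_loop_finished P (j + 1) e hInv.phase (hInv.idx ▸ Nat.lt_succ_self _))
    refine ⟨rfl, ?_⟩
    rw [run_eq_of_step_eq (M := M + 1) (by omega) (by rw [hstep]; rfl), hstep]
  · rcases hi with hi | ⟨rfl, hv⟩
    · obtain ⟨M, L, τ, hM, hInv⟩ :=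
        exists_run_inv_of_strictSep hS (hg.mono (Nat.lt_succ_iff.1 hi)) (by omega)
      exact ⟨M, by omega, hInv.holds hS (by omega)⟩
    · obtain ⟨rfl, M, L, τ, hM, hInv⟩ := hend hv
      exact ⟨M, by omega, hInv.holds hS le_rfl⟩
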